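/- Let $Q$ and $B$ be smooth vector bundles of finite rank over a smooth (Hausdorff, second countable) manifold $M$. Let $\mathcal M=Q[-1]\oplus B^*[-2]$ be the split $[2]$-manifold whose sheaf of functions is the sheaf of graded commutative algebras $U\mapsto C^\infty(\mathcal M)(U)=\Gamma_U(\wedge Q^*\otimes \operatorname{Sym} B)$, generated over the smooth functions on $U$ (degree $0$) by the sections of $Q^*$ (degree $1$) and of $B$ (degree $2$). A Poisson bracket of degree $-2$ on $\mathcal M$ is an $\mathbb R$-bilinear morphism of sheaves $\{\cdot,\cdot\}\colon C^\infty(\mathcal M)\times C^\infty(\mathcal M)\to C^\infty(\mathcal M)$ such that, for homogeneous $\xi_1,\xi_2,\xi_3$, one has $|\{\xi_1,\xi_2\}|=|\xi_1|+|\xi_2|-2$, $\{\xi_1,\xi_2\}=-(-1)^{|\xi_1||\xi_2|}\{\xi_2,\xi_1\}$, $\{\xi_1,\xi_2\xi_3\}=\{\xi_1,\xi_2\}\xi_3+(-1)^{|\xi_1||\xi_2|}\xi_2\{\xi_1,\xi_3\}$ and $\{\xi_1,\{\xi_2,\xi_3\}\}=\{\{\xi_1,\xi_2\},\xi_3\}+(-1)^{|\xi_1||\xi_2|}\{\xi_2,\{\xi_1,\xi_3\}\}$.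 If $(\rho,[\cdot,\cdot])$ is a Lie algebroid structure on $B$, a 2-term representation up to homotopy of $B$ on a complex $\partial_Q\colon Q^*\to Q$ (a vector bundle morphism over the identity of $M$) consists of two linear $B$-connections, $\nabla^{Q^*}$ on $Q^*$ and $\nabla^{Q}$ on $Q$, and a form $R\in\Omega^2(B,\operatorname{Hom}(Q,Q^*))$ such that $\partial_Q\circ\nabla^{Q^*}=\nabla^Q\circ\partial_Q$, $R_{\nabla^{Q^*}}=R\circ\partial_Q$, $R_{\nabla^Q}=\partial_Q\circ R$ and $\mathbf d_{\nabla^{\operatorname{Hom}}}R=0$, where $R_\nabla$ denotes the curvature of $\nabla$ and $\nabla^{\operatorname{Hom}}$ is the induced connection on $\operatorname{Hom}(Q,Q^*)$. It is self-dual if $\partial_Q=\partial_Q^*$, $\nabla^{Q}$ and $\nabla^{Q^*}$ are dual to each other, and $R^*=-R$. **Theorem.** There is a bijection between the Poisson brackets of degree $-2$ on $Q[-1]\oplus B^*[-2]$ and the pairs consisting of a Lie algebroid structure $(\rho,[\cdot,\cdot])$ on $B$ and a self-dual 2-term representation up to homotopy $(\partial_Q,\nabla^{Q^*},\nabla^Q,R)$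 of this Lie algebroid on a complex $\partial_Q\colon Q^*\to Q$. A bracket and a pair correspond to each other if and only if $$\{b,f\}=\rho(b)(f),\qquad \{\tau_1,\tau_2\}=\langle\tau_2,\partial_Q\tau_1\rangle,\qquad \{b,\tau\}=\nabla^{Q^*}_b\tau,\qquad \{b_1,b_2\}=[b_1,b_2]-R(b_1,b_2)$$ for all $f\in C^\infty(M)$, $\tau,\tau_1,\tau_2\in\Gamma(Q^*)$ and $b,b_1,b_2\in\Gamma(B)$. Here $R(b_1,b_2)$ is considered as the section of $\wedge^2Q^*$ given by $(q_1,q_2)\mapsto\langle R(b_1,b_2)q_1,q_2\rangle$, where $(\tau_1\wedge\tau_2)(q_1,q_2)=\tau_1(q_1)\tau_2(q_2)-\tau_1(q_2)\tau_2(q_1)$. -/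

import Mathlib

open Bundle Manifold Set TopologicalSpace
open scoped Manifold ContDiff Bundle Topology TensorProduct

noncomputable section

namespace SplitPoisson

/-! ### Smooth sections -/

section Sections

variable {E : Type*} [NormedAddCommGroup E] [NormedSpace ℝ E] {H : Type*} [TopologicalSpace H]
  (I : ModelWithCorners ℝ E H) {M : Type*} [TopologicalSpace M] [ChartedSpace H M]

/-- `Γ(V)`: the smooth (global) sections of a vector bundle `V` over `M` with model fibre `F`. -/
abbrev Sec (F : Type*) [NormedAddCommGroup F] [NormedSpace ℝ F] (V : M → Type*)
    [TopologicalSpace (TotalSpace F V)] [∀ x, TopologicalSpace (V x)] [FiberBundle F V] : Type _ :=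
  ContMDiffSection I F ∞ V

/-- The dual bundle `V*`. -/
abbrev DualBundle (V : M → Type*) [∀ x, AddCommGroup (V x)] [∀ x, Module ℝ (V x)]
    [∀ x, TopologicalSpace (V x)] : M → Type _ := fun x => V x →L[ℝ] ℝ

/-- The bundle `Hom(V, W)`. -/
abbrev HomBundle (V W : M → Type*)
    [∀ x, AddCommGroup (V x)] [∀ x, Module ℝ (V x)] [∀ x, TopologicalSpace (V x)]
    [∀ x, AddCommGroup (W x)] [∀ x, Module ℝ (W x)] [∀ x, TopologicalSpace (W x)] :
    M → Type _ := fun x => V x →L[ℝ] W x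

variable {I}

section
variable {F : Type*} [NormedAddCommGroup F] [NormedSpace ℝ F] {V : M → Type*}
  [TopologicalSpace (TotalSpace F V)] [∀ x, AddCommGroup (V x)] [∀ x, Module ℝ (V x)]
  [∀ x, TopologicalSpace (V x)] [FiberBundle F V] [VectorBundle ℝ F V]

/-- The product `f s` of a smooth function and a smooth section. -/
def fsmul (f : C^∞⟮I, M; ℝ⟯) (s : Sec I F V) : Sec I F V :=
  ⟨fun x => f x • s x, f.contMDiff.smul_section s.contMDiff⟩

variable {F' : Type*} [NormedAddCommGroup F'] [NormedSpace ℝ F'] {W : M → Type*}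
  [TopologicalSpace (TotalSpace F' W)] [∀ x, AddCommGroup (W x)] [∀ x, Module ℝ (W x)]
  [∀ x, TopologicalSpace (W x)] [FiberBundle F' W] [VectorBundle ℝ F' W]
  [∀ x, IsTopologicalAddGroup (W x)] [∀ x, ContinuousSMul ℝ (W x)]

/-- The section `φ(s)` of `W`, for `φ ∈ Γ(Hom(V, W))` and `s ∈ Γ(V)`. -/
def homApply (φ : Sec I (F →L[ℝ] F') (HomBundle V W)) (s : Sec I F V) : Sec I F' W :=
  ⟨fun x => φ x (s x), φ.contMDiff.clm_bundle_apply s.contMDiff⟩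

end

end Sections

/-! ### Lie algebroids, connections and 2-term representations up to homotopy -/

section Ruth

variable {E : Type*} [NormedAddCommGroup E] [NormedSpace ℝ E] {H : Type*} [TopologicalSpace H]
  (I : ModelWithCorners ℝ E H) {M : Type*} [TopologicalSpace M] [ChartedSpace H M]
  [IsManifold I ∞ M]
  (FB : Type*) [NormedAddCommGroup FB] [NormedSpace ℝ FB] (B : M → Type*)
  [TopologicalSpace (TotalSpace FB B)] [∀ x, AddCommGroup (B x)] [∀ x, Module ℝ (B x)]
  [∀ x, TopologicalSpace (B x)] [FiberBundle FB B] [VectorBundle ℝ FB B]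

/-- Smooth vector bundle morphisms `B → TM` over the identity of `M`. -/
abbrev Anchor : Type _ := Sec I (FB →L[ℝ] E) (HomBundle B (fun x : M => TangentSpace I x))

variable {I FB B}

/-- `ρ(b)(f)`: the derivative of the function `f` along the vector field `ρ(b)`. -/
def Anchor.deriv (ρ : Anchor I FB B) (b : Sec I FB B) (f : M → ℝ) (x : M) : ℝ :=
  mfderiv I 𝓘(ℝ, ℝ) f x (ρ x (b x))

variable (I FB B)

/-- A Lie algebroid structure `(ρ, [·,·])` on the vector bundle `B → M`. -/
@[ext]
structure LieAlgebroid where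
  /-- the anchor `ρ : B → TM` -/
  anchor : Anchor I FB B
  /-- the Lie bracket on `Γ(B)` -/
  bracket : Sec I FB B →ₗ[ℝ] Sec I FB B →ₗ[ℝ] Sec I FB B
  skew : ∀ a b, bracket a b = -bracket b a
  jacobi : ∀ a b c, bracket a (bracket b c) = bracket (bracket a b) c + bracket b (bracket a c)
  /-- `[a, f b] = f [a, b] + ρ(a)(f) b` -/
  leibniz : ∀ (a b : Sec I FB B) (f : C^∞⟮I, M; ℝ⟯) (x : M),
    bracket a (fsmul f b) x = f x • bracket a b x + anchor.deriv a f x • b x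
  /-- `ρ([a, b]) = [ρ(a), ρ(b)]`, the commutator of derivations of the smooth functions -/
  anchor_bracket : ∀ (a b : Sec I FB B) (f : C^∞⟮I, M; ℝ⟯) (x : M),
    anchor.deriv (bracket a b) f x =
      anchor.deriv a (anchor.deriv b f) x - anchor.deriv b (anchor.deriv a f) x

variable {I FB B}

/-- A linear `B`-connection `∇ : Γ(B) × Γ(V) → Γ(V)` on a vector bundle `V`, for the Lie algebroid
structure `A` on `B`. -/
@[ext]
structure Connection (A : LieAlgebroid I FB B)
    (F : Type*) [NormedAddCommGroup F] [NormedSpace ℝ F] (V : M → Type*)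
    [TopologicalSpace (TotalSpace F V)] [∀ x, AddCommGroup (V x)] [∀ x, Module ℝ (V x)]
    [∀ x, TopologicalSpace (V x)] [FiberBundle F V] [VectorBundle ℝ F V] where
  /-- `∇ b s = ∇_b s` -/
  nabla : Sec I FB B →ₗ[ℝ] Sec I F V →ₗ[ℝ] Sec I F V
  /-- `∇_{f b} s = f ∇_b s` -/
  nabla_fsmul : ∀ (f : C^∞⟮I, M; ℝ⟯) (b : Sec I FB B) (s : Sec I F V),
    nabla (fsmul f b) s = fsmul f (nabla b s)
  /-- `∇_b (f s) = f ∇_b s + ρ(b)(f) s` -/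
  leibniz : ∀ (b : Sec I FB B) (f : C^∞⟮I, M; ℝ⟯) (s : Sec I F V) (x : M),
    nabla b (fsmul f s) x = f x • nabla b s x + A.anchor.deriv b f x • s x

/-- The curvature `R_∇(a, b) s = ∇_a ∇_b s - ∇_b ∇_a s - ∇_{[a, b]} s`. -/
def Connection.curvature {A : LieAlgebroid I FB B}
    {F : Type*} [NormedAddCommGroup F] [NormedSpace ℝ F] {V : M → Type*}
    [TopologicalSpace (TotalSpace F V)] [∀ x, AddCommGroup (V x)] [∀ x, Module ℝ (V x)]
    [∀ x, TopologicalSpace (V x)] [FiberBundle F V] [VectorBundle ℝ F V]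
    (D : Connection A F V) (a b : Sec I FB B) (s : Sec I F V) : Sec I F V :=
  D.nabla a (D.nabla b s) - D.nabla b (D.nabla a s) - D.nabla (A.bracket a b) s

variable (FB B) in
/-- `Ω²(B, W)`: the smooth 2-forms on `B` with values in the vector bundle `W`. -/
@[ext]
structure TwoForm (I : ModelWithCorners ℝ E H)
    (F : Type*) [NormedAddCommGroup F] [NormedSpace ℝ F] (W : M → Type*)
    [TopologicalSpace (TotalSpace F W)] [∀ x, AddCommGroup (W x)] [∀ x, Module ℝ (W x)]
    [∀ x, TopologicalSpace (W x)] [FiberBundle F W] [VectorBundle ℝ F W] where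
  /-- the bilinear maps `B_x × B_x → W_x` -/
  toFun : Π x : M, B x →ₗ[ℝ] B x →ₗ[ℝ] W x
  alt : ∀ (x : M) (b : B x), toFun x b b = 0
  smooth : ∀ a b : Sec I FB B,
    ContMDiff I (I.prod 𝓘(ℝ, F)) ∞ (fun x => TotalSpace.mk' F x (toFun x (a x) (b x)))

/-- The section `R(a, b)` of `W`, for `R ∈ Ω²(B, W)`. -/
def TwoForm.eval {F : Type*} [NormedAddCommGroup F] [NormedSpace ℝ F] {W : M → Type*}
    [TopologicalSpace (TotalSpace F W)] [∀ x, AddCommGroup (W x)] [∀ x, Module ℝ (W x)]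
    [∀ x, TopologicalSpace (W x)] [FiberBundle F W] [VectorBundle ℝ F W]
    (R : TwoForm FB B I F W) (a b : Sec I FB B) : Sec I F W :=
  ⟨fun x => R.toFun x (a x) (b x), R.smooth a b⟩

section TwoTerm

variable {F₀ : Type*} [NormedAddCommGroup F₀] [NormedSpace ℝ F₀] {V₀ : M → Type*}
  [TopologicalSpace (TotalSpace F₀ V₀)] [∀ x, AddCommGroup (V₀ x)] [∀ x, Module ℝ (V₀ x)]
  [∀ x, TopologicalSpace (V₀ x)] [FiberBundle F₀ V₀] [VectorBundle ℝ F₀ V₀]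
  [∀ x, IsTopologicalAddGroup (V₀ x)] [∀ x, ContinuousSMul ℝ (V₀ x)]
  {F₁ : Type*} [NormedAddCommGroup F₁] [NormedSpace ℝ F₁] {V₁ : M → Type*}
  [TopologicalSpace (TotalSpace F₁ V₁)] [∀ x, AddCommGroup (V₁ x)] [∀ x, Module ℝ (V₁ x)]
  [∀ x, TopologicalSpace (V₁ x)] [FiberBundle F₁ V₁] [VectorBundle ℝ F₁ V₁]
  [∀ x, IsTopologicalAddGroup (V₁ x)] [∀ x, ContinuousSMul ℝ (V₁ x)]

/-- The section `(∇^Hom_b φ)(s) = ∇⁰_b (φ(s)) - φ(∇¹_b s)`, where `∇^Hom` is the connection on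
`Hom(V₁, V₀)` induced by `∇⁰` on `V₀` and `∇¹` on `V₁`. -/
def nablaHom {A : LieAlgebroid I FB B} (D₀ : Connection A F₀ V₀) (D₁ : Connection A F₁ V₁)
    (b : Sec I FB B) (φ : Sec I (F₁ →L[ℝ] F₀) (HomBundle V₁ V₀)) (s : Sec I F₁ V₁) :
    Sec I F₀ V₀ :=
  D₀.nabla b (homApply φ s) - homApply φ (D₁.nabla b s)

end TwoTerm

/-- A 2-term representation up to homotopy `(∂, ∇⁰, ∇¹, R)` of the Lie algebroid `(B, A)` on the
complex `∂ : V₀ → V₁`. -/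
@[ext]
structure TwoRep (A : LieAlgebroid I FB B)
    (F₀ : Type*) [NormedAddCommGroup F₀] [NormedSpace ℝ F₀] (V₀ : M → Type*)
    [TopologicalSpace (TotalSpace F₀ V₀)] [∀ x, AddCommGroup (V₀ x)] [∀ x, Module ℝ (V₀ x)]
    [∀ x, TopologicalSpace (V₀ x)] [FiberBundle F₀ V₀] [VectorBundle ℝ F₀ V₀]
    [∀ x, IsTopologicalAddGroup (V₀ x)] [∀ x, ContinuousSMul ℝ (V₀ x)]
    (F₁ : Type*) [NormedAddCommGroup F₁] [NormedSpace ℝ F₁] (V₁ : M → Type*)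
    [TopologicalSpace (TotalSpace F₁ V₁)] [∀ x, AddCommGroup (V₁ x)] [∀ x, Module ℝ (V₁ x)]
    [∀ x, TopologicalSpace (V₁ x)] [FiberBundle F₁ V₁] [VectorBundle ℝ F₁ V₁]
    [∀ x, IsTopologicalAddGroup (V₁ x)] [∀ x, ContinuousSMul ℝ (V₁ x)] where
  /-- the vector bundle morphism `∂ : V₀ → V₁` -/
  bd : Sec I (F₀ →L[ℝ] F₁) (HomBundle V₀ V₁)
  /-- the `B`-connection `∇⁰` on `V₀` -/
  conn₀ : Connection A F₀ V₀
  /-- the `B`-connection `∇¹` on `V₁` -/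
  conn₁ : Connection A F₁ V₁
  /-- the form `R ∈ Ω²(B, Hom(V₁, V₀))` -/
  R : TwoForm FB B I (F₁ →L[ℝ] F₀) (HomBundle V₁ V₀)
  /-- `∂ ∘ ∇⁰ = ∇¹ ∘ ∂` -/
  bd_nabla : ∀ b s, homApply bd (conn₀.nabla b s) = conn₁.nabla b (homApply bd s)
  /-- `R_{∇⁰} = R ∘ ∂` -/
  curvature₀ : ∀ a b s, conn₀.curvature a b s = homApply (R.eval a b) (homApply bd s)
  /-- `R_{∇¹} = ∂ ∘ R` -/
  curvature₁ : ∀ a b s, conn₁.curvature a b s = homApply bd (homApply (R.eval a b) s)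
  /-- `d_{∇^Hom} R = 0` -/
  dR : ∀ a b c s,
    -homApply (R.eval (A.bracket a b) c) s + homApply (R.eval (A.bracket a c) b) s
      - homApply (R.eval (A.bracket b c) a) s
      + nablaHom conn₀ conn₁ a (R.eval b c) s - nablaHom conn₀ conn₁ b (R.eval a c) s
      + nablaHom conn₀ conn₁ c (R.eval a b) s = 0

variable (I FB B)
variable (FQ : Type*) [NormedAddCommGroup FQ] [NormedSpace ℝ FQ] (Q : M → Type*)
  [TopologicalSpace (TotalSpace FQ Q)] [∀ x, AddCommGroup (Q x)] [∀ x, Module ℝ (Q x)]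
  [∀ x, TopologicalSpace (Q x)] [FiberBundle FQ Q] [VectorBundle ℝ FQ Q]
  [∀ x, IsTopologicalAddGroup (Q x)] [∀ x, ContinuousSMul ℝ (Q x)]

/-- A Lie algebroid structure on `B` together with a self-dual 2-term representation up to homotopy
of it on a complex `∂ : Q* → Q` : the pairing of `τ ∈ Q*` with `q ∈ Q` is `τ q`. -/
@[ext]
structure SelfDualTwoRep where
  /-- the Lie algebroid structure on `B` -/
  alg : LieAlgebroid I FB B
  /-- the 2-representation on `∂ : Q* → Q` -/
  rep : TwoRep alg (FQ →L[ℝ] ℝ) (DualBundle Q) FQ Q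
  /-- `∂* = ∂` -/
  bd_symm : ∀ (x : M) (τ₁ τ₂ : Q x →L[ℝ] ℝ), τ₂ (rep.bd x τ₁) = τ₁ (rep.bd x τ₂)
  /-- the connections on `Q*` and `Q` are dual to each other:
  `ρ(b)⟨τ, q⟩ = ⟨∇_b τ, q⟩ + ⟨τ, ∇_b q⟩` -/
  conn_dual : ∀ (b : Sec I FB B) (τ : Sec I (FQ →L[ℝ] ℝ) (DualBundle Q)) (q : Sec I FQ Q) (x : M),
    alg.anchor.deriv b (fun y => τ y (q y)) x =
      rep.conn₀.nabla b τ x (q x) + τ x (rep.conn₁.nabla b q x)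
  /-- `R* = -R` -/
  R_dual : ∀ (x : M) (b c : B x) (q₁ q₂ : Q x), rep.R.toFun x b c q₁ q₂ = -rep.R.toFun x b c q₂ q₁

end Ruth

/-! ### The split `[2]`-manifold `Q[-1] ⊕ B*[-2]` -/

section Functions

/-- The graded commutative algebra `⋀ V* ⊗ Sym W`, freely generated by `V*` in degree `1` and by `W`
in degree `2`. As `Sym W` sits in even degrees, no sign occurs in the product of the tensor
product. -/
def FreeAlg (V W : Type*) [AddCommGroup V] [Module ℝ V] [TopologicalSpace V]
    [AddCommGroup W] [Module ℝ W] : Type _ :=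
  ExteriorAlgebra ℝ (V →L[ℝ] ℝ) ⊗[ℝ] SymmetricAlgebra ℝ W

section Fibre

variable (V W : Type*) [AddCommGroup V] [Module ℝ V] [TopologicalSpace V]
  [AddCommGroup W] [Module ℝ W]

instance : Ring (FreeAlg V W) :=
  inferInstanceAs (Ring (ExteriorAlgebra ℝ (V →L[ℝ] ℝ) ⊗[ℝ] SymmetricAlgebra ℝ W))

instance : Algebra ℝ (FreeAlg V W) :=
  inferInstanceAs (Algebra ℝ (ExteriorAlgebra ℝ (V →L[ℝ] ℝ) ⊗[ℝ] SymmetricAlgebra ℝ W))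

/-- The inclusion `⋀ V* → ⋀ V* ⊗ Sym W`. -/
def FreeAlg.ofExt : ExteriorAlgebra ℝ (V →L[ℝ] ℝ) →ₐ[ℝ] FreeAlg V W :=
  Algebra.TensorProduct.includeLeft (R := ℝ) (S := ℝ) (A := ExteriorAlgebra ℝ (V →L[ℝ] ℝ))
    (B := SymmetricAlgebra ℝ W)

/-- The inclusion `Sym W → ⋀ V* ⊗ Sym W`. -/
def FreeAlg.ofSym : SymmetricAlgebra ℝ W →ₐ[ℝ] FreeAlg V W :=
  Algebra.TensorProduct.includeRight (R := ℝ) (A := ExteriorAlgebra ℝ (V →L[ℝ] ℝ))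
    (B := SymmetricAlgebra ℝ W)

/-- The inclusion of `V*` as generators of degree `1`. -/
def FreeAlg.gen₁ : (V →L[ℝ] ℝ) →ₗ[ℝ] FreeAlg V W :=
  (FreeAlg.ofExt V W).toLinearMap ∘ₗ ExteriorAlgebra.ι ℝ

/-- The inclusion of `W` as generators of degree `2`. -/
def FreeAlg.gen₂ : W →ₗ[ℝ] FreeAlg V W :=
  (FreeAlg.ofSym V W).toLinearMap ∘ₗ SymmetricAlgebra.ι ℝ W

/-- The homogeneous elements of degree `n` : the span of all products of `i` generators of degree
`1` and `j` generators of degree `2` with `i + 2 j = n`. There are none but `0` if `n < 0`. -/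
def FreeAlg.deg (n : ℤ) : Submodule ℝ (FreeAlg V W) :=
  ⨆ (i : ℕ) (j : ℕ) (_ : (i : ℤ) + 2 * j = n),
    LinearMap.range (FreeAlg.gen₁ V W) ^ i * LinearMap.range (FreeAlg.gen₂ V W) ^ j

variable {V}

/-- `θ ∈ ⋀² V*` is the 2-form `r : V × V → ℝ`, i.e. `θ(v, w) = r(v)(w)`. The form is read off by the
contractions, which are odd derivations: for `θ = τ₁ ∧ τ₂` this is
`r(v)(w) = τ₁(v) τ₂(w) - τ₁(w) τ₂(v)`. -/
def IsTwoForm (θ : ExteriorAlgebra ℝ (V →L[ℝ] ℝ)) (r : V → V → ℝ) : Prop :=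
  θ ∈ ⋀[ℝ]^2 (V →L[ℝ] ℝ) ∧ ∀ v w : V,
    CliffordAlgebra.contractLeft (Module.Dual.eval ℝ V w ∘ₗ ContinuousLinearMap.coeLM ℝ)
      (CliffordAlgebra.contractLeft (Module.Dual.eval ℝ V v ∘ₗ ContinuousLinearMap.coeLM ℝ) θ) =
      algebraMap ℝ _ (r v w)

end Fibre

variable {E : Type*} [NormedAddCommGroup E] [NormedSpace ℝ E] {H : Type*} [TopologicalSpace H]
  (I : ModelWithCorners ℝ E H) {M : Type*} [TopologicalSpace M] [ChartedSpace H M]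
  (FB : Type*) [NormedAddCommGroup FB] [NormedSpace ℝ FB] (B : M → Type*)
  [TopologicalSpace (TotalSpace FB B)] [∀ x, AddCommGroup (B x)] [∀ x, Module ℝ (B x)]
  [∀ x, TopologicalSpace (B x)] [FiberBundle FB B] [VectorBundle ℝ FB B]
  (FQ : Type*) [NormedAddCommGroup FQ] [NormedSpace ℝ FQ] (Q : M → Type*)
  [TopologicalSpace (TotalSpace FQ Q)] [∀ x, AddCommGroup (Q x)] [∀ x, Module ℝ (Q x)]
  [∀ x, TopologicalSpace (Q x)] [FiberBundle FQ Q] [VectorBundle ℝ FQ Q]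

/-- The generators over the open set `U` : the smooth functions on `U`, the smooth sections of
`Q*` over `U` and the smooth sections of `B = (B*)*` over `U`. (They are represented by families
defined on all of `M`, whose values outside of `U` are irrelevant.) -/
def generators (U : Opens M) : Set (Π x : M, FreeAlg (Q x) (B x)) :=
  {s | ∃ f : M → ℝ, ContMDiffOn I 𝓘(ℝ, ℝ) ∞ f U ∧ s = fun x => algebraMap ℝ _ (f x)} ∪
  {s | ∃ τ : Π x : M, Q x →L[ℝ] ℝ,
    ContMDiffOn I (I.prod 𝓘(ℝ, FQ →L[ℝ] ℝ)) ∞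
      (fun x => TotalSpace.mk' (FQ →L[ℝ] ℝ) (E := DualBundle Q) x (τ x)) U ∧
    s = fun x => FreeAlg.gen₁ (Q x) (B x) (τ x)} ∪
  {s | ∃ b : Π x : M, B x,
    ContMDiffOn I (I.prod 𝓘(ℝ, FB)) ∞ (fun x => TotalSpace.mk' FB x (b x)) U ∧
    s = fun x => FreeAlg.gen₂ (Q x) (B x) (b x)}

variable {B Q} in
lemma generators_mono {U V : Opens M} (h : V ≤ U) :
    generators I FB B FQ Q U ⊆ generators I FB B FQ Q V := by
  rintro s ((⟨f, hf, rfl⟩ | ⟨f, hf, rfl⟩) | ⟨f, hf, rfl⟩)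
  · exact Or.inl (Or.inl ⟨f, hf.mono h, rfl⟩)
  · exact Or.inl (Or.inr ⟨f, hf.mono h, rfl⟩)
  · exact Or.inr ⟨f, hf.mono h, rfl⟩

/-- `C^∞(𝓜)(U)` for the split `[2]`-manifold `𝓜 = Q[-1] ⊕ B*[-2]` : the algebra of all families
`s x ∈ ⋀ Q_x* ⊗ Sym B_x`, `x ∈ U`, that are locally polynomials in the generators. -/
def Fun (U : Opens M) : Subalgebra ℝ (Π x : U, FreeAlg (Q x) (B x)) where
  carrier := {s | ∀ x : U, ∃ V : Opens M, (x : M) ∈ V ∧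
    ∃ t ∈ Algebra.adjoin ℝ (generators I FB B FQ Q V), ∀ y : U, (y : M) ∈ V → s y = t y}
  mul_mem' := by
    intro s s' hs hs' x
    obtain ⟨V, hxV, t, ht, h⟩ := hs x
    obtain ⟨V', hxV', t', ht', h'⟩ := hs' x
    exact ⟨V ⊓ V', ⟨hxV, hxV'⟩, t * t',
      mul_mem (Algebra.adjoin_mono (generators_mono I FB FQ inf_le_left) ht)
        (Algebra.adjoin_mono (generators_mono I FB FQ inf_le_right) ht'),
      fun y hy => by simp [h y hy.1, h' y hy.2]⟩
  add_mem' := by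
    intro s s' hs hs' x
    obtain ⟨V, hxV, t, ht, h⟩ := hs x
    obtain ⟨V', hxV', t', ht', h'⟩ := hs' x
    exact ⟨V ⊓ V', ⟨hxV, hxV'⟩, t + t',
      add_mem (Algebra.adjoin_mono (generators_mono I FB FQ inf_le_left) ht)
        (Algebra.adjoin_mono (generators_mono I FB FQ inf_le_right) ht'),
      fun y hy => by simp [h y hy.1, h' y hy.2]⟩
  algebraMap_mem' := fun r x =>
    ⟨U, x.2, algebraMap ℝ _ r, Subalgebra.algebraMap_mem _ r, fun _ _ => rfl⟩

variable {I FB B FQ Q}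

/-- The restriction `C^∞(𝓜)(U) → C^∞(𝓜)(V)` for `V ⊆ U`. -/
def Fun.res {U V : Opens M} (h : V ≤ U) (s : Fun I FB B FQ Q U) : Fun I FB B FQ Q V :=
  ⟨fun x => s.1 ⟨x, h x.2⟩, fun x => by
    obtain ⟨W, hxW, t, ht, hs⟩ := s.2 ⟨x, h x.2⟩
    exact ⟨W, hxW, t, ht, fun y hy => hs ⟨y, h y.2⟩ hy⟩⟩

/-- `s` is homogeneous of degree `n`. -/
def Fun.IsHomogeneous {U : Opens M} (n : ℤ) (s : Fun I FB B FQ Q U) : Prop :=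
  ∀ x : U, s.1 x ∈ FreeAlg.deg (Q x) (B x) n

variable (B FQ Q FB)

/-- A smooth function on `M`, as a function of degree `0` on `𝓜`. -/
def incl₀ (f : C^∞⟮I, M; ℝ⟯) : Fun I FB B FQ Q ⊤ :=
  ⟨fun x => algebraMap ℝ _ (f x), fun _ => ⟨⊤, trivial, _,
    Algebra.subset_adjoin (Or.inl (Or.inl ⟨f, f.contMDiff.contMDiffOn, rfl⟩)), fun _ _ => rfl⟩⟩

variable {FQ Q}

/-- A section of `Q*`, as a function of degree `1` on `𝓜`. -/
def incl₁ (τ : Sec I (FQ →L[ℝ] ℝ) (DualBundle Q)) : Fun I FB B FQ Q ⊤ :=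
  ⟨fun x => FreeAlg.gen₁ (Q x) (B x) (τ x), fun _ => ⟨⊤, trivial, _,
    Algebra.subset_adjoin (Or.inl (Or.inr ⟨τ, τ.contMDiff.contMDiffOn, rfl⟩)), fun _ _ => rfl⟩⟩

variable {FB B} (FQ Q)

/-- A section of `B`, as a function of degree `2` on `𝓜`. -/
def incl₂ (b : Sec I FB B) : Fun I FB B FQ Q ⊤ :=
  ⟨fun x => FreeAlg.gen₂ (Q x) (B x) (b x), fun _ => ⟨⊤, trivial, _,
    Algebra.subset_adjoin (Or.inr ⟨b, b.contMDiff.contMDiffOn, rfl⟩), fun _ _ => rfl⟩⟩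

variable (I FB B)

/-- A Poisson bracket of degree `-2` on (the sheaf of functions of) the split `[2]`-manifold
`𝓜 = Q[-1] ⊕ B*[-2]`. -/
@[ext]
structure PoissonBracket where
  /-- the bracket over the open set `U` -/
  bracket : ∀ U : Opens M,
    Fun I FB B FQ Q U →ₗ[ℝ] Fun I FB B FQ Q U →ₗ[ℝ] Fun I FB B FQ Q U
  res_bracket : ∀ {U V : Opens M} (h : V ≤ U) (ξ η : Fun I FB B FQ Q U),
    Fun.res h (bracket U ξ η) = bracket V (Fun.res h ξ) (Fun.res h η)
  degree : ∀ {U : Opens M} {i j : ℕ} {ξ η : Fun I FB B FQ Q U},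
    Fun.IsHomogeneous i ξ → Fun.IsHomogeneous j η → Fun.IsHomogeneous ((i : ℤ) + j - 2) (bracket U ξ η)
  skew : ∀ {U : Opens M} {i j : ℕ} {ξ η : Fun I FB B FQ Q U},
    Fun.IsHomogeneous i ξ → Fun.IsHomogeneous j η →
      bracket U ξ η = -((-1 : ℝ) ^ (i * j) • bracket U η ξ)
  leibniz : ∀ {U : Opens M} {i j k : ℕ} {ξ₁ ξ₂ ξ₃ : Fun I FB B FQ Q U},
    Fun.IsHomogeneous i ξ₁ → Fun.IsHomogeneous j ξ₂ → Fun.IsHomogeneous k ξ₃ →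
      bracket U ξ₁ (ξ₂ * ξ₃) =
        bracket U ξ₁ ξ₂ * ξ₃ + (-1 : ℝ) ^ (i * j) • (ξ₂ * bracket U ξ₁ ξ₃)
  jacobi : ∀ {U : Opens M} {i j k : ℕ} {ξ₁ ξ₂ ξ₃ : Fun I FB B FQ Q U},
    Fun.IsHomogeneous i ξ₁ → Fun.IsHomogeneous j ξ₂ → Fun.IsHomogeneous k ξ₃ →
      bracket U ξ₁ (bracket U ξ₂ ξ₃) =
        bracket U (bracket U ξ₁ ξ₂) ξ₃ + (-1 : ℝ) ^ (i * j) • bracket U ξ₂ (bracket U ξ₁ ξ₃)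

variable {I FB B FQ Q}
variable [IsManifold I ∞ M] [∀ x, IsTopologicalAddGroup (Q x)] [∀ x, ContinuousSMul ℝ (Q x)]

/-- The Poisson bracket `P` and the self-dual 2-representation `D` determine each other by
`{b, f} = ρ(b)(f)`, `{τ₁, τ₂} = ⟨τ₂, ∂τ₁⟩`, `{b, τ} = ∇_b τ` and
`{b₁, b₂} = [b₁, b₂] - R(b₁, b₂)`, where the skew-symmetric `R(b₁, b₂) ∈ Γ(Hom(Q, Q*))` is
considered as the section `θ` of `⋀² Q*` with `θ(q₁, q₂) = ⟨R(b₁, b₂) q₁, q₂⟩`. -/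
structure Corresponds (P : PoissonBracket I FB B FQ Q) (D : SelfDualTwoRep I FB B FQ Q) :
    Prop where
  bracket_two_zero : ∀ (b : Sec I FB B) (f : C^∞⟮I, M; ℝ⟯) (x : (⊤ : Opens M)),
    (P.bracket ⊤ (incl₂ FQ Q b) (incl₀ FB B FQ Q f)).1 x =
      algebraMap ℝ _ (D.alg.anchor.deriv b f x)
  bracket_one_one : ∀ (τ₁ τ₂ : Sec I (FQ →L[ℝ] ℝ) (DualBundle Q)) (x : (⊤ : Opens M)),
    (P.bracket ⊤ (incl₁ FB B τ₁) (incl₁ FB B τ₂)).1 x =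
      algebraMap ℝ _ (τ₂ x (D.rep.bd x (τ₁ x)))
  bracket_two_one : ∀ (b : Sec I FB B) (τ : Sec I (FQ →L[ℝ] ℝ) (DualBundle Q)),
    P.bracket ⊤ (incl₂ FQ Q b) (incl₁ FB B τ) = incl₁ FB B (D.rep.conn₀.nabla b τ)
  bracket_two_two : ∀ (b₁ b₂ : Sec I FB B) (x : (⊤ : Opens M)),
    ∃ θ : ExteriorAlgebra ℝ (Q x →L[ℝ] ℝ),
      IsTwoForm θ (fun q₁ q₂ => D.rep.R.toFun x (b₁ x) (b₂ x) q₁ q₂) ∧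
      (P.bracket ⊤ (incl₂ FQ Q b₁) (incl₂ FQ Q b₂)).1 x =
        FreeAlg.gen₂ (Q x) (B x) (D.alg.bracket b₁ b₂ x) - FreeAlg.ofExt (Q x) (B x) θ

end Functions

end SplitPoisson

end

/-! A skew-symmetric biderivation of degree `-2` is determined by its values on pairs of generators,
and the degree leaves four kinds of pairs that can be nonzero. `{b, f}` and `{τ₁, τ₂}` are
functions, `{b, τ}` is a section of `Q*`, and `{b₁, b₂}` is a section of `B` plus a section of
`∧²Q*`. The Leibniz rule tells how these values change when a generator is multiplied by a function.
The resulting rules are those of an anchor, of a symmetric `∂ : Q* → Q`, of a `B`-connection on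
`Q*`, of a skew bracket on `Γ(B)` with its Leibniz rule, and of a tensor `R` with `R* = -R`. The
connection on `Q` is forced by duality.

The proof therefore separates the linear data from the quadratic equations. A `PreBracket` is a
Poisson bracket without the Jacobi identity, a `PreRep` is a self-dual 2-representation without its
structure equations, and `Corr` relates the two. Each determines the other (`Corr.preRep_unique`,
`Corr.bracket_unique`), and each exists for the other (`PreBracket.exists_preRep`,
`PreRep.exists_preBracket`).

For the quadratic part, the Jacobiator is a graded skew-symmetric derivation in each entry
(`jac_mul`, `jac_swap₁₂`, `jac_swap₂₃`) and lowers the total degree by `4`. Hence it vanishes as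
soon as it does on generators of degrees `(2,2,0)`, `(2,2,1)`, `(2,1,1)` and `(2,2,2)`. There it
measures, in turn, the failure of `ρ[b,c] = [ρb,ρc]`, of `R_∇ = R ∘ ∂` on `Q*`, of `∂∇ = ∇∂`, and,
split into its `B`-part and its `∧²Q*`-part, of the Jacobi identity in `Γ(B)` and of `d_∇ R = 0`.
The remaining equation `R_∇ = ∂ ∘ R` on `Q` follows by duality (`IsFlat.curvature₁`). So Jacobi for
the bracket is equivalent to flatness of the data (`Corr.isFlat`, `Corr.jacobi`).

The laborious direction is the construction of the bracket from the data. It is done one point at a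
time: at `x`, dual frames give odd contractions `ι_k` along `Q` and even derivations `κ_i` along
`B*`, and the value of the bracket is a symmetric combination of the `ι_k ι_l` with coefficients
from `∂` plus the antisymmetrised products of `κ_i` with derivations `X_i` that imitate `{s_i, ·}`
(`exists_bracketAt`). These values depend on germs only, and every function on the graded manifold
is locally a polynomial in global sections, so smoothness on generators is enough to assemble a
bracket of sheaves (`bracketFamily_of_generators`, `BracketFamily.toPreBracket`). -/

open Bundle Manifold Set TopologicalSpace
open scoped Manifold ContDiff Bundle Topology TensorProduct
noncomputable section
namespace SplitPoisson
set_option linter.unusedSectionVars false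

section Instances

variable {M : Type*} {V W : M → Type*} [∀ x, AddCommGroup (V x)] [∀ x, Module ℝ (V x)]
  [∀ x, TopologicalSpace (V x)] [∀ x, AddCommGroup (W x)] [∀ x, Module ℝ (W x)]
  [∀ x, TopologicalSpace (W x)] [∀ x, IsTopologicalAddGroup (W x)] [∀ x, ContinuousSMul ℝ (W x)]

/-! Shortcuts for the instance search. -/

instance (x : M) : TopologicalSpace (DualBundle V x) := inferInstance
instance (x : M) : AddCommGroup (DualBundle V x) := inferInstance
instance (x : M) : AddCommMonoid (DualBundle V x) := inferInstance
instance (x : M) : Module ℝ (DualBundle V x) := inferInstance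
instance (x : M) : IsTopologicalAddGroup (DualBundle V x) := inferInstance
instance (x : M) : ContinuousAdd (DualBundle V x) := inferInstance
instance (x : M) : ContinuousSMul ℝ (DualBundle V x) := inferInstance
instance (x : M) : TopologicalSpace (HomBundle V W x) := inferInstance
instance (x : M) : AddCommGroup (HomBundle V W x) := inferInstance
instance (x : M) : AddCommMonoid (HomBundle V W x) := inferInstance
instance (x : M) : Module ℝ (HomBundle V W x) := inferInstance

end Instances

/-! ### Cut-offs, dual frames and tensoriality -/

section Geometry

variable {m : ℕ} {M : Type*} [TopologicalSpace M] [ChartedSpace (EuclideanSpace ℝ (Fin m)) M]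

/-- The smooth functions on `M`. -/
abbrev SmoothFun (m : ℕ) (M : Type*) [TopologicalSpace M]
    [ChartedSpace (EuclideanSpace ℝ (Fin m)) M] : Type _ := C^∞⟮𝓡 m, M; ℝ⟯

variable {F : Type*} [NormedAddCommGroup F] [NormedSpace ℝ F] {V : M → Type*}
  [TopologicalSpace (TotalSpace F V)] [∀ x, AddCommGroup (V x)] [∀ x, Module ℝ (V x)]
  [∀ x, TopologicalSpace (V x)] [FiberBundle F V] [VectorBundle ℝ F V]

instance : AddCommGroup (Sec (𝓡 m) (F →L[ℝ] ℝ) (DualBundle V)) := inferInstance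
instance : AddCommMonoid (Sec (𝓡 m) (F →L[ℝ] ℝ) (DualBundle V)) := inferInstance
instance : Module ℝ (Sec (𝓡 m) (F →L[ℝ] ℝ) (DualBundle V)) := inferInstance

@[simp] lemma fsmul_apply (f : SmoothFun m M) (s : Sec (𝓡 m) F V) (x : M) :
    fsmul f s x = f x • s x := rfl

section Bump

variable [T2Space M] [IsManifold (𝓡 m) ∞ M]

lemma exists_bump {U : Set M} {x₀ : M} (hU : U ∈ 𝓝 x₀) :
    ∃ f : SmoothFun m M, (∀ᶠ x in 𝓝 x₀, f x = 1) ∧ tsupport f ⊆ U := by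
  obtain ⟨f, hf⟩ := ((SmoothBumpFunction.nhds_basis_tsupport (I := 𝓡 m) x₀).mem_iff.1 hU)
  exact ⟨⟨f, f.contMDiff⟩, f.eventuallyEq_one, hf.2⟩

/-- Multiplication by a bump function that is `1` near `x₀` keeps the germ and extends by zero.
Thanks to this and its analogue for sections, statements about a sheaf can be tested on global
functions and sections. -/
lemma exists_global_fun {U : Set M} (hU : IsOpen U) {x₀ : M} (hx : x₀ ∈ U) {f : M → ℝ}
    (hf : ContMDiffOn (𝓡 m) 𝓘(ℝ, ℝ) ∞ f U) : ∃ g : SmoothFun m M, ∀ᶠ x in 𝓝 x₀, g x = f x := by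
  obtain ⟨ψ, h1, h2⟩ := exists_bump (m := m) (hU.mem_nhds hx)
  refine ⟨⟨fun x => ψ x • f x, contMDiff_of_tsupport fun x hx => ?_⟩, ?_⟩
  · have hxU : x ∈ U := h2 (tsupport_smul_subset_left _ _ hx)
    exact (ψ.contMDiff x).smul (hf.contMDiffAt (hU.mem_nhds hxU))
  · filter_upwards [h1] with x hx
    change ψ x • f x = f x
    simp [hx]

lemma exists_global_sec {U : Set M} (hU : IsOpen U) {x₀ : M} (hx : x₀ ∈ U) {s : Π x, V x}
    (hs : ContMDiffOn (𝓡 m) ((𝓡 m).prod 𝓘(ℝ, F)) ∞ (fun x => TotalSpace.mk' F x (s x)) U) :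
    ∃ t : Sec (𝓡 m) F V, ∀ᶠ x in 𝓝 x₀, t x = s x := by
  obtain ⟨ψ, h1, h2⟩ := exists_bump (m := m) (hU.mem_nhds hx)
  refine ⟨⟨fun x => ψ x • s x, ContMDiffOn.smul_section_of_tsupport
    ψ.contMDiff.contMDiffOn hU h2 hs⟩, ?_⟩
  filter_upwards [h1] with x hx
  change ψ x • s x = s x
  simp [hx]

end Bump

/-- The function `⟨τ, s⟩` for `τ ∈ Γ(V*)` and `s ∈ Γ(V)`. -/
def pairing (τ : Sec (𝓡 m) (F →L[ℝ] ℝ) (DualBundle V)) (s : Sec (𝓡 m) F V) : SmoothFun m M :=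
  ⟨fun x => τ x (s x), by
    have h := ContMDiff.clm_bundle_apply (E₂ := Bundle.Trivial M ℝ) (F₂ := ℝ) τ.contMDiff s.contMDiff
    intro x
    have := (contMDiffAt_section x).1 (h x)
    simpa using this⟩

@[simp] lemma pairing_apply (τ : Sec (𝓡 m) (F →L[ℝ] ℝ) (DualBundle V)) (s : Sec (𝓡 m) F V)
    (x : M) : pairing τ s x = τ x (s x) := rfl

section Criterion

variable [T2Space M] [IsManifold (𝓡 m) ∞ M] [FiniteDimensional ℝ F]
  [ContMDiffVectorBundle ∞ F V (𝓡 m)]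
  {F' : Type*} [NormedAddCommGroup F'] [NormedSpace ℝ F'] {W : M → Type*}
  [TopologicalSpace (TotalSpace F' W)] [∀ x, AddCommGroup (W x)] [∀ x, Module ℝ (W x)]
  [∀ x, TopologicalSpace (W x)] [FiberBundle F' W] [VectorBundle ℝ F' W]
  [∀ x, IsTopologicalAddGroup (W x)] [∀ x, ContinuousSMul ℝ (W x)]
  [ContMDiffVectorBundle ∞ F' W (𝓡 m)]

/-- In trivialisations a homomorphism is the sum of its values on a basis of the model fibre
tensored with the dual basis. Those values are values on a local frame, and each frame section has
the germ of a global section. -/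
lemma contMDiffAt_hom_of_apply {φ : Π x, V x →L[ℝ] W x} {x₀ : M}
    (h : ∀ s : Sec (𝓡 m) F V, ContMDiffAt (𝓡 m) ((𝓡 m).prod 𝓘(ℝ, F')) ∞
      (fun x => TotalSpace.mk' F' x (φ x (s x))) x₀) :
    ContMDiffAt (𝓡 m) ((𝓡 m).prod 𝓘(ℝ, F →L[ℝ] F')) ∞
      (fun x => TotalSpace.mk' (F →L[ℝ] F') (E := HomBundle V W) x (φ x)) x₀ := by
  rw [contMDiffAt_hom_bundle]
  refine ⟨contMDiffAt_id, ?_⟩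
  let b := Module.finBasis ℝ F
  have key : ∀ T : F →L[ℝ] F', T = ∑ i, (b.coord i).toContinuousLinearMap.smulRight (T (b i)) := by
    intro T
    refine ContinuousLinearMap.coe_injective (b.ext fun j => ?_)
    simp [Finsupp.single_apply]
  have h2 : ∀ i, ContMDiffAt (𝓡 m) 𝓘(ℝ, F') ∞ (fun x =>
      ContinuousLinearMap.inCoordinates F V F' W x₀ x x₀ x (φ x) (b i)) x₀ := by
    intro i
    have hx : x₀ ∈ (trivializationAt F V x₀).baseSet := FiberBundle.mem_baseSet_trivializationAt' x₀
    obtain ⟨s, hs⟩ := exists_global_sec (trivializationAt F V x₀).open_baseSet hx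
      ((trivializationAt F V x₀).contMDiffOn_localFrame_baseSet (I := 𝓡 m) ∞ b i)
    have := (contMDiffAt_section x₀).1 (h s)
    refine this.congr_of_eventuallyEq ?_
    filter_upwards [hs, (trivializationAt F V x₀).open_baseSet.mem_nhds hx,
      (trivializationAt F' W x₀).open_baseSet.mem_nhds (FiberBundle.mem_baseSet_trivializationAt' x₀)]
      with x hx1 hx2 hx3
    rw [ContinuousLinearMap.inCoordinates_eq hx2 hx3, hx1]
    simp [hx2, Trivialization.basisAt]
  have : (fun x => ContinuousLinearMap.inCoordinates F V F' W x₀ x x₀ x (φ x)) = fun x =>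
      ∑ i, (ContinuousLinearMap.smulRightL ℝ F F' (b.coord i).toContinuousLinearMap)
        (ContinuousLinearMap.inCoordinates F V F' W x₀ x x₀ x (φ x) (b i)) := by
    funext x
    exact key _
  simp only [this]
  refine ContMDiffAt.sum fun i _ => ?_
  exact (ContinuousLinearMap.contMDiff _).contMDiffAt.comp x₀ (h2 i)

lemma contMDiffAt_dual_of_apply {φ : Π x, V x →L[ℝ] ℝ} {x₀ : M}
    (h : ∀ s : Sec (𝓡 m) F V, ContMDiffAt (𝓡 m) 𝓘(ℝ, ℝ) ∞ (fun x => φ x (s x)) x₀) :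
    ContMDiffAt (𝓡 m) ((𝓡 m).prod 𝓘(ℝ, F →L[ℝ] ℝ)) ∞
      (fun x => TotalSpace.mk' (F →L[ℝ] ℝ) (E := DualBundle V) x (φ x)) x₀ := by
  refine contMDiffAt_hom_of_apply (W := Bundle.Trivial M ℝ) (F' := ℝ) fun s => ?_
  rw [contMDiffAt_section]
  simpa using h s

end Criterion

section Frame

variable [T2Space M] [IsManifold (𝓡 m) ∞ M] [FiniteDimensional ℝ F]
  [ContMDiffVectorBundle ∞ F V (𝓡 m)]

variable (F V) in
/-- Sections `s i` of `V` and `τ i` of `V*` that are dual bases of the fibres near `x₀`. -/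
structure DualFrameAt (x₀ : M) where
  /-- the sections of `V` -/
  s : Fin (Module.finrank ℝ F) → Sec (𝓡 m) F V
  /-- the sections of `V*` -/
  τ : Fin (Module.finrank ℝ F) → Sec (𝓡 m) (F →L[ℝ] ℝ) (DualBundle V)
  pair : ∀ᶠ x in 𝓝 x₀, ∀ i j, τ i x (s j x) = if i = j then 1 else 0
  expand : ∀ᶠ x in 𝓝 x₀, ∀ v : V x, v = ∑ i, τ i x v • s i x

variable (F V) in
-- The local frame and the coordinate functionals of a trivialisation, both cut off to global
-- sections. Duality and expansion survive only near the point, which is why the structure states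
-- them as germs.
lemma nonempty_dualFrameAt (x₀ : M) : Nonempty (DualFrameAt (m := m) F V x₀) := by
  let b := Module.finBasis ℝ F
  let e := trivializationAt F V x₀
  have hx : x₀ ∈ e.baseSet := FiberBundle.mem_baseSet_trivializationAt' x₀
  have h1 : ∀ i, ∃ t : Sec (𝓡 m) F V, ∀ᶠ x in 𝓝 x₀, t x = e.localFrame b i x := fun i =>
    exists_global_sec e.open_baseSet hx
      (e.contMDiffOn_localFrame_baseSet (I := 𝓡 m) ∞ b i)
  let φ : Fin (Module.finrank ℝ F) → Π x : M, V x →L[ℝ] ℝ := fun i x =>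
    (b.coord i).toContinuousLinearMap ∘L e.continuousLinearMapAt ℝ x
  have hφ : ∀ i, ContMDiffOn (𝓡 m) ((𝓡 m).prod 𝓘(ℝ, F →L[ℝ] ℝ)) ∞
      (fun x => TotalSpace.mk' (F →L[ℝ] ℝ) (E := DualBundle V) x (φ i x)) e.baseSet := by
    intro i x hxe
    refine (contMDiffAt_dual_of_apply fun s => ?_).contMDiffWithinAt
    have hs := (e.contMDiffAt_section_iff hxe).1 (s.contMDiff x)
    have := ((b.coord i).toContinuousLinearMap.contMDiff (n := ∞)).contMDiffAt.comp x hs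
    refine this.congr_of_eventuallyEq ?_
    filter_upwards [e.open_baseSet.mem_nhds hxe] with y hy
    simp [φ, hy]
  have h2 : ∀ i, ∃ t : Sec (𝓡 m) (F →L[ℝ] ℝ) (DualBundle V), ∀ᶠ x in 𝓝 x₀, t x = φ i x :=
    fun i => exists_global_sec e.open_baseSet hx (hφ i)
  choose s hs using h1
  choose τ hτ using h2
  have hs' := Filter.eventually_all.2 hs
  have hτ' := Filter.eventually_all.2 hτ
  refine ⟨⟨s, τ, ?_, ?_⟩⟩
  · filter_upwards [hs', hτ', e.open_baseSet.mem_nhds hx] with x h1 h2 h3 i j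
    rw [h1, h2]
    simp [φ, h3, Trivialization.basisAt, Finsupp.single_apply, eq_comm]
  · filter_upwards [hs', hτ', e.open_baseSet.mem_nhds hx] with x h1 h2 h3 v
    conv_lhs => rw [← (e.basisAt b h3).sum_repr v]
    refine Finset.sum_congr rfl fun i _ => ?_
    rw [h1, h2]
    simp [φ, h3, Trivialization.basisAt]

/-- A chosen dual frame. -/
def dualFrameAt (F : Type*) [NormedAddCommGroup F] [NormedSpace ℝ F] [FiniteDimensional ℝ F]
    (V : M → Type*)
    [TopologicalSpace (TotalSpace F V)] [∀ x, AddCommGroup (V x)] [∀ x, Module ℝ (V x)]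
    [∀ x, TopologicalSpace (V x)] [FiberBundle F V] [VectorBundle ℝ F V]
    [ContMDiffVectorBundle ∞ F V (𝓡 m)] (x₀ : M) :
    DualFrameAt (m := m) F V x₀ := (nonempty_dualFrameAt F V x₀).some

lemma DualFrameAt.expand_self {x₀ : M} (e : DualFrameAt (m := m) F V x₀) (v : V x₀) :
    v = ∑ i, e.τ i x₀ v • e.s i x₀ := e.expand.self_of_nhds v

lemma DualFrameAt.expand_dual {x₀ : M} (e : DualFrameAt (m := m) F V x₀) :
    ∀ᶠ x in 𝓝 x₀, ∀ t : V x →L[ℝ] ℝ, t = ∑ i, t (e.s i x) • e.τ i x := by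
  filter_upwards [e.expand] with x hx t
  ext v
  conv_lhs => rw [hx v]
  simp [mul_comm]

/-- The extension of a vector to a global section, linear in the vector. -/
def DualFrameAt.ext {x₀ : M} (e : DualFrameAt (m := m) F V x₀) : V x₀ →ₗ[ℝ] Sec (𝓡 m) F V where
  toFun v := ∑ i, e.τ i x₀ v • e.s i
  map_add' v w := by simp [add_smul, Finset.sum_add_distrib]
  map_smul' r v := by simp [mul_smul, Finset.smul_sum]

/-- The evaluation of sections at a point. -/
def evSec (F : Type*) [NormedAddCommGroup F] [NormedSpace ℝ F] {V : M → Type*}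
    [TopologicalSpace (TotalSpace F V)] [∀ x, AddCommGroup (V x)] [∀ x, Module ℝ (V x)]
    [∀ x, TopologicalSpace (V x)] [FiberBundle F V] [VectorBundle ℝ F V] (x : M) :
    Sec (𝓡 m) F V →ₗ[ℝ] V x where
  toFun s := s x
  map_add' _ _ := rfl
  map_smul' _ _ := rfl

/-- The evaluation of functions at a point. -/
def evFun (x : M) : SmoothFun m M →ₗ[ℝ] ℝ where
  toFun f := f x
  map_add' _ _ := rfl
  map_smul' _ _ := rfl

@[simp] lemma fun_sum_apply {ι : Type*} (t : Finset ι) (f : ι → SmoothFun m M) (x : M) :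
    (∑ i ∈ t, f i) x = ∑ i ∈ t, f i x := map_sum (evFun x) f t

@[simp] lemma sec_sum_apply {ι : Type*} (t : Finset ι) (s : ι → Sec (𝓡 m) F V) (x : M) :
    (∑ i ∈ t, s i) x = ∑ i ∈ t, s i x :=
  map_sum (evSec F x) s t

@[simp] lemma DualFrameAt.ext_self {x₀ : M} (e : DualFrameAt (m := m) F V x₀) (v : V x₀) :
    e.ext v x₀ = v := by
  conv_rhs => rw [e.expand_self v]
  simp [DualFrameAt.ext]

variable (F V) in
lemma exists_sec_eq {x₀ : M} (v : V x₀) : ∃ s : Sec (𝓡 m) F V, s x₀ = v :=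
  ⟨(dualFrameAt (m := m) F V x₀).ext v, by simp⟩

variable (F V) in
lemma exists_dual_eq {x₀ : M} (t : V x₀ →L[ℝ] ℝ) :
    ∃ s : Sec (𝓡 m) (F →L[ℝ] ℝ) (DualBundle V), s x₀ = t := by
  let e := dualFrameAt (m := m) F V x₀
  refine ⟨∑ i, t (e.s i x₀) • e.τ i, ?_⟩
  conv_rhs => rw [e.expand_dual.self_of_nhds t]
  simp

lemma DualFrameAt.eq_of_dual {x : M} (e : DualFrameAt (m := m) F V x) {v w : V x}
    (h : ∀ t : V x →L[ℝ] ℝ, t v = t w) : v = w := by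
  rw [e.expand_self v, e.expand_self w]
  simp [h]

/-- Near `x₀` the section is the combination of a smooth frame with the assumed smooth coefficients.
-/
lemma contMDiffAt_sec_of_pairing {s : Π x, V x} {x₀ : M}
    (h : ∀ τ : Sec (𝓡 m) (F →L[ℝ] ℝ) (DualBundle V),
      ContMDiffAt (𝓡 m) 𝓘(ℝ, ℝ) ∞ (fun x => τ x (s x)) x₀) :
    ContMDiffAt (𝓡 m) ((𝓡 m).prod 𝓘(ℝ, F)) ∞ (fun x => TotalSpace.mk' F x (s x)) x₀ := by
  let e := dualFrameAt (m := m) F V x₀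
  have : ContMDiffAt (𝓡 m) ((𝓡 m).prod 𝓘(ℝ, F)) ∞
      (fun x => TotalSpace.mk' F x (∑ i, e.τ i x (s x) • e.s i x)) x₀ := by
    refine ContMDiffAt.sum_section fun i _ => ?_
    exact (h (e.τ i)).smul_section ((e.s i).contMDiff x₀)
  refine this.congr_of_eventuallyEq ?_
  filter_upwards [e.expand] with x hx
  rw [← hx]

/-- A local version of the expansion in a dual frame: a section is a sum of products, up to a
section vanishing near the point. -/
lemma DualFrameAt.expand_sec {x₀ : M} (e : DualFrameAt (m := m) F V x₀) (s : Sec (𝓡 m) F V) :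
    ∀ᶠ x in 𝓝 x₀, s x = (∑ i, fsmul (pairing (e.τ i) s) (e.s i)) x := by
  filter_upwards [e.expand] with x hx
  conv_lhs => rw [hx (s x)]
  simp

lemma DualFrameAt.expand_dual_sec {x₀ : M} (e : DualFrameAt (m := m) F V x₀)
    (t : Sec (𝓡 m) (F →L[ℝ] ℝ) (DualBundle V)) :
    ∀ᶠ x in 𝓝 x₀, t x = (∑ i, fsmul (pairing t (e.s i)) (e.τ i)) x := by
  filter_upwards [e.expand_dual] with x hx
  conv_lhs => rw [hx (t x)]
  rw [sec_sum_apply]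
  rfl

/-- A family of additive operators with values in some group that is linear over the functions, at
`x₀`, depends on the value at `x₀` only. -/
lemma tensorial {G : Type*} [AddCommGroup G] [Module ℝ G] {x₀ : M}
    (T : Sec (𝓡 m) F V →ₗ[ℝ] G)
    (hT : ∀ (f : SmoothFun m M) s, T (fsmul f s) = f x₀ • T s)
    {s t : Sec (𝓡 m) F V} (hst : s x₀ = t x₀) : T s = T t := by
  suffices H : ∀ s : Sec (𝓡 m) F V, s x₀ = 0 → T s = 0 by
    have := H (s - t) (by simp [hst])
    rwa [map_sub, sub_eq_zero] at this
  intro s hs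
  let e := dualFrameAt (m := m) F V x₀
  obtain ⟨U, hU, hUo, hxU⟩ := eventually_nhds_iff.1 (e.expand_sec s)
  obtain ⟨ψ, h1, h2⟩ := exists_bump (m := m) (hUo.mem_nhds hxU)
  -- The frame expansion holds only near `x₀`. After multiplication by `ψ` it holds everywhere, and
  -- `ψ x₀ = 1` lets linearity remove `ψ` again.
  have key : fsmul ψ s = fsmul ψ (∑ i, fsmul (pairing (e.τ i) s) (e.s i)) := by
    ext x
    by_cases hx : x ∈ U
    · simp only [fsmul_apply]; rw [hU x hx]
    · have : ψ x = 0 := image_eq_zero_of_notMem_tsupport fun h => hx (h2 h)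
      simp [this]
  have := congrArg T key
  rw [hT, hT, h1.self_of_nhds, one_smul, one_smul, map_sum] at this
  rw [this]
  refine Finset.sum_eq_zero fun i _ => ?_
  rw [hT]
  simp [hs]

end Frame

section Tensorial

variable [T2Space M] [IsManifold (𝓡 m) ∞ M] [FiniteDimensional ℝ F]
  [ContMDiffVectorBundle ∞ F V (𝓡 m)]
  {F' : Type*} [NormedAddCommGroup F'] [NormedSpace ℝ F'] {W : M → Type*}
  [TopologicalSpace (TotalSpace F' W)] [∀ x, AddCommGroup (W x)] [∀ x, Module ℝ (W x)]
  [∀ x, TopologicalSpace (W x)] [FiberBundle F' W] [VectorBundle ℝ F' W]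
  [∀ x, IsTopologicalAddGroup (W x)] [∀ x, ContinuousSMul ℝ (W x)]
  [ContMDiffVectorBundle ∞ F' W (𝓡 m)]

/-- A linear map from a fibre of finite rank is continuous. -/
def fibreCLM (F : Type*) [NormedAddCommGroup F] [NormedSpace ℝ F] [FiniteDimensional ℝ F]
    {V : M → Type*}
    [TopologicalSpace (TotalSpace F V)] [∀ x, AddCommGroup (V x)] [∀ x, Module ℝ (V x)]
    [∀ x, TopologicalSpace (V x)] [FiberBundle F V] [VectorBundle ℝ F V] {x : M} {G : Type*}
    [AddCommGroup G] [Module ℝ G] [TopologicalSpace G] [IsTopologicalAddGroup G]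
    [ContinuousSMul ℝ G] (L : V x →ₗ[ℝ] G) : V x →L[ℝ] G :=
  -- The fibre has no norm of its own: continuity is automatic on the finite-dimensional model fibre
  -- and is carried over by the trivialisation.
  (LinearMap.toContinuousLinearMap (L ∘ₗ (((trivializationAt F V x).continuousLinearEquivAt ℝ x
    (FiberBundle.mem_baseSet_trivializationAt' x)).symm : F →ₗ[ℝ] V x))) ∘L
    ((trivializationAt F V x).continuousLinearEquivAt ℝ x
    (FiberBundle.mem_baseSet_trivializationAt' x) : V x →L[ℝ] F)

@[simp] lemma fibreCLM_apply {x : M} {G : Type*}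
    [AddCommGroup G] [Module ℝ G] [TopologicalSpace G] [IsTopologicalAddGroup G]
    [ContinuousSMul ℝ G] (L : V x →ₗ[ℝ] G) (v : V x) : fibreCLM F L v = L v := by
  simp only [fibreCLM, ContinuousLinearMap.comp_apply, LinearMap.coe_toContinuousLinearMap',
    LinearMap.comp_apply]
  exact congrArg L (((trivializationAt F V x).continuousLinearEquivAt ℝ x
    (FiberBundle.mem_baseSet_trivializationAt' x)).symm_apply_apply v)

@[simp] lemma homApply_apply (φ : Sec (𝓡 m) (F →L[ℝ] F') (HomBundle V W)) (s : Sec (𝓡 m) F V)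
    (x : M) : homApply φ s x = φ x (s x) := rfl

/-- A map of sections that is linear over the functions is given by a bundle morphism. -/
lemma exists_hom_of_linear (T : Sec (𝓡 m) F V →ₗ[ℝ] Sec (𝓡 m) F' W)
    (hT : ∀ f s, T (fsmul f s) = fsmul f (T s)) :
    ∃ φ : Sec (𝓡 m) (F →L[ℝ] F') (HomBundle V W), ∀ s, T s = homApply φ s := by
  let ev (x : M) : Sec (𝓡 m) F V →ₗ[ℝ] W x :=
    { toFun := fun s => T s x, map_add' := by simp, map_smul' := by simp }
  have hev (x : M) {s t : Sec (𝓡 m) F V} (h : s x = t x) : T s x = T t x :=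
    tensorial (ev x) (fun f s => by simp [ev, hT]) h
  -- A vector at `x` is extended to a section through the frame at `x`; by tensoriality the choice
  -- of extension has no effect on the value.
  let φ (x : M) : V x →L[ℝ] W x :=
    fibreCLM F (ev x ∘ₗ (dualFrameAt (m := m) F V x).ext)
  have hφ (s : Sec (𝓡 m) F V) (x : M) : T s x = φ x (s x) := by
    simp only [φ, fibreCLM_apply]
    exact hev x (by simp)
  refine ⟨⟨φ, fun x => contMDiffAt_hom_of_apply fun s => ?_⟩, fun s => ?_⟩
  · simp only [← hφ]
    exact (T s).contMDiff x
  · ext x; exact hφ s x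

/-- A map from the sections of `V*` to the functions that is linear over the functions is the
pairing with a section of `V`. -/
lemma exists_sec_of_linear (T : Sec (𝓡 m) (F →L[ℝ] ℝ) (DualBundle V) →ₗ[ℝ] SmoothFun m M)
    (hT : ∀ f s, T (fsmul f s) = f * T s) :
    ∃ q : Sec (𝓡 m) F V, ∀ τ, T τ = pairing τ q := by
  let ev (x : M) : Sec (𝓡 m) (F →L[ℝ] ℝ) (DualBundle V) →ₗ[ℝ] ℝ :=
    { toFun := fun s => T s x, map_add' := by simp, map_smul' := by simp }
  have hev (x : M) {s t : Sec (𝓡 m) (F →L[ℝ] ℝ) (DualBundle V)} (h : s x = t x) :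
      T s x = T t x :=
    tensorial (ev x) (fun f s => by simp [ev, hT]) h
  let q (x : M) : V x := ∑ i, T ((dualFrameAt (m := m) F V x).τ i) x •
    (dualFrameAt (m := m) F V x).s i x
  have hq (s : Sec (𝓡 m) (F →L[ℝ] ℝ) (DualBundle V)) (x : M) : T s x = s x (q x) := by
    have h1 := (dualFrameAt (m := m) F V x).expand_dual_sec s
    rw [hev x h1.self_of_nhds, map_sum]
    simp only [q, hT, fun_sum_apply, map_sum, map_smul, smul_eq_mul]
    exact Finset.sum_congr rfl fun i _ => mul_comm _ _
  refine ⟨⟨q, fun x => contMDiffAt_sec_of_pairing fun s => ?_⟩, fun s => ?_⟩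
  · simp only [← hq]
    exact (T s).contMDiff x
  · ext x; exact hq s x

end Tensorial

end Geometry
end SplitPoisson
end

/-! ### Hadamard's lemma and point derivations -/

open Bundle Manifold Set TopologicalSpace
open scoped Manifold ContDiff Bundle Topology TensorProduct
noncomputable section
namespace SplitPoisson
set_option linter.unusedSectionVars false

section Hadamard

/-- Differentiation under the integral sign gives an integral of the same kind with values in `E
→L[ℝ] G`, so the induction has to run over all targets `G`. Keeping `E` in `Type` keeps these
targets in one universe. -/
lemma contDiff_nat_intervalIntegral.{u} {E : Type} [NormedAddCommGroup E] [NormedSpace ℝ E]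
    [FiniteDimensional ℝ E] (n : ℕ) : ∀ {G : Type u} [NormedAddCommGroup G] [NormedSpace ℝ G]
    [CompleteSpace G] (f : E → ℝ → G), ContDiff ℝ ∞ (Function.uncurry f) →
    ContDiff ℝ n (fun y => ∫ t in (0 : ℝ)..1, f y t) := by
  induction n with
  | zero =>
    intro G _ _ _ f hf
    exact contDiff_zero.2
      (intervalIntegral.continuous_parametric_intervalIntegral_of_continuous' hf.continuous 0 1)
  | succ n ih =>
    intro G _ _ _ f hf
    let f' : E → ℝ → E →L[ℝ] G := fun y t =>
      (fderiv ℝ (Function.uncurry f) (y, t)).comp (ContinuousLinearMap.inl ℝ E ℝ)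
    have hf' : ContDiff ℝ ∞ (Function.uncurry f') :=
      (hf.fderiv_right (m := ∞) (by simp)).clm_comp contDiff_const
    have hd : ∀ y t, HasFDerivAt (fun y => f y t) (f' y t) y := by
      intro y t
      have h1 := (hf.differentiable (by simp) (y, t)).hasFDerivAt
      have h2 : HasFDerivAt (fun y : E => (y, t)) (ContinuousLinearMap.inl ℝ E ℝ) y :=
        hasFDerivAt_prodMk_left y t
      exact HasFDerivAt.comp y h1 h2
    have hcont : ∀ y, Continuous (f y) := fun y =>
      hf.continuous.comp (Continuous.prodMk_right y)
    have hcont' : ∀ y, Continuous (f' y) := fun y =>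
      hf'.continuous.comp (Continuous.prodMk_right y)
    refine contDiff_succ_iff_hasFDerivAt.2 ⟨fun y => ∫ t in (0 : ℝ)..1, f' y t, ih f' hf', ?_⟩
    intro y
    obtain ⟨C, hC⟩ := ((isCompact_closedBall y 1).prod (isCompact_Icc (a := (0 : ℝ)) (b := 1))
      ).exists_bound_of_continuousOn hf'.continuous.continuousOn
    refine intervalIntegral.hasFDerivAt_integral_of_dominated_of_fderiv_le
      (s := Metric.closedBall y 1) (bound := fun _ => C)
      (Metric.closedBall_mem_nhds y one_pos) ?_ ?_ ?_ ?_ ?_ ?_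
    · exact Filter.Eventually.of_forall fun z => (hcont z).aestronglyMeasurable
    · exact (hcont y).intervalIntegrable _ _
    · exact (hcont' y).aestronglyMeasurable
    · refine Filter.Eventually.of_forall fun t ht z hz => ?_
      rw [uIoc_of_le zero_le_one] at ht
      exact hC (z, t) ⟨hz, ht.1.le, ht.2⟩
    · exact intervalIntegrable_const
    · exact Filter.Eventually.of_forall fun t _ z _ => hd z t

/-- Hadamard's lemma. -/
lemma hadamard {E : Type} [NormedAddCommGroup E] [NormedSpace ℝ E]
    [FiniteDimensional ℝ E] {f : E → ℝ} (hf : ContDiff ℝ ∞ f) (p : E) :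
    ∃ g : E → E →L[ℝ] ℝ, ContDiff ℝ ∞ g ∧ g p = fderiv ℝ f p ∧
      ∀ y, f y = f p + g y (y - p) := by
  -- The derivative along the segment from `p` to `y`; its mean over the segment is the required
  -- `g`.
  let h : E → ℝ → E →L[ℝ] ℝ := fun y t => fderiv ℝ f (p + t • (y - p))
  have hh : ContDiff ℝ ∞ (Function.uncurry h) := by
    refine (hf.fderiv_right (m := ∞) (by simp)).comp ?_
    exact contDiff_const.add (contDiff_snd.smul (contDiff_fst.sub contDiff_const))
  refine ⟨fun y => ∫ t in (0 : ℝ)..1, h y t,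
    contDiff_infty.2 fun n => contDiff_nat_intervalIntegral n h hh, by simp [h], fun y => ?_⟩
  have hc : Continuous (h y) := hh.continuous.comp (Continuous.prodMk_right y)
  have h1 : ∀ t : ℝ, HasDerivAt (fun t : ℝ => f (p + t • (y - p))) (h y t (y - p)) t := by
    intro t
    have h2 : HasDerivAt (fun t : ℝ => p + t • (y - p)) (y - p) t := by
      simpa using ((hasDerivAt_id t).smul_const (y - p)).const_add p
    exact ((hf.differentiable (by simp) _).hasFDerivAt).comp_hasDerivAt t h2
  have h3 := intervalIntegral.integral_eq_sub_of_hasDerivAt (a := 0) (b := 1)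
    (fun t _ => h1 t) ((hc.clm_apply continuous_const).intervalIntegrable _ _)
  rw [ContinuousLinearMap.intervalIntegral_apply (hc.intervalIntegrable _ _), h3]
  simp

variable {m : ℕ} {M : Type*} [TopologicalSpace M] [ChartedSpace (EuclideanSpace ℝ (Fin m)) M]
  [T2Space M] [IsManifold (𝓡 m) ∞ M]

/-- Functions that are coordinates centred at `x₀`, near `x₀`. -/
lemma exists_coord (x₀ : M) : ∃ X : Fin m → SmoothFun m M, ∀ᶠ x in 𝓝 x₀, ∀ k,
    X k x = (extChartAt (𝓡 m) x₀ x - extChartAt (𝓡 m) x₀ x₀) k := by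
  have h : ∀ k, ∃ X : SmoothFun m M, ∀ᶠ x in 𝓝 x₀,
      X x = (extChartAt (𝓡 m) x₀ x - extChartAt (𝓡 m) x₀ x₀) k := by
    intro k
    refine exists_global_fun (U := (chartAt (EuclideanSpace ℝ (Fin m)) x₀).source)
      (chartAt (EuclideanSpace ℝ (Fin m)) x₀).open_source (mem_chart_source _ x₀) ?_
    have h1 := contMDiffOn_extChartAt (I := 𝓡 m) (n := ∞) (x := x₀)
    have h2 : ContDiff ℝ ∞ (fun y : EuclideanSpace ℝ (Fin m) =>
      (y - extChartAt (𝓡 m) x₀ x₀) k) := by fun_prop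
    exact h2.contMDiff.comp_contMDiffOn h1
  choose X hX using h
  exact ⟨X, Filter.eventually_all.2 hX⟩

/-- With `ψ = 1` near `x₀` and supported where `f = g`, one has `ψ f = ψ g` globally, and the
Leibniz rule at `x₀` turns this into the claim. -/
lemma local_of_derivation {x₀ : M} (D : SmoothFun m M →ₗ[ℝ] ℝ)
    (hD : ∀ f g, D (f * g) = f x₀ * D g + g x₀ * D f) {f g : SmoothFun m M}
    (h : ∀ᶠ x in 𝓝 x₀, f x = g x) : D f = D g := by
  obtain ⟨U, hU, hUo, hxU⟩ := eventually_nhds_iff.1 h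
  obtain ⟨ψ, h1, h2⟩ := exists_bump (m := m) (hUo.mem_nhds hxU)
  have key : ψ * f = ψ * g := by
    ext x
    by_cases hx : x ∈ U
    · simp [hU x hx]
    · have : ψ x = 0 := image_eq_zero_of_notMem_tsupport fun h => hx (h2 h)
      simp [this]
  have := congrArg D key
  rw [hD, hD, h1.self_of_nhds, h.self_of_nhds] at this
  linarith

/-- The model `𝓡 m` has no boundary, so the derivative within the range of the model is an ordinary
derivative in the preferred chart. -/
lemma mfderiv_eq_fderiv {f : M → ℝ} {x₀ : M} (hf : ContMDiffAt (𝓡 m) 𝓘(ℝ, ℝ) ∞ f x₀)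
    (v : TangentSpace (𝓡 m) x₀) : mfderiv (𝓡 m) 𝓘(ℝ, ℝ) f x₀ v =
    fderiv ℝ (f ∘ (extChartAt (𝓡 m) x₀).symm) (extChartAt (𝓡 m) x₀ x₀) v := by
  have h := (hf.mdifferentiableAt (by simp)).hasMFDerivAt.2
  simp only [writtenInExtChartAt, extChartAt_model_space_eq_id, PartialEquiv.refl_coe,
    Function.id_comp, modelWithCornersSelf_coe, range_id] at h
  have h' := (show HasFDerivWithinAt (𝕜 := ℝ) (E := EuclideanSpace ℝ (Fin m)) (F := ℝ) _ _ univ _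
    from h).hasFDerivAt Filter.univ_mem
  exact congrArg (fun L : EuclideanSpace ℝ (Fin m) →L[ℝ] ℝ => L v) h'.fderiv.symm

/-- Point derivations are tangent vectors. -/
lemma exists_tangent_of_derivation {x₀ : M} (D : SmoothFun m M →ₗ[ℝ] ℝ)
    (hD : ∀ f g, D (f * g) = f x₀ * D g + g x₀ * D f) :
    ∃ v : TangentSpace (𝓡 m) x₀, ∀ f, D f = mfderiv (𝓡 m) 𝓘(ℝ, ℝ) f x₀ v := by
  obtain ⟨X, hX⟩ := exists_coord (m := m) x₀
  -- A derivation has to take the value of the `k`-th component of its vector on the `k`-th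
  -- coordinate function.
  let v : EuclideanSpace ℝ (Fin m) := WithLp.toLp 2 fun k => D (X k)
  refine ⟨v, fun f => ?_⟩
  let φ := extChartAt (𝓡 m) x₀
  let p := φ x₀
  have hsmooth : ContMDiffOn (𝓡 m) 𝓘(ℝ, ℝ) ∞ (f ∘ φ.symm) φ.target :=
    f.contMDiff.comp_contMDiffOn (contMDiffOn_extChartAt_symm x₀)
  obtain ⟨F, hF⟩ := exists_global_fun (m := m) (isOpen_extChartAt_target x₀)
    (mem_extChartAt_target (I := 𝓡 m) x₀) hsmooth
  have hFs : ContDiff ℝ ∞ F := F.contMDiff.contDiff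
  obtain ⟨g, hg, hgp, hgF⟩ := hadamard hFs p
  have hgk : ∀ k, ∃ h : SmoothFun m M, ∀ᶠ x in 𝓝 x₀,
      h x = g (φ x) (EuclideanSpace.basisFun (Fin m) ℝ k) := by
    intro k
    refine exists_global_fun (U := (chartAt (EuclideanSpace ℝ (Fin m)) x₀).source)
      (chartAt (EuclideanSpace ℝ (Fin m)) x₀).open_source (mem_chart_source _ x₀) ?_
    have h1 := contMDiffOn_extChartAt (I := 𝓡 m) (n := ∞) (x := x₀)
    exact (hg.clm_apply contDiff_const).contMDiff.comp_contMDiffOn h1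
  choose h hh using hgk
  -- Hadamard's lemma in the chart: near `x₀` the function is a constant plus a sum of products `X k
  -- * h k`. Since `X k` vanishes at `x₀`, the derivation sees only `h k x₀`, the `k`-th partial
  -- derivative.
  have hexp : ∀ᶠ x in 𝓝 x₀, f x = (ContMDiffMap.const (f x₀) + ∑ k, X k * h k : SmoothFun m M) x := by
    filter_upwards [hX, Filter.eventually_all.2 hh, extChartAt_source_mem_nhds (I := 𝓡 m) x₀,
      (continuousAt_extChartAt (I := 𝓡 m) x₀).eventually hF] with x h1 h2 h3 h4
    have h5 : f x = F (φ x) := by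
      rw [h4, Function.comp_apply, (extChartAt (𝓡 m) x₀).left_inv h3]
    have h6 : F p = f x₀ := by
      rw [hF.self_of_nhds, Function.comp_apply, extChartAt_to_inv]
    rw [h5, hgF, h6]
    have h7 : φ x - p = ∑ k, (φ x - p) k • EuclideanSpace.basisFun (Fin m) ℝ k := by
      conv_lhs => rw [← (EuclideanSpace.basisFun (Fin m) ℝ).sum_repr (φ x - p)]
      simp
    conv_lhs => rw [h7]
    simp only [map_sum, map_smul, smul_eq_mul, ContMDiffMap.coe_add, Pi.add_apply, fun_sum_apply,
      ContMDiffMap.coe_mul, Pi.mul_apply, h1, h2]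
    rfl
  have hX0 : ∀ k, X k x₀ = 0 := fun k => by rw [hX.self_of_nhds k]; simp
  have hconst : D (ContMDiffMap.const (f x₀)) = 0 := by
    have h1 : D 1 = 0 := by
      have := hD 1 1
      simp at this
      linarith
    have : (ContMDiffMap.const (f x₀) : SmoothFun m M) = f x₀ • 1 := by
      ext x; simp [ContMDiffMap.const]
    rw [this, map_smul, h1, smul_zero]
  refine Eq.trans ?_ (mfderiv_eq_fderiv (f.contMDiff x₀) v).symm
  rw [local_of_derivation D hD hexp, map_add, hconst, map_sum, ← Filter.EventuallyEq.fderiv_eq (f₁ := F) hF, ← hgp]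
  have h7 : v = ∑ k, v k • EuclideanSpace.basisFun (Fin m) ℝ k := by
    conv_lhs => rw [← (EuclideanSpace.basisFun (Fin m) ℝ).sum_repr v]
    simp
  conv_rhs => rw [h7]
  rw [map_sum]
  simp only [zero_add]
  refine Finset.sum_congr rfl fun k _ => ?_
  rw [hD, hX0, (hh k).self_of_nhds, map_smul]
  simp [v, p, φ, mul_comm]

/-- There are enough global functions to realise every covector at a point, hence to separate
tangent vectors. -/
lemma exists_fun_mfderiv (x₀ : M) (ℓ : EuclideanSpace ℝ (Fin m) →L[ℝ] ℝ) :
    ∃ f : SmoothFun m M, ∀ v : TangentSpace (𝓡 m) x₀, mfderiv (𝓡 m) 𝓘(ℝ, ℝ) f x₀ v = ℓ v := by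
  obtain ⟨f, hf⟩ := exists_global_fun (m := m)
    (U := (chartAt (EuclideanSpace ℝ (Fin m)) x₀).source)
    (f := ℓ ∘ extChartAt (𝓡 m) x₀)
    (chartAt (EuclideanSpace ℝ (Fin m)) x₀).open_source (mem_chart_source _ x₀)
    (ℓ.contMDiff.comp_contMDiffOn (contMDiffOn_extChartAt (I := 𝓡 m) (n := ∞) (x := x₀)))
  refine ⟨f, fun v => ?_⟩
  rw [mfderiv_eq_fderiv (f.contMDiff x₀)]
  have : (f ∘ (extChartAt (𝓡 m) x₀).symm) =ᶠ[𝓝 (extChartAt (𝓡 m) x₀ x₀)] ℓ := by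
    have h1 := (continuousAt_extChartAt_symm (I := 𝓡 m) x₀)
    rw [ContinuousAt, extChartAt_to_inv] at h1
    filter_upwards [h1.eventually hf, extChartAt_target_mem_nhds (I := 𝓡 m) x₀] with y h2 h3
    rw [Function.comp_apply, h2, Function.comp_apply, (extChartAt (𝓡 m) x₀).right_inv h3]
  rw [this.fderiv_eq, ContinuousLinearMap.fderiv]

end Hadamard
end SplitPoisson
end

/-! ### The fibre algebra: universal property, grading, low degrees, derivations -/

open Bundle Manifold Set TopologicalSpace
open scoped Manifold ContDiff Bundle Topology TensorProduct
noncomputable section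
namespace SplitPoisson
set_option linter.unusedSectionVars false

section FibreAlgebra

namespace FreeAlg

variable {V W : Type*} [AddCommGroup V] [Module ℝ V] [TopologicalSpace V]
  [AddCommGroup W] [Module ℝ W]

section Lift

variable {A : Type*} [Ring A] [Algebra ℝ A]

/-- `SymmetricAlgebra.lift` wants a commutative target, and the subalgebra generated by the
commuting images is one. -/
lemma exists_symmetric_lift (g : W →ₗ[ℝ] A) (hg : ∀ w w', Commute (g w) (g w')) :
    ∃ φ : SymmetricAlgebra ℝ W →ₐ[ℝ] A, ∀ w, φ (SymmetricAlgebra.ι ℝ W w) = g w := by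
  have h : ∀ a ∈ Set.range g, ∀ b ∈ Set.range g, a * b = b * a := by
    rintro _ ⟨w, rfl⟩ _ ⟨w', rfl⟩
    exact hg w w'
  have hc := Algebra.isMulCommutative_adjoin ℝ h
  let _ : CommSemiring (Algebra.adjoin ℝ (Set.range g)) :=
    { (Algebra.adjoin ℝ (Set.range g)).toSemiring with mul_comm := hc.is_comm.comm }
  let g' : W →ₗ[ℝ] Algebra.adjoin ℝ (Set.range g) :=
    g.codRestrict (Subalgebra.toSubmodule (Algebra.adjoin ℝ (Set.range g)))
      fun w => Algebra.subset_adjoin ⟨w, rfl⟩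
  let γ : SymmetricAlgebra ℝ W →ₐ[ℝ] Algebra.adjoin ℝ (Set.range g) := SymmetricAlgebra.lift g'
  refine ⟨(Algebra.adjoin ℝ (Set.range g)).val.comp γ, fun w => ?_⟩
  exact congrArg Subtype.val (SymmetricAlgebra.lift_ι_apply g' w)

/-- The target may be noncommutative, which is essential: polynomials and matrices over the algebra
itself are used below to produce the grading and the derivations. The two factors lift separately,
and that their images commute is checked on generators by a double induction. -/
lemma exists_lift (f : (V →L[ℝ] ℝ) →ₗ[ℝ] A) (g : W →ₗ[ℝ] A) (hf : ∀ v, f v * f v = 0)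
    (hg : ∀ w w', Commute (g w) (g w')) (hfg : ∀ v w, Commute (f v) (g w)) :
    ∃ φ : FreeAlg V W →ₐ[ℝ] A, (∀ v, φ (gen₁ V W v) = f v) ∧ ∀ w, φ (gen₂ V W w) = g w := by
  obtain ⟨γ, hγ⟩ := exists_symmetric_lift g hg
  let φ := ExteriorAlgebra.lift ℝ ⟨f, hf⟩
  have hφ : ∀ v, φ (ExteriorAlgebra.ι ℝ v) = f v := fun v => ExteriorAlgebra.lift_ι_apply _ _ _ _
  have hcomm : ∀ x y, Commute (φ x) (γ y) := by
    intro x y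
    induction x using ExteriorAlgebra.induction with
    | algebraMap r => rw [AlgHom.commutes]; exact Algebra.commute_algebraMap_left _ _
    | ι v =>
      rw [hφ]
      induction y using SymmetricAlgebra.induction with
      | algebraMap r => rw [AlgHom.commutes]; exact Algebra.commute_algebraMap_right _ _
      | ι w => rw [hγ]; exact hfg v w
      | mul a b ha hb => rw [map_mul]; exact ha.mul_right hb
      | add a b ha hb => rw [map_add]; exact ha.add_right hb
    | mul a b ha hb => rw [map_mul]; exact ha.mul_left hb
    | add a b ha hb => rw [map_add]; exact ha.add_left hb
  refine ⟨Algebra.TensorProduct.lift φ γ hcomm, fun v => ?_, fun w => ?_⟩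
  · refine (Algebra.TensorProduct.lift_tmul φ γ hcomm _ 1).trans ?_
    rw [map_one, mul_one, hφ]
  · refine (Algebra.TensorProduct.lift_tmul φ γ hcomm 1 _).trans ?_
    rw [map_one, one_mul, hγ]

end Lift

lemma gen₁_sq (v : V →L[ℝ] ℝ) : gen₁ V W v * gen₁ V W v = 0 := by
  change ofExt V W (ExteriorAlgebra.ι ℝ v) * ofExt V W (ExteriorAlgebra.ι ℝ v) = 0
  rw [← map_mul, ExteriorAlgebra.ι_sq_zero, map_zero]

lemma gen₁_mul_gen₁ (v w : V →L[ℝ] ℝ) : gen₁ V W v * gen₁ V W w = -(gen₁ V W w * gen₁ V W v) := by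
  have := gen₁_sq (W := W) (v + w)
  simp only [map_add, add_mul, mul_add, gen₁_sq, zero_add, add_zero] at this
  exact eq_neg_of_add_eq_zero_left (by rw [add_comm]; exact this)

lemma commute_gen₂ (w w' : W) : Commute (gen₂ V W w) (gen₂ V W w') := by
  exact (Commute.all (SymmetricAlgebra.ι ℝ W w) (SymmetricAlgebra.ι ℝ W w')).map (ofSym V W)

lemma commute_gen₁_gen₂ (v : V →L[ℝ] ℝ) (w : W) : Commute (gen₁ V W v) (gen₂ V W w) := by
  exact Commute.tmul (Commute.one_right (ExteriorAlgebra.ι ℝ v))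
    (Commute.one_left (SymmetricAlgebra.ι ℝ W w))

lemma induction {C : FreeAlg V W → Prop} (hr : ∀ r : ℝ, C (algebraMap ℝ _ r))
    (h₁ : ∀ v, C (gen₁ V W v)) (h₂ : ∀ w, C (gen₂ V W w))
    (hadd : ∀ a b, C a → C b → C (a + b)) (hmul : ∀ a b, C a → C b → C (a * b))
    (a : FreeAlg V W) : C a := by
  have hE : ∀ x, C (ofExt V W x) := by
    intro x
    induction x using ExteriorAlgebra.induction with
    | algebraMap r => rw [AlgHom.commutes]; exact hr r
    | ι v => exact h₁ v
    | mul a b ha hb => rw [map_mul]; exact hmul _ _ ha hb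
    | add a b ha hb => rw [map_add]; exact hadd _ _ ha hb
  have hS : ∀ x, C (ofSym V W x) := by
    intro x
    induction x using SymmetricAlgebra.induction with
    | algebraMap r => rw [AlgHom.commutes]; exact hr r
    | ι v => exact h₂ v
    | mul a b ha hb => rw [map_mul]; exact hmul _ _ ha hb
    | add a b ha hb => rw [map_add]; exact hadd _ _ ha hb
  refine TensorProduct.induction_on (motive := C) a ?_ (fun x y => ?_) (fun x y => hadd x y)
  · have := hr 0
    rwa [map_zero] at this
  · have h := hmul _ _ (hE x) (hS y)
    have e : ofExt V W x * ofSym V W y = (x ⊗ₜ[ℝ] y : FreeAlg V W) := by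
      refine (Algebra.TensorProduct.tmul_mul_tmul x 1 1 y).trans ?_
      rw [mul_one, one_mul]
    rwa [e] at h

lemma hom_ext {A : Type*} [Ring A] [Algebra ℝ A] {φ ψ : FreeAlg V W →ₐ[ℝ] A}
    (h₁ : ∀ v, φ (gen₁ V W v) = ψ (gen₁ V W v)) (h₂ : ∀ w, φ (gen₂ V W w) = ψ (gen₂ V W w)) :
    φ = ψ := by
  ext a
  induction a using FreeAlg.induction with
  | hr r => simp
  | h₁ v => exact h₁ v
  | h₂ w => exact h₂ w
  | hadd a b ha hb => rw [map_add, map_add, ha, hb]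
  | hmul a b ha hb => rw [map_mul, map_mul, ha, hb]

/-! #### Functoriality -/

section Map

variable {V' W' V'' W'' : Type*} [AddCommGroup V'] [Module ℝ V'] [TopologicalSpace V']
  [AddCommGroup W'] [Module ℝ W'] [AddCommGroup V''] [Module ℝ V''] [TopologicalSpace V'']
  [AddCommGroup W''] [Module ℝ W'']

lemma exists_map (f : (V →L[ℝ] ℝ) →ₗ[ℝ] (V' →L[ℝ] ℝ)) (g : W →ₗ[ℝ] W') :
    ∃ φ : FreeAlg V W →ₐ[ℝ] FreeAlg V' W', (∀ v, φ (gen₁ V W v) = gen₁ V' W' (f v)) ∧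
      ∀ w, φ (gen₂ V W w) = gen₂ V' W' (g w) :=
  exists_lift (gen₁ V' W' ∘ₗ f) (gen₂ V' W' ∘ₗ g) (fun _ => gen₁_sq _)
    (fun _ _ => commute_gen₂ _ _) fun _ _ => commute_gen₁_gen₂ _ _

/-- The functoriality of `⋀ V* ⊗ Sym W`. -/
def map (f : (V →L[ℝ] ℝ) →ₗ[ℝ] (V' →L[ℝ] ℝ)) (g : W →ₗ[ℝ] W') :
    FreeAlg V W →ₐ[ℝ] FreeAlg V' W' := (exists_map f g).choose

@[simp] lemma map_gen₁ (f : (V →L[ℝ] ℝ) →ₗ[ℝ] (V' →L[ℝ] ℝ)) (g : W →ₗ[ℝ] W') (v) :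
    map f g (gen₁ V W v) = gen₁ V' W' (f v) := (exists_map f g).choose_spec.1 v

@[simp] lemma map_gen₂ (f : (V →L[ℝ] ℝ) →ₗ[ℝ] (V' →L[ℝ] ℝ)) (g : W →ₗ[ℝ] W') (w) :
    map f g (gen₂ V W w) = gen₂ V' W' (g w) := (exists_map f g).choose_spec.2 w

lemma map_id (a : FreeAlg V W) : map LinearMap.id LinearMap.id a = a :=
  DFunLike.congr_fun (hom_ext (ψ := AlgHom.id ℝ (FreeAlg V W)) (by simp) (by simp)) a

end Map

variable (V W) in
/-- The parity automorphism. -/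
def parity : FreeAlg V W →ₐ[ℝ] FreeAlg V W := map (-LinearMap.id) LinearMap.id

@[simp] lemma parity_gen₁ (v) : parity V W (gen₁ V W v) = -gen₁ V W v := by simp [parity]

@[simp] lemma parity_gen₂ (w) : parity V W (gen₂ V W w) = gen₂ V W w := by simp [parity]

/-! #### The degree -/

lemma deg_mem_of {i j : ℕ} {n : ℤ} (h : (i : ℤ) + 2 * j = n) {a : FreeAlg V W}
    (ha : a ∈ LinearMap.range (gen₁ V W) ^ i * LinearMap.range (gen₂ V W) ^ j) :
    a ∈ deg V W n :=
  Submodule.mem_iSup_of_mem i (Submodule.mem_iSup_of_mem j (Submodule.mem_iSup_of_mem h ha))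

lemma algebraMap_mem_deg (r : ℝ) : algebraMap ℝ (FreeAlg V W) r ∈ deg V W 0 := by
  refine deg_mem_of (i := 0) (j := 0) (by simp) ?_
  rw [pow_zero, pow_zero, one_mul]
  exact Submodule.algebraMap_mem r

lemma gen₁_mem_deg (v) : gen₁ V W v ∈ deg V W 1 := by
  refine deg_mem_of (i := 1) (j := 0) (by simp) ?_
  rw [pow_zero, pow_one, mul_one]
  exact ⟨v, rfl⟩

lemma gen₂_mem_deg (w) : gen₂ V W w ∈ deg V W 2 := by
  refine deg_mem_of (i := 0) (j := 1) (by simp) ?_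
  rw [pow_zero, pow_one, one_mul]
  exact ⟨w, rfl⟩

lemma range_commute : LinearMap.range (gen₂ V W) * LinearMap.range (gen₁ V W) =
    LinearMap.range (gen₁ V W) * LinearMap.range (gen₂ V W) := by
  refine Submodule.mul_comm_of_commute ?_
  rintro _ ⟨w, rfl⟩ _ ⟨v, rfl⟩
  exact (commute_gen₁_gen₂ v w).symm

lemma mul_mem_deg {n k : ℤ} {a b : FreeAlg V W} (ha : a ∈ deg V W n) (hb : b ∈ deg V W k) :
    a * b ∈ deg V W (n + k) := by
  have hle : deg V W n * deg V W k ≤ deg V W (n + k) := by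
    simp only [deg, Submodule.iSup_mul, Submodule.mul_iSup, iSup_le_iff]
    intro i' j' h' i j h
    have hc : Commute (LinearMap.range (gen₂ V W)) (LinearMap.range (gen₁ V W)) := range_commute
    have : LinearMap.range (gen₁ V W) ^ i * LinearMap.range (gen₂ V W) ^ j *
        (LinearMap.range (gen₁ V W) ^ i' * LinearMap.range (gen₂ V W) ^ j') =
        LinearMap.range (gen₁ V W) ^ (i + i') * LinearMap.range (gen₂ V W) ^ (j + j') := by
      rw [mul_assoc, ← mul_assoc (LinearMap.range (gen₂ V W) ^ j),
        (hc.pow_pow j i').eq, pow_add, pow_add]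
      simp only [mul_assoc]
    rw [this]
    intro x hx
    exact deg_mem_of (by push_cast; linarith) hx
  exact hle (Submodule.mul_mem_mul ha hb)

/-- The induction principle for homogeneous elements. A linear identity depending on the degree is
proved by taking for `S n` the kernel of the difference of its two sides and checking left
multiplication by generators. -/
lemma deg_le {S : ℕ → Submodule ℝ (FreeAlg V W)} (h₀ : 1 ∈ S 0)
    (h₁ : ∀ n v, ∀ a ∈ S n, gen₁ V W v * a ∈ S (n + 1))
    (h₂ : ∀ n w, ∀ a ∈ S n, gen₂ V W w * a ∈ S (n + 2)) (n : ℕ) : deg V W n ≤ S n := by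
  have hq : ∀ j : ℕ, ∀ a ∈ LinearMap.range (gen₂ V W) ^ j, a ∈ S (2 * j) := by
    intro j a ha
    induction ha using Submodule.pow_induction_on_left' with
    | algebraMap r => rw [Algebra.algebraMap_eq_smul_one]; exact (S 0).smul_mem _ h₀
    | add x y i hx hy ihx ihy => exact add_mem ihx ihy
    | mem_mul u hu i x hx ih =>
      obtain ⟨w, rfl⟩ := hu
      exact h₂ _ _ _ ih
  have hpq : ∀ (j : ℕ), ∀ b ∈ S (2 * j), ∀ (i : ℕ),
      ∀ a ∈ LinearMap.range (gen₁ V W) ^ i, a * b ∈ S (i + 2 * j) := by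
    intro j b hb i a ha
    induction ha using Submodule.pow_induction_on_left' with
    | algebraMap r => rw [← Algebra.smul_def, zero_add]; exact (S _).smul_mem _ hb
    | add x y i hx hy ihx ihy => rw [add_mul]; exact add_mem ihx ihy
    | mem_mul u hu i x hx ih =>
      obtain ⟨w, rfl⟩ := hu
      rw [mul_assoc, Nat.succ_add]
      exact h₁ _ _ _ ih
  simp only [deg, iSup_le_iff]
  intro i j h
  rw [Submodule.mul_le]
  intro a ha b hb
  have := hpq j b (hq j b hb) i a ha
  rwa [show i + 2 * j = n by exact_mod_cast h] at this

lemma deg_neg {n : ℤ} (hn : n < 0) : deg V W n = ⊥ := by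
  simp only [deg, iSup_eq_bot]
  intro i j h
  omega

lemma parity_of_mem_deg {n : ℕ} {a : FreeAlg V W} (ha : a ∈ deg V W n) :
    parity V W a = (-1 : ℝ) ^ n • a := by
  let S (n : ℕ) : Submodule ℝ (FreeAlg V W) :=
    LinearMap.ker ((parity V W).toLinearMap - (-1 : ℝ) ^ n • LinearMap.id)
  have hS : ∀ n a, a ∈ S n ↔ parity V W a = (-1 : ℝ) ^ n • a := by
    intro n a
    simp [S, sub_eq_zero]
  refine (hS n a).1 (deg_le ?_ (fun n v a ha => ?_) (fun n w a ha => ?_) n ha)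
  · simp [hS]
  · rw [hS] at ha ⊢
    rw [map_mul, ha, parity_gen₁, pow_succ]
    simp
  · rw [hS] at ha ⊢
    rw [map_mul, ha, parity_gen₂, pow_add]
    simp

lemma gen₁_mul_comm (v) {n : ℕ} {a : FreeAlg V W} (ha : a ∈ deg V W n) :
    gen₁ V W v * a = (-1 : ℝ) ^ n • (a * gen₁ V W v) := by
  let S (n : ℕ) : Submodule ℝ (FreeAlg V W) :=
    LinearMap.ker (LinearMap.mulLeft ℝ (gen₁ V W v) -
      (-1 : ℝ) ^ n • LinearMap.mulRight ℝ (gen₁ V W v))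
  have hS : ∀ n a, a ∈ S n ↔ gen₁ V W v * a = (-1 : ℝ) ^ n • (a * gen₁ V W v) := by
    intro n a
    simp [S, sub_eq_zero]
  refine (hS n a).1 (deg_le ?_ (fun n v a ha => ?_) (fun n w a ha => ?_) n ha)
  · simp [hS]
  · rw [hS] at ha ⊢
    rw [← mul_assoc, gen₁_mul_gen₁, neg_mul, mul_assoc, ha, pow_succ, mul_assoc]
    simp
  · rw [hS] at ha ⊢
    rw [← mul_assoc, (commute_gen₁_gen₂ _ w).eq, mul_assoc, ha, pow_add, mul_assoc]
    simp

lemma commute_gen₂_left (w) (a : FreeAlg V W) : Commute (gen₂ V W w) a := by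
  induction a using FreeAlg.induction with
  | hr r => exact Algebra.commute_algebraMap_right _ _
  | h₁ v => exact (commute_gen₁_gen₂ _ _).symm
  | h₂ w => exact commute_gen₂ _ _
  | hadd a b ha hb => exact ha.add_right hb
  | hmul a b ha hb => exact ha.mul_right hb

/-- Induction on the left factor through `deg_le`: a generator of degree `1` contributes the sign of
`b`, and one of degree `2` contributes none. -/
lemma mul_comm_of_mem_deg {n k : ℕ} {a b : FreeAlg V W} (ha : a ∈ deg V W n)
    (hb : b ∈ deg V W k) : a * b = (-1 : ℝ) ^ (n * k) • (b * a) := by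
  let S (n : ℕ) : Submodule ℝ (FreeAlg V W) :=
    LinearMap.ker (LinearMap.mulRight ℝ b - (-1 : ℝ) ^ (n * k) • LinearMap.mulLeft ℝ b)
  have hS : ∀ n a, a ∈ S n ↔ a * b = (-1 : ℝ) ^ (n * k) • (b * a) := by
    intro n a
    simp [S, sub_eq_zero]
  refine (hS n a).1 (deg_le ?_ (fun n v a ha => ?_) (fun n w a ha => ?_) n ha)
  · simp [hS]
  · rw [hS] at ha ⊢
    rw [mul_assoc, ha, mul_smul_comm, ← mul_assoc, gen₁_mul_comm v hb, smul_mul_assoc, smul_smul,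
      mul_assoc, ← pow_add, add_mul, one_mul]
  · rw [hS] at ha ⊢
    rw [mul_assoc, ha, mul_smul_comm, ← mul_assoc, (commute_gen₂_left w b).eq, mul_assoc, add_mul,
      pow_add, (even_two_mul k).neg_one_pow, mul_one]

/-! #### The homogeneous components -/

variable (V W) in
-- The grading is encoded as an algebra homomorphism to polynomials that marks each generator with
-- its degree. Its coefficients are the homogeneous projections, so no direct sum decomposition has
-- to be set up.
lemma exists_weight : ∃ φ : FreeAlg V W →ₐ[ℝ] Polynomial (FreeAlg V W),
    (∀ v, φ (gen₁ V W v) = Polynomial.monomial 1 (gen₁ V W v)) ∧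
    ∀ w, φ (gen₂ V W w) = Polynomial.monomial 2 (gen₂ V W w) := by
  refine exists_lift (((Polynomial.monomial 1).restrictScalars ℝ) ∘ₗ gen₁ V W)
    (((Polynomial.monomial 2).restrictScalars ℝ) ∘ₗ gen₂ V W) ?_ ?_ ?_
  · intro v
    simp [Polynomial.monomial_mul_monomial, gen₁_sq]
  · intro w w'
    simp [Commute, SemiconjBy, Polynomial.monomial_mul_monomial, (commute_gen₂ w w').eq]
  · intro v w
    simp [Commute, SemiconjBy, Polynomial.monomial_mul_monomial, (commute_gen₁_gen₂ v w).eq]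

variable (V W) in
/-- The homomorphism `a ↦ a Xⁿ` for `a` of degree `n`. -/
def weight : FreeAlg V W →ₐ[ℝ] Polynomial (FreeAlg V W) := (exists_weight V W).choose

variable (V W) in
/-- The homogeneous component of degree `n`. -/
def component (n : ℕ) : FreeAlg V W →ₗ[ℝ] FreeAlg V W :=
  ((Polynomial.lcoeff (FreeAlg V W) n).restrictScalars ℝ) ∘ₗ (weight V W).toLinearMap

lemma weight_of_mem_deg {n : ℕ} {a : FreeAlg V W} (ha : a ∈ deg V W n) :
    weight V W a = Polynomial.monomial n a := by
  let S (n : ℕ) : Submodule ℝ (FreeAlg V W) :=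
    LinearMap.ker ((weight V W).toLinearMap - (Polynomial.monomial n).restrictScalars ℝ)
  have hS : ∀ n a, a ∈ S n ↔ weight V W a = Polynomial.monomial n a := by
    intro n a
    simp [S, sub_eq_zero]
  refine (hS n a).1 (deg_le ?_ (fun n v a ha => ?_) (fun n w a ha => ?_) n ha)
  · simp [hS]
  · rw [hS] at ha ⊢
    rw [map_mul, ha, weight, (exists_weight V W).choose_spec.1, Polynomial.monomial_mul_monomial,
      add_comm]
  · rw [hS] at ha ⊢
    rw [map_mul, ha, weight, (exists_weight V W).choose_spec.2, Polynomial.monomial_mul_monomial,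
      add_comm]

lemma component_of_mem_deg {n k : ℕ} {a : FreeAlg V W} (ha : a ∈ deg V W n) :
    component V W k a = if n = k then a else 0 := by
  simp [component, weight_of_mem_deg ha, Polynomial.coeff_monomial]

/-! #### Degrees zero, one and two -/

/-- The equation `i + 2 j = 2` has only the solutions `(2, 0)` and `(0, 1)`. -/
lemma mem_deg_two {a : FreeAlg V W} (ha : a ∈ deg V W 2) :
    ∃ θ ∈ ⋀[ℝ]^2 (V →L[ℝ] ℝ), ∃ w, a = ofExt V W θ + gen₂ V W w := by
  have h1 : LinearMap.range (gen₁ V W) ^ 2 =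
      (⋀[ℝ]^2 (V →L[ℝ] ℝ)).map (ofExt V W).toLinearMap := by
    rw [Submodule.map_pow, gen₁, LinearMap.range_comp]
  have h : deg V W 2 ≤ LinearMap.range (gen₁ V W) ^ 2 ⊔ LinearMap.range (gen₂ V W) := by
    simp only [deg, iSup_le_iff]
    intro i j h
    have : (i = 2 ∧ j = 0) ∨ (i = 0 ∧ j = 1) := by omega
    rcases this with ⟨rfl, rfl⟩ | ⟨rfl, rfl⟩
    · simp
    · simp
  obtain ⟨x, hx, y, ⟨w, rfl⟩, rfl⟩ := Submodule.mem_sup.1 (h ha)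
  rw [h1] at hx
  obtain ⟨θ, hθ, rfl⟩ := hx
  exact ⟨θ, hθ, w, rfl⟩

variable (V W) in
lemma exists_toExt : ∃ φ : FreeAlg V W →ₐ[ℝ] ExteriorAlgebra ℝ (V →L[ℝ] ℝ),
    (∀ v, φ (gen₁ V W v) = ExteriorAlgebra.ι ℝ v) ∧ ∀ w, φ (gen₂ V W w) = 0 :=
  exists_lift (ExteriorAlgebra.ι ℝ) 0 (ExteriorAlgebra.ι_sq_zero) (by simp) (by simp)

variable (V W) in
/-- The projection to `⋀ V*`. -/
def toExt : FreeAlg V W →ₐ[ℝ] ExteriorAlgebra ℝ (V →L[ℝ] ℝ) := (exists_toExt V W).choose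

@[simp] lemma toExt_gen₁ (v) : toExt V W (gen₁ V W v) = ExteriorAlgebra.ι ℝ v :=
  (exists_toExt V W).choose_spec.1 v

@[simp] lemma toExt_gen₂ (w) : toExt V W (gen₂ V W w) = 0 :=
  (exists_toExt V W).choose_spec.2 w

@[simp] lemma toExt_ofExt (θ) : toExt V W (ofExt V W θ) = θ := by
  have : (toExt V W).comp (ofExt V W) = AlgHom.id ℝ _ := by
    refine ExteriorAlgebra.hom_ext (LinearMap.ext fun v => ?_)
    exact toExt_gen₁ v
  exact DFunLike.congr_fun this θ

variable (V W) in
-- Send the degree-one generators to `0` and embed `W` in the trivial square-zero extension of `ℝ`.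
-- The second component of this homomorphism keeps a generator from `W` and kills every multiple of
-- a generator from `V*`.
lemma exists_coeff₂ : ∃ c : FreeAlg V W →ₗ[ℝ] W, (∀ w, c (gen₂ V W w) = w) ∧
    ∀ v a, c (gen₁ V W v * a) = 0 := by
  -- The square-zero extension also asks for a right action of the scalars.
  let _ : Module ℝᵐᵒᵖ W := Module.compHom _ ((RingHom.id ℝ).fromOpposite mul_comm)
  have : IsCentralScalar ℝ W := ⟨fun r m => rfl⟩
  obtain ⟨φ, h1, h2⟩ := exists_lift (V := V) (A := TrivSqZeroExt ℝ W) 0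
    (TrivSqZeroExt.inrHom ℝ W) (by simp) (fun _ _ => Commute.all _ _) (by simp)
  exact ⟨TrivSqZeroExt.sndHom ℝ W ∘ₗ φ.toLinearMap, by simp [h2], by simp [h1]⟩

variable (V W) in
/-- The scalar part. -/
def scalar : FreeAlg V W →ₐ[ℝ] ℝ := ExteriorAlgebra.algebraMapInv.comp (toExt V W)

variable (V W) in
/-- The component in `V*`. -/
def coeff₁ : FreeAlg V W →ₗ[ℝ] (V →L[ℝ] ℝ) := ExteriorAlgebra.ιInv ∘ₗ (toExt V W).toLinearMap

variable (V W) in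
/-- The component in `W`. -/
def coeff₂ : FreeAlg V W →ₗ[ℝ] W := (exists_coeff₂ V W).choose

@[simp] lemma coeff₁_gen₁ (v) : coeff₁ V W (gen₁ V W v) = v := by
  simp [coeff₁, ExteriorAlgebra.ι_leftInverse v]

@[simp] lemma coeff₂_gen₂ (w) : coeff₂ V W (gen₂ V W w) = w :=
  (exists_coeff₂ V W).choose_spec.1 w

@[simp] lemma coeff₂_gen₁_mul (v) (a) : coeff₂ V W (gen₁ V W v * a) = 0 :=
  (exists_coeff₂ V W).choose_spec.2 v a

lemma coeff₂_ofExt {θ} (hθ : θ ∈ ⋀[ℝ]^2 (V →L[ℝ] ℝ)) : coeff₂ V W (ofExt V W θ) = 0 := by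
  have : ⋀[ℝ]^2 (V →L[ℝ] ℝ) ≤ LinearMap.ker (coeff₂ V W ∘ₗ (ofExt V W).toLinearMap) := by
    rw [ExteriorAlgebra.exteriorPower, pow_two, Submodule.mul_le]
    rintro _ ⟨v, rfl⟩ _ ⟨w, rfl⟩
    simp only [LinearMap.mem_ker, LinearMap.comp_apply, AlgHom.toLinearMap_apply, map_mul]
    exact coeff₂_gen₁_mul v _
  exact this hθ

lemma algebraMap_inj {r s : ℝ} (h : algebraMap ℝ (FreeAlg V W) r = algebraMap ℝ _ s) : r = s := by
  simpa using congrArg (scalar V W) h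

lemma gen₁_inj {v w} (h : gen₁ V W v = gen₁ V W w) : v = w := by
  simpa using congrArg (coeff₁ V W) h

variable (V W) in
/-- The value `θ(v, w)` of the component in `⋀² V*`. -/
def form (v w : V) : FreeAlg V W →ₗ[ℝ] ℝ :=
  ExteriorAlgebra.algebraMapInv.toLinearMap ∘ₗ
  CliffordAlgebra.contractLeft (Module.Dual.eval ℝ V w ∘ₗ ContinuousLinearMap.coeLM ℝ) ∘ₗ
  CliffordAlgebra.contractLeft (Module.Dual.eval ℝ V v ∘ₗ ContinuousLinearMap.coeLM ℝ) ∘ₗ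
  (toExt V W).toLinearMap

/-- Contraction is an odd derivation, and contracting first with `v` and then with `w` gives the
sign convention of the theorem for `a ∧ b`. -/
lemma contract_contract (a b : V →L[ℝ] ℝ) (v w : V) :
    CliffordAlgebra.contractLeft (Module.Dual.eval ℝ V w ∘ₗ ContinuousLinearMap.coeLM ℝ)
      (CliffordAlgebra.contractLeft (Module.Dual.eval ℝ V v ∘ₗ ContinuousLinearMap.coeLM ℝ)
        (ExteriorAlgebra.ι ℝ a * ExteriorAlgebra.ι ℝ b)) =
      algebraMap ℝ (ExteriorAlgebra ℝ (V →L[ℝ] ℝ)) (a v * b w - a w * b v) := by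
  have h1 := CliffordAlgebra.contractLeft_ι_mul (Q := (0 : QuadraticForm ℝ (V →L[ℝ] ℝ)))
    (d := Module.Dual.eval ℝ V v ∘ₗ ContinuousLinearMap.coeLM ℝ) a (CliffordAlgebra.ι _ b)
  erw [h1]
  simp only [CliffordAlgebra.contractLeft_ι, map_sub, map_smul, ← Algebra.commutes,
    ← Algebra.smul_def]
  simp only [LinearMap.comp_apply, ContinuousLinearMap.coeLM_apply, Module.Dual.eval_apply]
  simp only [Algebra.algebraMap_eq_smul_one, smul_smul, mul_comm]
  simp

@[simp] lemma form_gen₂ (v w : V) (u) : form V W v w (gen₂ V W u) = 0 := by simp [form]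

@[simp] lemma form_gen₁_mul_gen₁ (v w : V) (a b) :
    form V W v w (gen₁ V W a * gen₁ V W b) = a v * b w - a w * b v := by
  have := congrArg ExteriorAlgebra.algebraMapInv (contract_contract a b v w)
  rw [ExteriorAlgebra.algebraMap_leftInverse] at this
  simp only [form, LinearMap.comp_apply, AlgHom.toLinearMap_apply, map_mul, toExt_gen₁]
  exact this

/-- Both sides are linear, and `∧² V*` is spanned by products of two covectors, where the double
contraction is known to be a scalar. -/
lemma isTwoForm_of_mem {θ} (hθ : θ ∈ ⋀[ℝ]^2 (V →L[ℝ] ℝ)) :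
    IsTwoForm θ (fun v w => form V W v w (ofExt V W θ)) := by
  refine ⟨hθ, fun v w => ?_⟩
  let c := CliffordAlgebra.contractLeft (Q := (0 : QuadraticForm ℝ (V →L[ℝ] ℝ)))
      (Module.Dual.eval ℝ V w ∘ₗ ContinuousLinearMap.coeLM ℝ) ∘ₗ
    CliffordAlgebra.contractLeft (Module.Dual.eval ℝ V v ∘ₗ ContinuousLinearMap.coeLM ℝ)
  have : ⋀[ℝ]^2 (V →L[ℝ] ℝ) ≤ LinearMap.ker (c - Algebra.linearMap ℝ _ ∘ₗ form V W v w ∘ₗ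
      (ofExt V W).toLinearMap) := by
    rw [ExteriorAlgebra.exteriorPower, pow_two, Submodule.mul_le]
    rintro _ ⟨a, rfl⟩ _ ⟨b, rfl⟩
    rw [LinearMap.mem_ker, LinearMap.sub_apply, sub_eq_zero]
    refine (contract_contract a b v w).trans ?_
    rw [← form_gen₁_mul_gen₁ (W := W)]
    simp only [LinearMap.comp_apply, AlgHom.toLinearMap_apply, map_mul]
    rfl
  have := this hθ
  rw [LinearMap.mem_ker, LinearMap.sub_apply, sub_eq_zero] at this
  exact this

lemma form_of_isTwoForm {θ : ExteriorAlgebra ℝ (V →L[ℝ] ℝ)} {r : V → V → ℝ} (h : IsTwoForm θ r)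
    (v w : V) : form V W v w (ofExt V W θ) = r v w := by
  have := congrArg ExteriorAlgebra.algebraMapInv (h.2 v w)
  rw [ExteriorAlgebra.algebraMap_leftInverse] at this
  rw [← this]
  simp only [form, LinearMap.comp_apply, AlgHom.toLinearMap_apply, toExt_ofExt]

section Basis

variable {ι : Type*} [Fintype ι] {s : ι → V} {τ : ι → V →L[ℝ] ℝ}

/-- The expansion of an element of `⋀² V*` in a basis. -/
lemma ofExt_eq_sum (hs : ∀ t : V →L[ℝ] ℝ, t = ∑ i, t (s i) • τ i) {θ}
    (hθ : θ ∈ ⋀[ℝ]^2 (V →L[ℝ] ℝ)) : ofExt V W θ =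
    ∑ i, ∑ j, (2⁻¹ * form V W (s i) (s j) (ofExt V W θ)) • (gen₁ V W (τ i) * gen₁ V W (τ j)) := by
  -- The sum runs over ordered pairs, so each product of two basis covectors is met twice; this
  -- accounts for the factor `2⁻¹`.
  let L : FreeAlg V W →ₗ[ℝ] FreeAlg V W := ∑ i, ∑ j,
    ((2⁻¹ : ℝ) • form V W (s i) (s j)).smulRight (gen₁ V W (τ i) * gen₁ V W (τ j))
  have hL : ∀ x, L x =
      ∑ i, ∑ j, (2⁻¹ * form V W (s i) (s j) x) • (gen₁ V W (τ i) * gen₁ V W (τ j)) := by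
    intro x
    simp [L]
  rw [← hL]
  have : ⋀[ℝ]^2 (V →L[ℝ] ℝ) ≤ LinearMap.ker ((LinearMap.id - L) ∘ₗ (ofExt V W).toLinearMap) := by
    rw [ExteriorAlgebra.exteriorPower, pow_two, Submodule.mul_le]
    rintro _ ⟨a, rfl⟩ _ ⟨b, rfl⟩
    rw [LinearMap.mem_ker, LinearMap.comp_apply, LinearMap.sub_apply, sub_eq_zero]
    rw [AlgHom.toLinearMap_apply, map_mul]
    change gen₁ V W a * gen₁ V W b = L (gen₁ V W a * gen₁ V W b)
    have key : ∀ c d : V →L[ℝ] ℝ, gen₁ V W c * gen₁ V W d =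
        ∑ i, ∑ j, (c (s i) * d (s j)) • (gen₁ V W (τ i) * gen₁ V W (τ j)) := by
      intro c d
      conv_lhs => rw [hs c, hs d]
      simp only [map_sum, map_smul, Finset.sum_mul_sum, smul_mul_smul_comm]
    have h2 : ∀ i j, (2⁻¹ * (a (s i) * b (s j) - a (s j) * b (s i))) •
        (gen₁ V W (τ i) * gen₁ V W (τ j)) =
        (2⁻¹ : ℝ) • ((a (s i) * b (s j)) • (gen₁ V W (τ i) * gen₁ V W (τ j)) -
          (b (s i) * a (s j)) • (gen₁ V W (τ i) * gen₁ V W (τ j))) := by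
      intro i j
      rw [← sub_smul, smul_smul, mul_comm (b (s i))]
    simp only [hL, form_gen₁_mul_gen₁, h2, ← Finset.smul_sum, Finset.sum_sub_distrib, ← key]
    rw [gen₁_mul_gen₁ b a, sub_neg_eq_add, ← two_smul ℝ, smul_smul]
    norm_num
  have := this hθ
  rw [LinearMap.mem_ker, LinearMap.comp_apply, LinearMap.sub_apply, sub_eq_zero] at this
  exact this

/-- In degree two, `coeff₂` and `form` are a complete set of coordinates. Later identities in degree
two are checked on these two components. -/
lemma eq_of_deg_two (hs : ∀ t : V →L[ℝ] ℝ, t = ∑ i, t (s i) • τ i) {a b : FreeAlg V W}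
    (ha : a ∈ deg V W 2) (hb : b ∈ deg V W 2) (h : coeff₂ V W a = coeff₂ V W b)
    (hf : ∀ v w, form V W v w a = form V W v w b) : a = b := by
  obtain ⟨θ, hθ, w, rfl⟩ := mem_deg_two ha
  obtain ⟨θ', hθ', w', rfl⟩ := mem_deg_two hb
  simp only [map_add, coeff₂_ofExt hθ, coeff₂_ofExt hθ', coeff₂_gen₂, zero_add] at h
  simp only [map_add, form_gen₂, add_zero] at hf
  rw [ofExt_eq_sum hs hθ, ofExt_eq_sum hs hθ', h]
  simp only [hf]

end Basis

/-! #### Derivations -/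

/-- A twisted derivation is the upper right corner of a homomorphism to triangular `2 × 2` matrices
whose diagonal consists of the twist and the identity. The two hypotheses are the relations of the
algebra read in that corner: the matrices of covectors must square to zero, and they must commute
with those of `W`. Thus `ε = -1` leaves only `q` free and `ε = 1` leaves only `β`. -/
lemma exists_derivation (ε : ℝ) (q : (V →L[ℝ] ℝ) →ₗ[ℝ] ℝ) (β : W →ₗ[ℝ] ℝ)
    (hq : ∀ v, (1 + ε) * q v = 0) (hβ : ∀ w, (1 - ε) * β w = 0) :
    ∃ D : FreeAlg V W →ₗ[ℝ] FreeAlg V W, (∀ r, D (algebraMap ℝ _ r) = 0) ∧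
      (∀ v, D (gen₁ V W v) = algebraMap ℝ _ (q v)) ∧
      (∀ w, D (gen₂ V W w) = algebraMap ℝ _ (β w)) ∧
      ∀ a b, D (a * b) = D a * b + map (ε • LinearMap.id) LinearMap.id a * D b := by
  let f : (V →L[ℝ] ℝ) →ₗ[ℝ] Matrix (Fin 2) (Fin 2) (FreeAlg V W) :=
    { toFun := fun v => !![ε • gen₁ V W v, algebraMap ℝ _ (q v); 0, gen₁ V W v]
      map_add' := fun v w => by ext i j; fin_cases i <;> fin_cases j <;> simp
      map_smul' := fun r v => by
        ext i j; fin_cases i <;> fin_cases j <;> simp [smul_comm r ε, Algebra.smul_def r] }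
  let g : W →ₗ[ℝ] Matrix (Fin 2) (Fin 2) (FreeAlg V W) :=
    { toFun := fun w => !![gen₂ V W w, algebraMap ℝ _ (β w); 0, gen₂ V W w]
      map_add' := fun v w => by ext i j; fin_cases i <;> fin_cases j <;> simp
      map_smul' := fun r v => by
        ext i j; fin_cases i <;> fin_cases j <;> simp [Algebra.smul_def r] }
  obtain ⟨φ, hφ₁, hφ₂⟩ := exists_lift f g (by
      intro v
      have : ε • (q v • gen₁ V W v) + q v • gen₁ V W v = 0 := by
        rw [smul_smul, ← add_smul, show ε * q v + q v = (1 + ε) * q v by ring, hq, zero_smul]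
      ext i j; fin_cases i <;> fin_cases j <;>
        simp [f, Matrix.mul_apply, gen₁_sq, ← Algebra.commutes, ← Algebra.smul_def]
      exact this) (by
      intro w w'
      ext i j; fin_cases i <;> fin_cases j <;>
        simp [g, Matrix.mul_apply, (commute_gen₂ w w').eq, ← Algebra.commutes, add_comm]) (by
      intro v w
      have : ε • (β w • gen₁ V W v) = β w • gen₁ V W v := by
        rw [smul_smul, ← sub_eq_zero, ← sub_smul,
          show ε * β w - β w = -((1 - ε) * β w) by ring, hβ, neg_zero, zero_smul]
      ext i j; fin_cases i <;> fin_cases j <;>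
        simp [f, g, Matrix.mul_apply, (commute_gen₁_gen₂ v w).eq, ← Algebra.commutes,
          ← Algebra.smul_def, add_comm]
      exact this)
  -- Once the diagonal is known, multiplicativity of `φ` in the upper right corner is the twisted
  -- Leibniz rule.
  have hdiag : ∀ a, φ a 1 0 = 0 ∧ φ a 1 1 = a ∧
      φ a 0 0 = map (ε • LinearMap.id) LinearMap.id a := by
    intro a
    induction a using FreeAlg.induction with
    | hr r => simp [Matrix.algebraMap_matrix_apply]
    | h₁ v => rw [hφ₁]; simp [f]
    | h₂ w => rw [hφ₂]; simp [g]
    | hadd a b ha hb => simp [ha, hb]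
    | hmul a b ha hb => simp [ha, hb, Matrix.mul_apply]
  refine ⟨{ toFun := fun a => φ a 0 1, map_add' := by simp, map_smul' := by simp },
    fun r => ?_, fun v => ?_, fun w => ?_, fun a b => ?_⟩
  · simp [Matrix.algebraMap_matrix_apply]
  · simp [hφ₁, f]
  · simp [hφ₂, g]
  · simp [hdiag, Matrix.mul_apply, add_comm]

lemma exists_odd_derivation (q : V) : ∃ D : FreeAlg V W →ₗ[ℝ] FreeAlg V W,
    (∀ r, D (algebraMap ℝ _ r) = 0) ∧ (∀ v, D (gen₁ V W v) = algebraMap ℝ _ (v q)) ∧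
      (∀ w, D (gen₂ V W w) = 0) ∧ ∀ a b, D (a * b) = D a * b + parity V W a * D b := by
  obtain ⟨D, h0, h1, h2, h3⟩ := exists_derivation (W := W) (-1)
    (Module.Dual.eval ℝ V q ∘ₗ ContinuousLinearMap.coeLM ℝ) 0 (by simp) (by simp)
  refine ⟨D, h0, h1, by simpa using h2, fun a b => ?_⟩
  have e : ((-1 : ℝ) • LinearMap.id : (V →L[ℝ] ℝ) →ₗ[ℝ] (V →L[ℝ] ℝ)) = -LinearMap.id := by
    ext; simp
  rw [h3, parity, e]

lemma exists_even_derivation (β : W →ₗ[ℝ] ℝ) : ∃ D : FreeAlg V W →ₗ[ℝ] FreeAlg V W,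
    (∀ r, D (algebraMap ℝ _ r) = 0) ∧ (∀ v, D (gen₁ V W v) = 0) ∧
      (∀ w, D (gen₂ V W w) = algebraMap ℝ _ (β w)) ∧ ∀ a b, D (a * b) = D a * b + a * D b := by
  obtain ⟨D, h0, h1, h2, h3⟩ := exists_derivation (V := V) 1 0 β (by simp) (by simp)
  refine ⟨D, h0, by simpa using h1, h2, fun a b => ?_⟩
  rw [h3, one_smul, map_id]

end FreeAlg
end FibreAlgebra
end SplitPoisson
end

/-! ### Functions on the graded manifold as local polynomials in global sections -/

open Bundle Manifold Set TopologicalSpace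
open scoped Manifold ContDiff Bundle Topology TensorProduct
noncomputable section
namespace SplitPoisson
set_option linter.unusedSectionVars false

section GradedFunctions

variable {m : ℕ} {M : Type*} [TopologicalSpace M] [ChartedSpace (EuclideanSpace ℝ (Fin m)) M]
  [T2Space M] [IsManifold (𝓡 m) ∞ M]
  {FQ : Type*} [NormedAddCommGroup FQ] [NormedSpace ℝ FQ] [FiniteDimensional ℝ FQ]
  {Q : M → Type*} [TopologicalSpace (TotalSpace FQ Q)] [∀ x, AddCommGroup (Q x)]
  [∀ x, Module ℝ (Q x)] [∀ x, TopologicalSpace (Q x)] [∀ x, IsTopologicalAddGroup (Q x)]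
  [∀ x, ContinuousSMul ℝ (Q x)] [FiberBundle FQ Q] [VectorBundle ℝ FQ Q]
  [ContMDiffVectorBundle ∞ FQ Q (𝓡 m)]
  {FB : Type*} [NormedAddCommGroup FB] [NormedSpace ℝ FB] [FiniteDimensional ℝ FB]
  {B : M → Type*} [TopologicalSpace (TotalSpace FB B)] [∀ x, AddCommGroup (B x)]
  [∀ x, Module ℝ (B x)] [∀ x, TopologicalSpace (B x)] [FiberBundle FB B] [VectorBundle ℝ FB B]
  [ContMDiffVectorBundle ∞ FB B (𝓡 m)]

local notation "𝓕" => Fun (𝓡 m) FB B FQ Q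

/-- The value of a function of `𝓜` over `M` at a point. -/
def val (ξ : 𝓕 ⊤) (x : M) : FreeAlg (Q x) (B x) := ξ.1 ⟨x, trivial⟩

@[simp] lemma val_add (ξ η : 𝓕 ⊤) (x : M) : val (ξ + η) x = val ξ x + val η x := rfl
@[simp] lemma val_sub (ξ η : 𝓕 ⊤) (x : M) : val (ξ - η) x = val ξ x - val η x := rfl
@[simp] lemma val_neg (ξ : 𝓕 ⊤) (x : M) : val (-ξ) x = -val ξ x := rfl
@[simp] lemma val_zero (x : M) : val (0 : 𝓕 ⊤) x = 0 := rfl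
@[simp] lemma val_mul (ξ η : 𝓕 ⊤) (x : M) : val (ξ * η) x = val ξ x * val η x := rfl
@[simp] lemma val_smul (r : ℝ) (ξ : 𝓕 ⊤) (x : M) : val (r • ξ) x = r • val ξ x := rfl
@[simp] lemma val_incl₀ (f : SmoothFun m M) (x : M) :
    val (incl₀ FB B FQ Q f) x = algebraMap ℝ _ (f x) := rfl
@[simp] lemma val_incl₁ (τ : Sec (𝓡 m) (FQ →L[ℝ] ℝ) (DualBundle Q)) (x : M) :
    val (incl₁ FB B τ) x = FreeAlg.gen₁ (Q x) (B x) (τ x) := rfl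
@[simp] lemma val_incl₂ (b : Sec (𝓡 m) FB B) (x : M) :
    val (incl₂ FQ Q b) x = FreeAlg.gen₂ (Q x) (B x) (b x) := rfl

/-- The evaluation at a point, as an algebra homomorphism. -/
def valHom (x : M) : 𝓕 ⊤ →ₐ[ℝ] FreeAlg (Q x) (B x) :=
  (Pi.evalAlgHom ℝ (fun x : (⊤ : Opens M) => FreeAlg (Q x) (B x)) ⟨x, trivial⟩).comp
    (Subalgebra.val _)

@[simp] lemma valHom_apply (x : M) (ξ : 𝓕 ⊤) : valHom x ξ = val ξ x := rfl

@[simp] lemma val_sum {ι : Type*} (s : Finset ι) (ξ : ι → 𝓕 ⊤) (x : M) :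
    val (∑ i ∈ s, ξ i) x = ∑ i ∈ s, val (ξ i) x := map_sum (valHom x) ξ s

lemma fun_ext {ξ η : 𝓕 ⊤} (h : ∀ x, val ξ x = val η x) : ξ = η :=
  Subtype.ext (funext fun x => h x.1)

lemma incl₀_add (f g : SmoothFun m M) :
    incl₀ FB B FQ Q (f + g) = incl₀ FB B FQ Q f + incl₀ FB B FQ Q g := fun_ext fun x => by simp
lemma incl₀_smul (r : ℝ) (f : SmoothFun m M) :
    incl₀ FB B FQ Q (r • f) = r • incl₀ FB B FQ Q f :=
  fun_ext fun x => by
    rw [val_smul, val_incl₀, val_incl₀, ContMDiffMap.coe_smul, Pi.smul_apply, smul_eq_mul,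
      map_mul, ← Algebra.smul_def]
lemma incl₀_mul (f g : SmoothFun m M) :
    incl₀ FB B FQ Q (f * g) = incl₀ FB B FQ Q f * incl₀ FB B FQ Q g := fun_ext fun x => by simp
lemma incl₁_add (f g : Sec (𝓡 m) (FQ →L[ℝ] ℝ) (DualBundle Q)) :
    incl₁ FB B (f + g) = incl₁ FB B f + incl₁ FB B g := fun_ext fun x => by simp
lemma incl₁_smul (r : ℝ) (f : Sec (𝓡 m) (FQ →L[ℝ] ℝ) (DualBundle Q)) :
    incl₁ FB B (r • f) = r • incl₁ FB B f := fun_ext fun x => by simp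
lemma incl₁_fsmul (f : SmoothFun m M) (τ : Sec (𝓡 m) (FQ →L[ℝ] ℝ) (DualBundle Q)) :
    incl₁ FB B (fsmul f τ) = incl₀ FB B FQ Q f * incl₁ FB B τ :=
  fun_ext fun x => by simp [Algebra.smul_def]
lemma incl₂_add (f g : Sec (𝓡 m) FB B) :
    incl₂ FQ Q (f + g) = incl₂ FQ Q f + incl₂ FQ Q g := fun_ext fun x => by simp
lemma incl₂_smul (r : ℝ) (f : Sec (𝓡 m) FB B) :
    incl₂ FQ Q (r • f) = r • incl₂ FQ Q f := fun_ext fun x => by simp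
lemma incl₂_fsmul (f : SmoothFun m M) (b : Sec (𝓡 m) FB B) :
    incl₂ FQ Q (fsmul f b) = incl₀ FB B FQ Q f * incl₂ FQ Q b :=
  fun_ext fun x => by simp [Algebra.smul_def]

/-- The germs at `x` of two functions of `𝓜` agree. -/
def GermEq {U V : Opens M} (x : M) (ξ : 𝓕 U) (η : 𝓕 V) : Prop :=
  ∀ᶠ y in 𝓝 x, ∀ (h : y ∈ U) (h' : y ∈ V), ξ.1 ⟨y, h⟩ = η.1 ⟨y, h'⟩

lemma GermEq.val_eq {x : M} {ξ η : 𝓕 ⊤} (h : GermEq x ξ η) : val ξ x = val η x :=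
  h.self_of_nhds trivial trivial

lemma germEq_iff {x : M} {ξ η : 𝓕 ⊤} : GermEq x ξ η ↔ ∀ᶠ y in 𝓝 x, val ξ y = val η y :=
  Filter.eventually_congr (Filter.Eventually.of_forall fun _ =>
    ⟨fun h => h trivial trivial, fun h _ _ => h⟩)

/-- The polynomials of degree `n` in the smooth functions and the sections of `Q*` and `B`. -/
inductive HPoly : ℕ → 𝓕 ⊤ → Prop
  | fn (f : SmoothFun m M) : HPoly 0 (incl₀ FB B FQ Q f)
  | dual (τ : Sec (𝓡 m) (FQ →L[ℝ] ℝ) (DualBundle Q)) : HPoly 1 (incl₁ FB B τ)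
  | sec (b : Sec (𝓡 m) FB B) : HPoly 2 (incl₂ FQ Q b)
  | zero (n : ℕ) : HPoly n 0
  | add {n : ℕ} {ξ η : 𝓕 ⊤} : HPoly n ξ → HPoly n η → HPoly n (ξ + η)
  | mul {n k : ℕ} {ξ η : 𝓕 ⊤} : HPoly n ξ → HPoly k η → HPoly (n + k) (ξ * η)

lemma HPoly.homogeneous {n : ℕ} {ξ : 𝓕 ⊤} (h : HPoly n ξ) : Fun.IsHomogeneous n ξ := by
  intro x
  induction h with
  | fn f => exact FreeAlg.algebraMap_mem_deg _
  | dual τ => exact FreeAlg.gen₁_mem_deg _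
  | sec b => exact FreeAlg.gen₂_mem_deg _
  | zero n => exact zero_mem _
  | add _ _ h1 h2 => exact add_mem h1 h2
  | mul _ _ h1 h2 =>
    push_cast
    exact FreeAlg.mul_mem_deg h1 h2

lemma HPoly.val_mem {n : ℕ} {ξ : 𝓕 ⊤} (h : HPoly n ξ) (x : M) : val ξ x ∈ FreeAlg.deg (Q x) (B x) n :=
  h.homogeneous ⟨x, trivial⟩

variable (FB B FQ Q) in
/-- The polynomials in the smooth functions and the sections of `Q*` and `B`. -/
def Poly : AddSubmonoid (Fun (𝓡 m) FB B FQ Q ⊤) := AddSubmonoid.closure {ξ | ∃ n, HPoly n ξ}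

lemma HPoly.mem_poly {n : ℕ} {ξ : 𝓕 ⊤} (h : HPoly n ξ) : ξ ∈ Poly FQ Q FB B :=
  AddSubmonoid.subset_closure ⟨n, h⟩

lemma mul_mem_poly {ξ η : 𝓕 ⊤} (h : ξ ∈ Poly FQ Q FB B) (h' : η ∈ Poly FQ Q FB B) :
    ξ * η ∈ Poly FQ Q FB B := by
  induction h using AddSubmonoid.closure_induction with
  | zero => rw [zero_mul]; exact zero_mem _
  | add a b _ _ ha hb => rw [add_mul]; exact add_mem ha hb
  | mem a ha =>
    obtain ⟨n, ha⟩ := ha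
    induction h' using AddSubmonoid.closure_induction with
    | zero => rw [mul_zero]; exact zero_mem _
    | add a b _ _ ha hb => rw [mul_add]; exact add_mem ha hb
    | mem b hb =>
      obtain ⟨k, hb⟩ := hb
      exact (ha.mul hb).mem_poly

/-- The homogeneous components of a polynomial are polynomials. -/
lemma exists_component {ξ : 𝓕 ⊤} (h : ξ ∈ Poly FQ Q FB B) (n : ℕ) :
    ∃ η : 𝓕 ⊤, HPoly n η ∧ ∀ x, val η x = FreeAlg.component (Q x) (B x) n (val ξ x) := by
  induction h using AddSubmonoid.closure_induction with
  | zero => exact ⟨0, HPoly.zero n, by simp⟩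
  | add a b _ _ ha hb =>
    obtain ⟨a', ha', ha''⟩ := ha
    obtain ⟨b', hb', hb''⟩ := hb
    exact ⟨a' + b', ha'.add hb', by simp [ha'', hb'']⟩
  | mem a ha =>
    obtain ⟨k, ha⟩ := ha
    by_cases hk : k = n
    · subst hk
      refine ⟨a, ha, fun x => ?_⟩
      rw [FreeAlg.component_of_mem_deg (ha.val_mem x), if_pos rfl]
    · refine ⟨0, HPoly.zero n, fun x => ?_⟩
      rw [FreeAlg.component_of_mem_deg (ha.val_mem x), if_neg hk, val_zero]

/-- Generators over `V` are sections over `V`, whose germs at `x` extend globally; sums and products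
of representatives represent sums and products. -/
lemma exists_poly_of_adjoin {V : Opens M} {x : M} (hx : x ∈ V) {t : Π x, FreeAlg (Q x) (B x)}
    (ht : t ∈ Algebra.adjoin ℝ (generators (𝓡 m) FB B FQ Q V)) :
    ∃ η ∈ Poly FQ Q FB B, ∀ᶠ y in 𝓝 x, t y = val (m := m) (FQ := FQ) (FB := FB) η y := by
  induction ht using Algebra.adjoin_induction with
  | mem s hs =>
    rcases hs with (⟨f, hf, rfl⟩ | ⟨f, hf, rfl⟩) | ⟨f, hf, rfl⟩
    · obtain ⟨g, hg⟩ := exists_global_fun V.isOpen hx hf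
      exact ⟨_, (HPoly.fn g).mem_poly, hg.mono fun y hy => by simp [hy]⟩
    · obtain ⟨g, hg⟩ := exists_global_sec V.isOpen hx hf
      exact ⟨_, (HPoly.dual g).mem_poly, hg.mono fun y hy => by simp [hy]⟩
    · obtain ⟨g, hg⟩ := exists_global_sec V.isOpen hx hf
      exact ⟨_, (HPoly.sec g).mem_poly, hg.mono fun y hy => by simp [hy]⟩
  | algebraMap r =>
    exact ⟨_, (HPoly.fn (r • 1)).mem_poly, Filter.Eventually.of_forall fun y => by simp⟩
  | add a b _ _ ha hb =>
    obtain ⟨a', ha', ha''⟩ := ha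
    obtain ⟨b', hb', hb''⟩ := hb
    refine ⟨a' + b', add_mem ha' hb', ?_⟩
    filter_upwards [ha'', hb''] with y h1 h2
    simp [h1, h2]
  | mul a b _ _ ha hb =>
    obtain ⟨a', ha', ha''⟩ := ha
    obtain ⟨b', hb', hb''⟩ := hb
    refine ⟨a' * b', mul_mem_poly ha' hb', ?_⟩
    filter_upwards [ha'', hb''] with y h1 h2
    simp [h1, h2]

/-- Every function of `𝓜` is locally a polynomial in global sections. -/
lemma exists_poly {U : Opens M} (ξ : 𝓕 U) {x : M} (hx : x ∈ U) :
    ∃ η ∈ Poly FQ Q FB B, GermEq x ξ η := by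
  obtain ⟨V, hxV, t, ht, h⟩ := ξ.2 ⟨x, hx⟩
  obtain ⟨η, hη, hη'⟩ := exists_poly_of_adjoin hxV ht
  refine ⟨η, hη, ?_⟩
  filter_upwards [hη', V.isOpen.mem_nhds hxV] with y h1 h2 h3 h4
  rw [h ⟨y, h3⟩ h2]
  exact h1

/-- Every homogeneous function of `𝓜` is locally a homogeneous polynomial in global sections. -/
lemma exists_hpoly {U : Opens M} {ξ : 𝓕 U} {n : ℕ} (hξ : Fun.IsHomogeneous n ξ) {x : M}
    (hx : x ∈ U) : ∃ η : 𝓕 ⊤, HPoly n η ∧ GermEq x ξ η := by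
  obtain ⟨η, hη, h⟩ := exists_poly ξ hx
  -- Taking the component of degree `n` does not change the germ, since `ξ` equals its own
  -- component.
  obtain ⟨ζ, hζ, h'⟩ := exists_component hη n
  refine ⟨ζ, hζ, ?_⟩
  filter_upwards [h] with y h1 h2 h3
  have h4 := h' y
  change ζ.1 ⟨y, h3⟩ = FreeAlg.component _ _ n (η.1 ⟨y, h3⟩) at h4
  rw [h4, ← h1 h2 h3, FreeAlg.component_of_mem_deg (hξ ⟨y, h2⟩), if_pos rfl]

/-! #### Low degrees -/

/-- The three degrees have to be treated in one induction, because a product of degree `2` may split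
as `0 + 2`, `1 + 1` or `2 + 0`. The part in `∧²Q*` is kept as a sum of products, the form in which
the Leibniz rule applies to it. -/
lemma HPoly.exists_incl {n : ℕ} {ξ : 𝓕 ⊤} (h : HPoly n ξ) :
    (n = 0 → ∃ f, ξ = incl₀ FB B FQ Q f) ∧ (n = 1 → ∃ τ, ξ = incl₁ FB B τ) ∧
    (n = 2 → ∃ b, ∃ Θ ∈ AddSubmonoid.closure
      {Θ : 𝓕 ⊤ | ∃ τ τ' : Sec (𝓡 m) (FQ →L[ℝ] ℝ) (DualBundle Q), Θ = incl₁ FB B τ * incl₁ FB B τ'},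
      ξ = incl₂ FQ Q b + Θ) := by
  induction h with
  | fn f => simp
  | dual τ => simp
  | sec b => exact ⟨by simp, by simp, fun _ => ⟨b, 0, zero_mem _, (add_zero _).symm⟩⟩
  | zero n =>
    refine ⟨fun _ => ⟨0, fun_ext fun x => by simp⟩, fun _ => ⟨0, fun_ext fun x => by simp⟩,
      fun _ => ⟨0, 0, zero_mem _, fun_ext fun x => by simp⟩⟩
  | add _ _ h1 h2 =>
    refine ⟨fun h => ?_, fun h => ?_, fun h => ?_⟩
    · obtain ⟨f, rfl⟩ := h1.1 h
      obtain ⟨g, rfl⟩ := h2.1 h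
      exact ⟨f + g, (incl₀_add f g).symm⟩
    · obtain ⟨f, rfl⟩ := h1.2.1 h
      obtain ⟨g, rfl⟩ := h2.2.1 h
      exact ⟨f + g, (incl₁_add f g).symm⟩
    · obtain ⟨f, Θ, hΘ, rfl⟩ := h1.2.2 h
      obtain ⟨g, Θ', hΘ', rfl⟩ := h2.2.2 h
      exact ⟨f + g, Θ + Θ', add_mem hΘ hΘ', by rw [incl₂_add]; abel⟩
  | @mul n k ξ η hξ hη h1 h2 =>
    have hf : ∀ f, ∀ Θ ∈ AddSubmonoid.closure
        {Θ : 𝓕 ⊤ | ∃ τ τ', Θ = incl₁ FB B τ * incl₁ FB B τ'},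
        incl₀ FB B FQ Q f * Θ ∈ AddSubmonoid.closure
        {Θ : 𝓕 ⊤ | ∃ τ τ', Θ = incl₁ FB B τ * incl₁ FB B τ'} := by
      intro f Θ hΘ
      induction hΘ using AddSubmonoid.closure_induction with
      | zero => rw [mul_zero]; exact zero_mem _
      | add a b _ _ ha hb => rw [mul_add]; exact add_mem ha hb
      | mem a ha =>
        obtain ⟨τ, τ', rfl⟩ := ha
        rw [← mul_assoc, ← incl₁_fsmul]
        exact AddSubmonoid.subset_closure ⟨_, _, rfl⟩
    have hcomm : ∀ (f : SmoothFun m M) (ζ : 𝓕 ⊤), ζ * incl₀ FB B FQ Q f = incl₀ FB B FQ Q f * ζ :=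
      fun f ζ => fun_ext fun x => by simp [Algebra.commutes]
    refine ⟨fun h => ?_, fun h => ?_, fun h => ?_⟩
    · obtain ⟨f, rfl⟩ := h1.1 (by omega)
      obtain ⟨g, rfl⟩ := h2.1 (by omega)
      exact ⟨f * g, (incl₀_mul f g).symm⟩
    · rcases (by omega : (n = 0 ∧ k = 1) ∨ (n = 1 ∧ k = 0)) with ⟨hn, hk⟩ | ⟨hn, hk⟩
      · obtain ⟨f, rfl⟩ := h1.1 hn
        obtain ⟨g, rfl⟩ := h2.2.1 hk
        exact ⟨fsmul f g, (incl₁_fsmul f g).symm⟩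
      · obtain ⟨f, rfl⟩ := h1.2.1 hn
        obtain ⟨g, rfl⟩ := h2.1 hk
        exact ⟨fsmul g f, by rw [hcomm, incl₁_fsmul]⟩
    · rcases (by omega : (n = 0 ∧ k = 2) ∨ (n = 1 ∧ k = 1) ∨ (n = 2 ∧ k = 0)) with
        ⟨hn, hk⟩ | ⟨hn, hk⟩ | ⟨hn, hk⟩
      · obtain ⟨f, rfl⟩ := h1.1 hn
        obtain ⟨b, Θ, hΘ, rfl⟩ := h2.2.2 hk
        exact ⟨fsmul f b, _, hf f Θ hΘ, by rw [mul_add, incl₂_fsmul]⟩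
      · obtain ⟨f, rfl⟩ := h1.2.1 hn
        obtain ⟨g, rfl⟩ := h2.2.1 hk
        exact ⟨0, _, AddSubmonoid.subset_closure ⟨f, g, rfl⟩, fun_ext fun x => by simp⟩
      · obtain ⟨f, rfl⟩ := h2.1 hk
        obtain ⟨b, Θ, hΘ, rfl⟩ := h1.2.2 hn
        exact ⟨fsmul f b, _, hf f Θ hΘ, by rw [hcomm, mul_add, incl₂_fsmul]⟩

/-- A function of degree `0` is a smooth function. -/
lemma exists_eq_incl₀ {ξ : 𝓕 ⊤} (h : Fun.IsHomogeneous 0 ξ) : ∃ f, ξ = incl₀ FB B FQ Q f := by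
  have hs : ∀ x, ∃ g : SmoothFun m M, ∀ᶠ y in 𝓝 x, val ξ y = algebraMap ℝ _ (g y) := by
    intro x
    obtain ⟨η, hη, hg⟩ := exists_hpoly (n := 0) h (x := x) trivial
    obtain ⟨g, rfl⟩ := hη.exists_incl.1 rfl
    exact ⟨g, germEq_iff.1 hg⟩
  -- The candidate is defined globally by a fibrewise projection; its smoothness is local and is
  -- read off from the polynomial representative.
  refine ⟨⟨fun x => FreeAlg.scalar _ _ (val ξ x), fun x => ?_⟩, fun_ext fun x => ?_⟩
  · obtain ⟨g, hg⟩ := hs x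
    refine (g.contMDiff x).congr_of_eventuallyEq ?_
    filter_upwards [hg] with y hy
    simp [hy]
  · obtain ⟨g, hg⟩ := hs x
    change val ξ x = algebraMap ℝ _ (FreeAlg.scalar _ _ (val ξ x))
    simp [hg.self_of_nhds]

/-- A function of degree `1` is a section of `Q*`. -/
lemma exists_eq_incl₁ {ξ : 𝓕 ⊤} (h : Fun.IsHomogeneous 1 ξ) : ∃ τ, ξ = incl₁ FB B τ := by
  have hs : ∀ x, ∃ g : Sec (𝓡 m) (FQ →L[ℝ] ℝ) (DualBundle Q), ∀ᶠ y in 𝓝 x,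
      val ξ y = FreeAlg.gen₁ _ _ (g y) := by
    intro x
    obtain ⟨η, hη, hg⟩ := exists_hpoly (n := 1) h (x := x) trivial
    obtain ⟨g, rfl⟩ := hη.exists_incl.2.1 rfl
    exact ⟨g, germEq_iff.1 hg⟩
  refine ⟨⟨fun x => FreeAlg.coeff₁ _ _ (val ξ x), fun x => ?_⟩, fun_ext fun x => ?_⟩
  · obtain ⟨g, hg⟩ := hs x
    refine (g.contMDiff x).congr_of_eventuallyEq ?_
    filter_upwards [hg] with y hy
    simp [hy]
  · obtain ⟨g, hg⟩ := hs x
    change val ξ x = FreeAlg.gen₁ _ _ (FreeAlg.coeff₁ _ _ (val ξ x))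
    simp [hg.self_of_nhds]

lemma coeff₂_of_closure {Θ : 𝓕 ⊤} (h : Θ ∈ AddSubmonoid.closure
      {Θ : 𝓕 ⊤ | ∃ τ τ', Θ = incl₁ FB B τ * incl₁ FB B τ'}) (x : M) :
    FreeAlg.coeff₂ _ _ (val Θ x) = 0 := by
  induction h using AddSubmonoid.closure_induction with
  | zero => simp
  | add a b _ _ ha hb => simp [ha, hb]
  | mem a ha => obtain ⟨τ, τ', rfl⟩ := ha; simp

/-- The component in `Γ(B)` of a function of degree `2`. -/
lemma exists_coeff₂_eq {ξ : 𝓕 ⊤} (h : Fun.IsHomogeneous 2 ξ) :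
    ∃ b : Sec (𝓡 m) FB B, ∀ x, FreeAlg.coeff₂ _ _ (val ξ x) = b x := by
  refine ⟨⟨fun x => FreeAlg.coeff₂ _ _ (val ξ x), fun x => ?_⟩, fun x => rfl⟩
  obtain ⟨η, hη, hg⟩ := exists_hpoly (n := 2) h (x := x) trivial
  obtain ⟨b, Θ, hΘ, rfl⟩ := hη.exists_incl.2.2 rfl
  refine (b.contMDiff x).congr_of_eventuallyEq ?_
  filter_upwards [germEq_iff.1 hg] with y hy
  simp [hy, coeff₂_of_closure hΘ]

end GradedFunctions
end SplitPoisson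
end

/-! ### Derivatives along tangent vectors, and locality from a Leibniz rule -/

open Bundle Manifold Set TopologicalSpace
open scoped Manifold ContDiff Bundle Topology TensorProduct
noncomputable section
namespace SplitPoisson
set_option linter.unusedSectionVars false

section TangentDerivative

variable {m : ℕ} {M : Type*} [TopologicalSpace M] [ChartedSpace (EuclideanSpace ℝ (Fin m)) M]

lemma SmoothFun.hasMFDerivAt (f : SmoothFun m M) (x : M) :
    HasMFDerivAt (𝓡 m) 𝓘(ℝ, ℝ) f x (mfderiv (𝓡 m) 𝓘(ℝ, ℝ) f x) :=
  (f.contMDiff.mdifferentiable (by simp) x).hasMFDerivAt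

/-- The derivative of smooth functions along a tangent vector. -/
def tderiv {x : M} (v : TangentSpace (𝓡 m) x) : SmoothFun m M →ₗ[ℝ] ℝ where
  toFun f := mfderiv (𝓡 m) 𝓘(ℝ, ℝ) f x v
  map_add' f g := by
    have := ((f.hasMFDerivAt x).add (g.hasMFDerivAt x)).mfderiv
    exact DFunLike.congr_fun this v
  map_smul' r f := by
    have := ((f.hasMFDerivAt x).const_smul r).mfderiv
    exact DFunLike.congr_fun this v

lemma tderiv_apply {x : M} (v : TangentSpace (𝓡 m) x) (f : SmoothFun m M) :
    tderiv v f = mfderiv (𝓡 m) 𝓘(ℝ, ℝ) f x v := rfl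

lemma tderiv_mul {x : M} (v : TangentSpace (𝓡 m) x) (f g : SmoothFun m M) :
    tderiv v (f * g) = f x * tderiv v g + g x * tderiv v f := by
  have := ((f.hasMFDerivAt x).mul (g.hasMFDerivAt x)).mfderiv
  exact DFunLike.congr_fun this v

lemma tderiv_vec_add {x : M} (v w : TangentSpace (𝓡 m) x) (f : SmoothFun m M) :
    tderiv (v + w) f = tderiv v f + tderiv w f := map_add (mfderiv (𝓡 m) 𝓘(ℝ, ℝ) f x) v w

lemma tderiv_vec_smul {x : M} (r : ℝ) (v : TangentSpace (𝓡 m) x) (f : SmoothFun m M) :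
    tderiv (r • v) f = r * tderiv v f := map_smul (mfderiv (𝓡 m) 𝓘(ℝ, ℝ) f x) r v

lemma tderiv_vec_sum {ι : Type*} (s : Finset ι) {x : M} (v : ι → TangentSpace (𝓡 m) x)
    (f : SmoothFun m M) : tderiv (∑ i ∈ s, v i) f = ∑ i ∈ s, tderiv (v i) f :=
  map_sum (mfderiv (𝓡 m) 𝓘(ℝ, ℝ) f x) v s

variable [T2Space M] [IsManifold (𝓡 m) ∞ M]

lemma tderiv_congr {x : M} (v : TangentSpace (𝓡 m) x) {f g : SmoothFun m M}
    (h : ∀ᶠ y in 𝓝 x, f y = g y) : tderiv v f = tderiv v g :=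
  local_of_derivation _ (tderiv_mul v) h

/-- Tested on functions whose differential at `x` is the inner product with an arbitrary vector. -/
lemma tderiv_vec_injective {x : M} {v w : TangentSpace (𝓡 m) x}
    (h : ∀ f : SmoothFun m M, tderiv v f = tderiv w f) : v = w := by
  refine ext_inner_left ℝ (E := EuclideanSpace ℝ (Fin m)) fun u => ?_
  obtain ⟨f, hf⟩ := exists_fun_mfderiv (m := m) x (innerSL ℝ u)
  have := h f
  rwa [tderiv_apply, tderiv_apply, hf, hf] at this

/-- An operator satisfying a Leibniz rule is local. -/
lemma local_of_leibniz {F : Type*} [NormedAddCommGroup F] [NormedSpace ℝ F] {V : M → Type*}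
    [TopologicalSpace (TotalSpace F V)] [∀ x, AddCommGroup (V x)] [∀ x, Module ℝ (V x)]
    [∀ x, TopologicalSpace (V x)] [FiberBundle F V] [VectorBundle ℝ F V]
    {G : Type*} [AddCommGroup G] [Module ℝ G] {x : M} (T : Sec (𝓡 m) F V →ₗ[ℝ] G)
    (δ : SmoothFun m M → ℝ) (e : V x →ₗ[ℝ] G)
    (hT : ∀ (f : SmoothFun m M) s, T (fsmul f s) = f x • T s + δ f • e (s x))
    {s t : Sec (𝓡 m) F V} (hst : ∀ᶠ y in 𝓝 x, s y = t y) : T s = T t := by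
  suffices H : ∀ s : Sec (𝓡 m) F V, (∀ᶠ y in 𝓝 x, s y = 0) → T s = 0 by
    have := H (s - t) (hst.mono fun y hy => by simp [hy])
    rwa [map_sub, sub_eq_zero] at this
  intro s hs
  obtain ⟨U, hU, hUo, hxU⟩ := eventually_nhds_iff.1 hs
  obtain ⟨ψ, h1, h2⟩ := exists_bump (m := m) (hUo.mem_nhds hxU)
  have key : fsmul ψ s = 0 := by
    ext y
    by_cases hy : y ∈ U
    · simp [hU y hy]
    · have : ψ y = 0 := image_eq_zero_of_notMem_tsupport fun h => hy (h2 h)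
      simp [this]
  have := hT ψ s
  rwa [key, map_zero, h1.self_of_nhds, hs.self_of_nhds, map_zero, smul_zero, add_zero, one_smul,
    eq_comm] at this

variable {FB : Type*} [NormedAddCommGroup FB] [NormedSpace ℝ FB] {B : M → Type*}
  [TopologicalSpace (TotalSpace FB B)] [∀ x, AddCommGroup (B x)] [∀ x, Module ℝ (B x)]
  [∀ x, TopologicalSpace (B x)] [FiberBundle FB B] [VectorBundle ℝ FB B]

/-- The smooth function `ρ(b)(f)`. -/
def anchorFun (ρ : Anchor (𝓡 m) FB B) (b : Sec (𝓡 m) FB B) (f : SmoothFun m M) :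
    SmoothFun m M :=
  ⟨ρ.deriv b f, by
    have h1 : ContMDiff (𝓡 m) ((𝓡 m).prod 𝓘(ℝ, EuclideanSpace ℝ (Fin m))) ∞
        (fun x => TotalSpace.mk' (EuclideanSpace ℝ (Fin m)) (E := fun x : M => TangentSpace (𝓡 m) x)
          x (ρ x (b x))) := ρ.contMDiff.clm_bundle_apply b.contMDiff
    -- The function is the fibre component of the tangent map of `f` composed with the smooth vector
    -- field `ρ(b)`.
    have h2 := f.contMDiff.contMDiff_tangentMap (m := ∞) (by simp)
    exact (contMDiff_snd_tangentBundle_modelSpace ℝ 𝓘(ℝ, ℝ)).comp (h2.comp h1)⟩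

lemma anchorFun_apply (ρ : Anchor (𝓡 m) FB B) (b : Sec (𝓡 m) FB B) (f : SmoothFun m M) (x : M) :
    anchorFun ρ b f x = tderiv (ρ x (b x)) f := rfl

end TangentDerivative
end SplitPoisson
end

/-! ### Graded skew biderivations and their Jacobiator -/

open Bundle Manifold Set TopologicalSpace
open scoped Manifold ContDiff Bundle Topology TensorProduct
noncomputable section
namespace SplitPoisson
set_option linter.unusedSectionVars false
section PreBrackets


variable {m : ℕ} {M : Type*} [TopologicalSpace M] [ChartedSpace (EuclideanSpace ℝ (Fin m)) M]
  [T2Space M] [IsManifold (𝓡 m) ∞ M]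
  {FQ : Type*} [NormedAddCommGroup FQ] [NormedSpace ℝ FQ] [FiniteDimensional ℝ FQ]
  {Q : M → Type*} [TopologicalSpace (TotalSpace FQ Q)] [∀ x, AddCommGroup (Q x)]
  [∀ x, Module ℝ (Q x)] [∀ x, TopologicalSpace (Q x)] [∀ x, IsTopologicalAddGroup (Q x)]
  [∀ x, ContinuousSMul ℝ (Q x)] [FiberBundle FQ Q] [VectorBundle ℝ FQ Q]
  [ContMDiffVectorBundle ∞ FQ Q (𝓡 m)]
  {FB : Type*} [NormedAddCommGroup FB] [NormedSpace ℝ FB] [FiniteDimensional ℝ FB]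
  {B : M → Type*} [TopologicalSpace (TotalSpace FB B)] [∀ x, AddCommGroup (B x)]
  [∀ x, Module ℝ (B x)] [∀ x, TopologicalSpace (B x)] [FiberBundle FB B] [VectorBundle ℝ FB B]
  [ContMDiffVectorBundle ∞ FB B (𝓡 m)]


local notation "𝓕" => Fun (𝓡 m) FB B FQ Q
local notation "𝓢" => Sec (𝓡 m) FB B
local notation "𝓓" => Sec (𝓡 m) (FQ →L[ℝ] ℝ) (DualBundle Q)

/-- The sign `(-1)ⁿ`. -/
def koszul (n : ℤ) : ℝ := if Even n then 1 else -1

lemma koszul_natCast (n : ℕ) : koszul n = (-1) ^ n := by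
  rcases Nat.even_or_odd n with h | h
  · simp [koszul, h]
  · simp [koszul, h, Nat.not_even_iff_odd.2 h]

variable (m FB B FQ Q) in
/-- A bracket of degree `-2` that is a skew-symmetric biderivation. The Jacobi identity is not
required. -/
structure PreBracket where
  /-- the bracket over the open set `U` -/
  bracket : ∀ U : Opens M, 𝓕 U →ₗ[ℝ] 𝓕 U →ₗ[ℝ] 𝓕 U
  res_bracket : ∀ {U V : Opens M} (h : V ≤ U) (ξ η : 𝓕 U),
    Fun.res h (bracket U ξ η) = bracket V (Fun.res h ξ) (Fun.res h η)
  degree : ∀ {U : Opens M} {i j : ℕ} {ξ η : 𝓕 U}, Fun.IsHomogeneous i ξ →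
    Fun.IsHomogeneous j η → Fun.IsHomogeneous ((i : ℤ) + j - 2) (bracket U ξ η)
  skew : ∀ {U : Opens M} {i j : ℕ} {ξ η : 𝓕 U}, Fun.IsHomogeneous i ξ →
    Fun.IsHomogeneous j η → bracket U ξ η = -((-1 : ℝ) ^ (i * j) • bracket U η ξ)
  leibniz : ∀ {U : Opens M} {i j k : ℕ} {ξ₁ ξ₂ ξ₃ : 𝓕 U}, Fun.IsHomogeneous i ξ₁ →
    Fun.IsHomogeneous j ξ₂ → Fun.IsHomogeneous k ξ₃ → bracket U ξ₁ (ξ₂ * ξ₃) =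
      bracket U ξ₁ ξ₂ * ξ₃ + (-1 : ℝ) ^ (i * j) • (ξ₂ * bracket U ξ₁ ξ₃)

/-- The bracket underlying a Poisson bracket. -/
def PoissonBracket.toPreBracket (P : PoissonBracket (𝓡 m) FB B FQ Q) : PreBracket m FQ Q FB B where
  bracket := P.bracket
  res_bracket := P.res_bracket
  degree := P.degree
  skew := P.skew
  leibniz := P.leibniz

lemma isHomogeneous_zero {U : Opens M} (n : ℤ) : Fun.IsHomogeneous n (0 : 𝓕 U) :=
  fun _ => zero_mem _

lemma Fun.IsHomogeneous.add {U : Opens M} {n : ℤ} {ξ η : 𝓕 U} (h : Fun.IsHomogeneous n ξ)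
    (h' : Fun.IsHomogeneous n η) : Fun.IsHomogeneous n (ξ + η) := fun x => add_mem (h x) (h' x)

lemma Fun.IsHomogeneous.mul {U : Opens M} {n k : ℤ} {ξ η : 𝓕 U} (h : Fun.IsHomogeneous n ξ)
    (h' : Fun.IsHomogeneous k η) : Fun.IsHomogeneous (n + k) (ξ * η) :=
  fun x => FreeAlg.mul_mem_deg (h x) (h' x)

lemma Fun.IsHomogeneous.eq_zero {U : Opens M} {n : ℤ} {ξ : 𝓕 U} (h : Fun.IsHomogeneous n ξ)
    (hn : n < 0) : ξ = 0 := by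
  refine Subtype.ext (funext fun x => ?_)
  have := h x
  rwa [FreeAlg.deg_neg hn, Submodule.mem_bot] at this

namespace PreBracket

variable (P : PreBracket m FQ Q FB B)

/-- Functions of negative degree are zero, so the axioms hold for all integer degrees. Iterated
brackets, of degrees like `i + j - 2`, can then be handled without asking whether the degree is
natural. -/
lemma degree' {U : Opens M} {i j : ℤ} {ξ η : 𝓕 U} (h : Fun.IsHomogeneous i ξ)
    (h' : Fun.IsHomogeneous j η) : Fun.IsHomogeneous (i + j - 2) (P.bracket U ξ η) := by
  rcases lt_or_ge i 0 with hi | hi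
  · rw [h.eq_zero hi, map_zero]; exact isHomogeneous_zero _
  rcases lt_or_ge j 0 with hj | hj
  · rw [h'.eq_zero hj, map_zero]; exact isHomogeneous_zero _
  lift i to ℕ using hi
  lift j to ℕ using hj
  exact P.degree h h'

lemma bracket_eq_zero {U : Opens M} {i j : ℤ} {ξ η : 𝓕 U} (h : Fun.IsHomogeneous i ξ)
    (h' : Fun.IsHomogeneous j η) (hij : i + j < 2) : P.bracket U ξ η = 0 :=
  (P.degree' h h').eq_zero (by omega)

lemma skew' {U : Opens M} {i j : ℤ} {ξ η : 𝓕 U} (h : Fun.IsHomogeneous i ξ)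
    (h' : Fun.IsHomogeneous j η) : P.bracket U ξ η = -(koszul (i * j) • P.bracket U η ξ) := by
  rcases lt_or_ge i 0 with hi | hi
  · rw [h.eq_zero hi]; simp
  rcases lt_or_ge j 0 with hj | hj
  · rw [h'.eq_zero hj]; simp
  lift i to ℕ using hi
  lift j to ℕ using hj
  rw [← Nat.cast_mul, koszul_natCast]
  exact P.skew h h'

lemma leibniz' {U : Opens M} {i j k : ℤ} {ξ₁ ξ₂ ξ₃ : 𝓕 U} (h₁ : Fun.IsHomogeneous i ξ₁)
    (h₂ : Fun.IsHomogeneous j ξ₂) (h₃ : Fun.IsHomogeneous k ξ₃) : P.bracket U ξ₁ (ξ₂ * ξ₃) =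
      P.bracket U ξ₁ ξ₂ * ξ₃ + koszul (i * j) • (ξ₂ * P.bracket U ξ₁ ξ₃) := by
  rcases lt_or_ge i 0 with hi | hi
  · rw [h₁.eq_zero hi]; simp
  rcases lt_or_ge j 0 with hj | hj
  · rw [h₂.eq_zero hj]; simp
  rcases lt_or_ge k 0 with hk | hk
  · rw [h₃.eq_zero hk]; simp
  lift i to ℕ using hi
  lift j to ℕ using hj
  lift k to ℕ using hk
  rw [← Nat.cast_mul, koszul_natCast]
  exact P.leibniz h₁ h₂ h₃

/-- The bracket is local. -/
lemma germ_congr {U V : Opens M} {x : M} {ξ η : 𝓕 U} {ξ' η' : 𝓕 V} (hU : x ∈ U) (hV : x ∈ V)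
    (h : GermEq x ξ ξ') (h' : GermEq x η η') :
    GermEq x (P.bracket U ξ η) (P.bracket V ξ' η') := by
  have hp : ∀ᶠ y in 𝓝 x, (∀ (h : y ∈ U) (h' : y ∈ V), ξ.1 ⟨y, h⟩ = ξ'.1 ⟨y, h'⟩) ∧
      ∀ (h : y ∈ U) (h' : y ∈ V), η.1 ⟨y, h⟩ = η'.1 ⟨y, h'⟩ := h.and h'
  obtain ⟨t, ht, hto, hxt⟩ := eventually_nhds_iff.1 hp
  -- On this neighbourhood both pairs of functions have equal restrictions, and the bracket commutes
  -- with restriction.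
  let W : Opens M := ⟨t, hto⟩ ⊓ (U ⊓ V)
  have h₁ : W ≤ U := fun y hy => hy.2.1
  have h₂ : W ≤ V := fun y hy => hy.2.2
  have e1 : Fun.res h₁ ξ = Fun.res h₂ ξ' :=
    Subtype.ext (funext fun y => (ht y.1 y.2.1).1 y.2.2.1 y.2.2.2)
  have e2 : Fun.res h₁ η = Fun.res h₂ η' :=
    Subtype.ext (funext fun y => (ht y.1 y.2.1).2 y.2.2.1 y.2.2.2)
  have key : Fun.res h₁ (P.bracket U ξ η) = Fun.res h₂ (P.bracket V ξ' η') := by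
    rw [P.res_bracket, P.res_bracket, e1, e2]
  filter_upwards [W.isOpen.mem_nhds (⟨hxt, hU, hV⟩ : x ∈ W)] with y hy h3 h4
  exact congrFun (congrArg Subtype.val key) ⟨y, hy⟩

/-! #### The Jacobiator -/

/-- The Jacobiator of functions, the first two of which have degrees `i` and `j`. -/
def jac {U : Opens M} (i j : ℤ) (ξ₁ ξ₂ ξ₃ : 𝓕 U) : 𝓕 U :=
  P.bracket U ξ₁ (P.bracket U ξ₂ ξ₃) - P.bracket U (P.bracket U ξ₁ ξ₂) ξ₃ -
    koszul (i * j) • P.bracket U ξ₂ (P.bracket U ξ₁ ξ₃)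

lemma jac_homogeneous {U : Opens M} {i j k : ℤ} {ξ₁ ξ₂ ξ₃ : 𝓕 U} (h₁ : Fun.IsHomogeneous i ξ₁)
    (h₂ : Fun.IsHomogeneous j ξ₂) (h₃ : Fun.IsHomogeneous k ξ₃) :
    Fun.IsHomogeneous (i + j + k - 4) (P.jac i j ξ₁ ξ₂ ξ₃) := by
  have e1 := P.degree' h₁ (P.degree' h₂ h₃)
  have e2 := P.degree' (P.degree' h₁ h₂) h₃
  have e3 := P.degree' h₂ (P.degree' h₁ h₃)
  rw [show i + (j + k - 2) - 2 = i + j + k - 4 by ring] at e1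
  rw [show i + j - 2 + k - 2 = i + j + k - 4 by ring] at e2
  rw [show j + (i + k - 2) - 2 = i + j + k - 4 by ring] at e3
  exact fun x => sub_mem (sub_mem (e1 x) (e2 x)) (Submodule.smul_mem _ _ (e3 x))

lemma jac_add {U : Opens M} (i j : ℤ) (ξ₁ ξ₂ ξ₃ ξ₄ : 𝓕 U) :
    P.jac i j ξ₁ ξ₂ (ξ₃ + ξ₄) = P.jac i j ξ₁ ξ₂ ξ₃ + P.jac i j ξ₁ ξ₂ ξ₄ := by
  simp only [jac, map_add, smul_add]
  abel

/-- All second-order terms cancel between the three double brackets, so the Jacobiator is again a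
derivation in its last entry. This makes it possible to check the Jacobi identity on generators. -/
lemma jac_mul {U : Opens M} {i j k l : ℤ} {ξ₁ ξ₂ ξ₃ ξ₄ : 𝓕 U} (h₁ : Fun.IsHomogeneous i ξ₁)
    (h₂ : Fun.IsHomogeneous j ξ₂) (h₃ : Fun.IsHomogeneous k ξ₃) (h₄ : Fun.IsHomogeneous l ξ₄) :
    P.jac i j ξ₁ ξ₂ (ξ₃ * ξ₄) = P.jac i j ξ₁ ξ₂ ξ₃ * ξ₄ +
      koszul ((i + j) * k) • (ξ₃ * P.jac i j ξ₁ ξ₂ ξ₄) := by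
  have e12 := P.degree' h₁ h₂
  have e13 := P.degree' h₁ h₃
  have e14 := P.degree' h₁ h₄
  have e23 := P.degree' h₂ h₃
  have e24 := P.degree' h₂ h₄
  simp only [jac, P.leibniz' h₂ h₃ h₄, P.leibniz' h₁ h₃ h₄, map_add, map_smul,
    P.leibniz' h₁ e23 h₄, P.leibniz' h₁ h₃ e24, P.leibniz' e12 h₃ h₄, P.leibniz' h₂ e13 h₄,
    P.leibniz' h₂ h₃ e14]
  -- The signs depend only on the parities of the degrees; in each case the identity is additive
  -- bookkeeping.
  by_cases hi : Even i <;> by_cases hj : Even j <;> by_cases hk : Even k <;>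
  · simp only [koszul, Int.even_add, Int.even_mul, Int.even_sub, hi, hj, hk, even_two, if_true,
      if_false, true_or, or_true, or_self, iff_true, iff_false, not_true_eq_false,
      one_smul, neg_smul, iff_self]
    simp only [sub_neg_eq_add, mul_add, add_mul, mul_sub, sub_mul]
    abel

/-- Graded skew symmetry of the bracket alone makes the Jacobiator graded skew in adjacent entries.
With the companion for the last two entries, any entry can be moved to the last place, where the
derivation rule is available. -/
lemma jac_swap₁₂ {U : Opens M} {i j : ℤ} {ξ₁ ξ₂ ξ₃ : 𝓕 U} (h₁ : Fun.IsHomogeneous i ξ₁)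
    (h₂ : Fun.IsHomogeneous j ξ₂) (h : P.jac j i ξ₂ ξ₁ ξ₃ = 0) : P.jac i j ξ₁ ξ₂ ξ₃ = 0 := by
  have e : P.jac i j ξ₁ ξ₂ ξ₃ = -(koszul (i * j) • P.jac j i ξ₂ ξ₁ ξ₃) := by
    simp only [jac, P.skew' h₁ h₂, map_neg, map_smul, LinearMap.neg_apply, LinearMap.smul_apply]
    by_cases hi : Even i <;> by_cases hj : Even j <;>
    · simp only [koszul, Int.even_mul, hi, hj, if_true, if_false, true_or, or_true, or_self,
        one_smul, neg_smul]
      abel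
  rw [e, h, smul_zero, neg_zero]

lemma jac_swap₂₃ {U : Opens M} {i j k : ℤ} {ξ₁ ξ₂ ξ₃ : 𝓕 U} (h₁ : Fun.IsHomogeneous i ξ₁)
    (h₂ : Fun.IsHomogeneous j ξ₂) (h₃ : Fun.IsHomogeneous k ξ₃) (h : P.jac i k ξ₁ ξ₃ ξ₂ = 0) :
    P.jac i j ξ₁ ξ₂ ξ₃ = 0 := by
  have e : P.jac i j ξ₁ ξ₂ ξ₃ = -(koszul (j * k) • P.jac i k ξ₁ ξ₃ ξ₂) := by
    simp only [jac, P.skew' h₂ h₃, P.skew' (P.degree' h₁ h₂) h₃, P.skew' (P.degree' h₁ h₃) h₂,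
      map_neg, map_smul]
    by_cases hi : Even i <;> by_cases hj : Even j <;> by_cases hk : Even k <;>
    · simp only [koszul, Int.even_add, Int.even_mul, Int.even_sub, hi, hj, hk, even_two, if_true,
        if_false, true_or, or_true, or_self, iff_true, iff_false, not_true_eq_false,
        one_smul, neg_smul, iff_self]
      abel
  rw [e, h, smul_zero, neg_zero]

end PreBracket

end PreBrackets
end SplitPoisson
end

/-! ### The linear data of a self-dual 2-representation and its structure equations -/

open Bundle Manifold Set TopologicalSpace
open scoped Manifold ContDiff Bundle Topology TensorProduct
noncomputable section
namespace SplitPoisson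
set_option linter.unusedSectionVars false
section PreReps


variable {m : ℕ} {M : Type*} [TopologicalSpace M] [ChartedSpace (EuclideanSpace ℝ (Fin m)) M]
  [T2Space M] [IsManifold (𝓡 m) ∞ M]
  {FQ : Type*} [NormedAddCommGroup FQ] [NormedSpace ℝ FQ] [FiniteDimensional ℝ FQ]
  {Q : M → Type*} [TopologicalSpace (TotalSpace FQ Q)] [∀ x, AddCommGroup (Q x)]
  [∀ x, Module ℝ (Q x)] [∀ x, TopologicalSpace (Q x)] [∀ x, IsTopologicalAddGroup (Q x)]
  [∀ x, ContinuousSMul ℝ (Q x)] [FiberBundle FQ Q] [VectorBundle ℝ FQ Q]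
  [ContMDiffVectorBundle ∞ FQ Q (𝓡 m)]
  {FB : Type*} [NormedAddCommGroup FB] [NormedSpace ℝ FB] [FiniteDimensional ℝ FB]
  {B : M → Type*} [TopologicalSpace (TotalSpace FB B)] [∀ x, AddCommGroup (B x)]
  [∀ x, Module ℝ (B x)] [∀ x, TopologicalSpace (B x)] [FiberBundle FB B] [VectorBundle ℝ FB B]
  [ContMDiffVectorBundle ∞ FB B (𝓡 m)]


local notation "𝓕" => Fun (𝓡 m) FB B FQ Q
local notation "𝓢" => Sec (𝓡 m) FB B
local notation "𝓓" => Sec (𝓡 m) (FQ →L[ℝ] ℝ) (DualBundle Q)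

variable (m FB B FQ Q) in
/-- The structure maps of a Lie algebroid with a self-dual 2-representation, without the equations
that are quadratic in them. -/
@[ext]
structure PreRep where
  /-- the anchor -/
  anchor : Anchor (𝓡 m) FB B
  /-- the bracket -/
  bracket : 𝓢 →ₗ[ℝ] 𝓢 →ₗ[ℝ] 𝓢
  skew : ∀ a b, bracket a b = -bracket b a
  leibniz : ∀ (a b : 𝓢) (f : SmoothFun m M) (x : M),
    bracket a (fsmul f b) x = f x • bracket a b x + tderiv (anchor x (a x)) f • b x
  /-- the morphism `Q* → Q` -/
  bd : Sec (𝓡 m) ((FQ →L[ℝ] ℝ) →L[ℝ] FQ) (HomBundle (DualBundle Q) Q)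
  bd_symm : ∀ (x : M) (τ₁ τ₂ : Q x →L[ℝ] ℝ), τ₂ (bd x τ₁) = τ₁ (bd x τ₂)
  /-- the connection on `Q*` -/
  nabla₀ : 𝓢 →ₗ[ℝ] 𝓓 →ₗ[ℝ] 𝓓
  nabla₀_fsmul : ∀ (f : SmoothFun m M) (b : 𝓢) (τ : 𝓓),
    nabla₀ (fsmul f b) τ = fsmul f (nabla₀ b τ)
  nabla₀_leibniz : ∀ (b : 𝓢) (f : SmoothFun m M) (τ : 𝓓) (x : M),
    nabla₀ b (fsmul f τ) x = f x • nabla₀ b τ x + tderiv (anchor x (b x)) f • τ x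
  /-- the connection on `Q` -/
  nabla₁ : 𝓢 →ₗ[ℝ] Sec (𝓡 m) FQ Q →ₗ[ℝ] Sec (𝓡 m) FQ Q
  conn_dual : ∀ (b : 𝓢) (τ : 𝓓) (q : Sec (𝓡 m) FQ Q) (x : M),
    tderiv (anchor x (b x)) (pairing τ q) = nabla₀ b τ x (q x) + τ x (nabla₁ b q x)
  /-- the curvature form -/
  R : TwoForm FB B (𝓡 m) (FQ →L[ℝ] (FQ →L[ℝ] ℝ)) (HomBundle Q (DualBundle Q))
  R_dual : ∀ (x : M) (b c : B x) (q₁ q₂ : Q x), R.toFun x b c q₁ q₂ = -R.toFun x b c q₂ q₁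

/-- The structure equations of a Lie algebroid with a self-dual 2-representation. -/
structure PreRep.IsFlat (D : PreRep m FQ Q FB B) : Prop where
  anchor_bracket : ∀ (a b : 𝓢) (f : SmoothFun m M) (x : M),
    tderiv (D.anchor x (D.bracket a b x)) f = tderiv (D.anchor x (a x)) (anchorFun D.anchor b f) -
      tderiv (D.anchor x (b x)) (anchorFun D.anchor a f)
  jacobi : ∀ a b c, D.bracket a (D.bracket b c) =
    D.bracket (D.bracket a b) c + D.bracket b (D.bracket a c)
  bd_nabla : ∀ b τ, homApply D.bd (D.nabla₀ b τ) = D.nabla₁ b (homApply D.bd τ)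
  curvature₀ : ∀ a b τ, D.nabla₀ a (D.nabla₀ b τ) - D.nabla₀ b (D.nabla₀ a τ) -
    D.nabla₀ (D.bracket a b) τ = homApply (D.R.eval a b) (homApply D.bd τ)
  dR : ∀ a b c s,
    -homApply (D.R.eval (D.bracket a b) c) s + homApply (D.R.eval (D.bracket a c) b) s
      - homApply (D.R.eval (D.bracket b c) a) s
      + (D.nabla₀ a (homApply (D.R.eval b c) s) - homApply (D.R.eval b c) (D.nabla₁ a s))
      - (D.nabla₀ b (homApply (D.R.eval a c) s) - homApply (D.R.eval a c) (D.nabla₁ b s))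
      + (D.nabla₀ c (homApply (D.R.eval a b) s) - homApply (D.R.eval a b) (D.nabla₁ c s)) = 0

lemma sec_eq_of_pairing {s t : Sec (𝓡 m) FQ Q} {x : M}
    (h : ∀ τ : 𝓓, τ x (s x) = τ x (t x)) : s x = t x := by
  refine (dualFrameAt (m := m) FQ Q x).eq_of_dual fun t => ?_
  obtain ⟨τ, rfl⟩ := exists_dual_eq (m := m) FQ Q t
  exact h τ

lemma dual_eq_of_pairing {s t : 𝓓} {x : M}
    (h : ∀ q : Sec (𝓡 m) FQ Q, s x (q x) = t x (q x)) : s x = t x := by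
  ext v
  obtain ⟨q, rfl⟩ := exists_sec_eq (m := m) FQ Q v
  exact h q

namespace PreRep

variable (D : PreRep m FQ Q FB B)

/-- `conn_dual` determines the connection on `Q`, so its tensoriality and its Leibniz rule are
inherited from the connection on `Q*` and need not be part of the data. -/
lemma nabla₁_fsmul (f : SmoothFun m M) (b : 𝓢) (q : Sec (𝓡 m) FQ Q) :
    D.nabla₁ (fsmul f b) q = fsmul f (D.nabla₁ b q) := by
  ext x
  refine sec_eq_of_pairing fun τ => ?_
  have h1 := D.conn_dual (fsmul f b) τ q x
  have h2 := D.conn_dual b τ q x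
  rw [D.nabla₀_fsmul] at h1
  simp only [fsmul_apply, map_smul, tderiv_vec_smul, h2, smul_apply,
    smul_eq_mul] at h1 ⊢
  linarith

lemma nabla₁_leibniz (b : 𝓢) (f : SmoothFun m M) (q : Sec (𝓡 m) FQ Q) (x : M) :
    D.nabla₁ b (fsmul f q) x = f x • D.nabla₁ b q x + tderiv (D.anchor x (b x)) f • q x := by
  refine (dualFrameAt (m := m) FQ Q x).eq_of_dual fun t => ?_
  obtain ⟨τ, rfl⟩ := exists_dual_eq (m := m) FQ Q t
  have h1 := D.conn_dual b τ (fsmul f q) x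
  have h2 := D.conn_dual b τ q x
  have h3 : pairing τ (fsmul f q) = f * pairing τ q := by ext y; simp
  rw [h3, tderiv_mul, h2] at h1
  simp only [fsmul_apply, map_smul, map_add, pairing_apply, smul_eq_mul] at h1 ⊢
  linarith

variable {D} in
-- Applying `ρ[a,b] = [ρa,ρb]` to the function `⟨τ, q⟩` shows that the curvatures on `Q*` and on `Q`
-- are negative transposes of each other. The transpose of `R ∘ ∂` is `-∂ ∘ R` because `∂* = ∂` and
-- `R* = -R`.
lemma IsFlat.curvature₁ (h : D.IsFlat) (a b : 𝓢) (q : Sec (𝓡 m) FQ Q) :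
    D.nabla₁ a (D.nabla₁ b q) - D.nabla₁ b (D.nabla₁ a q) - D.nabla₁ (D.bracket a b) q =
      homApply D.bd (homApply (D.R.eval a b) q) := by
  ext x
  refine sec_eq_of_pairing fun τ => ?_
  have e : ∀ c, anchorFun D.anchor c (pairing τ q) =
      pairing (D.nabla₀ c τ) q + pairing τ (D.nabla₁ c q) := fun c =>
    ContMDiffMap.ext fun x => D.conn_dual c τ q x
  have h1 := h.anchor_bracket a b (pairing τ q) x
  rw [e, e, map_add, map_add, D.conn_dual, D.conn_dual, D.conn_dual, D.conn_dual, D.conn_dual] at h1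
  have h2 := congrArg (fun s : 𝓓 => s x (q x)) (h.curvature₀ a b τ)
  simp only [homApply_apply, ContMDiffSection.coe_sub, Pi.sub_apply, sub_apply,
    map_sub] at h2 ⊢
  have h3 := D.R_dual x (a x) (b x) (D.bd x (τ x)) (q x)
  have h4 := D.bd_symm x (τ x) (D.R.toFun x (a x) (b x) (q x))
  change _ = D.R.toFun x (a x) (b x) (D.bd x (τ x)) (q x) at h2
  change _ = τ x (D.bd x (D.R.toFun x (a x) (b x) (q x)))
  linarith

end PreRep

/-- The 2-representation given by structure maps that satisfy the structure equations. -/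
def PreRep.IsFlat.toSelfDualTwoRep {D : PreRep m FQ Q FB B} (h : D.IsFlat) :
    SelfDualTwoRep (𝓡 m) FB B FQ Q where
  alg :=
    { anchor := D.anchor
      bracket := D.bracket
      skew := D.skew
      jacobi := h.jacobi
      leibniz := D.leibniz
      anchor_bracket := h.anchor_bracket }
  rep :=
    { bd := D.bd
      conn₀ :=
        { nabla := D.nabla₀
          nabla_fsmul := D.nabla₀_fsmul
          leibniz := D.nabla₀_leibniz }
      conn₁ :=
        { nabla := D.nabla₁
          nabla_fsmul := D.nabla₁_fsmul
          leibniz := D.nabla₁_leibniz }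
      R := D.R
      bd_nabla := h.bd_nabla
      curvature₀ := h.curvature₀
      curvature₁ := h.curvature₁
      dR := h.dR }
  bd_symm := D.bd_symm
  conn_dual := D.conn_dual
  R_dual := D.R_dual

/-- The structure maps of a 2-representation. -/
def SelfDualTwoRep.toPreRep (D : SelfDualTwoRep (𝓡 m) FB B FQ Q) : PreRep m FQ Q FB B where
  anchor := D.alg.anchor
  bracket := D.alg.bracket
  skew := D.alg.skew
  leibniz := D.alg.leibniz
  bd := D.rep.bd
  bd_symm := D.bd_symm
  nabla₀ := D.rep.conn₀.nabla
  nabla₀_fsmul := D.rep.conn₀.nabla_fsmul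
  nabla₀_leibniz := D.rep.conn₀.leibniz
  nabla₁ := D.rep.conn₁.nabla
  conn_dual := D.conn_dual
  R := D.rep.R
  R_dual := D.R_dual

lemma SelfDualTwoRep.isFlat (D : SelfDualTwoRep (𝓡 m) FB B FQ Q) : D.toPreRep.IsFlat where
  anchor_bracket := D.alg.anchor_bracket
  jacobi := D.alg.jacobi
  bd_nabla := D.rep.bd_nabla
  curvature₀ := D.rep.curvature₀
  dR := D.rep.dR

/-- Only propositions are forgotten. -/
lemma SelfDualTwoRep.toPreRep_injective :
    Function.Injective (SelfDualTwoRep.toPreRep (m := m) (FQ := FQ) (Q := Q) (FB := FB) (B := B)) := by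
  rintro ⟨⟨anchor, bracket, _, _, _, _⟩, ⟨bd, ⟨n₀, _, _⟩, ⟨n₁, _, _⟩, R, _, _, _, _⟩, _, _, _⟩
    ⟨⟨anchor', bracket', _, _, _, _⟩, ⟨bd', ⟨n₀', _, _⟩, ⟨n₁', _, _⟩, R', _, _, _, _⟩, _, _, _⟩ h
  simp only [SelfDualTwoRep.toPreRep] at h
  obtain ⟨rfl, rfl, rfl, rfl, rfl, rfl⟩ := h
  rfl

/-- The correspondence, without the Jacobi identity and the structure equations. -/
structure Corr (P : PreBracket m FQ Q FB B) (D : PreRep m FQ Q FB B) : Prop where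
  two_zero : ∀ (b : 𝓢) (f : SmoothFun m M), P.bracket ⊤ (incl₂ FQ Q b) (incl₀ FB B FQ Q f) =
    incl₀ FB B FQ Q (anchorFun D.anchor b f)
  one_one : ∀ τ₁ τ₂ : 𝓓, P.bracket ⊤ (incl₁ FB B τ₁) (incl₁ FB B τ₂) =
    incl₀ FB B FQ Q (pairing τ₂ (homApply D.bd τ₁))
  two_one : ∀ (b : 𝓢) (τ : 𝓓), P.bracket ⊤ (incl₂ FQ Q b) (incl₁ FB B τ) =
    incl₁ FB B (D.nabla₀ b τ)
  coeff₂_two_two : ∀ (b₁ b₂ : 𝓢) (x : M), FreeAlg.coeff₂ _ _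
    (val (P.bracket ⊤ (incl₂ FQ Q b₁) (incl₂ FQ Q b₂)) x) = D.bracket b₁ b₂ x
  form_two_two : ∀ (b₁ b₂ : 𝓢) (x : M) (q₁ q₂ : Q x), FreeAlg.form _ _ q₁ q₂
    (val (P.bracket ⊤ (incl₂ FQ Q b₁) (incl₂ FQ Q b₂)) x) = -D.R.toFun x (b₁ x) (b₂ x) q₁ q₂

lemma incl₀_homogeneous (f : SmoothFun m M) : Fun.IsHomogeneous 0 (incl₀ FB B FQ Q f) :=
  (HPoly.fn f).homogeneous
lemma incl₁_homogeneous (τ : 𝓓) : Fun.IsHomogeneous 1 (incl₁ FB B τ) :=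
  (HPoly.dual τ).homogeneous
lemma incl₂_homogeneous (b : 𝓢) : Fun.IsHomogeneous 2 (incl₂ FQ Q b) :=
  (HPoly.sec b).homogeneous

lemma incl₀_injective : Function.Injective (incl₀ (I := 𝓡 m) (M := M) FB B FQ Q) := fun _ _ h =>
  ContMDiffMap.ext fun x => FreeAlg.algebraMap_inj (congrArg (fun ξ => val ξ x) h)

lemma incl₁_injective : Function.Injective (incl₁ (I := 𝓡 m) (FQ := FQ) (Q := Q) FB B) :=
  fun _ _ h => ContMDiffSection.ext fun x => FreeAlg.gen₁_inj (congrArg (fun ξ => val ξ x) h)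

/-- The element `θ` is replaced by the coordinates `coeff₂` and `form` of degree two, which can be
computed with. The minus sign before `R` moves into the value of `form`. -/
lemma corresponds_iff_corr {P : PoissonBracket (𝓡 m) FB B FQ Q}
    {D : SelfDualTwoRep (𝓡 m) FB B FQ Q} :
    Corresponds P D ↔ Corr P.toPreBracket D.toPreRep := by
  constructor
  · intro h
    refine ⟨fun b f => Subtype.ext (funext fun x => h.bracket_two_zero b f x),
      fun τ₁ τ₂ => Subtype.ext (funext fun x => h.bracket_one_one τ₁ τ₂ x), h.bracket_two_one,
      fun b₁ b₂ x => ?_, fun b₁ b₂ x q₁ q₂ => ?_⟩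
    · obtain ⟨θ, h1, h2⟩ := h.bracket_two_two b₁ b₂ ⟨x, trivial⟩
      refine (congrArg _ h2).trans ?_
      rw [map_sub, FreeAlg.coeff₂_gen₂, FreeAlg.coeff₂_ofExt h1.1, sub_zero]
      rfl
    · obtain ⟨θ, h1, h2⟩ := h.bracket_two_two b₁ b₂ ⟨x, trivial⟩
      refine (congrArg _ h2).trans ?_
      rw [map_sub, FreeAlg.form_gen₂, FreeAlg.form_of_isTwoForm h1, zero_sub]
      rfl
  · intro h
    refine ⟨fun b f x => congrFun (congrArg Subtype.val (h.two_zero b f)) x,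
      fun τ₁ τ₂ x => congrFun (congrArg Subtype.val (h.one_one τ₁ τ₂)) x, h.two_one,
      fun b₁ b₂ x => ?_⟩
    have h1 := h.coeff₂_two_two b₁ b₂ x
    have h2 := h.form_two_two b₁ b₂ x
    have h3 : val (P.bracket ⊤ (incl₂ FQ Q b₁) (incl₂ FQ Q b₂)) x ∈ FreeAlg.deg (Q x) (B x) 2 :=
      P.degree (incl₂_homogeneous b₁) (incl₂_homogeneous b₂) x
    change FreeAlg.coeff₂ _ _ (val (P.bracket ⊤ (incl₂ FQ Q b₁) (incl₂ FQ Q b₂)) x) = _ at h1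
    change ∀ q₁ q₂, FreeAlg.form _ _ q₁ q₂
      (val (P.bracket ⊤ (incl₂ FQ Q b₁) (incl₂ FQ Q b₂)) x) = _ at h2
    change ∃ θ, _ ∧ val (P.bracket ⊤ (incl₂ FQ Q b₁) (incl₂ FQ Q b₂)) x = _
    obtain ⟨θ, hθ, w, hw⟩ := FreeAlg.mem_deg_two h3
    rw [hw] at h1 h2 ⊢
    rw [map_add, FreeAlg.coeff₂_gen₂, FreeAlg.coeff₂_ofExt hθ, zero_add] at h1
    -- The sign is there because `Corresponds` subtracts its witness, whereas `θ` here is the full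
    -- `∧²`-part of the bracket.
    refine ⟨-θ, ⟨neg_mem hθ, fun v w => ?_⟩, ?_⟩
    · rw [map_neg, map_neg, (FreeAlg.isTwoForm_of_mem (W := B x) hθ).2 v w, ← map_neg]
      have := h2 v w
      rw [map_add, FreeAlg.form_gen₂, add_zero] at this
      simp only [this, neg_neg]
      rfl
    · rw [h1, map_neg, sub_neg_eq_add, add_comm]
      rfl

end PreReps
end SplitPoisson
end

/-! ### Each side determines the other -/

open Bundle Manifold Set TopologicalSpace
open scoped Manifold ContDiff Bundle Topology TensorProduct
noncomputable section
namespace SplitPoisson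
set_option linter.unusedSectionVars false
section Uniqueness


variable {m : ℕ} {M : Type*} [TopologicalSpace M] [ChartedSpace (EuclideanSpace ℝ (Fin m)) M]
  [T2Space M] [IsManifold (𝓡 m) ∞ M]
  {FQ : Type*} [NormedAddCommGroup FQ] [NormedSpace ℝ FQ] [FiniteDimensional ℝ FQ]
  {Q : M → Type*} [TopologicalSpace (TotalSpace FQ Q)] [∀ x, AddCommGroup (Q x)]
  [∀ x, Module ℝ (Q x)] [∀ x, TopologicalSpace (Q x)] [∀ x, IsTopologicalAddGroup (Q x)]
  [∀ x, ContinuousSMul ℝ (Q x)] [FiberBundle FQ Q] [VectorBundle ℝ FQ Q]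
  [ContMDiffVectorBundle ∞ FQ Q (𝓡 m)]
  {FB : Type*} [NormedAddCommGroup FB] [NormedSpace ℝ FB] [FiniteDimensional ℝ FB]
  {B : M → Type*} [TopologicalSpace (TotalSpace FB B)] [∀ x, AddCommGroup (B x)]
  [∀ x, Module ℝ (B x)] [∀ x, TopologicalSpace (B x)] [FiberBundle FB B] [VectorBundle ℝ FB B]
  [ContMDiffVectorBundle ∞ FB B (𝓡 m)]


local notation "𝓕" => Fun (𝓡 m) FB B FQ Q
local notation "𝓢" => Sec (𝓡 m) FB B
local notation "𝓓" => Sec (𝓡 m) (FQ →L[ℝ] ℝ) (DualBundle Q)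

/-- A bracket determines the structure maps of the 2-representation. -/
lemma Corr.preRep_unique {P : PreBracket m FQ Q FB B} {D D' : PreRep m FQ Q FB B}
    (h : Corr P D) (h' : Corr P D') : D = D' := by
  have hρ : ∀ x (v : B x), D.anchor x v = D'.anchor x v := by
    intro x v
    obtain ⟨b, rfl⟩ := exists_sec_eq (m := m) FB B v
    refine tderiv_vec_injective fun f => ?_
    exact DFunLike.congr_fun (incl₀_injective ((h.two_zero b f).symm.trans (h'.two_zero b f))) x
  have h0 : D.nabla₀ = D'.nabla₀ := LinearMap.ext₂ fun b τ =>
    incl₁_injective ((h.two_one b τ).symm.trans (h'.two_one b τ))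
  refine PreRep.ext ?_ ?_ ?_ h0 ?_ ?_
  · exact ContMDiffSection.ext fun x => ContinuousLinearMap.ext fun v => hρ x v
  · exact LinearMap.ext₂ fun a b => ContMDiffSection.ext fun x =>
      (h.coeff₂_two_two a b x).symm.trans (h'.coeff₂_two_two a b x)
  · refine ContMDiffSection.ext fun x => ContinuousLinearMap.ext fun t => ?_
    obtain ⟨τ, rfl⟩ := exists_dual_eq (m := m) FQ Q t
    refine (dualFrameAt (m := m) FQ Q x).eq_of_dual fun t' => ?_
    obtain ⟨τ', rfl⟩ := exists_dual_eq (m := m) FQ Q t'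
    exact DFunLike.congr_fun (incl₀_injective ((h.one_one τ τ').symm.trans (h'.one_one τ τ'))) x
  -- The connection on `Q` does not occur in `Corr`; it is pinned down by duality, once the anchors
  -- and the connections on `Q*` agree.
  · refine LinearMap.ext₂ fun b q => ContMDiffSection.ext fun x => sec_eq_of_pairing fun τ => ?_
    have h1 := D.conn_dual b τ q x
    have h2 := D'.conn_dual b τ q x
    rw [hρ, h0] at h1
    linarith
  · refine TwoForm.ext (funext fun x => LinearMap.ext₂ fun b c => ContinuousLinearMap.ext fun q =>
      ContinuousLinearMap.ext fun q' => ?_)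
    obtain ⟨b, rfl⟩ := exists_sec_eq (m := m) FB B b
    obtain ⟨c, rfl⟩ := exists_sec_eq (m := m) FB B c
    exact neg_injective ((h.form_two_two b c x q q').symm.trans (h'.form_two_two b c x q q'))

/-- Functions of degree `2` agree at a point if their components there do. -/
lemma val_eq_of_deg_two {ξ η : 𝓕 ⊤} (h : Fun.IsHomogeneous 2 ξ) (h' : Fun.IsHomogeneous 2 η) (x : M)
    (hc : FreeAlg.coeff₂ _ _ (val ξ x) = FreeAlg.coeff₂ _ _ (val η x))
    (hf : ∀ q q' : Q x, FreeAlg.form _ _ q q' (val ξ x) = FreeAlg.form _ _ q q' (val η x)) :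
    val ξ x = val η x :=
  FreeAlg.eq_of_deg_two (s := fun i => (dualFrameAt (m := m) FQ Q x).s i x)
    (τ := fun i => (dualFrameAt (m := m) FQ Q x).τ i x)
    (dualFrameAt (m := m) FQ Q x).expand_dual.self_of_nhds (h ⟨x, trivial⟩) (h' ⟨x, trivial⟩) hc hf

namespace PreBracket

variable {P P' : PreBracket m FQ Q FB B}

lemma eq_symm {i j : ℤ} {ξ η : 𝓕 ⊤} (h : Fun.IsHomogeneous i ξ) (h' : Fun.IsHomogeneous j η)
    (e : P.bracket ⊤ η ξ = P'.bracket ⊤ η ξ) : P.bracket ⊤ ξ η = P'.bracket ⊤ ξ η := by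
  rw [P.skew' h h', P'.skew' h h', e]

lemma eq_of_low {i j : ℤ} {ξ η : 𝓕 ⊤} (h : Fun.IsHomogeneous i ξ) (h' : Fun.IsHomogeneous j η)
    (e : i + j < 2) : P.bracket ⊤ ξ η = P'.bracket ⊤ ξ η := by
  rw [P.bracket_eq_zero h h' e, P'.bracket_eq_zero h h' e]

/-- By the Leibniz rule in the second entry, agreement on generators spreads to homogeneous
polynomials. -/
lemma eq_right {i : ℤ} {ξ : 𝓕 ⊤} (h : Fun.IsHomogeneous i ξ)
    (h0 : ∀ f, P.bracket ⊤ ξ (incl₀ FB B FQ Q f) = P'.bracket ⊤ ξ (incl₀ FB B FQ Q f))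
    (h1 : ∀ τ, P.bracket ⊤ ξ (incl₁ FB B τ) = P'.bracket ⊤ ξ (incl₁ FB B τ))
    (h2 : ∀ b, P.bracket ⊤ ξ (incl₂ FQ Q b) = P'.bracket ⊤ ξ (incl₂ FQ Q b))
    {n : ℕ} {η : 𝓕 ⊤} (hη : HPoly n η) : P.bracket ⊤ ξ η = P'.bracket ⊤ ξ η := by
  induction hη with
  | fn f => exact h0 f
  | dual τ => exact h1 τ
  | sec b => exact h2 b
  | zero n => exact (map_zero (P.bracket ⊤ ξ)).trans (map_zero (P'.bracket ⊤ ξ)).symm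
  | @add n η₁ η₂ k1 k2 e1 e2 =>
    refine (map_add (P.bracket ⊤ ξ) η₁ η₂).trans ?_
    rw [e1, e2]
    exact (map_add (P'.bracket ⊤ ξ) η₁ η₂).symm
  | @mul n k η₁ η₂ k1 k2 e1 e2 =>
    refine (P.leibniz' h k1.homogeneous k2.homogeneous).trans ?_
    rw [e1, e2]
    exact (P'.leibniz' h k1.homogeneous k2.homogeneous).symm

lemma eq_of_poly (h : ∀ {n k : ℕ} {ξ η : 𝓕 ⊤}, HPoly n ξ → HPoly k η →
    P.bracket ⊤ ξ η = P'.bracket ⊤ ξ η) {ξ η : 𝓕 ⊤} (hξ : ξ ∈ Poly FQ Q FB B)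
    (hη : η ∈ Poly FQ Q FB B) : P.bracket ⊤ ξ η = P'.bracket ⊤ ξ η := by
  induction hξ using AddSubmonoid.closure_induction with
  | zero => rw [(P.bracket ⊤).map_zero, (P'.bracket ⊤).map_zero]
  | add a b _ _ ha hb =>
    rw [(P.bracket ⊤).map_add, (P'.bracket ⊤).map_add, LinearMap.add_apply, LinearMap.add_apply, ha,
      hb]
  | mem a ha =>
    obtain ⟨n, ha⟩ := ha
    induction hη using AddSubmonoid.closure_induction with
    | zero => exact (map_zero (P.bracket ⊤ a)).trans (map_zero (P'.bracket ⊤ a)).symm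
    | add c d _ _ hc hd =>
      exact ((P.bracket ⊤ a).map_add c d).trans
        ((congrArg₂ (· + ·) hc hd).trans ((P'.bracket ⊤ a).map_add c d).symm)
    | mem b hb =>
      obtain ⟨k, hb⟩ := hb
      exact h ha hb

/-- Arbitrary functions over arbitrary open sets have germs of global polynomials, and brackets are
local. -/
lemma eq_of_hpoly (h : ∀ {n k : ℕ} {ξ η : 𝓕 ⊤}, HPoly n ξ → HPoly k η →
    P.bracket ⊤ ξ η = P'.bracket ⊤ ξ η) : P.bracket = P'.bracket := by
  refine funext fun U => LinearMap.ext₂ fun ξ η => Subtype.ext (funext fun x => ?_)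
  obtain ⟨ξ', hξ', e1⟩ := exists_poly ξ x.2
  obtain ⟨η', hη', e2⟩ := exists_poly η x.2
  have e3 := (P.germ_congr (V := ⊤) x.2 trivial e1 e2).self_of_nhds x.2 trivial
  have e4 := (P'.germ_congr (V := ⊤) x.2 trivial e1 e2).self_of_nhds x.2 trivial
  refine e3.trans (Eq.trans ?_ e4.symm)
  rw [eq_of_poly (P := P) (P' := P') h hξ' hη']

variable (P) in
lemma degree_two_two (b b' : 𝓢) :
    Fun.IsHomogeneous 2 (P.bracket ⊤ (incl₂ FQ Q b) (incl₂ FQ Q b')) :=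
  P.degree' (i := 2) (j := 2) (incl₂_homogeneous b) (incl₂_homogeneous b')

/-- A bracket is determined by its values on generators. -/
lemma eq_of_generators
    (h20 : ∀ b f, P.bracket ⊤ (incl₂ FQ Q b) (incl₀ FB B FQ Q f) =
      P'.bracket ⊤ (incl₂ FQ Q b) (incl₀ FB B FQ Q f))
    (h11 : ∀ τ τ', P.bracket ⊤ (incl₁ FB B τ) (incl₁ FB B τ') =
      P'.bracket ⊤ (incl₁ FB B τ) (incl₁ FB B τ'))
    (h21 : ∀ b τ, P.bracket ⊤ (incl₂ FQ Q b) (incl₁ FB B τ) =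
      P'.bracket ⊤ (incl₂ FQ Q b) (incl₁ FB B τ))
    (h22 : ∀ b b', P.bracket ⊤ (incl₂ FQ Q b) (incl₂ FQ Q b') =
      P'.bracket ⊤ (incl₂ FQ Q b) (incl₂ FQ Q b')) : P.bracket = P'.bracket := by
  have r0 : ∀ f, ∀ {n : ℕ} {η : 𝓕 ⊤}, HPoly n η →
      P.bracket ⊤ (incl₀ FB B FQ Q f) η = P'.bracket ⊤ (incl₀ FB B FQ Q f) η := fun f =>
    eq_right (incl₀_homogeneous f)
      (fun g => eq_of_low (incl₀_homogeneous f) (incl₀_homogeneous g) (by norm_num))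
      (fun g => eq_of_low (incl₀_homogeneous f) (incl₁_homogeneous g) (by norm_num))
      (fun b => eq_symm (incl₀_homogeneous f) (incl₂_homogeneous b) (h20 b f))
  have r1 : ∀ τ, ∀ {n : ℕ} {η : 𝓕 ⊤}, HPoly n η →
      P.bracket ⊤ (incl₁ FB B τ) η = P'.bracket ⊤ (incl₁ FB B τ) η := fun τ =>
    eq_right (incl₁_homogeneous τ)
      (fun g => eq_of_low (incl₁_homogeneous τ) (incl₀_homogeneous g) (by norm_num)) (h11 τ)
      (fun b => eq_symm (incl₁_homogeneous τ) (incl₂_homogeneous b) (h21 b τ))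
  have r2 : ∀ b, ∀ {n : ℕ} {η : 𝓕 ⊤}, HPoly n η →
      P.bracket ⊤ (incl₂ FQ Q b) η = P'.bracket ⊤ (incl₂ FQ Q b) η := fun b =>
    eq_right (incl₂_homogeneous b) (h20 b) (h21 b) (h22 b)
  -- The second round: a polynomial against a generator is turned around by skew symmetry into a
  -- generator against a polynomial, which `r0`, `r1` and `r2` have settled.
  exact eq_of_hpoly fun {n k ξ η} hξ hη => eq_right hξ.homogeneous
    (fun f => eq_symm hξ.homogeneous (incl₀_homogeneous f) (r0 f hξ))
    (fun f => eq_symm hξ.homogeneous (incl₁_homogeneous f) (r1 f hξ))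
    (fun f => eq_symm hξ.homogeneous (incl₂_homogeneous f) (r2 f hξ)) hη

end PreBracket

/-- The structure maps of the 2-representation determine the bracket. -/
lemma Corr.bracket_unique {P P' : PreBracket m FQ Q FB B} {D : PreRep m FQ Q FB B}
    (h : Corr P D) (h' : Corr P' D) : P.bracket = P'.bracket := by
  refine PreBracket.eq_of_generators (fun b f => ?_) (fun τ τ' => ?_) (fun b τ => ?_) fun b b' => ?_
  · rw [h.two_zero, h'.two_zero]
  · rw [h.one_one, h'.one_one]
  · rw [h.two_one, h'.two_one]
  · refine fun_ext fun x => val_eq_of_deg_two (P.degree_two_two b b') (P'.degree_two_two b b') x ?_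
      fun q q' => ?_
    · rw [h.coeff₂_two_two, h'.coeff₂_two_two]
    · rw [h.form_two_two, h'.form_two_two]

end Uniqueness
end SplitPoisson
end

/-! ### Tools for extracting the data from a bracket -/

open Bundle Manifold Set TopologicalSpace
open scoped Manifold ContDiff Bundle Topology TensorProduct
noncomputable section
namespace SplitPoisson
set_option linter.unusedSectionVars false

/-- An injective linear map over a field has a linear left inverse, and composing with it makes the
chosen preimages bilinear at no further cost. -/
lemma exists_bilinear_lift {X Y Z W : Type*} [AddCommGroup X] [Module ℝ X] [AddCommGroup Y]
    [Module ℝ Y] [AddCommGroup Z] [Module ℝ Z] [AddCommGroup W] [Module ℝ W] (ι : Z →ₗ[ℝ] W)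
    (hι : Function.Injective ι) (T : X →ₗ[ℝ] Y →ₗ[ℝ] W) (h : ∀ x y, ∃ z, ι z = T x y) :
    ∃ T' : X →ₗ[ℝ] Y →ₗ[ℝ] Z, ∀ x y, ι (T' x y) = T x y := by
  obtain ⟨p, hp⟩ := ι.exists_leftInverse_of_injective (LinearMap.ker_eq_bot.2 hι)
  refine ⟨T.compr₂ p, fun x y => ?_⟩
  obtain ⟨z, hz⟩ := h x y
  rw [LinearMap.compr₂_apply, ← hz]
  exact congrArg ι (DFunLike.congr_fun hp z)

section VectorFields

variable {m : ℕ} {M : Type*} [TopologicalSpace M] [ChartedSpace (EuclideanSpace ℝ (Fin m)) M]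
  [T2Space M] [IsManifold (𝓡 m) ∞ M]

/-- A vector field is smooth if it maps smooth functions to smooth functions. -/
lemma contMDiff_vectorField {v : Π x : M, TangentSpace (𝓡 m) x}
    (h : ∀ f : SmoothFun m M, ContMDiff (𝓡 m) 𝓘(ℝ, ℝ) ∞ fun x => tderiv (v x) f) :
    ContMDiff (𝓡 m) ((𝓡 m).prod 𝓘(ℝ, EuclideanSpace ℝ (Fin m))) ∞
      (fun x => TotalSpace.mk' (EuclideanSpace ℝ (Fin m))
        (E := fun x : M => TangentSpace (𝓡 m) x) x (v x)) := by
  intro x₀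
  rw [contMDiffAt_section]
  obtain ⟨X, hX⟩ := exists_coord (m := m) x₀
  -- In the trivialisation by the chart at `x₀`, the components of a vector field are its
  -- derivatives of the coordinate functions.
  have h1 : ContMDiffAt (𝓡 m) 𝓘(ℝ, EuclideanSpace ℝ (Fin m)) ∞
      (fun x => (WithLp.toLp 2 fun k => tderiv (v x) (X k) : EuclideanSpace ℝ (Fin m))) x₀ := by
    refine ContDiff.contMDiff (PiLp.contDiff_toLp) |>.contMDiffAt.comp x₀ ?_
    exact contMDiffAt_pi_space.2 fun k => h (X k) x₀
  refine h1.congr_of_eventuallyEq ?_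
  filter_upwards [hX.eventually_nhds, (chartAt (EuclideanSpace ℝ (Fin m)) x₀).open_source.mem_nhds
    (mem_chart_source _ x₀)] with x hx hxs
  have e1 := TangentBundle.continuousLinearMapAt_trivializationAt (I := 𝓡 m) (x₀ := x₀) hxs
  have e2 := DFunLike.congr_fun e1 (v x)
  rw [Trivialization.continuousLinearMapAt_apply, Trivialization.linearMapAt_apply] at e2
  rw [if_pos (by simpa using hxs)] at e2
  refine e2.trans ?_
  ext k
  have e3 : MDifferentiableAt (𝓡 m) 𝓘(ℝ, EuclideanSpace ℝ (Fin m)) (extChartAt (𝓡 m) x₀) x :=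
    mdifferentiableAt_extChartAt hxs
  let L : EuclideanSpace ℝ (Fin m) →L[ℝ] ℝ := EuclideanSpace.proj k
  have e5 : HasMFDerivAt (𝓡 m) 𝓘(ℝ, ℝ)
      (fun y => L (extChartAt (𝓡 m) x₀ y) - L (extChartAt (𝓡 m) x₀ x₀)) x
      (L.comp (mfderiv (𝓡 m) 𝓘(ℝ, EuclideanSpace ℝ (Fin m)) (extChartAt (𝓡 m) x₀) x)) :=
    (L.hasFDerivAt.sub_const (L (extChartAt (𝓡 m) x₀ x₀))).hasMFDerivAt.comp x e3.hasMFDerivAt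
  have e6 : (X k : M → ℝ) =ᶠ[𝓝 x]
      (fun y => L (extChartAt (𝓡 m) x₀ y) - L (extChartAt (𝓡 m) x₀ x₀)) :=
    hx.mono fun y hy => hy k
  have e7 := (e5.congr_of_eventuallyEq e6).mfderiv
  have e8 := DFunLike.congr_fun e7 (v x)
  exact e8.symm

variable {FB : Type*} [NormedAddCommGroup FB] [NormedSpace ℝ FB] [FiniteDimensional ℝ FB]
  {B : M → Type*} [TopologicalSpace (TotalSpace FB B)] [∀ x, AddCommGroup (B x)]
  [∀ x, Module ℝ (B x)] [∀ x, TopologicalSpace (B x)] [FiberBundle FB B] [VectorBundle ℝ FB B]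
  [ContMDiffVectorBundle ∞ FB B (𝓡 m)]

/-- A family of derivations that is linear over the functions comes from an anchor. -/
lemma exists_anchor (δ : Sec (𝓡 m) FB B →ₗ[ℝ] SmoothFun m M →ₗ[ℝ] SmoothFun m M)
    (h1 : ∀ f b g, δ (fsmul f b) g = f * δ b g) (h2 : ∀ b f g, δ b (f * g) = f * δ b g + g * δ b f) :
    ∃ ρ : Anchor (𝓡 m) FB B, ∀ b f, δ b f = anchorFun ρ b f := by
  have hv : ∀ b x, ∃ v : TangentSpace (𝓡 m) x, ∀ f, δ b f x = tderiv v f := fun b x =>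
    exists_tangent_of_derivation (evFun x ∘ₗ δ b) fun f g => by
      simp only [LinearMap.comp_apply, h2]
      rfl
  choose v hv using hv
  let T : Sec (𝓡 m) FB B →ₗ[ℝ] Sec (𝓡 m) (EuclideanSpace ℝ (Fin m))
      (fun x : M => TangentSpace (𝓡 m) x) :=
    { toFun := fun b => ⟨v b, contMDiff_vectorField fun f =>
        (δ b f).contMDiff.congr fun x => (hv b x f).symm⟩
      map_add' := fun b c => ContMDiffSection.ext fun x => tderiv_vec_injective fun f => by
        refine (hv _ _ _).symm.trans (Eq.trans ?_ (tderiv_vec_add _ _ _).symm)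
        rw [map_add, LinearMap.add_apply, ContMDiffMap.coe_add, Pi.add_apply, hv, hv]
        rfl
      map_smul' := fun r b => ContMDiffSection.ext fun x => tderiv_vec_injective fun f => by
        refine (hv _ _ _).symm.trans (Eq.trans ?_ (tderiv_vec_smul _ _ _).symm)
        rw [map_smul, LinearMap.smul_apply, ContMDiffMap.coe_smul, Pi.smul_apply, hv]
        rfl }
  obtain ⟨ρ, hρ⟩ := exists_hom_of_linear T fun f b => ContMDiffSection.ext fun x =>
    tderiv_vec_injective fun g => by
      refine (hv _ _ _).symm.trans (Eq.trans ?_ (tderiv_vec_smul _ _ _).symm)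
      rw [h1, ContMDiffMap.coe_mul, Pi.mul_apply, hv]
      rfl
  refine ⟨ρ, fun b f => ContMDiffMap.ext fun x => ?_⟩
  rw [hv, anchorFun_apply]
  have := congrArg (fun s => s x) (hρ b)
  change v b x = ρ x (b x) at this
  rw [this]

end VectorFields

section Form

variable {V W : Type*} [AddCommGroup V] [Module ℝ V] [TopologicalSpace V]
  [AddCommGroup W] [Module ℝ W]

lemma FreeAlg.form_add_left (v v' w : V) (a : FreeAlg V W) :
    form V W (v + v') w a = form V W v w a + form V W v' w a := by
  simp [form, LinearMap.add_comp]
lemma FreeAlg.form_smul_left (r : ℝ) (v w : V) (a : FreeAlg V W) :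
    form V W (r • v) w a = r * form V W v w a := by
  simp [form, LinearMap.smul_comp]
lemma FreeAlg.form_add_right (v w w' : V) (a : FreeAlg V W) :
    form V W v (w + w') a = form V W v w a + form V W v w' a := by
  simp [form, LinearMap.add_comp]
lemma FreeAlg.form_smul_right (r : ℝ) (v w : V) (a : FreeAlg V W) :
    form V W v (r • w) a = r * form V W v w a := by
  simp [form, LinearMap.smul_comp]
-- Two contractions anticommute.
lemma FreeAlg.form_swap (v w : V) (a : FreeAlg V W) :
    form V W v w a = -form V W w v a := by
  simp only [form, LinearMap.comp_apply, AlgHom.toLinearMap_apply]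
  rw [CliffordAlgebra.contractLeft_comm, map_neg]

end Form

end SplitPoisson
end

/-! ### From the bracket to the anchor, the connections, the bracket on sections and the curvature
form -/

open Bundle Manifold Set TopologicalSpace
open scoped Manifold ContDiff Bundle Topology TensorProduct
noncomputable section
namespace SplitPoisson
set_option linter.unusedSectionVars false
section ExistsPreRep


variable {m : ℕ} {M : Type*} [TopologicalSpace M] [ChartedSpace (EuclideanSpace ℝ (Fin m)) M]
  [T2Space M] [IsManifold (𝓡 m) ∞ M]
  {FQ : Type*} [NormedAddCommGroup FQ] [NormedSpace ℝ FQ] [FiniteDimensional ℝ FQ]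
  {Q : M → Type*} [TopologicalSpace (TotalSpace FQ Q)] [∀ x, AddCommGroup (Q x)]
  [∀ x, Module ℝ (Q x)] [∀ x, TopologicalSpace (Q x)] [∀ x, IsTopologicalAddGroup (Q x)]
  [∀ x, ContinuousSMul ℝ (Q x)] [FiberBundle FQ Q] [VectorBundle ℝ FQ Q]
  [ContMDiffVectorBundle ∞ FQ Q (𝓡 m)]
  {FB : Type*} [NormedAddCommGroup FB] [NormedSpace ℝ FB] [FiniteDimensional ℝ FB]
  {B : M → Type*} [TopologicalSpace (TotalSpace FB B)] [∀ x, AddCommGroup (B x)]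
  [∀ x, Module ℝ (B x)] [∀ x, TopologicalSpace (B x)] [FiberBundle FB B] [VectorBundle ℝ FB B]
  [ContMDiffVectorBundle ∞ FB B (𝓡 m)]


local notation "𝓕" => Fun (𝓡 m) FB B FQ Q
local notation "𝓢" => Sec (𝓡 m) FB B
local notation "𝓓" => Sec (𝓡 m) (FQ →L[ℝ] ℝ) (DualBundle Q)

variable (FQ Q FB B) in
/-- The inclusion of the smooth functions, as a linear map. -/
def inclₗ₀ : SmoothFun m M →ₗ[ℝ] 𝓕 ⊤ where
  toFun := incl₀ FB B FQ Q
  map_add' := incl₀_add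
  map_smul' := incl₀_smul

variable (FQ Q FB B) in
/-- The inclusion of the sections of `Q*`, as a linear map. -/
def inclₗ₁ : 𝓓 →ₗ[ℝ] 𝓕 ⊤ where
  toFun := incl₁ FB B
  map_add' := incl₁_add
  map_smul' := incl₁_smul

variable (FQ Q FB B) in
/-- The inclusion of the sections of `B`, as a linear map. -/
def inclₗ₂ : 𝓢 →ₗ[ℝ] 𝓕 ⊤ where
  toFun := incl₂ FQ Q
  map_add' := incl₂_add
  map_smul' := incl₂_smul

/-- Near a point, a function of degree `2` is a section of `B` plus a sum of products of sections
of `Q*`. -/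
lemma exists_germ_two {ξ : 𝓕 ⊤} (h : Fun.IsHomogeneous 2 ξ) (x : M) :
    ∃ b : 𝓢, ∃ Θ ∈ AddSubmonoid.closure
      {Θ : 𝓕 ⊤ | ∃ τ τ' : 𝓓, Θ = incl₁ FB B τ * incl₁ FB B τ'}, GermEq x ξ (incl₂ FQ Q b + Θ) := by
  obtain ⟨η, hη, hg⟩ := exists_hpoly (n := 2) h (x := x) trivial
  obtain ⟨b, Θ, hΘ, rfl⟩ := hη.exists_incl.2.2 rfl
  exact ⟨b, Θ, hΘ, hg⟩

/-- Near a point the function is a section of `B`, invisible to `form`, plus a sum of products `τ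
τ'`, on which `form` is a polynomial in pairings. -/
lemma contMDiff_form {ξ : 𝓕 ⊤} (h : Fun.IsHomogeneous 2 ξ) (q q' : Sec (𝓡 m) FQ Q) :
    ContMDiff (𝓡 m) 𝓘(ℝ, ℝ) ∞ (fun x => FreeAlg.form _ _ (q x) (q' x) (val ξ x)) := by
  intro x
  obtain ⟨b, Θ, hΘ, hg⟩ := exists_germ_two h x
  have hs : ∃ g : SmoothFun m M, ∀ y, FreeAlg.form _ _ (q y) (q' y) (val Θ y) = g y := by
    clear hg
    induction hΘ using AddSubmonoid.closure_induction with
    | zero => exact ⟨0, fun y => by simp⟩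
    | add Θ Θ' _ _ h1 h2 =>
      obtain ⟨g, hg⟩ := h1
      obtain ⟨g', hg'⟩ := h2
      exact ⟨g + g', fun y => by rw [val_add, map_add, hg, hg']; rfl⟩
    | mem Θ hΘ =>
      obtain ⟨τ, τ', rfl⟩ := hΘ
      exact ⟨pairing τ q * pairing τ' q' - pairing τ q' * pairing τ' q, fun y => by simp⟩
  obtain ⟨g, hg'⟩ := hs
  refine (g.contMDiff x).congr_of_eventuallyEq ?_
  filter_upwards [germEq_iff.1 hg] with y hy
  rw [hy, val_add, map_add, hg', val_incl₂, FreeAlg.form_gen₂, zero_add]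

/-- The function `θ(q, q')` for a function of degree `2` with `∧²Q*`-part `θ`. -/
def formFun {ξ : 𝓕 ⊤} (h : Fun.IsHomogeneous 2 ξ) (q q' : Sec (𝓡 m) FQ Q) : SmoothFun m M :=
  ⟨fun x => FreeAlg.form _ _ (q x) (q' x) (val ξ x), contMDiff_form h q q'⟩

lemma formFun_apply {ξ : 𝓕 ⊤} (h : Fun.IsHomogeneous 2 ξ) (q q' : Sec (𝓡 m) FQ Q) (x : M) :
    formFun h q q' x = FreeAlg.form _ _ (q x) (q' x) (val ξ x) := rfl

variable (FQ Q) in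
/-- The pairing with a section of `Q`, as a linear map. -/
def pairingₗ : Sec (𝓡 m) FQ Q →ₗ[ℝ] 𝓓 →ₗ[ℝ] SmoothFun m M :=
  LinearMap.mk₂ ℝ (fun q τ => pairing τ q) (fun q q' τ => by ext x; simp)
    (fun r q τ => by ext x; simp) (fun q τ τ' => by ext x; simp) (fun r q τ => by ext x; simp)

lemma pairingₗ_injective :
    Function.Injective (pairingₗ (m := m) FQ Q) := fun _ _ h => ContMDiffSection.ext fun x =>
  sec_eq_of_pairing fun τ => DFunLike.congr_fun (DFunLike.congr_fun h τ) x

lemma tderiv_anchor_add (ρ : Anchor (𝓡 m) FB B) (b c : 𝓢) (f : SmoothFun m M) (x : M) :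
    tderiv (ρ x ((b + c) x)) f = tderiv (ρ x (b x)) f + tderiv (ρ x (c x)) f := by
  rw [ContMDiffSection.coe_add, Pi.add_apply, map_add, tderiv_vec_add]

lemma tderiv_anchor_smul (ρ : Anchor (𝓡 m) FB B) (r : ℝ) (b : 𝓢) (f : SmoothFun m M) (x : M) :
    tderiv (ρ x ((r • b) x)) f = r * tderiv (ρ x (b x)) f := by
  rw [ContMDiffSection.coe_smul, Pi.smul_apply, map_smul, tderiv_vec_smul]

/-- The connection on `Q` that is dual to a connection on `Q*`. -/
lemma exists_nabla_dual (ρ : Anchor (𝓡 m) FB B) (n₀ : 𝓢 →ₗ[ℝ] 𝓓 →ₗ[ℝ] 𝓓)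
    (hl : ∀ b (f : SmoothFun m M) τ (x : M), n₀ b (fsmul f τ) x =
      f x • n₀ b τ x + tderiv (ρ x (b x)) f • τ x) :
    ∃ n₁ : 𝓢 →ₗ[ℝ] Sec (𝓡 m) FQ Q →ₗ[ℝ] Sec (𝓡 m) FQ Q, ∀ b (τ : 𝓓) q x,
      tderiv (ρ x (b x)) (pairing τ q) = n₀ b τ x (q x) + τ x (n₁ b q x) := by
  -- What duality prescribes for `⟨τ, ∇_b q⟩`. The derivatives of a factor `f` cancel, so this is
  -- linear over the functions in `τ` and is the pairing with a section of `Q`.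
  let t (b : 𝓢) (q : Sec (𝓡 m) FQ Q) (τ : 𝓓) : SmoothFun m M :=
    anchorFun ρ b (pairing τ q) - pairing (n₀ b τ) q
  have ht : ∀ b q τ x, t b q τ x = tderiv (ρ x (b x)) (pairing τ q) - n₀ b τ x (q x) :=
    fun _ _ _ _ => rfl
  have hp : ∀ (q : Sec (𝓡 m) FQ Q) (τ : 𝓓), pairing τ q = pairingₗ FQ Q q τ := fun _ _ => rfl
  let t' (b : 𝓢) (q : Sec (𝓡 m) FQ Q) : 𝓓 →ₗ[ℝ] SmoothFun m M :=
    { toFun := t b q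
      map_add' := fun τ τ' => by
        ext x
        rw [ContMDiffMap.coe_add, Pi.add_apply, ht, ht, ht, hp, map_add, map_add, map_add]
        simp only [ContMDiffSection.coe_add, Pi.add_apply, add_apply, hp]
        ring
      map_smul' := fun r τ => by
        ext x
        rw [RingHom.id_apply, ContMDiffMap.coe_smul, Pi.smul_apply, ht, ht, hp, map_smul, map_smul,
          map_smul]
        simp only [ContMDiffSection.coe_smul, Pi.smul_apply, smul_apply, hp,
          smul_eq_mul]
        ring }
  let T : 𝓢 →ₗ[ℝ] Sec (𝓡 m) FQ Q →ₗ[ℝ] 𝓓 →ₗ[ℝ] SmoothFun m M :=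
    LinearMap.mk₂ ℝ t'
      (fun b b' q => LinearMap.ext fun τ => ContMDiffMap.ext fun x => by
        change t (b + b') q τ x = t b q τ x + t b' q τ x
        have e : n₀ (b + b') τ x (q x) = n₀ b τ x (q x) + n₀ b' τ x (q x) := by
          rw [n₀.map_add₂]; rfl
        rw [ht, ht, ht, e, tderiv_anchor_add]
        ring)
      (fun r b q => LinearMap.ext fun τ => ContMDiffMap.ext fun x => by
        change t (r • b) q τ x = r * t b q τ x
        have e : n₀ (r • b) τ x (q x) = r * n₀ b τ x (q x) := by
          rw [n₀.map_smul₂]; rfl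
        rw [ht, ht, e, tderiv_anchor_smul]
        ring)
      (fun b q q' => LinearMap.ext fun τ => ContMDiffMap.ext fun x => by
        change t b (q + q') τ x = t b q τ x + t b q' τ x
        simp only [ht, hp, ContMDiffSection.coe_add, Pi.add_apply, map_add, LinearMap.add_apply]
        ring)
      (fun r b q => LinearMap.ext fun τ => ContMDiffMap.ext fun x => by
        change t b (r • q) τ x = r * t b q τ x
        simp only [ht, hp, ContMDiffSection.coe_smul, Pi.smul_apply, map_smul,
          LinearMap.smul_apply, smul_eq_mul]
        ring)
  obtain ⟨n₁, hn₁⟩ := exists_bilinear_lift (pairingₗ FQ Q) pairingₗ_injective T fun b q => by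
    obtain ⟨s, hs⟩ := exists_sec_of_linear (t' b q) fun f τ => ContMDiffMap.ext fun x => by
      change t b q (fsmul f τ) x = f x * t b q τ x
      have e : pairing (fsmul f τ) q = f * pairing τ q := by ext y; simp
      rw [ht, ht, e, tderiv_mul, hl]
      simp only [add_apply, smul_apply, smul_eq_mul,
        pairing_apply]
      ring
    exact ⟨s, LinearMap.ext fun τ => (hs τ).symm⟩
  refine ⟨n₁, fun b τ q x => ?_⟩
  have h : pairing τ (n₁ b q) = t b q τ := DFunLike.congr_fun (hn₁ b q) τ
  have h' := DFunLike.congr_fun h x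
  rw [ht, pairing_apply] at h'
  linarith

namespace PreBracket

variable (P : PreBracket m FQ Q FB B)

lemma bracket_incl₀_mul {k : ℤ} {ξ η : 𝓕 ⊤} (f : SmoothFun m M) {n : ℤ} (h : Fun.IsHomogeneous n ξ)
    (h' : Fun.IsHomogeneous k η) : P.bracket ⊤ ξ (incl₀ FB B FQ Q f * η) =
      P.bracket ⊤ ξ (incl₀ FB B FQ Q f) * η + incl₀ FB B FQ Q f * P.bracket ⊤ ξ η := by
  rw [P.leibniz' h (incl₀_homogeneous f) h', mul_zero]
  simp [koszul]

/-- The Leibniz rule leaves the extra term `{η, f} b`, whose factor `{η, f}` has degree `k - 2 < 0`.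
Hence the anchor and the connection are linear over the functions in `b`; for `k = 2` the same term
is the anchor term in the Leibniz rule of the bracket on `Γ(B)`. -/
lemma bracket_fsmul_two (f : SmoothFun m M) (b : 𝓢) {k : ℤ} {η : 𝓕 ⊤} (h : Fun.IsHomogeneous k η)
    (hk : k < 2) : P.bracket ⊤ (incl₂ FQ Q (fsmul f b)) η =
      incl₀ FB B FQ Q f * P.bracket ⊤ (incl₂ FQ Q b) η := by
  have e : koszul (2 * k) = 1 := by simp [koszul]
  rw [P.skew' (incl₂_homogeneous (fsmul f b)) h, P.skew' (incl₂_homogeneous b) h, e, one_smul,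
    one_smul, incl₂_fsmul, P.bracket_incl₀_mul f h (incl₂_homogeneous b),
    P.bracket_eq_zero h (incl₀_homogeneous f) (by omega), zero_mul, zero_add]
  exact (mul_neg (incl₀ FB B FQ Q f) (P.bracket ⊤ η (incl₂ FQ Q b))).symm

lemma skew_two (b c : 𝓢) : P.bracket ⊤ (incl₂ FQ Q b) (incl₂ FQ Q c) =
    -P.bracket ⊤ (incl₂ FQ Q c) (incl₂ FQ Q b) := by
  have e : koszul (2 * 2) = 1 := if_pos ⟨2, rfl⟩
  rw [P.skew' (incl₂_homogeneous b) (incl₂_homogeneous c), e, one_smul]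

lemma exists_deriv : ∃ δ : 𝓢 →ₗ[ℝ] SmoothFun m M →ₗ[ℝ] SmoothFun m M, ∀ b f,
    incl₀ FB B FQ Q (δ b f) = P.bracket ⊤ (incl₂ FQ Q b) (incl₀ FB B FQ Q f) :=
  exists_bilinear_lift (inclₗ₀ FQ Q FB B) incl₀_injective
    ((P.bracket ⊤).compl₁₂ (inclₗ₂ FQ Q FB B) (inclₗ₀ FQ Q FB B)) fun b f => by
      obtain ⟨g, hg⟩ := exists_eq_incl₀
        (P.degree' (i := 2) (j := 0) (incl₂_homogeneous b) (incl₀_homogeneous f))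
      exact ⟨g, hg.symm⟩

lemma exists_anchor : ∃ ρ : Anchor (𝓡 m) FB B, ∀ b f,
    P.bracket ⊤ (incl₂ FQ Q b) (incl₀ FB B FQ Q f) = incl₀ FB B FQ Q (anchorFun ρ b f) := by
  obtain ⟨δ, hδ⟩ := P.exists_deriv
  obtain ⟨ρ, hρ⟩ := SplitPoisson.exists_anchor δ
    (fun f b g => incl₀_injective (FB := FB) (B := B) (FQ := FQ) (Q := Q) (by
      rw [incl₀_mul, hδ, hδ, P.bracket_fsmul_two f b (incl₀_homogeneous g) (by norm_num)]))
    (fun b f g => incl₀_injective (FB := FB) (B := B) (FQ := FQ) (Q := Q) (by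
      rw [mul_comm g, incl₀_add, incl₀_mul, incl₀_mul, hδ, hδ, hδ, incl₀_mul,
        P.bracket_incl₀_mul f (incl₂_homogeneous b) (incl₀_homogeneous g), add_comm]))
  exact ⟨ρ, fun b f => by rw [← hρ, hδ]⟩

lemma exists_nabla : ∃ n : 𝓢 →ₗ[ℝ] 𝓓 →ₗ[ℝ] 𝓓, ∀ b τ,
    incl₁ FB B (n b τ) = P.bracket ⊤ (incl₂ FQ Q b) (incl₁ FB B τ) :=
  exists_bilinear_lift (inclₗ₁ FQ Q FB B) incl₁_injective
    ((P.bracket ⊤).compl₁₂ (inclₗ₂ FQ Q FB B) (inclₗ₁ FQ Q FB B)) fun b f => by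
      obtain ⟨g, hg⟩ := exists_eq_incl₁
        (P.degree' (i := 2) (j := 1) (incl₂_homogeneous b) (incl₁_homogeneous f))
      exact ⟨g, hg.symm⟩

/-- The `B`-component is known to be a smooth section for each pair; lifting through all families of
vectors makes it a bilinear map. -/
lemma exists_bracket_two : ∃ n : 𝓢 →ₗ[ℝ] 𝓢 →ₗ[ℝ] 𝓢, ∀ b c x, n b c x =
    FreeAlg.coeff₂ _ _ (val (P.bracket ⊤ (incl₂ FQ Q b) (incl₂ FQ Q c)) x) := by
  let ι : 𝓢 →ₗ[ℝ] Π x, B x :=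
    { toFun := fun s x => s x, map_add' := fun _ _ => rfl, map_smul' := fun _ _ => rfl }
  let c₂ : 𝓕 ⊤ →ₗ[ℝ] Π x, B x :=
    LinearMap.pi fun x => FreeAlg.coeff₂ _ _ ∘ₗ (valHom x).toLinearMap
  obtain ⟨n, hn⟩ := exists_bilinear_lift ι (fun s t h => ContMDiffSection.ext (congrFun h))
    (((P.bracket ⊤).compl₁₂ (inclₗ₂ FQ Q FB B) (inclₗ₂ FQ Q FB B)).compr₂ c₂) fun b c => by
      obtain ⟨g, hg⟩ := exists_coeff₂_eq (P.degree_two_two b c)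
      exact ⟨g, funext fun x => (hg x).symm⟩
  exact ⟨n, fun b c x => congrFun (hn b c) x⟩

lemma exists_pairing : ∃ g : 𝓓 →ₗ[ℝ] 𝓓 →ₗ[ℝ] SmoothFun m M, ∀ τ τ',
    incl₀ FB B FQ Q (g τ τ') = P.bracket ⊤ (incl₁ FB B τ) (incl₁ FB B τ') :=
  exists_bilinear_lift (inclₗ₀ FQ Q FB B) incl₀_injective
    ((P.bracket ⊤).compl₁₂ (inclₗ₁ FQ Q FB B) (inclₗ₁ FQ Q FB B)) fun b f => by
      obtain ⟨g, hg⟩ := exists_eq_incl₀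
        (P.degree' (i := 1) (j := 1) (incl₁_homogeneous b) (incl₁_homogeneous f))
      exact ⟨g, hg.symm⟩

/-- Both entries are odd, so graded skew symmetry means symmetry. -/
lemma pairing_symm (τ τ' : 𝓓) : P.bracket ⊤ (incl₁ FB B τ) (incl₁ FB B τ') =
    P.bracket ⊤ (incl₁ FB B τ') (incl₁ FB B τ) := by
  have e : koszul (1 * 1) = -1 := by simp [koszul]
  rw [P.skew' (incl₁_homogeneous τ) (incl₁_homogeneous τ'), e, neg_one_smul, neg_neg]

/-- `{τ, f}` would have degree `-1`, so `{τ, ·}` is linear over the functions and is the pairing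
with a section of `Q`. By symmetry this section depends linearly over the functions on `τ` as well.
-/
lemma exists_bd : ∃ bd : Sec (𝓡 m) ((FQ →L[ℝ] ℝ) →L[ℝ] FQ) (HomBundle (DualBundle Q) Q),
    ∀ τ₁ τ₂ : 𝓓, P.bracket ⊤ (incl₁ FB B τ₁) (incl₁ FB B τ₂) =
      incl₀ FB B FQ Q (pairing τ₂ (homApply bd τ₁)) := by
  obtain ⟨g, hg⟩ := P.exists_pairing
  have hs : ∀ τ τ', g τ τ' = g τ' τ := fun τ τ' =>
    incl₀_injective (FB := FB) (B := B) (FQ := FQ) (Q := Q) (by rw [hg, hg, P.pairing_symm])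
  have hr : ∀ τ f τ', g τ (fsmul f τ') = f * g τ τ' := fun τ f τ' =>
    incl₀_injective (FB := FB) (B := B) (FQ := FQ) (Q := Q) (by
      rw [incl₀_mul, hg, hg, incl₁_fsmul,
        P.bracket_incl₀_mul f (incl₁_homogeneous τ) (incl₁_homogeneous τ'),
        P.bracket_eq_zero (incl₁_homogeneous τ) (incl₀_homogeneous f) (by norm_num), zero_mul,
        zero_add])
  have hq : ∀ τ, ∃ q : Sec (𝓡 m) FQ Q, ∀ τ', g τ τ' = pairing τ' q := fun τ =>
    exists_sec_of_linear (g τ) (hr τ)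
  choose q hq using hq
  have hinj : ∀ {s t : Sec (𝓡 m) FQ Q}, (∀ τ : 𝓓, pairing τ s = pairing τ t) → s = t :=
    fun h => pairingₗ_injective (LinearMap.ext h)
  let T : 𝓓 →ₗ[ℝ] Sec (𝓡 m) FQ Q :=
    { toFun := q
      map_add' := fun a b => hinj fun τ => by
        rw [← hq, map_add, LinearMap.add_apply, hq, hq]; ext x; simp
      map_smul' := fun r b => hinj fun τ => by
        rw [← hq, map_smul, LinearMap.smul_apply, hq]; ext x; simp }
  obtain ⟨bd, hbd⟩ := exists_hom_of_linear T fun f τ => hinj fun τ' => by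
    refine (hq _ _).symm.trans ?_
    rw [hs, hr, hs, hq]
    ext x
    simp [T]
  refine ⟨bd, fun τ₁ τ₂ => ?_⟩
  rw [← hg, ← hbd, hq]
  rfl

/-- Minus the value on `q`, `q'` of the `∧²Q*`-part of `{b, c}` at `x`. -/
def curv (x : M) (q q' : Q x) : 𝓢 →ₗ[ℝ] 𝓢 →ₗ[ℝ] ℝ :=
  ((P.bracket ⊤).compl₁₂ (inclₗ₂ FQ Q FB B) (inclₗ₂ FQ Q FB B)).compr₂
    (-(FreeAlg.form _ _ q q' ∘ₗ (valHom x).toLinearMap))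

lemma curv_apply (x : M) (q q' : Q x) (b c : 𝓢) : P.curv x q q' b c =
    -FreeAlg.form _ _ q q' (val (P.bracket ⊤ (incl₂ FQ Q b) (incl₂ FQ Q c)) x) := rfl

lemma curv_skew (x : M) (q q' : Q x) (b c : 𝓢) : P.curv x q q' b c = -P.curv x q q' c b := by
  rw [curv_apply, curv_apply, P.skew_two, val_neg, map_neg]

/-- The extra term `{b, f} c` of the Leibniz rule is a section of `B` and does not meet the
`∧²`-component. This is why the curvature form is a tensor although the bracket on sections is not.
-/
lemma curv_fsmul (x : M) (q q' : Q x) (b c : 𝓢) (f : SmoothFun m M) :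
    P.curv x q q' b (fsmul f c) = f x * P.curv x q q' b c := by
  rw [curv_apply, curv_apply, incl₂_fsmul,
    P.bracket_incl₀_mul f (incl₂_homogeneous b) (incl₂_homogeneous c)]
  obtain ⟨g, hg⟩ := exists_eq_incl₀
    (P.degree' (i := 2) (j := 0) (incl₂_homogeneous b) (incl₀_homogeneous f))
  rw [hg]
  simp only [val_add, val_mul, val_incl₀, val_incl₂, ← Algebra.smul_def, map_add, map_smul,
    FreeAlg.form_gen₂, smul_eq_mul, mul_zero, zero_add, mul_neg]

lemma curv_congr {x : M} (q q' : Q x) {b b' c c' : 𝓢} (hb : b x = b' x) (hc : c x = c' x) :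
    P.curv x q q' b c = P.curv x q q' b' c' := by
  have hr : ∀ (b : 𝓢) {c c' : 𝓢}, c x = c' x → P.curv x q q' b c = P.curv x q q' b c' :=
    fun b c c' h => tensorial (P.curv x q q' b) (fun f s => P.curv_fsmul x q q' b s f) h
  rw [hr b hc, curv_skew, hr c' hb, ← curv_skew]

/-- The bilinear form `curv` as a map from `Q` to its dual. -/
def curvHom (x : M) (b c : 𝓢) : Q x →L[ℝ] (Q x →L[ℝ] ℝ) :=
  fibreCLM FQ
    { toFun := fun q => fibreCLM FQ
        { toFun := fun q' => P.curv x q q' b c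
          map_add' := fun _ _ => by simp only [curv_apply, FreeAlg.form_add_right, neg_add]
          map_smul' := fun _ _ => by
            simp only [curv_apply, FreeAlg.form_smul_right, RingHom.id_apply, smul_eq_mul,
              mul_neg] }
      map_add' := fun _ _ => by
        ext
        simp [curv_apply, FreeAlg.form_add_left]
        ring
      map_smul' := fun _ _ => by
        ext
        simp [curv_apply, FreeAlg.form_smul_left] }

lemma curvHom_apply (x : M) (b c : 𝓢) (q q' : Q x) :
    P.curvHom x b c q q' = P.curv x q q' b c := by
  simp [curvHom]
  rfl

lemma exists_curvature : ∃ R : TwoForm FB B (𝓡 m) (FQ →L[ℝ] (FQ →L[ℝ] ℝ))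
      (HomBundle Q (DualBundle Q)), ∀ (b c : 𝓢) (x : M) (q q' : Q x),
    R.toFun x (b x) (c x) q q' = P.curv x q q' b c := by
  -- Vectors are extended to sections linearly, so the fibrewise form is bilinear by construction;
  -- `curv_congr` identifies its values on arbitrary sections.
  let e (x : M) := (dualFrameAt (m := m) FB B x).ext
  have he : ∀ x v, e x v x = v := fun x v => DualFrameAt.ext_self _ v
  let Φ (x : M) : B x →ₗ[ℝ] B x →ₗ[ℝ] HomBundle Q (DualBundle Q) x :=
    LinearMap.mk₂ ℝ (fun b c => P.curvHom x (e x b) (e x c))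
      (fun b b' c => ContinuousLinearMap.ext fun q => ContinuousLinearMap.ext fun q' => by
        refine (P.curvHom_apply _ _ _ _ _).trans (Eq.trans ?_ (congrArg₂ (· + ·)
          (P.curvHom_apply _ _ _ _ _).symm (P.curvHom_apply _ _ _ _ _).symm))
        rw [map_add, map_add, LinearMap.add_apply])
      (fun r b c => ContinuousLinearMap.ext fun q => ContinuousLinearMap.ext fun q' => by
        refine (P.curvHom_apply _ _ _ _ _).trans (Eq.trans ?_ (congrArg (r • ·)
          (P.curvHom_apply _ _ _ _ _).symm))
        rw [map_smul, map_smul, LinearMap.smul_apply])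
      (fun b c c' => ContinuousLinearMap.ext fun q => ContinuousLinearMap.ext fun q' => by
        refine (P.curvHom_apply _ _ _ _ _).trans (Eq.trans ?_ (congrArg₂ (· + ·)
          (P.curvHom_apply _ _ _ _ _).symm (P.curvHom_apply _ _ _ _ _).symm))
        rw [map_add, map_add])
      (fun r b c => ContinuousLinearMap.ext fun q => ContinuousLinearMap.ext fun q' => by
        refine (P.curvHom_apply _ _ _ _ _).trans (Eq.trans ?_ (congrArg (r • ·)
          (P.curvHom_apply _ _ _ _ _).symm))
        rw [map_smul, map_smul])
  have hΦ : ∀ (b c : 𝓢) (x : M) (q q' : Q x), Φ x (b x) (c x) q q' = P.curv x q q' b c :=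
    fun b c x q q' => (P.curvHom_apply _ _ _ _ _).trans (P.curv_congr q q' (he _ _) (he _ _))
  refine ⟨⟨Φ, fun x b => ContinuousLinearMap.ext fun q => ContinuousLinearMap.ext fun q' => ?_,
    fun a b x => ?_⟩, hΦ⟩
  · refine (P.curvHom_apply x (e x b) (e x b) q q').trans ?_
    have := P.curv_skew x q q' (e x b) (e x b)
    change _ = (0 : ℝ)
    linarith
  -- Smoothness is tested on two sections of `Q`, where the value is minus the smooth function
  -- `formFun`.
  · refine contMDiffAt_hom_of_apply (V := Q) (W := DualBundle Q) fun q =>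
      contMDiffAt_dual_of_apply (V := Q) fun q' => ?_
    exact ((-formFun (P.degree_two_two a b) q q').contMDiff x).congr_of_eventuallyEq
      (Filter.Eventually.of_forall fun y => hΦ a b y (q y) (q' y))

/-- Every bracket comes from structure maps of a 2-representation. -/
lemma exists_preRep : ∃ D : PreRep m FQ Q FB B, Corr P D := by
  obtain ⟨ρ, hρ⟩ := P.exists_anchor
  obtain ⟨n₀, hn₀⟩ := P.exists_nabla
  obtain ⟨br, hbr⟩ := P.exists_bracket_two
  obtain ⟨bd, hbd⟩ := P.exists_bd
  obtain ⟨R, hR⟩ := P.exists_curvature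
  have hl : ∀ b (f : SmoothFun m M) τ (x : M), n₀ b (fsmul f τ) x =
      f x • n₀ b τ x + tderiv (ρ x (b x)) f • τ x := by
    intro b f τ x
    have h1 := hn₀ b (fsmul f τ)
    rw [incl₁_fsmul, P.bracket_incl₀_mul f (incl₂_homogeneous b) (incl₁_homogeneous τ), hρ, ← hn₀,
      ← incl₁_fsmul, ← incl₁_fsmul, ← incl₁_add] at h1
    have h2 := congrArg (fun s : 𝓓 => s x) (incl₁_injective h1)
    refine h2.trans ?_
    rw [ContMDiffSection.coe_add, Pi.add_apply, fsmul_apply, fsmul_apply, anchorFun_apply, add_comm]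
  have hf : ∀ f b τ, n₀ (fsmul f b) τ = fsmul f (n₀ b τ) := fun f b τ => by
    apply incl₁_injective (FB := FB) (B := B)
    rw [incl₁_fsmul, hn₀, hn₀, P.bracket_fsmul_two f b (incl₁_homogeneous τ) (by norm_num)]
  obtain ⟨n₁, hn₁⟩ := exists_nabla_dual ρ n₀ hl
  refine ⟨⟨ρ, br, fun a b => ?_, fun a b f x => ?_, bd, fun x t t' => ?_, n₀, hf, hl, n₁, hn₁, R,
    fun x b c q q' => ?_⟩, hρ, hbd, fun b τ => (hn₀ b τ).symm, fun b c x => (hbr b c x).symm,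
    fun b c x q q' => ?_⟩
  · ext x
    rw [hbr, P.skew_two, val_neg, map_neg, ← hbr]
    rfl
  · rw [hbr, incl₂_fsmul, P.bracket_incl₀_mul f (incl₂_homogeneous a) (incl₂_homogeneous b), hρ]
    simp only [val_add, val_mul, val_incl₀, val_incl₂, ← Algebra.smul_def, map_add, map_smul,
      FreeAlg.coeff₂_gen₂, ← hbr, anchorFun_apply]
    rw [add_comm]
  · obtain ⟨τ, rfl⟩ := exists_dual_eq (m := m) FQ Q t
    obtain ⟨τ', rfl⟩ := exists_dual_eq (m := m) FQ Q t'
    have h := P.pairing_symm τ τ'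
    rw [hbd, hbd] at h
    exact DFunLike.congr_fun (incl₀_injective h) x
  · obtain ⟨b, rfl⟩ := exists_sec_eq (m := m) FB B b
    obtain ⟨c, rfl⟩ := exists_sec_eq (m := m) FB B c
    have h := FreeAlg.form_swap q q' (val (P.bracket ⊤ (incl₂ FQ Q b) (incl₂ FQ Q c)) x)
    refine (hR b c x q q').trans (Eq.trans ?_ (congrArg Neg.neg (hR b c x q' q)).symm)
    rw [curv_apply, curv_apply, h]
  · refine Eq.trans ?_ (congrArg Neg.neg (hR b c x q q')).symm
    rw [curv_apply, neg_neg]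

end PreBracket

end ExistsPreRep
end SplitPoisson
end

/-! ### Brackets with products of two sections of the dual bundle -/

open Bundle Manifold Set TopologicalSpace
open scoped Manifold ContDiff Bundle Topology TensorProduct
noncomputable section
namespace SplitPoisson
set_option linter.unusedSectionVars false
section Jacobi


variable {m : ℕ} {M : Type*} [TopologicalSpace M] [ChartedSpace (EuclideanSpace ℝ (Fin m)) M]
  [T2Space M] [IsManifold (𝓡 m) ∞ M]
  {FQ : Type*} [NormedAddCommGroup FQ] [NormedSpace ℝ FQ] [FiniteDimensional ℝ FQ]
  {Q : M → Type*} [TopologicalSpace (TotalSpace FQ Q)] [∀ x, AddCommGroup (Q x)]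
  [∀ x, Module ℝ (Q x)] [∀ x, TopologicalSpace (Q x)] [∀ x, IsTopologicalAddGroup (Q x)]
  [∀ x, ContinuousSMul ℝ (Q x)] [FiberBundle FQ Q] [VectorBundle ℝ FQ Q]
  [ContMDiffVectorBundle ∞ FQ Q (𝓡 m)]
  {FB : Type*} [NormedAddCommGroup FB] [NormedSpace ℝ FB] [FiniteDimensional ℝ FB]
  {B : M → Type*} [TopologicalSpace (TotalSpace FB B)] [∀ x, AddCommGroup (B x)]
  [∀ x, Module ℝ (B x)] [∀ x, TopologicalSpace (B x)] [FiberBundle FB B] [VectorBundle ℝ FB B]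
  [ContMDiffVectorBundle ∞ FB B (𝓡 m)]


local notation "𝓕" => Fun (𝓡 m) FB B FQ Q
local notation "𝓢" => Sec (𝓡 m) FB B
local notation "𝓓" => Sec (𝓡 m) (FQ →L[ℝ] ℝ) (DualBundle Q)

variable (m FQ Q FB B) in
/-- The sums of products of two sections of `Q*`. -/
abbrev Quad : AddSubmonoid (𝓕 ⊤) := AddSubmonoid.closure
  {Θ : 𝓕 ⊤ | ∃ τ τ' : 𝓓, Θ = incl₁ FB B τ * incl₁ FB B τ'}

lemma incl₁_mul_homogeneous (τ τ' : 𝓓) :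
    Fun.IsHomogeneous 2 (incl₁ FB B τ * incl₁ FB B τ') := by
  have := (incl₁_homogeneous (FB := FB) (B := B) τ).mul (incl₁_homogeneous (FB := FB) (B := B) τ')
  rwa [show (1 : ℤ) + 1 = 2 by norm_num] at this

lemma Quad.homogeneous {Θ : 𝓕 ⊤} (h : Θ ∈ Quad m FQ Q FB B) : Fun.IsHomogeneous 2 Θ := by
  induction h using AddSubmonoid.closure_induction with
  | zero => exact isHomogeneous_zero _
  | add a b _ _ h1 h2 => exact h1.add h2
  | mem a ha =>
    obtain ⟨τ, τ', rfl⟩ := ha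
    exact incl₁_mul_homogeneous τ τ'

/-- Formulas derived from the Leibniz rule need actual products; without a `B`-component, an element
of degree two is locally a sum of such products. -/
lemma exists_germ_quad {Θ : 𝓕 ⊤} (h : Fun.IsHomogeneous 2 Θ)
    (hc : ∀ x, FreeAlg.coeff₂ _ _ (val Θ x) = 0) (x : M) :
    ∃ Θ' ∈ Quad m FQ Q FB B, GermEq x Θ Θ' := by
  obtain ⟨b, Θ', hΘ', hg⟩ := exists_germ_two h x
  refine ⟨Θ', hΘ', germEq_iff.2 ?_⟩
  filter_upwards [germEq_iff.1 hg] with y hy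
  have := hc y
  rw [hy, val_add, map_add, coeff₂_of_closure hΘ', add_zero, val_incl₂, FreeAlg.coeff₂_gen₂] at this
  rw [hy, val_add, val_incl₂, this, map_zero, zero_add]

lemma GermEq.refl {U : Opens M} (x : M) (ξ : 𝓕 U) : GermEq x ξ ξ :=
  Filter.Eventually.of_forall fun _ _ _ => rfl

namespace PreBracket

variable (P : PreBracket m FQ Q FB B)

lemma val_bracket_congr {x : M} {ξ ξ' η η' : 𝓕 ⊤} (h : GermEq x ξ ξ') (h' : GermEq x η η') :
    val (P.bracket ⊤ ξ η) x = val (P.bracket ⊤ ξ' η') x :=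
  (P.germ_congr (U := ⊤) (V := ⊤) trivial trivial h h').val_eq

end PreBracket

namespace Corr

variable {P : PreBracket m FQ Q FB B} {D : PreRep m FQ Q FB B} (h : Corr P D)
include h

lemma bracket_quad_fn {Θ : 𝓕 ⊤} (hΘ : Θ ∈ Quad m FQ Q FB B) (f : SmoothFun m M) :
    P.bracket ⊤ Θ (incl₀ FB B FQ Q f) = 0 := by
  induction hΘ using AddSubmonoid.closure_induction with
  | zero => exact (P.bracket ⊤).map_zero₂ _
  | add a b _ _ h1 h2 => rw [(P.bracket ⊤).map_add₂, h1, h2, add_zero]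
  | mem a ha =>
    obtain ⟨τ, τ', rfl⟩ := ha
    rw [P.skew' ((incl₁_homogeneous τ).mul (incl₁_homogeneous τ')) (incl₀_homogeneous f),
      P.leibniz' (incl₀_homogeneous f) (incl₁_homogeneous τ) (incl₁_homogeneous τ'),
      P.bracket_eq_zero (incl₀_homogeneous f) (incl₁_homogeneous τ) (by norm_num),
      P.bracket_eq_zero (incl₀_homogeneous f) (incl₁_homogeneous τ') (by norm_num)]
    simp

lemma bracket_mul_dual (τ₁ τ₂ τ : 𝓓) :
    P.bracket ⊤ (incl₁ FB B τ₁ * incl₁ FB B τ₂) (incl₁ FB B τ) =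
      incl₁ FB B (fsmul (pairing τ₂ (homApply D.bd τ)) τ₁) -
      incl₁ FB B (fsmul (pairing τ₁ (homApply D.bd τ)) τ₂) := by
  have e1 : koszul ((1 + 1) * 1) = 1 := if_pos ⟨1, rfl⟩
  have e2 : koszul (1 * 1) = -1 := by simp [koszul]
  rw [P.skew' ((incl₁_homogeneous τ₁).mul (incl₁_homogeneous τ₂)) (incl₁_homogeneous τ),
    P.leibniz' (incl₁_homogeneous τ) (incl₁_homogeneous τ₁) (incl₁_homogeneous τ₂), e1, e2,
    h.one_one, h.one_one, one_smul, neg_one_smul, incl₁_fsmul, incl₁_fsmul]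
  refine fun_ext fun x => ?_
  simp only [val_neg, val_add, val_sub, val_mul, val_incl₀, val_incl₁, ← Algebra.smul_def]
  rw [← Algebra.commutes, ← Algebra.smul_def]
  abel

/-- On a product, the Leibniz rule and `{τ, τᵢ} = ⟨τᵢ, ∂τ⟩` give minus the contraction with `∂τ`;
both sides are additive. -/
lemma coeff₁_bracket_quad {Θ : 𝓕 ⊤} (hΘ : Θ ∈ Quad m FQ Q FB B) (τ : 𝓓) (x : M) (q : Q x) :
    FreeAlg.coeff₁ _ _ (val (P.bracket ⊤ Θ (incl₁ FB B τ)) x) q =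
      -FreeAlg.form _ _ (D.bd x (τ x)) q (val Θ x) := by
  induction hΘ using AddSubmonoid.closure_induction with
  | zero =>
    rw [(P.bracket ⊤).map_zero₂, val_zero, map_zero, map_zero, neg_zero]
    rfl
  | add a b _ _ h1 h2 =>
    rw [(P.bracket ⊤).map_add₂, val_add, val_add, map_add, map_add, neg_add, ← h1, ← h2]
    rfl
  | mem a ha =>
    obtain ⟨τ₁, τ₂, rfl⟩ := ha
    rw [h.bracket_mul_dual]
    simp only [val_sub, val_mul, val_incl₁, map_sub, FreeAlg.coeff₁_gen₁,
      FreeAlg.form_gen₁_mul_gen₁, fsmul_apply, pairing_apply, homApply_apply]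
    change τ₂ x (D.bd x (τ x)) * τ₁ x q - τ₁ x (D.bd x (τ x)) * τ₂ x q = _
    ring

lemma bracket_sec_mul (b : 𝓢) (τ₁ τ₂ : 𝓓) :
    P.bracket ⊤ (incl₂ FQ Q b) (incl₁ FB B τ₁ * incl₁ FB B τ₂) =
      incl₁ FB B (D.nabla₀ b τ₁) * incl₁ FB B τ₂ +
      incl₁ FB B τ₁ * incl₁ FB B (D.nabla₀ b τ₂) := by
  have e1 : koszul (2 * 1) = 1 := if_pos ⟨1, rfl⟩
  rw [P.leibniz' (incl₂_homogeneous b) (incl₁_homogeneous τ₁) (incl₁_homogeneous τ₂), e1,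
    h.two_one, h.two_one, one_smul]

lemma coeff₂_bracket_sec_quad (b : 𝓢) {Θ : 𝓕 ⊤} (hΘ : Θ ∈ Quad m FQ Q FB B) (x : M) :
    FreeAlg.coeff₂ _ _ (val (P.bracket ⊤ (incl₂ FQ Q b) Θ) x) = 0 := by
  induction hΘ using AddSubmonoid.closure_induction with
  | zero => rw [(P.bracket ⊤ (incl₂ FQ Q b)).map_zero, val_zero, map_zero]
  | add Θ Θ' _ _ h1 h2 =>
    rw [(P.bracket ⊤ (incl₂ FQ Q b)).map_add, val_add, map_add, h1, h2, add_zero]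
  | mem a ha =>
    obtain ⟨τ₁, τ₂, rfl⟩ := ha
    rw [h.bracket_sec_mul]
    simp

/-- `{b, ·}` acts on a product as the connection on `Q*` extended as a derivation. Duality rewrites
this as the usual formula for the covariant derivative of a 2-form, in terms of the connection on
`Q`. -/
lemma form_bracket_sec_mul (b : 𝓢) (τ₁ τ₂ : 𝓓) (q q' : Sec (𝓡 m) FQ Q) (x : M) :
    FreeAlg.form _ _ (q x) (q' x)
      (val (P.bracket ⊤ (incl₂ FQ Q b) (incl₁ FB B τ₁ * incl₁ FB B τ₂)) x) =
      tderiv (D.anchor x (b x)) (formFun (incl₁_mul_homogeneous (FB := FB) (B := B) τ₁ τ₂) q q') -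
      FreeAlg.form _ _ (D.nabla₁ b q x) (q' x) (val (incl₁ FB B τ₁ * incl₁ FB B τ₂) x) -
      FreeAlg.form _ _ (q x) (D.nabla₁ b q' x) (val (incl₁ FB B τ₁ * incl₁ FB B τ₂) x) := by
  have e : formFun (incl₁_mul_homogeneous (FB := FB) (B := B) τ₁ τ₂) q q' =
      pairing τ₁ q * pairing τ₂ q' - pairing τ₁ q' * pairing τ₂ q :=
    ContMDiffMap.ext fun y => FreeAlg.form_gen₁_mul_gen₁ _ _ _ _
  rw [e, h.bracket_sec_mul, map_sub, tderiv_mul, tderiv_mul, D.conn_dual, D.conn_dual, D.conn_dual,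
    D.conn_dual]
  simp only [val_add, val_mul, val_incl₁, map_add, FreeAlg.form_gen₁_mul_gen₁, pairing_apply]
  ring

lemma form_bracket_sec_quad (b : 𝓢) {Θ : 𝓕 ⊤} (hΘ : Θ ∈ Quad m FQ Q FB B)
    (q q' : Sec (𝓡 m) FQ Q) (x : M) :
    FreeAlg.form _ _ (q x) (q' x) (val (P.bracket ⊤ (incl₂ FQ Q b) Θ) x) =
      tderiv (D.anchor x (b x)) (formFun (Quad.homogeneous hΘ) q q') -
      FreeAlg.form _ _ (D.nabla₁ b q x) (q' x) (val Θ x) -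
      FreeAlg.form _ _ (q x) (D.nabla₁ b q' x) (val Θ x) := by
  induction hΘ using AddSubmonoid.closure_induction with
  | zero =>
    have e : formFun (Quad.homogeneous (zero_mem (Quad m FQ Q FB B))) q q' = 0 := by
      ext y
      rw [formFun_apply, val_zero, map_zero]
      rfl
    rw [e, (P.bracket ⊤ (incl₂ FQ Q b)).map_zero, val_zero, map_zero, map_zero, map_zero, map_zero]
    simp
  | add Θ Θ' k1 k2 h1 h2 =>
    have e : formFun (Quad.homogeneous (add_mem k1 k2)) q q' =
        formFun (Quad.homogeneous k1) q q' + formFun (Quad.homogeneous k2) q q' := by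
      ext y
      rw [formFun_apply, val_add, map_add]
      rfl
    rw [e, (P.bracket ⊤ (incl₂ FQ Q b)).map_add, val_add, val_add, map_add, map_add, map_add,
      map_add, h1, h2]
    ring
  | mem a ha =>
    obtain ⟨τ₁, τ₂, rfl⟩ := ha
    exact h.form_bracket_sec_mul b τ₁ τ₂ q q' x

end Corr

end Jacobi
end SplitPoisson
end

/-! ### The Jacobiator on generators -/

open Bundle Manifold Set TopologicalSpace
open scoped Manifold ContDiff Bundle Topology TensorProduct
noncomputable section
namespace SplitPoisson
set_option linter.unusedSectionVars false
set_option maxHeartbeats 1000000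
section Jacobi

variable {m : ℕ} {M : Type*} [TopologicalSpace M] [ChartedSpace (EuclideanSpace ℝ (Fin m)) M]
  [T2Space M] [IsManifold (𝓡 m) ∞ M]
  {FQ : Type*} [NormedAddCommGroup FQ] [NormedSpace ℝ FQ] [FiniteDimensional ℝ FQ]
  {Q : M → Type*} [TopologicalSpace (TotalSpace FQ Q)] [∀ x, AddCommGroup (Q x)]
  [∀ x, Module ℝ (Q x)] [∀ x, TopologicalSpace (Q x)] [∀ x, IsTopologicalAddGroup (Q x)]
  [∀ x, ContinuousSMul ℝ (Q x)] [FiberBundle FQ Q] [VectorBundle ℝ FQ Q]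
  [ContMDiffVectorBundle ∞ FQ Q (𝓡 m)]
  {FB : Type*} [NormedAddCommGroup FB] [NormedSpace ℝ FB] [FiniteDimensional ℝ FB]
  {B : M → Type*} [TopologicalSpace (TotalSpace FB B)] [∀ x, AddCommGroup (B x)]
  [∀ x, Module ℝ (B x)] [∀ x, TopologicalSpace (B x)] [FiberBundle FB B] [VectorBundle ℝ FB B]
  [ContMDiffVectorBundle ∞ FB B (𝓡 m)]

local notation "𝓕" => Fun (𝓡 m) FB B FQ Q
local notation "𝓢" => Sec (𝓡 m) FB B
local notation "𝓓" => Sec (𝓡 m) (FQ →L[ℝ] ℝ) (DualBundle Q)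

/-- The difference `[b, c] - {b, c}`. -/
def defect (P : PreBracket m FQ Q FB B) (D : PreRep m FQ Q FB B) (b c : 𝓢) : 𝓕 ⊤ :=
  incl₂ FQ Q (D.bracket b c) - P.bracket ⊤ (incl₂ FQ Q b) (incl₂ FQ Q c)

lemma bracket_eq_sub_defect (P : PreBracket m FQ Q FB B) (D : PreRep m FQ Q FB B) (b c : 𝓢) :
    P.bracket ⊤ (incl₂ FQ Q b) (incl₂ FQ Q c) =
      incl₂ FQ Q (D.bracket b c) - defect P D b c := by
  rw [defect, sub_sub_cancel]

lemma defect_homogeneous (P : PreBracket m FQ Q FB B) (D : PreRep m FQ Q FB B) (b c : 𝓢) :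
    Fun.IsHomogeneous 2 (defect P D b c) :=
  fun x => sub_mem (incl₂_homogeneous (D.bracket b c) x) (P.degree_two_two b c x)

/-- An even first entry removes the sign. -/
lemma PreBracket.jac_two (P : PreBracket m FQ Q FB B) (j : ℤ) (ξ₁ ξ₂ ξ₃ : 𝓕 ⊤) : P.jac 2 j ξ₁ ξ₂ ξ₃ =
    P.bracket ⊤ ξ₁ (P.bracket ⊤ ξ₂ ξ₃) - P.bracket ⊤ (P.bracket ⊤ ξ₁ ξ₂) ξ₃ -
      P.bracket ⊤ ξ₂ (P.bracket ⊤ ξ₁ ξ₃) := by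
  have e : koszul (2 * j) = 1 := if_pos ⟨j, two_mul j⟩
  exact congrArg (fun η => P.bracket ⊤ ξ₁ (P.bracket ⊤ ξ₂ ξ₃) -
    P.bracket ⊤ (P.bracket ⊤ ξ₁ ξ₂) ξ₃ - η)
    ((congrArg (fun r : ℝ => r • P.bracket ⊤ ξ₂ (P.bracket ⊤ ξ₁ ξ₃)) e).trans (one_smul ℝ _))

lemma TwoForm.skew {F : Type*} [NormedAddCommGroup F] [NormedSpace ℝ F]
    {W : M → Type*} [TopologicalSpace (TotalSpace F W)] [∀ x, AddCommGroup (W x)]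
    [∀ x, Module ℝ (W x)] [∀ x, TopologicalSpace (W x)] [FiberBundle F W] [VectorBundle ℝ F W]
    (R : TwoForm FB B (𝓡 m) F W) (x : M) (b c : B x) : R.toFun x b c = -R.toFun x c b := by
  have e1 := R.alt x (b + c)
  rw [(R.toFun x).map_add₂, map_add, map_add, R.alt, R.alt, zero_add, add_zero] at e1
  exact eq_neg_of_add_eq_zero_left e1

namespace Corr

variable {P : PreBracket m FQ Q FB B} {D : PreRep m FQ Q FB B} (h : Corr P D)
include h

lemma coeff₂_defect (b c : 𝓢) (x : M) : FreeAlg.coeff₂ _ _ (val (defect P D b c) x) = 0 := by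
  rw [defect, val_sub, map_sub, h.coeff₂_two_two, val_incl₂, FreeAlg.coeff₂_gen₂, sub_self]

lemma form_defect (b c : 𝓢) (x : M) (q q' : Q x) :
    FreeAlg.form _ _ q q' (val (defect P D b c) x) = D.R.toFun x (b x) (c x) q q' := by
  rw [defect, val_sub, map_sub, h.form_two_two, val_incl₂, FreeAlg.form_gen₂, zero_sub, neg_neg]

/-- The defect has no `B`-component, so locally it is a sum of products of sections of `Q*`, and
locality of the bracket transfers the formula. The next lemmas on the defect use the same transfer.
-/
lemma bracket_defect_fn (b c : 𝓢) (f : SmoothFun m M) :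
    P.bracket ⊤ (defect P D b c) (incl₀ FB B FQ Q f) = 0 := by
  refine fun_ext fun x => ?_
  obtain ⟨Θ, hΘ, hg⟩ := exists_germ_quad (defect_homogeneous P D b c) (h.coeff₂_defect b c) x
  rw [P.val_bracket_congr hg (GermEq.refl x _), h.bracket_quad_fn hΘ]

lemma coeff₁_bracket_defect (b c : 𝓢) (τ : 𝓓) (x : M) (q : Q x) :
    FreeAlg.coeff₁ _ _ (val (P.bracket ⊤ (defect P D b c) (incl₁ FB B τ)) x) q =
      -D.R.toFun x (b x) (c x) (D.bd x (τ x)) q := by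
  obtain ⟨Θ, hΘ, hg⟩ := exists_germ_quad (defect_homogeneous P D b c) (h.coeff₂_defect b c) x
  rw [P.val_bracket_congr hg (GermEq.refl x _), h.coeff₁_bracket_quad hΘ, ← hg.val_eq,
    h.form_defect]

lemma coeff₂_bracket_sec_defect (a b c : 𝓢) (x : M) :
    FreeAlg.coeff₂ _ _ (val (P.bracket ⊤ (incl₂ FQ Q a) (defect P D b c)) x) = 0 := by
  obtain ⟨Θ, hΘ, hg⟩ := exists_germ_quad (defect_homogeneous P D b c) (h.coeff₂_defect b c) x
  rw [P.val_bracket_congr (GermEq.refl x _) hg, h.coeff₂_bracket_sec_quad a hΘ]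

/-- The defect is `R(b, c)` as a 2-form, and its bracket with `a` is the derivative of `R(b, c)`
under the connection induced on `Hom(Q, Q*)`. Duality expands the derivative of `⟨R(b, c) q, q'⟩`,
and the term with `∇_a q'` cancels. -/
lemma form_bracket_sec_defect (a b c : 𝓢) (q q' : Sec (𝓡 m) FQ Q) (x : M) :
    FreeAlg.form _ _ (q x) (q' x) (val (P.bracket ⊤ (incl₂ FQ Q a) (defect P D b c)) x) =
      D.nabla₀ a (homApply (D.R.eval b c) q) x (q' x) -
        D.R.toFun x (b x) (c x) (D.nabla₁ a q x) (q' x) := by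
  obtain ⟨Θ, hΘ, hg⟩ := exists_germ_quad (defect_homogeneous P D b c) (h.coeff₂_defect b c) x
  have e : ∀ᶠ y in 𝓝 x, formFun (Quad.homogeneous hΘ) q q' y =
      pairing (homApply (D.R.eval b c) q) q' y := by
    filter_upwards [germEq_iff.1 hg] with y hy
    rw [formFun_apply, ← hy, h.form_defect]
    rfl
  have e1 := h.form_bracket_sec_quad a hΘ q q' x
  rw [← hg.val_eq, h.form_defect, h.form_defect, tderiv_congr _ e, D.conn_dual] at e1
  have e2 : homApply (D.R.eval b c) q x (D.nabla₁ a q' x) =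
    D.R.toFun x (b x) (c x) (q x) (D.nabla₁ a q' x) := rfl
  rw [P.val_bracket_congr (GermEq.refl x _) hg, e1, e2]
  ring

lemma bracket_bracket_sec (b c : 𝓢) (ξ : 𝓕 ⊤) :
    P.bracket ⊤ (P.bracket ⊤ (incl₂ FQ Q b) (incl₂ FQ Q c)) ξ =
      P.bracket ⊤ (incl₂ FQ Q (D.bracket b c)) ξ - P.bracket ⊤ (defect P D b c) ξ :=
  (congrArg (fun η => P.bracket ⊤ η ξ) (bracket_eq_sub_defect P D b c)).trans
    ((P.bracket ⊤).map_sub₂ _ _ _)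

lemma bracket_sec_bracket (a b c : 𝓢) :
    P.bracket ⊤ (incl₂ FQ Q a) (P.bracket ⊤ (incl₂ FQ Q b) (incl₂ FQ Q c)) =
      P.bracket ⊤ (incl₂ FQ Q a) (incl₂ FQ Q (D.bracket b c)) -
        P.bracket ⊤ (incl₂ FQ Q a) (defect P D b c) :=
  (congrArg (P.bracket ⊤ (incl₂ FQ Q a)) (bracket_eq_sub_defect P D b c)).trans
    ((P.bracket ⊤ (incl₂ FQ Q a)).map_sub _ _)

/-- The curvature form does not interfere, since the defect brackets trivially with functions; what
remains is the compatibility of the anchor with the brackets. -/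
lemma jac_sec_sec_fn (b c : 𝓢) (f : SmoothFun m M) (x : M) :
    val (P.jac 2 2 (incl₂ FQ Q b) (incl₂ FQ Q c) (incl₀ FB B FQ Q f)) x = algebraMap ℝ _
      (tderiv (D.anchor x (b x)) (anchorFun D.anchor c f) -
        tderiv (D.anchor x (c x)) (anchorFun D.anchor b f) -
        tderiv (D.anchor x (D.bracket b c x)) f) := by
  rw [P.jac_two, h.bracket_bracket_sec, h.bracket_defect_fn, sub_zero, h.two_zero, h.two_zero,
    h.two_zero, h.two_zero, h.two_zero]
  simp only [val_sub, val_incl₀, anchorFun_apply, map_sub]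
  abel

/-- The double bracket contributes the curvature of the connection on `Q*`, and the defect
contributes `R ∘ ∂`. -/
lemma jac_sec_sec_dual (b c : 𝓢) (τ : 𝓓) (x : M) (q : Q x) :
    FreeAlg.coeff₁ _ _
      (val (P.jac 2 2 (incl₂ FQ Q b) (incl₂ FQ Q c) (incl₁ FB B τ)) x) q =
      D.nabla₀ b (D.nabla₀ c τ) x q - D.nabla₀ c (D.nabla₀ b τ) x q -
        D.nabla₀ (D.bracket b c) τ x q - D.R.toFun x (b x) (c x) (D.bd x (τ x)) q := by
  have e1 := h.coeff₁_bracket_defect b c τ x q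
  rw [P.jac_two, h.bracket_bracket_sec, h.two_one, h.two_one, h.two_one, h.two_one, h.two_one]
  rw [val_sub, val_sub, val_sub, map_sub, map_sub, map_sub, val_incl₁, val_incl₁, val_incl₁,
    FreeAlg.coeff₁_gen₁, FreeAlg.coeff₁_gen₁, FreeAlg.coeff₁_gen₁]
  change D.nabla₀ b (D.nabla₀ c τ) x q - (D.nabla₀ (D.bracket b c) τ x q -
    FreeAlg.coeff₁ _ _ (val (P.bracket ⊤ (defect P D b c) (incl₁ FB B τ)) x) q) -
    D.nabla₀ c (D.nabla₀ b τ) x q = _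
  rw [e1]
  ring

/-- The derivative of `⟨τ', ∂τ⟩` along `ρ(b)` is expanded by duality, leaving the commutator of `∂`
with the connections, paired with `τ'`. -/
lemma jac_sec_dual_dual (b : 𝓢) (τ τ' : 𝓓) (x : M) :
    val (P.jac 2 1 (incl₂ FQ Q b) (incl₁ FB B τ) (incl₁ FB B τ')) x = algebraMap ℝ _
      (τ' x (D.nabla₁ b (homApply D.bd τ) x) - τ' x (D.bd x (D.nabla₀ b τ x))) := by
  have e := D.conn_dual b τ' (homApply D.bd τ) x
  rw [P.jac_two, h.one_one, h.two_zero, h.two_one, h.two_one, h.one_one, h.one_one, val_sub, val_sub,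
    val_incl₀, val_incl₀, val_incl₀, anchorFun_apply, e, ← map_sub, ← map_sub, pairing_apply,
    pairing_apply, homApply_apply, homApply_apply]
  congr 1
  ring

lemma bracket_defect_sec (a b c : 𝓢) : P.bracket ⊤ (defect P D a b) (incl₂ FQ Q c) =
    -P.bracket ⊤ (incl₂ FQ Q c) (defect P D a b) := by
  have e : koszul (2 * 2) = 1 := if_pos ⟨2, rfl⟩
  rw [P.skew' (defect_homogeneous P D a b) (incl₂_homogeneous c), e, one_smul]

lemma jac_sec_sec_sec (a b c : 𝓢) : P.jac 2 2 (incl₂ FQ Q a) (incl₂ FQ Q b) (incl₂ FQ Q c) =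
    P.bracket ⊤ (incl₂ FQ Q a) (incl₂ FQ Q (D.bracket b c)) -
      P.bracket ⊤ (incl₂ FQ Q a) (defect P D b c) -
      (P.bracket ⊤ (incl₂ FQ Q (D.bracket a b)) (incl₂ FQ Q c) +
        P.bracket ⊤ (incl₂ FQ Q c) (defect P D a b)) -
      (P.bracket ⊤ (incl₂ FQ Q b) (incl₂ FQ Q (D.bracket a c)) -
        P.bracket ⊤ (incl₂ FQ Q b) (defect P D a c)) := by
  rw [P.jac_two, h.bracket_bracket_sec, h.bracket_sec_bracket a b c, h.bracket_sec_bracket b a c,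
    h.bracket_defect_sec, sub_neg_eq_add]

lemma coeff₂_jac_sec_sec_sec (a b c : 𝓢) (x : M) :
    FreeAlg.coeff₂ _ _ (val (P.jac 2 2 (incl₂ FQ Q a) (incl₂ FQ Q b) (incl₂ FQ Q c)) x) =
      D.bracket a (D.bracket b c) x - D.bracket (D.bracket a b) c x -
        D.bracket b (D.bracket a c) x := by
  rw [h.jac_sec_sec_sec]
  simp only [val_sub, val_add, map_sub, map_add, h.coeff₂_two_two, h.coeff₂_bracket_sec_defect,
    sub_zero, add_zero]

/-- The `∧²`-component is minus `(d_∇ R)(a, b, c)`: brackets of sections give the terms with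
`R([·,·], ·)`, and brackets with defects give the covariant derivatives. -/
lemma form_jac_sec_sec_sec (a b c : 𝓢) (q q' : Sec (𝓡 m) FQ Q) (x : M) :
    FreeAlg.form _ _ (q x) (q' x)
      (val (P.jac 2 2 (incl₂ FQ Q a) (incl₂ FQ Q b) (incl₂ FQ Q c)) x) =
    -(-D.R.toFun x (D.bracket a b x) (c x) (q x) (q' x) +
      D.R.toFun x (D.bracket a c x) (b x) (q x) (q' x) -
      D.R.toFun x (D.bracket b c x) (a x) (q x) (q' x)
      + (D.nabla₀ a (homApply (D.R.eval b c) q) x (q' x) -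
        D.R.toFun x (b x) (c x) (D.nabla₁ a q x) (q' x))
      - (D.nabla₀ b (homApply (D.R.eval a c) q) x (q' x) -
        D.R.toFun x (a x) (c x) (D.nabla₁ b q x) (q' x))
      + (D.nabla₀ c (homApply (D.R.eval a b) q) x (q' x) -
        D.R.toFun x (a x) (b x) (D.nabla₁ c q x) (q' x))) := by
  have hs : ∀ b c : B x, D.R.toFun x b c (q x) (q' x) = -D.R.toFun x c b (q x) (q' x) := by
    intro b c
    rw [D.R.skew x b c]
    rfl
  rw [h.jac_sec_sec_sec]
  simp only [val_sub, val_add, map_sub, map_add, h.form_two_two, h.form_bracket_sec_defect]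
  rw [hs (a x), hs (b x) (D.bracket a c x)]
  ring

end Corr

end Jacobi
end SplitPoisson
end

/-! ### The Jacobi identity is equivalent to the structure equations -/

open Bundle Manifold Set TopologicalSpace
open scoped Manifold ContDiff Bundle Topology TensorProduct
noncomputable section
namespace SplitPoisson
set_option linter.unusedSectionVars false
set_option maxHeartbeats 1000000
section Jacobi


variable {m : ℕ} {M : Type*} [TopologicalSpace M] [ChartedSpace (EuclideanSpace ℝ (Fin m)) M]
  [T2Space M] [IsManifold (𝓡 m) ∞ M]
  {FQ : Type*} [NormedAddCommGroup FQ] [NormedSpace ℝ FQ] [FiniteDimensional ℝ FQ]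
  {Q : M → Type*} [TopologicalSpace (TotalSpace FQ Q)] [∀ x, AddCommGroup (Q x)]
  [∀ x, Module ℝ (Q x)] [∀ x, TopologicalSpace (Q x)] [∀ x, IsTopologicalAddGroup (Q x)]
  [∀ x, ContinuousSMul ℝ (Q x)] [FiberBundle FQ Q] [VectorBundle ℝ FQ Q]
  [ContMDiffVectorBundle ∞ FQ Q (𝓡 m)]
  {FB : Type*} [NormedAddCommGroup FB] [NormedSpace ℝ FB] [FiniteDimensional ℝ FB]
  {B : M → Type*} [TopologicalSpace (TotalSpace FB B)] [∀ x, AddCommGroup (B x)]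
  [∀ x, Module ℝ (B x)] [∀ x, TopologicalSpace (B x)] [FiberBundle FB B] [VectorBundle ℝ FB B]
  [ContMDiffVectorBundle ∞ FB B (𝓡 m)]


local notation "𝓕" => Fun (𝓡 m) FB B FQ Q
local notation "𝓢" => Sec (𝓡 m) FB B
local notation "𝓓" => Sec (𝓡 m) (FQ →L[ℝ] ℝ) (DualBundle Q)

/-- The generators: smooth functions, sections of `Q*` and sections of `B`. -/
inductive Gen : ℤ → 𝓕 ⊤ → Prop
  | fn (f : SmoothFun m M) : Gen 0 (incl₀ FB B FQ Q f)
  | dual (τ : 𝓓) : Gen 1 (incl₁ FB B τ)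
  | sec (b : 𝓢) : Gen 2 (incl₂ FQ Q b)

lemma Gen.homogeneous {n : ℤ} {ξ : 𝓕 ⊤} (h : Gen n ξ) : Fun.IsHomogeneous n ξ := by
  cases h with
  | fn f => exact incl₀_homogeneous f
  | dual f => exact incl₁_homogeneous f
  | sec f => exact incl₂_homogeneous f

lemma GermEq.sub {U V : Opens M} {x : M} {ξ η : 𝓕 U} {ξ' η' : 𝓕 V} (h : GermEq x ξ ξ')
    (h' : GermEq x η η') : GermEq x (ξ - η) (ξ' - η') := by
  filter_upwards [h, h'] with y h1 h2 h3 h4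
  exact congrArg₂ (· - ·) (h1 h3 h4) (h2 h3 h4)

lemma GermEq.smul {U V : Opens M} {x : M} {ξ : 𝓕 U} {ξ' : 𝓕 V} (h : GermEq x ξ ξ') (r : ℝ) :
    GermEq x (r • ξ) (r • ξ') := by
  filter_upwards [h] with y h1 h3 h4
  exact congrArg (r • ·) (h1 h3 h4)

namespace PreBracket

variable (P : PreBracket m FQ Q FB B)

/-- The graded Jacobi identity. -/
def Jacobi : Prop := ∀ {U : Opens M} {i j k : ℕ} {ξ₁ ξ₂ ξ₃ : 𝓕 U}, Fun.IsHomogeneous i ξ₁ →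
  Fun.IsHomogeneous j ξ₂ → Fun.IsHomogeneous k ξ₃ → P.jac i j ξ₁ ξ₂ ξ₃ = 0

variable {P}

lemma jac_eq_zero_of_low {i j k : ℤ} {ξ₁ ξ₂ ξ₃ : 𝓕 ⊤} (h₁ : Fun.IsHomogeneous i ξ₁)
    (h₂ : Fun.IsHomogeneous j ξ₂) (h₃ : Fun.IsHomogeneous k ξ₃) (h : i + j + k < 4) :
    P.jac i j ξ₁ ξ₂ ξ₃ = 0 := (P.jac_homogeneous h₁ h₂ h₃).eq_zero (by omega)

lemma jac_eq_zero_of_gen_right {i j : ℤ} {ξ₁ ξ₂ : 𝓕 ⊤} (h₁ : Fun.IsHomogeneous i ξ₁)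
    (h₂ : Fun.IsHomogeneous j ξ₂) (h : ∀ k ζ, Gen k ζ → P.jac i j ξ₁ ξ₂ ζ = 0) {n : ℕ} {η : 𝓕 ⊤}
    (hη : HPoly n η) : P.jac i j ξ₁ ξ₂ η = 0 := by
  induction hη with
  | fn f => exact h _ _ (.fn f)
  | dual f => exact h _ _ (.dual f)
  | sec f => exact h _ _ (.sec f)
  | zero n =>
    have := P.jac_add i j ξ₁ ξ₂ 0 0
    rwa [add_zero, left_eq_add] at this
  | @add n η η' _ _ e1 e2 =>
    refine (P.jac_add i j ξ₁ ξ₂ η η').trans ?_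
    rw [e1, e2, add_zero]
  | @mul n k η η' k1 k2 e1 e2 =>
    refine (P.jac_mul h₁ h₂ k1.homogeneous k2.homogeneous).trans ?_
    rw [e1, e2, zero_mul, mul_zero, smul_zero, add_zero]

/-- Only the last entry can be reduced to generators directly, so the entries are treated one at a
time and brought to the last place by the swap lemmas. -/
lemma jac_eq_zero_of_gen (h : ∀ {i j k : ℤ} {ξ₁ ξ₂ ξ₃ : 𝓕 ⊤}, Gen i ξ₁ → Gen j ξ₂ → Gen k ξ₃ →
    P.jac i j ξ₁ ξ₂ ξ₃ = 0) {i j k : ℕ} {ξ₁ ξ₂ ξ₃ : 𝓕 ⊤} (h₁ : HPoly i ξ₁) (h₂ : HPoly j ξ₂)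
    (h₃ : HPoly k ξ₃) : P.jac i j ξ₁ ξ₂ ξ₃ = 0 := by
  have s1 : ∀ {i j : ℤ} {k : ℕ} {ξ₁ ξ₂ ξ₃ : 𝓕 ⊤}, Gen i ξ₁ → Gen j ξ₂ → HPoly k ξ₃ →
      P.jac i j ξ₁ ξ₂ ξ₃ = 0 := fun g₁ g₂ p₃ =>
    jac_eq_zero_of_gen_right g₁.homogeneous g₂.homogeneous (fun _ _ g₃ => h g₁ g₂ g₃) p₃
  have s2 : ∀ {i : ℤ} {j k : ℕ} {ξ₁ ξ₂ ξ₃ : 𝓕 ⊤}, Gen i ξ₁ → HPoly j ξ₂ → HPoly k ξ₃ →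
      P.jac i j ξ₁ ξ₂ ξ₃ = 0 := fun g₁ p₂ p₃ =>
    jac_eq_zero_of_gen_right g₁.homogeneous p₂.homogeneous (fun _ _ g₃ =>
      P.jac_swap₂₃ g₁.homogeneous p₂.homogeneous g₃.homogeneous (s1 g₁ g₃ p₂)) p₃
  exact jac_eq_zero_of_gen_right h₁.homogeneous h₂.homogeneous (fun _ _ g₃ =>
      P.jac_swap₂₃ h₁.homogeneous h₂.homogeneous g₃.homogeneous
        (P.jac_swap₁₂ h₁.homogeneous g₃.homogeneous (s2 g₃ h₁ h₂))) h₃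

variable (P) in
lemma jac_germ_congr {U V : Opens M} {x : M} (hU : x ∈ U) (hV : x ∈ V) (i j : ℤ) {ξ₁ ξ₂ ξ₃ : 𝓕 U}
    {η₁ η₂ η₃ : 𝓕 V} (h₁ : GermEq x ξ₁ η₁) (h₂ : GermEq x ξ₂ η₂) (h₃ : GermEq x ξ₃ η₃) :
    GermEq x (P.jac i j ξ₁ ξ₂ ξ₃) (P.jac i j η₁ η₂ η₃) :=
  ((P.germ_congr hU hV h₁ (P.germ_congr hU hV h₂ h₃)).sub
    (P.germ_congr hU hV (P.germ_congr hU hV h₁ h₂) h₃)).sub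
    ((P.germ_congr hU hV h₂ (P.germ_congr hU hV h₁ h₃)).smul _)

lemma jacobi_of_gen (h : ∀ {i j k : ℤ} {ξ₁ ξ₂ ξ₃ : 𝓕 ⊤}, Gen i ξ₁ → Gen j ξ₂ → Gen k ξ₃ →
    P.jac i j ξ₁ ξ₂ ξ₃ = 0) : P.Jacobi := by
  intro U i j k ξ₁ ξ₂ ξ₃ h₁ h₂ h₃
  refine Subtype.ext (funext fun x => ?_)
  obtain ⟨η₁, p₁, g₁⟩ := exists_hpoly h₁ x.2
  obtain ⟨η₂, p₂, g₂⟩ := exists_hpoly h₂ x.2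
  obtain ⟨η₃, p₃, g₃⟩ := exists_hpoly h₃ x.2
  have e := (P.jac_germ_congr (V := ⊤) x.2 trivial i j g₁ g₂ g₃).self_of_nhds x.2 trivial
  rw [jac_eq_zero_of_gen h p₁ p₂ p₃] at e
  exact e

end PreBracket

namespace Corr

variable {P : PreBracket m FQ Q FB B} {D : PreRep m FQ Q FB B}

/-- Each structure equation is one component of the vanishing of the Jacobiator on a triple of
generators. -/
lemma isFlat (h : Corr P D) (hJ : P.Jacobi) : D.IsFlat where
  anchor_bracket b c f x := by
    have e := h.jac_sec_sec_fn b c f x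
    rw [show P.jac 2 2 (incl₂ FQ Q b) (incl₂ FQ Q c) (incl₀ FB B FQ Q f) = 0 from
      hJ (i := 2) (j := 2) (k := 0) (incl₂_homogeneous b) (incl₂_homogeneous c)
        (incl₀_homogeneous f), val_zero] at e
    have e' := FreeAlg.algebraMap_inj ((map_zero (algebraMap ℝ _)).trans e)
    linarith
  jacobi a b c := by
    ext x
    have e := h.coeff₂_jac_sec_sec_sec a b c x
    rw [show P.jac 2 2 (incl₂ FQ Q a) (incl₂ FQ Q b) (incl₂ FQ Q c) = 0 from
      hJ (i := 2) (j := 2) (k := 2) (incl₂_homogeneous a) (incl₂_homogeneous b)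
        (incl₂_homogeneous c), val_zero, map_zero, eq_comm, sub_sub, sub_eq_zero] at e
    exact e
  bd_nabla b τ := by
    ext x
    refine sec_eq_of_pairing fun τ' => ?_
    have e := h.jac_sec_dual_dual b τ τ' x
    rw [show P.jac 2 1 (incl₂ FQ Q b) (incl₁ FB B τ) (incl₁ FB B τ') = 0 from
      hJ (i := 2) (j := 1) (k := 1) (incl₂_homogeneous b) (incl₁_homogeneous τ)
        (incl₁_homogeneous τ'), val_zero] at e
    have e' := FreeAlg.algebraMap_inj ((map_zero (algebraMap ℝ _)).trans e)
    exact (sub_eq_zero.1 e'.symm).symm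
  curvature₀ b c τ := by
    refine ContMDiffSection.ext fun x => dual_eq_of_pairing (m := m) (FQ := FQ)
      fun (q : Sec (𝓡 m) FQ Q) => ?_
    have e := h.jac_sec_sec_dual b c τ x (q x)
    rw [show P.jac 2 2 (incl₂ FQ Q b) (incl₂ FQ Q c) (incl₁ FB B τ) = 0 from
      hJ (i := 2) (j := 2) (k := 1) (incl₂_homogeneous b) (incl₂_homogeneous c)
        (incl₁_homogeneous τ), val_zero, map_zero, eq_comm] at e
    exact sub_eq_zero.1 e
  dR a b c q := by
    refine ContMDiffSection.ext fun x => dual_eq_of_pairing (m := m) (FQ := FQ)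
      fun (q' : Sec (𝓡 m) FQ Q) => ?_
    have e := h.form_jac_sec_sec_sec a b c q q' x
    rw [show P.jac 2 2 (incl₂ FQ Q a) (incl₂ FQ Q b) (incl₂ FQ Q c) = 0 from
      hJ (i := 2) (j := 2) (k := 2) (incl₂_homogeneous a) (incl₂_homogeneous b)
        (incl₂_homogeneous c), val_zero, map_zero, eq_comm, neg_eq_zero] at e
    exact e

lemma jac_fn (h : Corr P D) (hD : D.IsFlat) (b c : 𝓢) (f : SmoothFun m M) :
    P.jac 2 2 (incl₂ FQ Q b) (incl₂ FQ Q c) (incl₀ FB B FQ Q f) = 0 := by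
  refine fun_ext fun x => ?_
  rw [h.jac_sec_sec_fn, hD.anchor_bracket, sub_self, map_zero, val_zero]

/-- The Jacobiator has degree `1` here and is therefore a section of `Q*`, which can be tested
against sections of `Q`. -/
lemma jac_dual (h : Corr P D) (hD : D.IsFlat) (b c : 𝓢) (τ : 𝓓) :
    P.jac 2 2 (incl₂ FQ Q b) (incl₂ FQ Q c) (incl₁ FB B τ) = 0 := by
  have hd := P.jac_homogeneous (incl₂_homogeneous b) (incl₂_homogeneous c) (incl₁_homogeneous τ)
  rw [show (2 : ℤ) + 2 + 1 - 4 = 1 by norm_num] at hd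
  obtain ⟨u, hu⟩ := exists_eq_incl₁ hd
  have e : u = 0 := by
    refine ContMDiffSection.ext fun x => dual_eq_of_pairing (m := m) (FQ := FQ)
      fun (q : Sec (𝓡 m) FQ Q) => ?_
    have e1 := h.jac_sec_sec_dual b c τ x (q x)
    rw [hu, val_incl₁, FreeAlg.coeff₁_gen₁] at e1
    refine e1.trans (sub_eq_zero.2 ?_)
    exact congrArg (fun s : 𝓓 => s x (q x)) (hD.curvature₀ b c τ)
  rw [hu, e]
  exact (inclₗ₁ FQ Q FB B).map_zero

lemma jac_dual_dual (h : Corr P D) (hD : D.IsFlat) (b : 𝓢) (τ τ' : 𝓓) :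
    P.jac 2 1 (incl₂ FQ Q b) (incl₁ FB B τ) (incl₁ FB B τ') = 0 := by
  refine fun_ext fun x => ?_
  rw [h.jac_sec_dual_dual, ← hD.bd_nabla, homApply_apply, sub_self, map_zero, val_zero]

/-- The Jacobiator has degree `2` here; its `B`-component and its `∧²`-component vanish by different
structure equations. -/
lemma jac_sec (h : Corr P D) (hD : D.IsFlat) (a b c : 𝓢) :
    P.jac 2 2 (incl₂ FQ Q a) (incl₂ FQ Q b) (incl₂ FQ Q c) = 0 := by
  have hd := P.jac_homogeneous (incl₂_homogeneous a) (incl₂_homogeneous b) (incl₂_homogeneous c)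
  rw [show (2 : ℤ) + 2 + 2 - 4 = 2 by norm_num] at hd
  refine fun_ext fun x => val_eq_of_deg_two hd (isHomogeneous_zero _) x ?_ fun q q' => ?_
  · rw [h.coeff₂_jac_sec_sec_sec, hD.jacobi, val_zero, map_zero, sub_sub, sub_eq_zero]
    rfl
  · obtain ⟨q, rfl⟩ := exists_sec_eq (m := m) FQ Q q
    obtain ⟨q', rfl⟩ := exists_sec_eq (m := m) FQ Q q'
    refine (h.form_jac_sec_sec_sec a b c q q' x).trans ?_
    rw [val_zero, map_zero, neg_eq_zero]
    exact congrArg (fun s : 𝓓 => s x (q' x)) (hD.dR a b c q)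

/-- A triple of total degree below `4` has a Jacobiator of negative degree. Up to order the
remaining triples have degrees `(2,2,0)`, `(2,1,1)`, `(2,2,1)` and `(2,2,2)`, and skew symmetry
covers the other orders. -/
lemma jacobi (h : Corr P D) (hD : D.IsFlat) : P.Jacobi := by
  refine PreBracket.jacobi_of_gen fun {i j k ξ₁ ξ₂ ξ₃} g₁ g₂ g₃ => ?_
  have k1 := g₁.homogeneous
  have k2 := g₂.homogeneous
  have k3 := g₃.homogeneous
  by_cases hlow : i + j + k < 4
  · exact PreBracket.jac_eq_zero_of_low k1 k2 k3 hlow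
  cases g₁ with
  | fn f =>
    cases g₂ with
    | fn g => cases g₃ <;> exact absurd (by norm_num) hlow
    | dual τ => cases g₃ <;> exact absurd (by norm_num) hlow
    | sec b =>
      cases g₃ with
      | fn g => exact absurd (by norm_num) hlow
      | dual τ => exact absurd (by norm_num) hlow
      | sec c => exact P.jac_swap₁₂ k1 k2 (P.jac_swap₂₃ k2 k1 k3 (h.jac_fn hD b c f))
  | dual τ =>
    cases g₂ with
    | fn g => cases g₃ <;> exact absurd (by norm_num) hlow
    | dual τ' =>
      cases g₃ with
      | fn g => exact absurd (by norm_num) hlow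
      | dual τ => exact absurd (by norm_num) hlow
      | sec c => exact P.jac_swap₂₃ k1 k2 k3 (P.jac_swap₁₂ k1 k3 (h.jac_dual_dual hD c τ τ'))
    | sec b =>
      cases g₃ with
      | fn g => exact absurd (by norm_num) hlow
      | dual τ' => exact P.jac_swap₁₂ k1 k2 (h.jac_dual_dual hD b τ τ')
      | sec c => exact P.jac_swap₁₂ k1 k2 (P.jac_swap₂₃ k2 k1 k3 (h.jac_dual hD b c τ))
  | sec b =>
    cases g₂ with
    | fn g =>
      cases g₃ with
      | fn g => exact absurd (by norm_num) hlow
      | dual τ' => exact absurd (by norm_num) hlow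
      | sec c => exact P.jac_swap₂₃ k1 k2 k3 (h.jac_fn hD b c g)
    | dual τ =>
      cases g₃ with
      | fn g => exact absurd (by norm_num) hlow
      | dual τ' => exact h.jac_dual_dual hD b τ τ'
      | sec c => exact P.jac_swap₂₃ k1 k2 k3 (h.jac_dual hD b c τ)
    | sec c =>
      cases g₃ with
      | fn g => exact h.jac_fn hD b c g
      | dual τ' => exact h.jac_dual hD b c τ'
      | sec d => exact h.jac_sec hD b c d

end Corr

lemma PoissonBracket.toPreBracket_jacobi (P : PoissonBracket (𝓡 m) FB B FQ Q) :
    P.toPreBracket.Jacobi := by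
  intro U i j k ξ₁ ξ₂ ξ₃ h₁ h₂ h₃
  have e := P.jacobi h₁ h₂ h₃
  rw [PreBracket.jac, ← Nat.cast_mul, koszul_natCast, sub_sub, sub_eq_zero]
  exact e

/-- The Poisson bracket given by a bracket that satisfies the Jacobi identity. -/
def PreBracket.Jacobi.toPoissonBracket {P : PreBracket m FQ Q FB B} (h : P.Jacobi) :
    PoissonBracket (𝓡 m) FB B FQ Q where
  bracket := P.bracket
  res_bracket := P.res_bracket
  degree := P.degree
  skew := P.skew
  leibniz := P.leibniz
  jacobi := by
    intro U i j k ξ₁ ξ₂ ξ₃ h₁ h₂ h₃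
    have e := h h₁ h₂ h₃
    rw [PreBracket.jac, ← Nat.cast_mul, koszul_natCast, sub_sub, sub_eq_zero] at e
    exact e

lemma exists_equiv_of_relation {X Y : Type*} (r : X → Y → Prop) (h₁ : ∀ x, ∃ y, r x y)
    (h₂ : ∀ y, ∃ x, r x y) (h₃ : ∀ {x y y'}, r x y → r x y' → y = y')
    (h₄ : ∀ {x x' y}, r x y → r x' y → x = x') : ∃ Φ : X ≃ Y, ∀ x y, Φ x = y ↔ r x y := by
  choose f hf using h₁
  choose g hg using h₂
  exact ⟨⟨f, g, fun x => h₄ (hg _) (hf _), fun y => h₃ (hf _) (hg _)⟩, fun x y =>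
    ⟨fun e => e ▸ hf x, fun e => h₃ (hf x) e⟩⟩

/-- Everything except the existence of a bracket for given data is in place by now, and that
existence is isolated as a hypothesis. The Jacobi identity and flatness are transferred across
`Corr`. -/
lemma exists_equiv_of_existence (hex : ∀ D : PreRep m FQ Q FB B, ∃ P : PreBracket m FQ Q FB B, Corr P D) :
    ∃ Φ : PoissonBracket (𝓡 m) FB B FQ Q ≃ SelfDualTwoRep (𝓡 m) FB B FQ Q,
      ∀ P D, Φ P = D ↔ Corresponds P D := by
  refine exists_equiv_of_relation _ (fun P => ?_) (fun D => ?_) (fun {P D D'} h h' => ?_)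
    fun {P P' D} h h' => ?_
  · obtain ⟨D, hD⟩ := P.toPreBracket.exists_preRep
    exact ⟨(hD.isFlat P.toPreBracket_jacobi).toSelfDualTwoRep, corresponds_iff_corr.2 hD⟩
  · obtain ⟨P, hP⟩ := hex D.toPreRep
    exact ⟨PreBracket.Jacobi.toPoissonBracket (hP.jacobi D.isFlat), corresponds_iff_corr.2 hP⟩
  · exact SelfDualTwoRep.toPreRep_injective
      ((corresponds_iff_corr.1 h).preRep_unique (corresponds_iff_corr.1 h'))
  · exact PoissonBracket.ext
      ((corresponds_iff_corr.1 h).bracket_unique (corresponds_iff_corr.1 h'))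

end Jacobi
end SplitPoisson
end

/-! ### Differentiating functions with values in a fixed algebra -/

open Bundle Manifold Set TopologicalSpace
open scoped Manifold ContDiff Bundle Topology TensorProduct
noncomputable section
namespace SplitPoisson
set_option linter.unusedSectionVars false

section FunctionTensor

variable {m : ℕ} {M : Type*} [TopologicalSpace M] [ChartedSpace (EuclideanSpace ℝ (Fin m)) M]
  {A : Type*} [Ring A] [Algebra ℝ A]

variable (m A) in
/-- The evaluation at a point of the smooth functions with values in `A`. -/
def tensorEval (x : M) : SmoothFun m M ⊗[ℝ] A →ₐ[ℝ] A :=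
  Algebra.TensorProduct.lift ((Algebra.ofId ℝ A).comp
    { toFun := fun f : SmoothFun m M => f x
      map_one' := rfl
      map_mul' := fun _ _ => rfl
      map_zero' := rfl
      map_add' := fun _ _ => rfl
      commutes' := fun _ => rfl }) (AlgHom.id ℝ A) fun f a => Algebra.commutes (f x) a

@[simp] lemma tensorEval_tmul (x : M) (f : SmoothFun m M) (a : A) :
    tensorEval m A x (f ⊗ₜ a) = f x • a :=
  (Algebra.TensorProduct.lift_tmul ..).trans (Algebra.smul_def (f x) a).symm

variable (A) in
/-- The derivative of the smooth functions with values in `A` along a tangent vector. -/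
def tensorDeriv {x : M} (v : TangentSpace (𝓡 m) x) : SmoothFun m M ⊗[ℝ] A →ₗ[ℝ] A :=
  TensorProduct.lift (LinearMap.lsmul ℝ A ∘ₗ tderiv v)

@[simp] lemma tensorDeriv_tmul {x : M} (v : TangentSpace (𝓡 m) x) (f : SmoothFun m M) (a : A) :
    tensorDeriv A v (f ⊗ₜ a) = tderiv v f • a := rfl

lemma tensorDeriv_mul {x : M} (v : TangentSpace (𝓡 m) x) (t u : SmoothFun m M ⊗[ℝ] A) :
    tensorDeriv A v (t * u) =
      tensorDeriv A v t * tensorEval m A x u + tensorEval m A x t * tensorDeriv A v u := by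
  induction t with
  | zero => simp
  | add t t' h h' => rw [add_mul, map_add, map_add, map_add, h, h']; noncomm_ring
  | tmul f a =>
    induction u with
    | zero => simp
    | add u u' h h' => rw [mul_add, map_add, map_add, map_add, h, h']; noncomm_ring
    | tmul g b =>
      rw [Algebra.TensorProduct.tmul_mul_tmul]
      simp only [tensorDeriv_tmul, tensorEval_tmul, tderiv_mul, smul_mul_smul_comm, ← add_smul]
      congr 1
      ring

/-- The algebra carries no topology, so derivatives are taken on the algebraic tensor product.
Linear functionals separate the points of `A`, and applying one reduces the claim to the locality of
the derivative of scalar functions. -/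
lemma tensorDeriv_eq_zero [T2Space M] [IsManifold (𝓡 m) ∞ M] {x : M} (v : TangentSpace (𝓡 m) x)
    {t : SmoothFun m M ⊗[ℝ] A} (h : ∀ᶠ y in 𝓝 x, tensorEval m A y t = 0) :
    tensorDeriv A v t = 0 := by
  refine (Module.forall_dual_apply_eq_zero_iff ℝ _).1 fun φ => ?_
  let Φ : SmoothFun m M ⊗[ℝ] A →ₗ[ℝ] SmoothFun m M :=
    (TensorProduct.rid ℝ (SmoothFun m M)).toLinearMap ∘ₗ φ.lTensor (SmoothFun m M)
  have h1 : ∀ (y : M) t, Φ t y = φ (tensorEval m A y t) := by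
    intro y t
    induction t with
    | zero => simp
    | add t t' e e' => rw [map_add, map_add, map_add, ← e, ← e']; rfl
    | tmul f a =>
      simp [Φ, mul_comm]
  have h2 : ∀ t, tderiv v (Φ t) = φ (tensorDeriv A v t) := by
    intro t
    induction t with
    | zero => simp
    | add t t' e e' => rw [map_add, map_add, map_add, map_add, ← e, ← e']
    | tmul f a => simp [Φ, mul_comm]
  rw [← h2, tderiv_congr v (g := 0), map_zero]
  filter_upwards [h] with y hy
  rw [h1, hy, map_zero]
  rfl

end FunctionTensor

/-! ### The derivation of the functions attached to a tangent vector -/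

section Horizontal


variable {m : ℕ} {M : Type*} [TopologicalSpace M] [ChartedSpace (EuclideanSpace ℝ (Fin m)) M]
  [T2Space M] [IsManifold (𝓡 m) ∞ M]
  {FQ : Type*} [NormedAddCommGroup FQ] [NormedSpace ℝ FQ] [FiniteDimensional ℝ FQ]
  {Q : M → Type*} [TopologicalSpace (TotalSpace FQ Q)] [∀ x, AddCommGroup (Q x)]
  [∀ x, Module ℝ (Q x)] [∀ x, TopologicalSpace (Q x)] [∀ x, IsTopologicalAddGroup (Q x)]
  [∀ x, ContinuousSMul ℝ (Q x)] [FiberBundle FQ Q] [VectorBundle ℝ FQ Q]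
  [ContMDiffVectorBundle ∞ FQ Q (𝓡 m)]
  {FB : Type*} [NormedAddCommGroup FB] [NormedSpace ℝ FB] [FiniteDimensional ℝ FB]
  {B : M → Type*} [TopologicalSpace (TotalSpace FB B)] [∀ x, AddCommGroup (B x)]
  [∀ x, Module ℝ (B x)] [∀ x, TopologicalSpace (B x)] [FiberBundle FB B] [VectorBundle ℝ FB B]
  [ContMDiffVectorBundle ∞ FB B (𝓡 m)]

local notation "𝓕" => Fun (𝓡 m) FB B FQ Q
local notation "𝓢" => Sec (𝓡 m) FB B
local notation "𝓓" => Sec (𝓡 m) (FQ →L[ℝ] ℝ) (DualBundle Q)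

/-- Dual frames identify nearby fibres with the fibre at `x₀`. The maps are defined at every point,
invertible or not, so a transported section is everywhere a sum of coefficient functions tensored
with the frame at `x₀`. Recording the degree of the second factors ensures that differentiation
preserves it. -/
lemma exists_transport (x₀ : M) : ∃ T : Π x, FreeAlg (Q x) (B x) →ₐ[ℝ] FreeAlg (Q x₀) (B x₀),
    (∀ a, T x₀ a = a) ∧
    (∀ τ : 𝓓, ∃ t ∈ (⊤ : Submodule ℝ (SmoothFun m M)).map₂ (TensorProduct.mk ℝ _ _)
        (FreeAlg.deg (Q x₀) (B x₀) 1),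
      ∀ x, T x (FreeAlg.gen₁ _ _ (τ x)) = tensorEval m _ x t) ∧
    ∀ b : 𝓢, ∃ t ∈ (⊤ : Submodule ℝ (SmoothFun m M)).map₂ (TensorProduct.mk ℝ _ _)
        (FreeAlg.deg (Q x₀) (B x₀) 2),
      ∀ x, T x (FreeAlg.gen₂ _ _ (b x)) = tensorEval m _ x t := by
  let e := dualFrameAt (m := m) FQ Q x₀
  let e' := dualFrameAt (m := m) FB B x₀
  let f : Π x, (Q x →L[ℝ] ℝ) →ₗ[ℝ] (Q x₀ →L[ℝ] ℝ) := fun x =>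
    { toFun := fun t => ∑ i, t (e.s i x) • e.τ i x₀
      map_add' := fun t u => by simp [add_smul, Finset.sum_add_distrib]
      map_smul' := fun r t => by simp [mul_smul, Finset.smul_sum] }
  let g : Π x, B x →ₗ[ℝ] B x₀ := fun x =>
    { toFun := fun w => ∑ i, e'.τ i x w • e'.s i x₀
      map_add' := fun t u => by simp [add_smul, Finset.sum_add_distrib]
      map_smul' := fun r t => by simp [mul_smul, Finset.smul_sum] }
  refine ⟨fun x => FreeAlg.map (f x) (g x), fun a => ?_, fun τ => ?_, fun b => ?_⟩
  · change FreeAlg.map (f x₀) (g x₀) a = a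
    have h1 : f x₀ = LinearMap.id :=
      LinearMap.ext fun t => (e.expand_dual.self_of_nhds t).symm
    have h2 : g x₀ = LinearMap.id := LinearMap.ext fun w => (e'.expand_self w).symm
    rw [h1, h2, FreeAlg.map_id]
  · refine ⟨∑ i, pairing τ (e.s i) ⊗ₜ FreeAlg.gen₁ (Q x₀) (B x₀) (e.τ i x₀),
      sum_mem fun i _ => Submodule.apply_mem_map₂ _ trivial (FreeAlg.gen₁_mem_deg _), fun x => ?_⟩
    rw [FreeAlg.map_gen₁, map_sum]
    simp [f]
  · refine ⟨∑ i, pairing (e'.τ i) b ⊗ₜ FreeAlg.gen₂ (Q x₀) (B x₀) (e'.s i x₀),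
      sum_mem fun i _ => Submodule.apply_mem_map₂ _ trivial (FreeAlg.gen₂_mem_deg _), fun x => ?_⟩
    rw [FreeAlg.map_gen₂, map_sum]
    simp [g]

lemma tensorDeriv_mem {A : Type*} [Ring A] [Algebra ℝ A] {S : Submodule ℝ A} {x : M}
    (v : TangentSpace (𝓡 m) x) {t : SmoothFun m M ⊗[ℝ] A}
    (ht : t ∈ (⊤ : Submodule ℝ (SmoothFun m M)).map₂ (TensorProduct.mk ℝ _ _) S) :
    tensorDeriv A v t ∈ S := by
  have : (⊤ : Submodule ℝ (SmoothFun m M)).map₂ (TensorProduct.mk ℝ _ _) S ≤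
      S.comap (tensorDeriv A v) :=
    Submodule.map₂_le.2 fun f _ a ha => S.smul_mem (tderiv v f) ha
  exact this ht

/-- A tangent vector acts on the functions of `𝓜`. -/
lemma exists_horizontal {x₀ : M} (v : TangentSpace (𝓡 m) x₀) :
    ∃ H : 𝓕 ⊤ →ₗ[ℝ] FreeAlg (Q x₀) (B x₀), (∀ ξ η : 𝓕 ⊤, GermEq x₀ ξ η → H ξ = H η) ∧
      (∀ ξ η : 𝓕 ⊤, H (ξ * η) = H ξ * val η x₀ + val ξ x₀ * H η) ∧
      (∀ f : SmoothFun m M, H (incl₀ FB B FQ Q f) = algebraMap ℝ _ (tderiv v f)) ∧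
      (∀ τ : 𝓓, H (incl₁ FB B τ) ∈ FreeAlg.deg (Q x₀) (B x₀) 1) ∧
      ∀ b : 𝓢, H (incl₂ FQ Q b) ∈ FreeAlg.deg (Q x₀) (B x₀) 2 := by
  obtain ⟨T, hT, h₁, h₂⟩ := exists_transport (m := m) (FQ := FQ) (Q := Q) (FB := FB) (B := B) x₀
  let A := FreeAlg (Q x₀) (B x₀)
  -- The tensor `t` represents the germ of the transported `ξ`. Representatives exist for all
  -- functions because they do for generators.
  let r (ξ : 𝓕 ⊤) (t : SmoothFun m M ⊗[ℝ] A) : Prop :=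
    ∀ᶠ x in 𝓝 x₀, T x (val ξ x) = tensorEval m A x t
  have r_fn : ∀ f : SmoothFun m M, r (incl₀ FB B FQ Q f) (f ⊗ₜ 1) := fun f =>
    Filter.Eventually.of_forall fun x => by
      rw [val_incl₀, AlgHom.commutes, tensorEval_tmul, Algebra.algebraMap_eq_smul_one]
  have r_add : ∀ {ξ η t u}, r ξ t → r η u → r (ξ + η) (t + u) := fun h h' => by
    filter_upwards [h, h'] with x e e'
    rw [val_add, map_add, map_add, e, e']
  have r_mul : ∀ {ξ η t u}, r ξ t → r η u → r (ξ * η) (t * u) := fun h h' => by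
    filter_upwards [h, h'] with x e e'
    rw [val_mul, map_mul, map_mul, e, e']
  have r_smul : ∀ (c : ℝ) {ξ t}, r ξ t → r (c • ξ) (c • t) := fun c ξ t h => by
    filter_upwards [h] with x e
    rw [val_smul, map_smul, map_smul, e]
  have r_zero : r 0 0 := Filter.Eventually.of_forall fun x => by rw [val_zero, map_zero, map_zero]
  have r_hpoly : ∀ {n} {ξ : 𝓕 ⊤}, HPoly n ξ → ∃ t, r ξ t := by
    intro n ξ h
    induction h with
    | fn f => exact ⟨_, r_fn f⟩
    | dual τ =>
      obtain ⟨t, -, ht⟩ := h₁ τ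
      exact ⟨t, Filter.Eventually.of_forall ht⟩
    | sec b =>
      obtain ⟨t, -, ht⟩ := h₂ b
      exact ⟨t, Filter.Eventually.of_forall ht⟩
    | zero n => exact ⟨0, r_zero⟩
    | add _ _ h h' =>
      obtain ⟨t, ht⟩ := h
      obtain ⟨u, hu⟩ := h'
      exact ⟨_, r_add ht hu⟩
    | mul _ _ h h' =>
      obtain ⟨t, ht⟩ := h
      obtain ⟨u, hu⟩ := h'
      exact ⟨_, r_mul ht hu⟩
  have r_ex : ∀ ξ : 𝓕 ⊤, ∃ t, r ξ t := by
    intro ξ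
    obtain ⟨η, hη, hg⟩ := exists_poly ξ (x := x₀) trivial
    have : ∃ t, r η t := by
      clear hg
      induction hη using AddSubmonoid.closure_induction with
      | mem η h =>
        obtain ⟨n, h⟩ := h
        exact r_hpoly h
      | zero => exact ⟨0, r_zero⟩
      | add η η' _ _ h h' =>
        obtain ⟨t, ht⟩ := h
        obtain ⟨u, hu⟩ := h'
        exact ⟨_, r_add ht hu⟩
    obtain ⟨t, ht⟩ := this
    refine ⟨t, ?_⟩
    filter_upwards [ht, germEq_iff.1 hg] with x e e'
    rw [e', e]
  -- Two representatives of one germ have the same evaluations near `x₀`, hence the same derivative.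
  -- So the choice of `L` below is harmless, and linearity and the Leibniz rule may be checked on
  -- any representative.
  have r_uniq : ∀ {ξ η : 𝓕 ⊤} {t u}, GermEq x₀ ξ η → r ξ t → r η u →
      tensorDeriv A v t = tensorDeriv A v u := by
    intro ξ η t u hg ht hu
    rw [← sub_eq_zero, ← map_sub]
    refine tensorDeriv_eq_zero v ?_
    filter_upwards [ht, hu, germEq_iff.1 hg] with x e e' e''
    rw [map_sub, ← e, ← e', e'', sub_self]
  choose L hL using r_ex
  have key : ∀ {ξ t}, r ξ t → tensorDeriv A v (L ξ) = tensorDeriv A v t := fun {ξ t} h =>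
    r_uniq (Filter.Eventually.of_forall fun _ _ _ => rfl) (hL ξ) h
  have hval : ∀ ξ, tensorEval m A x₀ (L ξ) = val ξ x₀ := fun ξ =>
    (hL ξ).self_of_nhds.symm.trans (hT _)
  refine ⟨{ toFun := fun ξ => tensorDeriv A v (L ξ)
            map_add' := fun ξ η => (key (r_add (hL ξ) (hL η))).trans (map_add _ _ _)
            map_smul' := fun c ξ => (key (r_smul c (hL ξ))).trans (map_smul _ _ _) },
    fun ξ η h => r_uniq h (hL ξ) (hL η), fun ξ η => ?_, fun f => ?_, fun τ => ?_, fun b => ?_⟩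
  · refine (key (r_mul (hL ξ) (hL η))).trans ?_
    rw [tensorDeriv_mul, hval, hval]
    rfl
  · refine (key (r_fn f)).trans ?_
    rw [tensorDeriv_tmul, Algebra.algebraMap_eq_smul_one]
  · obtain ⟨t, ht, h⟩ := h₁ τ
    have e : tensorDeriv A v (L (incl₁ FB B τ)) = tensorDeriv A v t :=
      key (Filter.Eventually.of_forall h)
    exact e ▸ tensorDeriv_mem v ht
  · obtain ⟨t, ht, h⟩ := h₂ b
    have e : tensorDeriv A v (L (incl₂ FQ Q b)) = tensorDeriv A v t :=
      key (Filter.Eventually.of_forall h)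
    exact e ▸ tensorDeriv_mem v ht

end Horizontal
end SplitPoisson
end

/-! ### Derivations at a point with prescribed values on generators -/

open Bundle Manifold Set TopologicalSpace
open scoped Manifold ContDiff Bundle Topology TensorProduct
noncomputable section
namespace SplitPoisson
set_option linter.unusedSectionVars false

lemma koszul_congr {n k : ℤ} (h : Even (n - k)) : koszul n = koszul k := by
  have : Even n ↔ Even k := by
    rw [Int.even_sub] at h
    exact h
  simp only [koszul, this]

lemma koszul_mul (n k : ℤ) : koszul n * koszul k = koszul (n + k) := by
  by_cases hn : Even n <;> by_cases hk : Even k <;> simp [koszul, Int.even_add, hn, hk]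

lemma koszul_add_one (n : ℤ) : koszul (n + 1) = -koszul n := by
  by_cases hn : Even n <;> simp [koszul, hn]

namespace FreeAlg

variable {V W : Type*} [AddCommGroup V] [Module ℝ V] [TopologicalSpace V]
  [IsTopologicalAddGroup V] [ContinuousSMul ℝ V] [AddCommGroup W] [Module ℝ W]

lemma mul_comm_koszul {n k : ℤ} {a b : FreeAlg V W} (ha : a ∈ deg V W n) (hb : b ∈ deg V W k) :
    a * b = koszul (n * k) • (b * a) := by
  rcases lt_or_ge n 0 with hn | hn
  · rw [deg_neg hn, Submodule.mem_bot] at ha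
    simp [ha]
  rcases lt_or_ge k 0 with hk | hk
  · rw [deg_neg hk, Submodule.mem_bot] at hb
    simp [hb]
  lift n to ℕ using hn
  lift k to ℕ using hk
  rw [← Nat.cast_mul, koszul_natCast]
  exact mul_comm_of_mem_deg ha hb

lemma parity_koszul {n : ℤ} {a : FreeAlg V W} (ha : a ∈ deg V W n) :
    parity V W a = koszul n • a := by
  rcases lt_or_ge n 0 with hn | hn
  · rw [deg_neg hn, Submodule.mem_bot] at ha
    simp [ha]
  lift n to ℕ using hn
  rw [koszul_natCast]
  exact parity_of_mem_deg ha

lemma parity_mem_deg {n : ℤ} {a : FreeAlg V W} (ha : a ∈ deg V W n) :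
    parity V W a ∈ deg V W n := by
  rw [parity_koszul ha]
  exact Submodule.smul_mem _ _ ha

/-- An odd factor passing `a` absorbs the parity of `a`. Multiplying an odd derivation by an element
of degree `1` thus gives an untwisted even derivation. -/
lemma mul_parity {θ : FreeAlg V W} (hθ : θ ∈ deg V W 1) (a : FreeAlg V W) :
    θ * parity V W a = a * θ := by
  induction a using FreeAlg.induction with
  | hr r => rw [AlgHom.commutes, Algebra.commutes]
  | h₁ v =>
    rw [parity_gen₁, mul_neg, mul_comm_koszul hθ (gen₁_mem_deg v)]
    simp [koszul]
  | h₂ w => rw [parity_gen₂, (commute_gen₂_left w θ).eq]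
  | hadd a b ha hb => rw [map_add, mul_add, add_mul, ha, hb]
  | hmul a b ha hb => rw [map_mul, ← mul_assoc, ha, mul_assoc, hb, mul_assoc]

lemma commute_of_mem_deg_two {c : FreeAlg V W} (hc : c ∈ deg V W 2) (a : FreeAlg V W) :
    c * a = a * c := by
  induction a using FreeAlg.induction with
  | hr r => rw [Algebra.commutes]
  | h₁ v =>
    rw [mul_comm_koszul hc (gen₁_mem_deg v)]
    simp [koszul]
  | h₂ w => rw [(commute_gen₂_left w c).eq]
  | hadd a b ha hb => rw [mul_add, add_mul, ha, hb]
  | hmul a b ha hb => rw [← mul_assoc, ha, mul_assoc, hb, mul_assoc]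

end FreeAlg

section PointDerivation


variable {m : ℕ} {M : Type*} [TopologicalSpace M] [ChartedSpace (EuclideanSpace ℝ (Fin m)) M]
  [T2Space M] [IsManifold (𝓡 m) ∞ M]
  {FQ : Type*} [NormedAddCommGroup FQ] [NormedSpace ℝ FQ] [FiniteDimensional ℝ FQ]
  {Q : M → Type*} [TopologicalSpace (TotalSpace FQ Q)] [∀ x, AddCommGroup (Q x)]
  [∀ x, Module ℝ (Q x)] [∀ x, TopologicalSpace (Q x)] [∀ x, IsTopologicalAddGroup (Q x)]
  [∀ x, ContinuousSMul ℝ (Q x)] [FiberBundle FQ Q] [VectorBundle ℝ FQ Q]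
  [ContMDiffVectorBundle ∞ FQ Q (𝓡 m)]
  {FB : Type*} [NormedAddCommGroup FB] [NormedSpace ℝ FB] [FiniteDimensional ℝ FB]
  {B : M → Type*} [TopologicalSpace (TotalSpace FB B)] [∀ x, AddCommGroup (B x)]
  [∀ x, Module ℝ (B x)] [∀ x, TopologicalSpace (B x)] [FiberBundle FB B] [VectorBundle ℝ FB B]
  [ContMDiffVectorBundle ∞ FB B (𝓡 m)]

local notation "𝓕" => Fun (𝓡 m) FB B FQ Q
local notation "𝓢" => Sec (𝓡 m) FB B
local notation "𝓓" => Sec (𝓡 m) (FQ →L[ℝ] ℝ) (DualBundle Q)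

/-- A derivation of degree `d`, twisted by `σ`, of the functions of `𝓜` into their values at the
point `x`. -/
structure IsDerAt (x : M) (σ : FreeAlg (Q x) (B x) →ₐ[ℝ] FreeAlg (Q x) (B x)) (d : ℤ)
    (δ : 𝓕 ⊤ →ₗ[ℝ] FreeAlg (Q x) (B x)) : Prop where
  twist_mem : ∀ {n : ℤ} {a}, a ∈ FreeAlg.deg (Q x) (B x) n → σ a ∈ FreeAlg.deg (Q x) (B x) n
  germ : ∀ {ξ η : 𝓕 ⊤}, GermEq x ξ η → δ ξ = δ η
  leibniz : ∀ ξ η : 𝓕 ⊤, δ (ξ * η) = δ ξ * val η x + σ (val ξ x) * δ η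
  fn : ∀ f : SmoothFun m M, δ (incl₀ FB B FQ Q f) ∈ FreeAlg.deg (Q x) (B x) d
  dual : ∀ τ : 𝓓, δ (incl₁ FB B τ) ∈ FreeAlg.deg (Q x) (B x) (1 + d)
  sec : ∀ b : 𝓢, δ (incl₂ FQ Q b) ∈ FreeAlg.deg (Q x) (B x) (2 + d)

local notation "Der" => IsDerAt (m := m) (FQ := FQ) (Q := Q) (FB := FB) (B := B)

namespace IsDerAt

variable {x : M} {σ : FreeAlg (Q x) (B x) →ₐ[ℝ] FreeAlg (Q x) (B x)} {d : ℤ}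

lemma mem_deg_of_hpoly {δ : 𝓕 ⊤ →ₗ[ℝ] FreeAlg (Q x) (B x)}
    (h : Der x σ d δ) {n : ℕ} {ξ : 𝓕 ⊤} (hξ : HPoly n ξ) :
    δ ξ ∈ FreeAlg.deg (Q x) (B x) (n + d) := by
  induction hξ with
  | fn f => simpa using h.fn f
  | dual τ => simpa using h.dual τ
  | sec b => simpa using h.sec b
  | zero n => rw [map_zero]; exact zero_mem _
  | add _ _ h1 h2 => rw [map_add]; exact add_mem h1 h2
  | @mul n k ξ η hξ hη h1 h2 =>
    rw [h.leibniz]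
    refine add_mem ?_ ?_
    · have e := FreeAlg.mul_mem_deg h1 (hη.val_mem x)
      rwa [show (n : ℤ) + d + k = ((n + k : ℕ) : ℤ) + d by push_cast; ring] at e
    · have e := FreeAlg.mul_mem_deg (h.twist_mem (hξ.val_mem x)) h2
      rwa [show (n : ℤ) + (k + d) = ((n + k : ℕ) : ℤ) + d by push_cast; ring] at e

lemma mem_deg {δ : 𝓕 ⊤ →ₗ[ℝ] FreeAlg (Q x) (B x)} (h : Der x σ d δ) {n : ℕ} {ξ : 𝓕 ⊤} (hξ : Fun.IsHomogeneous n ξ) :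
    δ ξ ∈ FreeAlg.deg (Q x) (B x) (n + d) := by
  obtain ⟨η, hη, hg⟩ := exists_hpoly hξ (x := x) trivial
  rw [h.germ hg]
  exact h.mem_deg_of_hpoly hη

lemma add {δ δ' : 𝓕 ⊤ →ₗ[ℝ] FreeAlg (Q x) (B x)} (h : Der x σ d δ) (h' : Der x σ d δ') : Der x σ d (δ + δ') where
  twist_mem := h.twist_mem
  germ hg := congrArg₂ (· + ·) (h.germ hg) (h'.germ hg)
  leibniz ξ η := by
    simp only [LinearMap.add_apply, h.leibniz, h'.leibniz, add_mul, mul_add]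
    abel
  fn f := add_mem (h.fn f) (h'.fn f)
  dual τ := add_mem (h.dual τ) (h'.dual τ)
  sec b := add_mem (h.sec b) (h'.sec b)

lemma sum {ι : Type*} (s : Finset ι) {δ : ι → 𝓕 ⊤ →ₗ[ℝ] FreeAlg (Q x) (B x)}
    {δ₀ : 𝓕 ⊤ →ₗ[ℝ] FreeAlg (Q x) (B x)}
    (h₀ : Der x σ d δ₀) (h : ∀ i, Der x σ d (δ i)) :
    Der x σ d (δ₀ + ∑ i ∈ s, δ i) := by
  classical
  induction s using Finset.induction_on with
  | empty => simpa using h₀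
  | insert i s hi hs =>
    rw [Finset.sum_insert hi, add_left_comm]
    exact (h i).add hs

lemma mul_left {δ : 𝓕 ⊤ →ₗ[ℝ] FreeAlg (Q x) (B x)}
    {a : FreeAlg (Q x) (B x)} {n : ℤ} {σ' : FreeAlg (Q x) (B x) →ₐ[ℝ] FreeAlg (Q x) (B x)}
    (h : Der x σ d δ) (ha : a ∈ FreeAlg.deg (Q x) (B x) n)
    (hσ' : ∀ {n : ℤ} {a}, a ∈ FreeAlg.deg (Q x) (B x) n → σ' a ∈ FreeAlg.deg (Q x) (B x) n)
    (hc : ∀ b, a * σ b = σ' b * a) :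
    Der x σ' (n + d) (LinearMap.mulLeft ℝ a ∘ₗ δ) where
  twist_mem := hσ'
  germ hg := congrArg (a * ·) (h.germ hg)
  leibniz ξ η := by
    simp only [LinearMap.comp_apply, LinearMap.mulLeft_apply, h.leibniz, mul_add]
    rw [← mul_assoc, ← mul_assoc, hc, mul_assoc (σ' _)]
  fn f := FreeAlg.mul_mem_deg ha (h.fn f)
  dual τ := by
    rw [add_left_comm]
    exact FreeAlg.mul_mem_deg ha (h.dual τ)
  sec b := by
    rw [add_left_comm]
    exact FreeAlg.mul_mem_deg ha (h.sec b)

end IsDerAt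

/-- The fibrewise odd derivation composed with evaluation at `x`; it involves no derivative along
the base. -/
lemma exists_contraction {x : M} (q : Q x) : ∃ δ : 𝓕 ⊤ →ₗ[ℝ] FreeAlg (Q x) (B x),
    Der x (FreeAlg.parity (Q x) (B x)) (-1) δ ∧
      (∀ f : SmoothFun m M, δ (incl₀ FB B FQ Q f) = 0) ∧
      (∀ τ : 𝓓, δ (incl₁ FB B τ) = algebraMap ℝ _ (τ x q)) ∧ ∀ b : 𝓢, δ (incl₂ FQ Q b) = 0 := by
  obtain ⟨C, h0, h1, h2, h⟩ := FreeAlg.exists_odd_derivation (W := B x) q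
  have k0 : ∀ f : SmoothFun m M, C (val (incl₀ FB B FQ Q f) x) = 0 := fun f => h0 (f x)
  have k1 : ∀ τ : 𝓓, C (val (incl₁ FB B τ) x) = algebraMap ℝ _ (τ x q) := fun τ => h1 (τ x)
  have k2 : ∀ b : 𝓢, C (val (incl₂ FQ Q b) x) = 0 := fun b => h2 (b x)
  refine ⟨C ∘ₗ (valHom x).toLinearMap, ⟨FreeAlg.parity_mem_deg, fun hg => congrArg C hg.val_eq,
    fun ξ η => h _ _, fun f => ?_, fun τ => ?_, fun b => ?_⟩, k0, k1, k2⟩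
  · exact (k0 f).symm ▸ zero_mem (FreeAlg.deg (Q x) (B x) (-1))
  · have e : C (val (incl₁ FB B τ) x) ∈ FreeAlg.deg (Q x) (B x) 0 :=
      (k1 τ).symm ▸ FreeAlg.algebraMap_mem_deg _
    exact e
  · exact (k2 b).symm ▸ zero_mem (FreeAlg.deg (Q x) (B x) (2 + -1))

lemma exists_vertical {x : M} (β : B x →ₗ[ℝ] ℝ) : ∃ δ : 𝓕 ⊤ →ₗ[ℝ] FreeAlg (Q x) (B x),
    Der x (AlgHom.id ℝ _) (-2) δ ∧ (∀ f : SmoothFun m M, δ (incl₀ FB B FQ Q f) = 0) ∧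
      (∀ τ : 𝓓, δ (incl₁ FB B τ) = 0) ∧
      ∀ b : 𝓢, δ (incl₂ FQ Q b) = algebraMap ℝ _ (β (b x)) := by
  obtain ⟨C, h0, h1, h2, h⟩ := FreeAlg.exists_even_derivation (V := Q x) β
  have k0 : ∀ f : SmoothFun m M, C (val (incl₀ FB B FQ Q f) x) = 0 := fun f => h0 (f x)
  have k1 : ∀ τ : 𝓓, C (val (incl₁ FB B τ) x) = 0 := fun τ => h1 (τ x)
  have k2 : ∀ b : 𝓢, C (val (incl₂ FQ Q b) x) = algebraMap ℝ _ (β (b x)) := fun b => h2 (b x)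
  refine ⟨C ∘ₗ (valHom x).toLinearMap, ⟨fun ha => ha, fun hg => congrArg C hg.val_eq,
    fun ξ η => h _ _, fun f => ?_, fun τ => ?_, fun b => ?_⟩, k0, k1, k2⟩
  · exact (k0 f).symm ▸ zero_mem (FreeAlg.deg (Q x) (B x) (-2))
  · exact (k1 τ).symm ▸ zero_mem (FreeAlg.deg (Q x) (B x) (1 + -2))
  · have e : C (val (incl₂ FQ Q b) x) ∈ FreeAlg.deg (Q x) (B x) 0 :=
      (k2 b).symm ▸ FreeAlg.algebraMap_mem_deg _
    exact e

/-- A derivation of degree `0` at a point with prescribed values on the generators. -/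
lemma exists_derAt {x : M} (v : TangentSpace (𝓡 m) x) (φ : 𝓓 →ₗ[ℝ] FreeAlg (Q x) (B x))
    (ψ : 𝓢 →ₗ[ℝ] FreeAlg (Q x) (B x)) (hφ : ∀ τ, φ τ ∈ FreeAlg.deg (Q x) (B x) 1)
    (hψ : ∀ b, ψ b ∈ FreeAlg.deg (Q x) (B x) 2)
    (hφ' : ∀ (f : SmoothFun m M) (τ : 𝓓),
      φ (fsmul f τ) = f x • φ τ + tderiv v f • FreeAlg.gen₁ (Q x) (B x) (τ x))
    (hψ' : ∀ (f : SmoothFun m M) (b : 𝓢),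
      ψ (fsmul f b) = f x • ψ b + tderiv v f • FreeAlg.gen₂ (Q x) (B x) (b x)) :
    ∃ δ : 𝓕 ⊤ →ₗ[ℝ] FreeAlg (Q x) (B x), Der x (AlgHom.id ℝ _) 0 δ ∧
      (∀ f : SmoothFun m M, δ (incl₀ FB B FQ Q f) = algebraMap ℝ _ (tderiv v f)) ∧
      (∀ τ : 𝓓, δ (incl₁ FB B τ) = φ τ) ∧ ∀ b : 𝓢, δ (incl₂ FQ Q b) = ψ b := by
  obtain ⟨H, Hg, Hl, H0, H1, H2⟩ :=
    exists_horizontal (m := m) (FQ := FQ) (Q := Q) (FB := FB) (B := B) v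
  let e := dualFrameAt (m := m) FQ Q x
  let e' := dualFrameAt (m := m) FB B x
  choose ι hι ι0 ι1 ι2 using
    fun i => exists_contraction (m := m) (FB := FB) (B := B) (FQ := FQ) (e.s i x)
  choose κ hκ κ0 κ1 κ2 using
    fun i => exists_vertical (m := m) (FQ := FQ) (Q := Q) (FB := FB) (e'.τ i x).toLinearMap
  -- The horizontal derivation already has the right symbol `v`. The differences between the
  -- prescribed values and its own are therefore tensorial, and they are produced by contractions
  -- and vertical derivations of a dual frame with these differences as coefficients.
  let φ' : 𝓓 →ₗ[ℝ] FreeAlg (Q x) (B x) := φ - H ∘ₗ inclₗ₁ FQ Q FB B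
  let ψ' : 𝓢 →ₗ[ℝ] FreeAlg (Q x) (B x) := ψ - H ∘ₗ inclₗ₂ FQ Q FB B
  have hφ'_apply : ∀ τ, φ' τ = φ τ - H (incl₁ FB B τ) := fun _ => rfl
  have hψ'_apply : ∀ b, ψ' b = ψ b - H (incl₂ FQ Q b) := fun _ => rfl
  have tφ : ∀ (f : SmoothFun m M) τ, φ' (fsmul f τ) = f x • φ' τ := fun f τ => by
    rw [hφ'_apply, hφ'_apply, hφ', incl₁_fsmul, Hl, H0, val_incl₀, val_incl₁, smul_sub,
      ← Algebra.smul_def, ← Algebra.smul_def]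
    abel
  have tψ : ∀ (f : SmoothFun m M) b, ψ' (fsmul f b) = f x • ψ' b := fun f b => by
    rw [hψ'_apply, hψ'_apply, hψ', incl₂_fsmul, Hl, H0, val_incl₀, val_incl₂, smul_sub,
      ← Algebra.smul_def, ← Algebra.smul_def]
    abel
  have mφ : ∀ τ, φ' τ ∈ FreeAlg.deg (Q x) (B x) 1 := fun τ => sub_mem (hφ τ) (H1 τ)
  have mψ : ∀ b, ψ' b ∈ FreeAlg.deg (Q x) (B x) 2 := fun b => sub_mem (hψ b) (H2 b)
  have sφ : ∀ τ : 𝓓, ∑ i, φ' (e.τ i) * algebraMap ℝ _ (τ x (e.s i x)) = φ' τ := fun τ => by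
    rw [tensorial (m := m) φ' tφ (s := τ) (t := ∑ i, fsmul (pairing τ (e.s i)) (e.τ i))
      (e.expand_dual_sec τ).self_of_nhds, map_sum]
    refine Finset.sum_congr rfl fun i _ => ?_
    rw [tφ, ← Algebra.commutes, ← Algebra.smul_def]
    rfl
  have sψ : ∀ b : 𝓢, ∑ i, ψ' (e'.s i) * algebraMap ℝ _ (e'.τ i x (b x)) = ψ' b := fun b => by
    rw [tensorial (m := m) ψ' tψ (s := b) (t := ∑ i, fsmul (pairing (e'.τ i) b) (e'.s i))
      (e'.expand_sec b).self_of_nhds, map_sum]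
    refine Finset.sum_congr rfl fun i _ => ?_
    rw [tψ, ← Algebra.commutes, ← Algebra.smul_def]
    rfl
  have hH : Der x (AlgHom.id ℝ _) 0 H := ⟨fun ha => ha, Hg _ _, Hl,
    fun f => H0 f ▸ FreeAlg.algebraMap_mem_deg _, H1, H2⟩
  refine ⟨H + ∑ i, LinearMap.mulLeft ℝ (φ' (e.τ i)) ∘ₗ ι i +
    ∑ i, LinearMap.mulLeft ℝ (ψ' (e'.s i)) ∘ₗ κ i, ?_, fun f => ?_, fun τ => ?_, fun b => ?_⟩
  · refine IsDerAt.sum _ (IsDerAt.sum _ hH fun i => ?_) fun i => ?_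
    · exact (hι i).mul_left (mφ _) (fun ha => ha) (FreeAlg.mul_parity (mφ _))
    · exact (hκ i).mul_left (mψ _) (fun ha => ha) (FreeAlg.commute_of_mem_deg_two (mψ _))
  · simp [LinearMap.sum_apply, ι0, κ0, H0]
  · simp only [LinearMap.add_apply, LinearMap.sum_apply, LinearMap.comp_apply,
      LinearMap.mulLeft_apply, ι1, κ1, mul_zero, Finset.sum_const_zero, add_zero, sφ]
    rw [hφ'_apply, add_sub_cancel]
  · simp only [LinearMap.add_apply, LinearMap.sum_apply, LinearMap.comp_apply,
      LinearMap.mulLeft_apply, ι2, κ2, mul_zero, Finset.sum_const_zero, add_zero,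
      ContinuousLinearMap.coe_coe, sψ]
    rw [hψ'_apply, add_sub_cancel]

end PointDerivation
end SplitPoisson
end

/-! ### Skew biderivations at a point -/

open Bundle Manifold Set TopologicalSpace
open scoped Manifold ContDiff Bundle Topology TensorProduct
noncomputable section
namespace SplitPoisson
set_option linter.unusedSectionVars false

section PointBracket


variable {m : ℕ} {M : Type*} [TopologicalSpace M] [ChartedSpace (EuclideanSpace ℝ (Fin m)) M]
  [T2Space M] [IsManifold (𝓡 m) ∞ M]
  {FQ : Type*} [NormedAddCommGroup FQ] [NormedSpace ℝ FQ] [FiniteDimensional ℝ FQ]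
  {Q : M → Type*} [TopologicalSpace (TotalSpace FQ Q)] [∀ x, AddCommGroup (Q x)]
  [∀ x, Module ℝ (Q x)] [∀ x, TopologicalSpace (Q x)] [∀ x, IsTopologicalAddGroup (Q x)]
  [∀ x, ContinuousSMul ℝ (Q x)] [FiberBundle FQ Q] [VectorBundle ℝ FQ Q]
  [ContMDiffVectorBundle ∞ FQ Q (𝓡 m)]
  {FB : Type*} [NormedAddCommGroup FB] [NormedSpace ℝ FB] [FiniteDimensional ℝ FB]
  {B : M → Type*} [TopologicalSpace (TotalSpace FB B)] [∀ x, AddCommGroup (B x)]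
  [∀ x, Module ℝ (B x)] [∀ x, TopologicalSpace (B x)] [FiberBundle FB B] [VectorBundle ℝ FB B]
  [ContMDiffVectorBundle ∞ FB B (𝓡 m)]

local notation "𝓕" => Fun (𝓡 m) FB B FQ Q
local notation "𝓢" => Sec (𝓡 m) FB B
local notation "𝓓" => Sec (𝓡 m) (FQ →L[ℝ] ℝ) (DualBundle Q)
local notation "Der" => IsDerAt (m := m) (FQ := FQ) (Q := Q) (FB := FB) (B := B)

/-- The values at the point `x` of a skew-symmetric biderivation of degree `-2`. -/
structure IsBracketAt (x : M) (β : 𝓕 ⊤ →ₗ[ℝ] 𝓕 ⊤ →ₗ[ℝ] FreeAlg (Q x) (B x)) : Prop where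
  germ : ∀ {ξ ξ' η η' : 𝓕 ⊤}, GermEq x ξ ξ' → GermEq x η η' → β ξ η = β ξ' η'
  degree : ∀ {i j : ℕ} {ξ η : 𝓕 ⊤}, Fun.IsHomogeneous i ξ → Fun.IsHomogeneous j η →
    β ξ η ∈ FreeAlg.deg (Q x) (B x) (i + j - 2)
  skew : ∀ {i j : ℕ} {ξ η : 𝓕 ⊤}, Fun.IsHomogeneous i ξ → Fun.IsHomogeneous j η →
    β ξ η = -((-1 : ℝ) ^ (i * j) • β η ξ)
  leibniz : ∀ {i j : ℕ} {ξ η : 𝓕 ⊤}, Fun.IsHomogeneous i ξ → Fun.IsHomogeneous j η →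
    ∀ ζ : 𝓕 ⊤, β ξ (η * ζ) = β ξ η * val ζ x + (-1 : ℝ) ^ (i * j) • (val η x * β ξ ζ)

/-- The antisymmetrised product of two even derivations. The degrees `-2` and `0` do not affect
parities, so commuting the factors yields the sign of `ξ` and `η` themselves. -/
lemma isBracketAt_even {x : M} {κ δ : 𝓕 ⊤ →ₗ[ℝ] FreeAlg (Q x) (B x)}
    (hκ : Der x (AlgHom.id ℝ _) (-2) κ) (hδ : Der x (AlgHom.id ℝ _) 0 δ) :
    IsBracketAt (m := m) (FQ := FQ) (FB := FB) x
      ((LinearMap.mul ℝ (FreeAlg (Q x) (B x))).compl₁₂ κ δ -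
        (LinearMap.mul ℝ (FreeAlg (Q x) (B x))).compl₁₂ δ κ) where
  germ h h' := by
    simp only [LinearMap.sub_apply, LinearMap.compl₁₂_apply, LinearMap.mul_apply', hκ.germ h,
      hκ.germ h', hδ.germ h, hδ.germ h']
  degree {i j ξ η} h h' := by
    refine sub_mem ?_ ?_
    · have e := FreeAlg.mul_mem_deg (hκ.mem_deg h) (hδ.mem_deg h')
      rwa [show (i : ℤ) + -2 + (j + 0) = i + j - 2 by ring] at e
    · have e := FreeAlg.mul_mem_deg (hδ.mem_deg h) (hκ.mem_deg h')
      rwa [show (i : ℤ) + 0 + (j + -2) = i + j - 2 by ring] at e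
  skew {i j ξ η} h h' := by
    have e1 := FreeAlg.mul_comm_koszul (hκ.mem_deg h) (hδ.mem_deg h')
    have e2 := FreeAlg.mul_comm_koszul (hδ.mem_deg h) (hκ.mem_deg h')
    rw [koszul_congr (k := (i * j : ℕ)) ⟨-j, by push_cast; ring⟩, koszul_natCast] at e1
    rw [koszul_congr (k := (i * j : ℕ)) ⟨-i, by push_cast; ring⟩, koszul_natCast] at e2
    simp only [LinearMap.sub_apply, LinearMap.compl₁₂_apply, LinearMap.mul_apply']
    rw [e1, e2, smul_sub, neg_sub]
  leibniz {i j ξ η} h h' ζ := by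
    have e1 := FreeAlg.mul_comm_koszul (hκ.mem_deg h) (h' ⟨x, trivial⟩)
    have e2 := FreeAlg.mul_comm_koszul (hδ.mem_deg h) (h' ⟨x, trivial⟩)
    rw [koszul_congr (k := (i * j : ℕ)) ⟨-j, by push_cast; ring⟩, koszul_natCast] at e1
    rw [koszul_congr (k := (i * j : ℕ)) ⟨0, by push_cast; ring⟩, koszul_natCast] at e2
    change _ * val η x = _ • (val η x * _) at e1
    change _ * val η x = _ • (val η x * _) at e2
    simp only [LinearMap.sub_apply, LinearMap.compl₁₂_apply, LinearMap.mul_apply', hκ.leibniz,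
      hδ.leibniz, AlgHom.id_apply, mul_add, sub_mul]
    rw [← mul_assoc (κ ξ) (val η x), e1, ← mul_assoc (δ ξ) (val η x), e2, mul_sub, smul_sub]
    simp only [smul_mul_assoc, mul_assoc]
    abel

/-- For odd derivations a symmetric matrix gives a graded skew bracket. The parity applied to the
first factor supplies the sign that turns the twisted Leibniz rule of `ι l` into the one required of
the bracket. -/
lemma isBracketAt_odd {x : M} {n : ℕ} {ι : Fin n → 𝓕 ⊤ →ₗ[ℝ] FreeAlg (Q x) (B x)}
    (hι : ∀ i, Der x (FreeAlg.parity (Q x) (B x)) (-1) (ι i)) {g : Fin n → Fin n → ℝ}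
    (hg : ∀ i j, g i j = g j i) :
    IsBracketAt (m := m) (FQ := FQ) (FB := FB) x
      (∑ k, ∑ l, g k l • (LinearMap.mul ℝ (FreeAlg (Q x) (B x))).compl₁₂
        ((FreeAlg.parity (Q x) (B x)).toLinearMap ∘ₗ ι k) (ι l)) where
  germ h h' := by
    simp only [LinearMap.sum_apply, LinearMap.smul_apply, LinearMap.compl₁₂_apply,
      LinearMap.mul_apply', LinearMap.comp_apply, (hι _).germ h, (hι _).germ h']
  degree {i j ξ η} h h' := by
    simp only [LinearMap.sum_apply]
    refine sum_mem fun k _ => sum_mem fun l _ => Submodule.smul_mem _ _ ?_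
    have e := FreeAlg.mul_mem_deg (FreeAlg.parity_mem_deg ((hι k).mem_deg h)) ((hι l).mem_deg h')
    rwa [show (i : ℤ) + -1 + (j + -1) = i + j - 2 by ring] at e
  skew {i j ξ η} h h' := by
    simp only [LinearMap.sum_apply, LinearMap.smul_apply, LinearMap.compl₁₂_apply,
      LinearMap.mul_apply', LinearMap.comp_apply, AlgHom.toLinearMap_apply]
    rw [Finset.sum_comm, Finset.smul_sum, ← Finset.sum_neg_distrib]
    refine Finset.sum_congr rfl fun l _ => ?_
    rw [Finset.smul_sum, ← Finset.sum_neg_distrib]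
    refine Finset.sum_congr rfl fun k _ => ?_
    rw [hg k l, smul_comm _ (g l k), ← smul_neg]
    congr 1
    rw [FreeAlg.parity_koszul ((hι k).mem_deg h), FreeAlg.parity_koszul ((hι l).mem_deg h'),
      smul_mul_assoc, smul_mul_assoc, FreeAlg.mul_comm_koszul ((hι k).mem_deg h) ((hι l).mem_deg h'),
      smul_smul, smul_smul, koszul_mul, ← koszul_natCast, koszul_mul, ← neg_smul, ← koszul_add_one]
    congr 1
    exact koszul_congr ⟨-j, by push_cast; ring⟩
  leibniz {i j ξ η} h h' ζ := by
    simp only [LinearMap.sum_apply, LinearMap.smul_apply, LinearMap.compl₁₂_apply,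
      LinearMap.mul_apply', LinearMap.comp_apply, AlgHom.toLinearMap_apply]
    rw [Finset.sum_mul, Finset.mul_sum, Finset.smul_sum, ← Finset.sum_add_distrib]
    refine Finset.sum_congr rfl fun k _ => ?_
    rw [Finset.sum_mul, Finset.mul_sum, Finset.smul_sum, ← Finset.sum_add_distrib]
    refine Finset.sum_congr rfl fun l _ => ?_
    have e : FreeAlg.parity (Q x) (B x) (ι k ξ) * FreeAlg.parity (Q x) (B x) (val η x) =
        (-1 : ℝ) ^ (i * j) • (val η x * FreeAlg.parity (Q x) (B x) (ι k ξ)) := by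
      have hη : val η x ∈ FreeAlg.deg (Q x) (B x) j := h' ⟨x, trivial⟩
      rw [FreeAlg.parity_koszul hη, mul_smul_comm,
        FreeAlg.mul_comm_koszul (FreeAlg.parity_mem_deg ((hι k).mem_deg h)) hη, smul_smul,
        koszul_mul, ← koszul_natCast]
      congr 1
      exact koszul_congr ⟨0, by push_cast; ring⟩
    rw [(hι l).leibniz, mul_add, ← mul_assoc, ← mul_assoc, e, smul_add, smul_mul_assoc,
      smul_mul_assoc, mul_smul_comm, smul_comm (g k l), mul_assoc (val η x)]

namespace IsBracketAt

variable {x : M}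

lemma add {β β' : 𝓕 ⊤ →ₗ[ℝ] 𝓕 ⊤ →ₗ[ℝ] FreeAlg (Q x) (B x)}
    (h : IsBracketAt (m := m) (FQ := FQ) (FB := FB) x β)
    (h' : IsBracketAt (m := m) (FQ := FQ) (FB := FB) x β') :
    IsBracketAt (m := m) (FQ := FQ) (FB := FB) x (β + β') where
  germ e e' := congrArg₂ (· + ·) (h.germ e e') (h'.germ e e')
  degree e e' := add_mem (h.degree e e') (h'.degree e e')
  skew {i j ξ η} e e' := by
    refine (congrArg₂ (· + ·) (h.skew e e') (h'.skew e e')).trans ?_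
    change _ = -((-1 : ℝ) ^ (i * j) • (β η ξ + β' η ξ))
    rw [smul_add, neg_add]
  leibniz {i j ξ η} e e' ζ := by
    refine (congrArg₂ (· + ·) (h.leibniz e e' ζ) (h'.leibniz e e' ζ)).trans ?_
    change _ = (β ξ η + β' ξ η) * val ζ x + (-1 : ℝ) ^ (i * j) • (val η x * (β ξ ζ + β' ξ ζ))
    rw [add_mul, mul_add, smul_add]
    exact add_add_add_comm _ _ _ _

lemma add_sum {n : ℕ} (s : Finset (Fin n)) {β₀ : 𝓕 ⊤ →ₗ[ℝ] 𝓕 ⊤ →ₗ[ℝ] FreeAlg (Q x) (B x)}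
    {β : Fin n → 𝓕 ⊤ →ₗ[ℝ] 𝓕 ⊤ →ₗ[ℝ] FreeAlg (Q x) (B x)}
    (h₀ : IsBracketAt (m := m) (FQ := FQ) (FB := FB) x β₀)
    (h : ∀ i, IsBracketAt (m := m) (FQ := FQ) (FB := FB) x (β i)) :
    IsBracketAt (m := m) (FQ := FQ) (FB := FB) x (β₀ + ∑ i ∈ s, β i) := by
  induction s using Finset.induction_on with
  | empty => simpa using h₀
  | insert i s hi hs =>
    rw [Finset.sum_insert hi, add_left_comm]
    exact (h i).add hs

end IsBracketAt

end PointBracket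
end SplitPoisson
end

/-! ### The curvature form and the bracket on sections in a frame -/

open Bundle Manifold Set TopologicalSpace
open scoped Manifold ContDiff Bundle Topology TensorProduct
noncomputable section
namespace SplitPoisson
set_option linter.unusedSectionVars false

namespace FreeAlg

variable {V W : Type*} [AddCommGroup V] [Module ℝ V] [TopologicalSpace V]
  [IsTopologicalAddGroup V] [ContinuousSMul ℝ V] [AddCommGroup W] [Module ℝ W] {n : ℕ}

variable (W) in
/-- The element of `⋀² V*` given by a bilinear form, in terms of dual bases. -/
def ofForm (s : Fin n → V) (τ : Fin n → V →L[ℝ] ℝ) : (V →L[ℝ] V →L[ℝ] ℝ) →ₗ[ℝ] FreeAlg V W where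
  toFun r := (2⁻¹ : ℝ) • ∑ i, ∑ j, r (s i) (s j) • (gen₁ V W (τ i) * gen₁ V W (τ j))
  map_add' r r' := by simp [add_smul, Finset.sum_add_distrib]
  map_smul' c r := by
    rw [RingHom.id_apply, smul_comm c (2⁻¹ : ℝ), Finset.smul_sum]
    simp only [Finset.smul_sum, smul_smul]
    rfl

lemma ofForm_apply (s : Fin n → V) (τ : Fin n → V →L[ℝ] ℝ) (r : V →L[ℝ] V →L[ℝ] ℝ) :
    ofForm W s τ r =
      (2⁻¹ : ℝ) • ∑ i, ∑ j, r (s i) (s j) • (gen₁ V W (τ i) * gen₁ V W (τ j)) := rfl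

lemma ofForm_mem (s : Fin n → V) (τ : Fin n → V →L[ℝ] ℝ) (r : V →L[ℝ] V →L[ℝ] ℝ) :
    ofForm W s τ r ∈ deg V W 2 := by
  rw [ofForm_apply]
  refine (deg V W 2).smul_mem _ (sum_mem fun i _ => sum_mem fun j _ => (deg V W 2).smul_mem _ ?_)
  have := mul_mem_deg (gen₁_mem_deg (W := W) (τ i)) (gen₁_mem_deg (W := W) (τ j))
  rwa [one_add_one_eq_two] at this

lemma coeff₂_ofForm (s : Fin n → V) (τ : Fin n → V →L[ℝ] ℝ) (r : V →L[ℝ] V →L[ℝ] ℝ) :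
    coeff₂ V W (ofForm W s τ r) = 0 := by
  simp only [ofForm_apply, map_smul, map_sum, coeff₂_gen₁_mul, smul_zero, Finset.sum_const_zero]

/-- Expanding `r` in the basis gives `2⁻¹ (r v w - r w v)`, which is `r v w` by skew symmetry. -/
lemma form_ofForm {s : Fin n → V} {τ : Fin n → V →L[ℝ] ℝ} (h : ∀ v, v = ∑ i, τ i v • s i)
    (r : V →L[ℝ] V →L[ℝ] ℝ) (hr : ∀ v w, r v w = -r w v) (v w : V) :
    form V W v w (ofForm W s τ r) = r v w := by
  have key : ∀ v w, r v w = ∑ i, ∑ j, r (s i) (s j) * (τ i v * τ j w) := by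
    intro v w
    conv_lhs => rw [h v, h w]
    simp only [map_sum, map_smul, sum_apply, smul_apply, smul_eq_mul, Finset.mul_sum]
    rw [Finset.sum_comm]
    exact Finset.sum_congr rfl fun i _ => Finset.sum_congr rfl fun j _ => by ring
  simp only [ofForm_apply, map_smul, map_sum, form_gen₁_mul_gen₁, smul_eq_mul, mul_sub,
    Finset.sum_sub_distrib]
  rw [← key, ← key, hr w v]
  ring

end FreeAlg

section BracketOfRep


variable {m : ℕ} {M : Type*} [TopologicalSpace M] [ChartedSpace (EuclideanSpace ℝ (Fin m)) M]
  [T2Space M] [IsManifold (𝓡 m) ∞ M]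
  {FQ : Type*} [NormedAddCommGroup FQ] [NormedSpace ℝ FQ] [FiniteDimensional ℝ FQ]
  {Q : M → Type*} [TopologicalSpace (TotalSpace FQ Q)] [∀ x, AddCommGroup (Q x)]
  [∀ x, Module ℝ (Q x)] [∀ x, TopologicalSpace (Q x)] [∀ x, IsTopologicalAddGroup (Q x)]
  [∀ x, ContinuousSMul ℝ (Q x)] [FiberBundle FQ Q] [VectorBundle ℝ FQ Q]
  [ContMDiffVectorBundle ∞ FQ Q (𝓡 m)]
  {FB : Type*} [NormedAddCommGroup FB] [NormedSpace ℝ FB] [FiniteDimensional ℝ FB]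
  {B : M → Type*} [TopologicalSpace (TotalSpace FB B)] [∀ x, AddCommGroup (B x)]
  [∀ x, Module ℝ (B x)] [∀ x, TopologicalSpace (B x)] [FiberBundle FB B] [VectorBundle ℝ FB B]
  [ContMDiffVectorBundle ∞ FB B (𝓡 m)]

local notation "𝓕" => Fun (𝓡 m) FB B FQ Q
local notation "𝓢" => Sec (𝓡 m) FB B
local notation "𝓓" => Sec (𝓡 m) (FQ →L[ℝ] ℝ) (DualBundle Q)

namespace PreRep

variable (D : PreRep m FQ Q FB B)

/-- The elements of `⋀² Q_x*` given by the curvature form. -/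
def curvAt (x : M) : B x →ₗ[ℝ] B x →ₗ[ℝ] FreeAlg (Q x) (B x) :=
  (D.R.toFun x).compr₂ (FreeAlg.ofForm (B x) (fun i => (dualFrameAt (m := m) FQ Q x).s i x)
    fun i => (dualFrameAt (m := m) FQ Q x).τ i x)

lemma curvAt_mem (x : M) (b c : B x) : D.curvAt x b c ∈ FreeAlg.deg (Q x) (B x) 2 :=
  FreeAlg.ofForm_mem _ _ _

lemma coeff₂_curvAt (x : M) (b c : B x) : FreeAlg.coeff₂ _ _ (D.curvAt x b c) = 0 :=
  FreeAlg.coeff₂_ofForm _ _ _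

lemma form_curvAt (x : M) (b c : B x) (q q' : Q x) :
    FreeAlg.form _ _ q q' (D.curvAt x b c) = D.R.toFun x b c q q' :=
  FreeAlg.form_ofForm (dualFrameAt (m := m) FQ Q x).expand_self (D.R.toFun x b c)
    (D.R_dual x b c) q q'

lemma curvAt_skew (x : M) (b c : B x) : D.curvAt x b c = -D.curvAt x c b :=
  (congrArg (FreeAlg.ofForm (B x) (fun i => (dualFrameAt (m := m) FQ Q x).s i x)
    fun i => (dualFrameAt (m := m) FQ Q x).τ i x) (TwoForm.skew D.R x b c)).trans (map_neg _ _)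

/-- The frame expansion of `c` holds only near `x`; the Leibniz rule makes the bracket local, so it
may be inserted and expanded there. -/
lemma bracket_expand (b c : 𝓢) {x : M} (e : DualFrameAt (m := m) FB B x) :
    D.bracket b c x = ∑ i, (e.τ i x (c x) • D.bracket b (e.s i) x +
      tderiv (D.anchor x (b x)) (pairing (e.τ i) c) • e.s i x) := by
  refine (local_of_leibniz (m := m) (evSec FB x ∘ₗ D.bracket b) (tderiv (D.anchor x (b x)))
    LinearMap.id (fun f s => D.leibniz b s f x) (e.expand_sec c)).trans ?_
  rw [map_sum]
  exact Finset.sum_congr rfl fun i _ => D.leibniz b _ _ x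

/-- The first two sums involve only brackets with frame sections, in the antisymmetrised shape that
products of point derivations can produce. Both contain the contribution of the brackets of frame
sections, so that contribution is subtracted once. -/
lemma bracket_frame (b c : 𝓢) {x : M} (e : DualFrameAt (m := m) FB B x) :
    D.bracket b c x = ∑ i, e.τ i x (b x) • D.bracket (e.s i) c x -
      ∑ i, e.τ i x (c x) • D.bracket (e.s i) b x -
      ∑ i, ∑ j, (e.τ i x (b x) * e.τ j x (c x)) • D.bracket (e.s i) (e.s j) x := by
  have h1 : ∀ f : SmoothFun m M, tderiv (D.anchor x (b x)) f =
      ∑ i, e.τ i x (b x) * tderiv (D.anchor x (e.s i x)) f := fun f => by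
    conv_lhs => rw [e.expand_self (b x)]
    rw [map_sum, tderiv_vec_sum]
    exact Finset.sum_congr rfl fun i _ => by rw [map_smul, tderiv_vec_smul]
  have h2 : ∀ i, e.τ i x (b x) • D.bracket (e.s i) c x =
      ∑ j, (e.τ i x (b x) * e.τ j x (c x)) • D.bracket (e.s i) (e.s j) x +
      ∑ j, (e.τ i x (b x) * tderiv (D.anchor x (e.s i x)) (pairing (e.τ j) c)) • e.s j x := by
    intro i
    rw [D.bracket_expand (e.s i) c e, Finset.smul_sum, ← Finset.sum_add_distrib]
    exact Finset.sum_congr rfl fun j _ => by rw [smul_add, smul_smul, smul_smul]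
  have h3 : ∑ i, ∑ j, (e.τ i x (b x) * tderiv (D.anchor x (e.s i x)) (pairing (e.τ j) c)) •
      e.s j x = ∑ j, tderiv (D.anchor x (b x)) (pairing (e.τ j) c) • e.s j x := by
    rw [Finset.sum_comm]
    exact Finset.sum_congr rfl fun j _ => by rw [← Finset.sum_smul, h1]
  rw [D.bracket_expand b c e, Finset.sum_add_distrib, Finset.sum_congr rfl fun i _ => h2 i,
    Finset.sum_add_distrib, h3]
  have h4 : ∑ i, e.τ i x (c x) • D.bracket b (e.s i) x =
      -∑ i, e.τ i x (c x) • D.bracket (e.s i) b x := by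
    rw [← Finset.sum_neg_distrib]
    refine Finset.sum_congr rfl fun i _ => ?_
    rw [D.skew b]
    exact smul_neg _ _
  rw [h4]
  abel

/-- The bracket on the fibre of `B` in a frame, together with the curvature form. -/
lemma exists_structureAt {x : M} (e : DualFrameAt (m := m) FB B x) :
    ∃ L : B x →ₗ[ℝ] B x →ₗ[ℝ] FreeAlg (Q x) (B x),
      (∀ b c, L b c ∈ FreeAlg.deg (Q x) (B x) 2) ∧ (∀ b c, L b c = -L c b) ∧
      ∀ b c, L b c = FreeAlg.gen₂ _ _ (∑ i, ∑ j, (e.τ i x b * e.τ j x c) •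
        D.bracket (e.s i) (e.s j) x) + D.curvAt x b c := by
  refine ⟨LinearMap.mk₂ ℝ (fun b c => FreeAlg.gen₂ _ _ (∑ i, ∑ j, (e.τ i x b * e.τ j x c) •
      D.bracket (e.s i) (e.s j) x) + D.curvAt x b c) (fun b b' c => ?_) (fun r b c => ?_)
      (fun b c c' => ?_) (fun r b c => ?_), fun b c => ?_, fun b c => ?_, fun b c => rfl⟩
  · simp only [map_add, add_mul, add_smul, Finset.sum_add_distrib, LinearMap.add_apply]
    abel
  · simp only [map_smul, smul_eq_mul, mul_assoc, mul_smul, ← Finset.smul_sum, smul_add,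
      LinearMap.smul_apply]
  · simp only [map_add, mul_add, add_smul, Finset.sum_add_distrib]
    abel
  · simp only [map_smul, smul_eq_mul, mul_left_comm _ r, mul_smul r, ← Finset.smul_sum, smul_add]
  · exact add_mem (FreeAlg.gen₂_mem_deg _) (D.curvAt_mem x b c)
  · refine (congrArg₂ (· + ·) (Eq.trans (congrArg _ ?_) (map_neg (FreeAlg.gen₂ (Q x) (B x)) _))
      (D.curvAt_skew x b c)).trans (neg_add _ _).symm
    rw [Finset.sum_comm, ← Finset.sum_neg_distrib]
    refine Finset.sum_congr rfl fun i _ => ?_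
    rw [← Finset.sum_neg_distrib]
    refine Finset.sum_congr rfl fun j _ => ?_
    rw [D.skew (e.s j), mul_comm (e.τ i x c)]
    exact smul_neg _ _

end PreRep

end BracketOfRep
end SplitPoisson
end

/-! ### The value of the bracket at a point -/

open Bundle Manifold Set TopologicalSpace
open scoped Manifold ContDiff Bundle Topology TensorProduct
noncomputable section
namespace SplitPoisson
set_option linter.unusedSectionVars false

section BracketAt


variable {m : ℕ} {M : Type*} [TopologicalSpace M] [ChartedSpace (EuclideanSpace ℝ (Fin m)) M]
  [T2Space M] [IsManifold (𝓡 m) ∞ M]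
  {FQ : Type*} [NormedAddCommGroup FQ] [NormedSpace ℝ FQ] [FiniteDimensional ℝ FQ]
  {Q : M → Type*} [TopologicalSpace (TotalSpace FQ Q)] [∀ x, AddCommGroup (Q x)]
  [∀ x, Module ℝ (Q x)] [∀ x, TopologicalSpace (Q x)] [∀ x, IsTopologicalAddGroup (Q x)]
  [∀ x, ContinuousSMul ℝ (Q x)] [FiberBundle FQ Q] [VectorBundle ℝ FQ Q]
  [ContMDiffVectorBundle ∞ FQ Q (𝓡 m)]
  {FB : Type*} [NormedAddCommGroup FB] [NormedSpace ℝ FB] [FiniteDimensional ℝ FB]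
  {B : M → Type*} [TopologicalSpace (TotalSpace FB B)] [∀ x, AddCommGroup (B x)]
  [∀ x, Module ℝ (B x)] [∀ x, TopologicalSpace (B x)] [FiberBundle FB B] [VectorBundle ℝ FB B]
  [ContMDiffVectorBundle ∞ FB B (𝓡 m)]

local notation "𝓕" => Fun (𝓡 m) FB B FQ Q
local notation "𝓢" => Sec (𝓡 m) FB B
local notation "𝓓" => Sec (𝓡 m) (FQ →L[ℝ] ℝ) (DualBundle Q)
local notation "Der" => IsDerAt (m := m) (FQ := FQ) (Q := Q) (FB := FB) (B := B)

namespace PreRep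

variable (D : PreRep m FQ Q FB B)

/-- A substitute for `{s, ·}`, corrected on sections of `B` by half of `L`. Antisymmetrisation with
the vertical derivations doubles this correction, so that all of `L` is subtracted from the bracket
of two sections. -/
lemma exists_hamiltonianAt {x : M}
    {L : B x →ₗ[ℝ] B x →ₗ[ℝ] FreeAlg (Q x) (B x)}
    (hL : ∀ b c, L b c ∈ FreeAlg.deg (Q x) (B x) 2) (s : 𝓢) :
    ∃ δ : 𝓕 ⊤ →ₗ[ℝ] FreeAlg (Q x) (B x), Der x (AlgHom.id ℝ _) 0 δ ∧
      (∀ f : SmoothFun m M, δ (incl₀ FB B FQ Q f) = algebraMap ℝ _ (tderiv (D.anchor x (s x)) f)) ∧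
      (∀ τ : 𝓓, δ (incl₁ FB B τ) = FreeAlg.gen₁ _ _ (D.nabla₀ s τ x)) ∧
      ∀ b : 𝓢, δ (incl₂ FQ Q b) =
        FreeAlg.gen₂ _ _ (D.bracket s b x) - (2⁻¹ : ℝ) • L (s x) (b x) := by
  refine exists_derAt (m := m) (D.anchor x (s x))
    (FreeAlg.gen₁ (Q x) (B x) ∘ₗ evSec (FQ →L[ℝ] ℝ) x ∘ₗ D.nabla₀ s)
    (FreeAlg.gen₂ (Q x) (B x) ∘ₗ evSec FB x ∘ₗ D.bracket s -
      (2⁻¹ : ℝ) • (L (s x) ∘ₗ evSec FB x))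
    (fun τ => FreeAlg.gen₁_mem_deg _)
    (fun b => sub_mem (FreeAlg.gen₂_mem_deg _) (Submodule.smul_mem _ _ (hL _ _)))
    (fun f τ => ?_) fun f b => ?_
  · change FreeAlg.gen₁ _ _ (D.nabla₀ s (fsmul f τ) x) = f x • FreeAlg.gen₁ _ _ (D.nabla₀ s τ x) + _
    rw [D.nabla₀_leibniz, map_add, map_smul, map_smul]
  · change FreeAlg.gen₂ _ _ (D.bracket s (fsmul f b) x) - (2⁻¹ : ℝ) • L (s x) (f x • b x) =
      f x • (FreeAlg.gen₂ _ _ (D.bracket s b x) - (2⁻¹ : ℝ) • L (s x) (b x)) + _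
    rw [D.leibniz, map_add, map_smul, map_smul, map_smul, smul_sub, smul_comm (2⁻¹ : ℝ)]
    abel

/-- The data of `D` define the values of a bracket at each point. -/
lemma exists_bracketAt (x : M) : ∃ β : 𝓕 ⊤ →ₗ[ℝ] 𝓕 ⊤ →ₗ[ℝ] FreeAlg (Q x) (B x),
    IsBracketAt (m := m) (FQ := FQ) (FB := FB) x β ∧
    (∀ (b : 𝓢) (f : SmoothFun m M), β (incl₂ FQ Q b) (incl₀ FB B FQ Q f) =
      algebraMap ℝ _ (tderiv (D.anchor x (b x)) f)) ∧
    (∀ τ τ' : 𝓓, β (incl₁ FB B τ) (incl₁ FB B τ') = algebraMap ℝ _ (τ' x (D.bd x (τ x)))) ∧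
    (∀ (b : 𝓢) (τ : 𝓓), β (incl₂ FQ Q b) (incl₁ FB B τ) =
      FreeAlg.gen₁ _ _ (D.nabla₀ b τ x)) ∧
    ∀ b c : 𝓢, β (incl₂ FQ Q b) (incl₂ FQ Q c) =
      FreeAlg.gen₂ _ _ (D.bracket b c x) - D.curvAt x (b x) (c x) := by
  let e := dualFrameAt (m := m) FQ Q x
  let e' := dualFrameAt (m := m) FB B x
  obtain ⟨L, hLm, hLs, hL⟩ := D.exists_structureAt e'
  choose ι hι ι0 ι1 ι2 using
    fun i => exists_contraction (m := m) (FB := FB) (B := B) (FQ := FQ) (e.s i x)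
  choose κ hκ κ0 κ1 κ2 using
    fun i => exists_vertical (m := m) (FQ := FQ) (Q := Q) (FB := FB) (e'.τ i x).toLinearMap
  choose X hX X0 X1 X2 using fun i => D.exists_hamiltonianAt hLm (e'.s i)
  -- The matrix of `∂` in the frame of `Q*`, symmetric because `∂* = ∂`.
  let g : Fin (Module.finrank ℝ FQ) → Fin (Module.finrank ℝ FQ) → ℝ :=
    fun k l => e.τ l x (D.bd x (e.τ k x))
  have hβ := (isBracketAt_odd hι (g := g) fun k l => D.bd_symm x _ _).add_sum Finset.univ
    fun i => isBracketAt_even (hκ i) (hX i)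
  refine ⟨_, hβ, fun b f => ?_, fun τ τ' => ?_, fun b τ => ?_, fun b c => ?_⟩
  · simp only [LinearMap.add_apply, LinearMap.sum_apply, LinearMap.smul_apply, LinearMap.sub_apply,
      LinearMap.compl₁₂_apply, LinearMap.mul_apply', LinearMap.comp_apply, ι0, κ0, κ2, X0, mul_zero,
      smul_zero, Finset.sum_const_zero, zero_add, sub_zero, ← map_mul, ← map_sum]
    congr 1
    conv_rhs => rw [e'.expand_self (b x)]
    rw [map_sum, tderiv_vec_sum]
    exact Finset.sum_congr rfl fun i _ => by rw [map_smul, tderiv_vec_smul]; rfl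
  · simp only [LinearMap.add_apply, LinearMap.sum_apply, LinearMap.smul_apply, LinearMap.sub_apply,
      LinearMap.compl₁₂_apply, LinearMap.mul_apply', LinearMap.comp_apply, ι1, κ1, mul_zero,
      zero_mul, Finset.sum_const_zero, add_zero, sub_zero, AlgHom.toLinearMap_apply,
      AlgHom.commutes]
    simp only [Algebra.smul_def, ← map_mul, ← map_sum]
    congr 1
    conv_rhs => rw [e.expand_dual.self_of_nhds (τ x), e.expand_dual.self_of_nhds (τ' x)]
    simp only [map_sum, map_smul, sum_apply, smul_apply, smul_eq_mul, Finset.mul_sum]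
    exact Finset.sum_congr rfl fun k _ => Finset.sum_congr rfl fun l _ => by simp only [g]; ring
  · simp only [LinearMap.add_apply, LinearMap.sum_apply, LinearMap.smul_apply, LinearMap.sub_apply,
      LinearMap.compl₁₂_apply, LinearMap.mul_apply', LinearMap.comp_apply, ι2, κ1, κ2, X1,
      smul_zero, Finset.sum_const_zero, zero_add, sub_zero, map_zero, LinearMap.zero_apply,
      ← Algebra.smul_def, ContinuousLinearMap.coe_coe]
    rw [Finset.sum_congr rfl fun i _ => (map_smul (FreeAlg.gen₁ (Q x) (B x)) _ _).symm, ← map_sum]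
    refine congrArg _ ?_
    have := tensorial (m := m) (evSec (FQ →L[ℝ] ℝ) x ∘ₗ D.nabla₀.flip τ) (fun f s => by
      change D.nabla₀ (fsmul f s) τ x = f x • D.nabla₀ s τ x
      rw [D.nabla₀_fsmul]
      rfl) (s := b) (t := ∑ i, fsmul (pairing (e'.τ i) b) (e'.s i)) (e'.expand_sec b).self_of_nhds
    refine Eq.trans ?_ this.symm
    rw [map_sum]
    refine Finset.sum_congr rfl fun i _ => ?_
    change _ = D.nabla₀ (fsmul (pairing (e'.τ i) b) (e'.s i)) τ x
    rw [D.nabla₀_fsmul]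
    rfl
  · simp only [LinearMap.add_apply, LinearMap.sum_apply, LinearMap.smul_apply, LinearMap.sub_apply,
      LinearMap.compl₁₂_apply, LinearMap.mul_apply', LinearMap.comp_apply, ι2, κ2, X2, mul_zero,
      smul_zero, Finset.sum_const_zero, zero_add, ← Algebra.commutes, ← Algebra.smul_def,
      ContinuousLinearMap.coe_coe]
    have h1 : ∀ b c : B x, ∑ i, e'.τ i x b • L (e'.s i x) c = L b c := fun b c => by
      conv_rhs => rw [e'.expand_self b]
      rw [map_sum, LinearMap.sum_apply]
      exact Finset.sum_congr rfl fun i _ => by rw [map_smul, LinearMap.smul_apply]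
    have h2 : ∀ b c : 𝓢, ∑ i, e'.τ i x (b x) • (FreeAlg.gen₂ (Q x) (B x) (D.bracket (e'.s i) c x) -
        (2⁻¹ : ℝ) • L (e'.s i x) (c x)) =
        FreeAlg.gen₂ _ _ (∑ i, e'.τ i x (b x) • D.bracket (e'.s i) c x) -
          (2⁻¹ : ℝ) • L (b x) (c x) := fun b c => by
      rw [← h1, map_sum, Finset.smul_sum, ← Finset.sum_sub_distrib]
      exact Finset.sum_congr rfl fun i _ => by rw [smul_sub, map_smul, smul_comm (2⁻¹ : ℝ)]
    -- The two halves add up by skew symmetry of `L`. Subtracting `L` corrects the double count in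
    -- `bracket_frame` and at the same time introduces the term `-R`.
    have h3 : L (b x) (c x) = (2⁻¹ : ℝ) • L (b x) (c x) - (2⁻¹ : ℝ) • L (c x) (b x) := by
      rw [hLs (c x), smul_neg, sub_neg_eq_add, ← add_smul]
      norm_num
    rw [Finset.sum_sub_distrib, h2, h2, D.bracket_frame b c e', map_sub, map_sub]
    have h4 := h3.symm.trans (hL (b x) (c x))
    rw [eq_sub_of_add_eq' h4.symm]
    abel

end PreRep

end BracketAt
end SplitPoisson
end

/-! ### From pointwise values to a bracket of sheaves -/

open Bundle Manifold Set TopologicalSpace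
open scoped Manifold ContDiff Bundle Topology TensorProduct
noncomputable section
namespace SplitPoisson
set_option linter.unusedSectionVars false

section BracketExistence


variable {m : ℕ} {M : Type*} [TopologicalSpace M] [ChartedSpace (EuclideanSpace ℝ (Fin m)) M]
  [T2Space M] [IsManifold (𝓡 m) ∞ M]
  {FQ : Type*} [NormedAddCommGroup FQ] [NormedSpace ℝ FQ] [FiniteDimensional ℝ FQ]
  {Q : M → Type*} [TopologicalSpace (TotalSpace FQ Q)] [∀ x, AddCommGroup (Q x)]
  [∀ x, Module ℝ (Q x)] [∀ x, TopologicalSpace (Q x)] [∀ x, IsTopologicalAddGroup (Q x)]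
  [∀ x, ContinuousSMul ℝ (Q x)] [FiberBundle FQ Q] [VectorBundle ℝ FQ Q]
  [ContMDiffVectorBundle ∞ FQ Q (𝓡 m)]
  {FB : Type*} [NormedAddCommGroup FB] [NormedSpace ℝ FB] [FiniteDimensional ℝ FB]
  {B : M → Type*} [TopologicalSpace (TotalSpace FB B)] [∀ x, AddCommGroup (B x)]
  [∀ x, Module ℝ (B x)] [∀ x, TopologicalSpace (B x)] [FiberBundle FB B] [VectorBundle ℝ FB B]
  [ContMDiffVectorBundle ∞ FB B (𝓡 m)]

local notation "𝓕" => Fun (𝓡 m) FB B FQ Q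
local notation "𝓢" => Sec (𝓡 m) FB B
local notation "𝓓" => Sec (𝓡 m) (FQ →L[ℝ] ℝ) (DualBundle Q)

lemma mem_fun_of_local {U : Opens M} {s : Π x : U, FreeAlg (Q x) (B x)}
    (h : ∀ x : U, ∃ ζ : 𝓕 ⊤, ∀ᶠ y in 𝓝 (x : M), ∀ hy : y ∈ U, s ⟨y, hy⟩ = val ζ y) :
    s ∈ 𝓕 U := by
  intro x
  obtain ⟨ζ, hζ⟩ := h x
  obtain ⟨V, hxV, t, ht, hVt⟩ := ζ.2 ⟨x, trivial⟩
  obtain ⟨W, hW, hWo, hxW⟩ := eventually_nhds_iff.1 hζ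
  refine ⟨V ⊓ ⟨W, hWo⟩, ⟨hxV, hxW⟩, t,
    Algebra.adjoin_mono (generators_mono (𝓡 m) FB FQ inf_le_left) ht, fun y hy => ?_⟩
  exact (hW y hy.2 y.2).trans (hVt ⟨y, trivial⟩ hy.1)

/-- `curvAt` uses a different frame at every point, so its smoothness is not visible. Near a given
point the expression in one fixed frame is a polynomial in sections, and the two agree because their
`coeff₂` and `form` do. -/
lemma PreRep.exists_curv (D : PreRep m FQ Q FB B) (b c : 𝓢) :
    ∃ ζ : 𝓕 ⊤, ∀ x, val ζ x = D.curvAt x (b x) (c x) := by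
  refine ⟨⟨fun x => D.curvAt x (b x) (c x), mem_fun_of_local fun x => ?_⟩, fun x => rfl⟩
  let e := dualFrameAt (m := m) FQ Q x.1
  refine ⟨(2⁻¹ : ℝ) • ∑ i, ∑ j,
    incl₀ FB B FQ Q (pairing (homApply (D.R.eval b c) (e.s i)) (e.s j)) *
      (incl₁ FB B (e.τ i) * incl₁ FB B (e.τ j)), ?_⟩
  filter_upwards [e.expand, e.expand_dual] with y hy hy' _
  have h1 : val ((2⁻¹ : ℝ) • ∑ i, ∑ j,
      incl₀ FB B FQ Q (pairing (homApply (D.R.eval b c) (e.s i)) (e.s j)) *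
        (incl₁ FB B (e.τ i) * incl₁ FB B (e.τ j))) y =
      FreeAlg.ofForm (B y) (fun i => e.s i y) (fun i => e.τ i y) (D.R.toFun y (b y) (c y)) := by
    rw [val_smul, val_sum, FreeAlg.ofForm_apply]
    refine congrArg _ (Finset.sum_congr rfl fun i _ => ?_)
    rw [val_sum]
    refine Finset.sum_congr rfl fun j _ => ?_
    rw [val_mul, val_incl₀, ← Algebra.smul_def]
    rfl
  rw [h1]
  refine FreeAlg.eq_of_deg_two hy' (D.curvAt_mem _ _ _) (FreeAlg.ofForm_mem _ _ _) ?_ fun v w => ?_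
  · rw [D.coeff₂_curvAt, FreeAlg.coeff₂_ofForm]
  · rw [D.form_curvAt, FreeAlg.form_ofForm hy _ (D.R_dual y _ _)]

lemma GermEq.trans_left {U : Opens M} {x : M} (hx : x ∈ U) {ξ : 𝓕 U} {p q : 𝓕 ⊤}
    (hp : GermEq x ξ p) (hq : GermEq x ξ q) : GermEq x p q := by
  filter_upwards [hp, hq, U.isOpen.mem_nhds hx] with y h1 h2 hy h3 h4
  exact (h1 hy h3).symm.trans (h2 hy h4)

/-- A family of pointwise brackets that maps the polynomials in the generators to functions. -/
structure BracketFamily (β : Π x : M, 𝓕 ⊤ →ₗ[ℝ] 𝓕 ⊤ →ₗ[ℝ] FreeAlg (Q x) (B x)) : Prop where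
  isBracketAt : ∀ x, IsBracketAt (m := m) (FQ := FQ) (FB := FB) x (β x)
  smooth : ∀ {p q : 𝓕 ⊤}, p ∈ Poly FQ Q FB B → q ∈ Poly FQ Q FB B →
    ∃ ζ : 𝓕 ⊤, ∀ x, val ζ x = β x p q

section Family

variable (m FQ Q FB B) in
/-- A polynomial in the generators that represents the germ of a function. -/
def polyRep {U : Opens M} (x : U) (ξ : Fun (𝓡 m) FB B FQ Q U) : Fun (𝓡 m) FB B FQ Q ⊤ :=
  (exists_poly ξ x.2).choose

lemma polyRep_mem {U : Opens M} (x : U) (ξ : 𝓕 U) : polyRep m FQ Q FB B x ξ ∈ Poly FQ Q FB B :=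
  (exists_poly ξ x.2).choose_spec.1

lemma polyRep_germ {U : Opens M} (x : U) (ξ : 𝓕 U) :
    GermEq (x : M) ξ (polyRep m FQ Q FB B x ξ) :=
  (exists_poly ξ x.2).choose_spec.2

lemma GermEq.add {U V : Opens M} {x : M} {ξ ξ' : 𝓕 U} {η η' : 𝓕 V} (h : GermEq x ξ η)
    (h' : GermEq x ξ' η') : GermEq x (ξ + ξ') (η + η') := by
  filter_upwards [h, h'] with y e e' h1 h2
  exact congrArg₂ (· + ·) (e h1 h2) (e' h1 h2)

lemma GermEq.mul {U V : Opens M} {x : M} {ξ ξ' : 𝓕 U} {η η' : 𝓕 V} (h : GermEq x ξ η)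
    (h' : GermEq x ξ' η') : GermEq x (ξ * ξ') (η * η') := by
  filter_upwards [h, h'] with y e e' h1 h2
  exact congrArg₂ (· * ·) (e h1 h2) (e' h1 h2)

lemma GermEq.res {U V : Opens M} (hV : V ≤ U) {x : M} {ξ : 𝓕 U} {p : 𝓕 ⊤} (h : GermEq x ξ p) :
    GermEq x (Fun.res hV ξ) p := by
  filter_upwards [h] with y e h1 h2
  exact e (hV h1) h2

namespace BracketFamily

variable {β : Π x : M, Fun (𝓡 m) FB B FQ Q ⊤ →ₗ[ℝ] Fun (𝓡 m) FB B FQ Q ⊤ →ₗ[ℝ]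
  FreeAlg (Q x) (B x)}

lemma polyRep_eq (h : BracketFamily (m := m) (FQ := FQ) (FB := FB) β) {U : Opens M} (x : U)
    {ξ η : 𝓕 U} {p q : 𝓕 ⊤} (hp : GermEq (x : M) ξ p) (hq : GermEq (x : M) η q) :
    β x (polyRep m FQ Q FB B x ξ) (polyRep m FQ Q FB B x η) = β x p q :=
  (h.isBracketAt x).germ ((polyRep_germ x ξ).trans_left x.2 hp)
    ((polyRep_germ x η).trans_left x.2 hq)

/-- Polynomials representing the germs of `ξ` and `η` at `x` also represent their germs at nearby
points. Since the pointwise brackets depend on germs only, the values near `x` are those of one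
fixed pair of polynomials. -/
lemma mem (h : BracketFamily (m := m) (FQ := FQ) (FB := FB) β) {U : Opens M} (ξ η : 𝓕 U) :
    (fun x : U => β x (polyRep m FQ Q FB B x ξ) (polyRep m FQ Q FB B x η)) ∈ 𝓕 U := by
  refine mem_fun_of_local fun x => ?_
  obtain ⟨ζ, hζ⟩ := h.smooth (polyRep_mem x ξ) (polyRep_mem x η)
  refine ⟨ζ, ?_⟩
  filter_upwards [(polyRep_germ x ξ).eventually_nhds, (polyRep_germ x η).eventually_nhds]
    with y h1 h2 hy
  rw [hζ]
  exact h.polyRep_eq ⟨y, hy⟩ h1 h2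

/-- The bracket of functions over an open set. -/
def bracket (h : BracketFamily (m := m) (FQ := FQ) (FB := FB) β) (U : Opens M) :
    𝓕 U →ₗ[ℝ] 𝓕 U →ₗ[ℝ] 𝓕 U :=
  LinearMap.mk₂ ℝ (fun ξ η => ⟨_, h.mem ξ η⟩)
    (fun ξ ξ' η => Subtype.ext (funext fun x =>
      (h.polyRep_eq x ((polyRep_germ x ξ).add (polyRep_germ x ξ')) (polyRep_germ x η)).trans
        ((β x).map_add₂ _ _ _)))
    (fun r ξ η => Subtype.ext (funext fun x =>
      (h.polyRep_eq x ((polyRep_germ x ξ).smul r) (polyRep_germ x η)).trans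
        ((β x).map_smul₂ _ _ _)))
    (fun ξ η η' => Subtype.ext (funext fun x =>
      (h.polyRep_eq x (polyRep_germ x ξ) ((polyRep_germ x η).add (polyRep_germ x η'))).trans
        ((β x _).map_add _ _)))
    (fun r ξ η => Subtype.ext (funext fun x =>
      (h.polyRep_eq x (polyRep_germ x ξ) ((polyRep_germ x η).smul r)).trans
        ((β x _).map_smul _ _)))

lemma bracket_apply (h : BracketFamily (m := m) (FQ := FQ) (FB := FB) β) {U : Opens M} (x : U)
    {ξ η : 𝓕 U} {p q : 𝓕 ⊤} (hp : GermEq (x : M) ξ p) (hq : GermEq (x : M) η q) :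
    (h.bracket U ξ η).1 x = β x p q := h.polyRep_eq x hp hq

lemma val_bracket (h : BracketFamily (m := m) (FQ := FQ) (FB := FB) β) (ξ η : 𝓕 ⊤) (x : M) :
    val (h.bracket ⊤ ξ η) x = β x ξ η :=
  h.polyRep_eq (U := ⊤) ⟨x, trivial⟩ (GermEq.refl x ξ) (GermEq.refl x η)

/-- The bracket given by a family of pointwise brackets. -/
def toPreBracket (h : BracketFamily (m := m) (FQ := FQ) (FB := FB) β) :
    PreBracket m FQ Q FB B where
  bracket := h.bracket
  res_bracket {U V} hV ξ η := Subtype.ext (funext fun x => by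
    have gξ := polyRep_germ (⟨x, hV x.2⟩ : U) ξ
    have gη := polyRep_germ (⟨x, hV x.2⟩ : U) η
    exact (h.bracket_apply ⟨x, hV x.2⟩ gξ gη).trans
      (h.bracket_apply x (gξ.res hV) (gη.res hV)).symm)
  degree {U i j ξ η} h₁ h₂ x := by
    obtain ⟨p, hp, gp⟩ := exists_hpoly h₁ x.2
    obtain ⟨q, hq, gq⟩ := exists_hpoly h₂ x.2
    rw [h.bracket_apply x gp gq]
    exact (h.isBracketAt x).degree hp.homogeneous hq.homogeneous
  skew {U i j ξ η} h₁ h₂ := Subtype.ext (funext fun x => by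
    obtain ⟨p, hp, gp⟩ := exists_hpoly h₁ x.2
    obtain ⟨q, hq, gq⟩ := exists_hpoly h₂ x.2
    refine (h.bracket_apply x gp gq).trans
      (((h.isBracketAt x).skew hp.homogeneous hq.homogeneous).trans ?_)
    exact congrArg (fun a => -((-1 : ℝ) ^ (i * j) • a)) (h.bracket_apply x gq gp).symm)
  leibniz {U i j k ξ₁ ξ₂ ξ₃} h₁ h₂ h₃ := Subtype.ext (funext fun x => by
    obtain ⟨p, hp, gp⟩ := exists_hpoly h₁ x.2
    obtain ⟨q, hq, gq⟩ := exists_hpoly h₂ x.2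
    obtain ⟨r, hr, gr⟩ := exists_hpoly h₃ x.2
    refine (h.bracket_apply x gp (gq.mul gr)).trans
      (((h.isBracketAt x).leibniz hp.homogeneous hq.homogeneous r).trans ?_)
    rw [← h.bracket_apply x gp gq, ← h.bracket_apply x gp gr]
    have e1 : val q x = ξ₂.1 x := (gq.self_of_nhds x.2 trivial).symm
    have e2 : val r x = ξ₃.1 x := (gr.self_of_nhds x.2 trivial).symm
    rw [e1, e2]
    rfl)

end BracketFamily

end Family

end BracketExistence
end SplitPoisson
end

/-! ### Existence of the bracket and the correspondence -/

open Bundle Manifold Set TopologicalSpace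
open scoped Manifold ContDiff Bundle Topology TensorProduct
noncomputable section
namespace SplitPoisson
set_option linter.unusedSectionVars false

section Existence


variable {m : ℕ} {M : Type*} [TopologicalSpace M] [ChartedSpace (EuclideanSpace ℝ (Fin m)) M]
  [T2Space M] [IsManifold (𝓡 m) ∞ M]
  {FQ : Type*} [NormedAddCommGroup FQ] [NormedSpace ℝ FQ] [FiniteDimensional ℝ FQ]
  {Q : M → Type*} [TopologicalSpace (TotalSpace FQ Q)] [∀ x, AddCommGroup (Q x)]
  [∀ x, Module ℝ (Q x)] [∀ x, TopologicalSpace (Q x)] [∀ x, IsTopologicalAddGroup (Q x)]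
  [∀ x, ContinuousSMul ℝ (Q x)] [FiberBundle FQ Q] [VectorBundle ℝ FQ Q]
  [ContMDiffVectorBundle ∞ FQ Q (𝓡 m)]
  {FB : Type*} [NormedAddCommGroup FB] [NormedSpace ℝ FB] [FiniteDimensional ℝ FB]
  {B : M → Type*} [TopologicalSpace (TotalSpace FB B)] [∀ x, AddCommGroup (B x)]
  [∀ x, Module ℝ (B x)] [∀ x, TopologicalSpace (B x)] [FiberBundle FB B] [VectorBundle ℝ FB B]
  [ContMDiffVectorBundle ∞ FB B (𝓡 m)]

local notation "𝓕" => Fun (𝓡 m) FB B FQ Q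
local notation "𝓢" => Sec (𝓡 m) FB B
local notation "𝓓" => Sec (𝓡 m) (FQ →L[ℝ] ℝ) (DualBundle Q)

/-- The pairs whose pointwise brackets form a function are stable under sums, under swapping
homogeneous entries, and under products in the second entry when the first entry and the left factor
are homogeneous. Pairs of too low degree qualify with the value zero, so the four remaining kinds of
generator pairs suffice. -/
lemma bracketFamily_of_generators
    {β : Π x : M, Fun (𝓡 m) FB B FQ Q ⊤ →ₗ[ℝ] Fun (𝓡 m) FB B FQ Q ⊤ →ₗ[ℝ] FreeAlg (Q x) (B x)}
    (h : ∀ x, IsBracketAt (m := m) (FQ := FQ) (FB := FB) x (β x))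
    (h₂₀ : ∀ (b : 𝓢) (f : SmoothFun m M), ∃ ζ : 𝓕 ⊤, ∀ x, val ζ x =
      β x (incl₂ FQ Q b) (incl₀ FB B FQ Q f))
    (h₁₁ : ∀ τ τ' : 𝓓, ∃ ζ : 𝓕 ⊤, ∀ x, val ζ x = β x (incl₁ FB B τ) (incl₁ FB B τ'))
    (h₂₁ : ∀ (b : 𝓢) (τ : 𝓓), ∃ ζ : 𝓕 ⊤, ∀ x, val ζ x = β x (incl₂ FQ Q b) (incl₁ FB B τ))
    (h₂₂ : ∀ b c : 𝓢, ∃ ζ : 𝓕 ⊤, ∀ x, val ζ x = β x (incl₂ FQ Q b) (incl₂ FQ Q c)) :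
    BracketFamily (m := m) (FQ := FQ) (FB := FB) β := by
  let S (p q : 𝓕 ⊤) : Prop := ∃ ζ : 𝓕 ⊤, ∀ x, val ζ x = β x p q
  have S_symm : ∀ {i j : ℕ} {p q : 𝓕 ⊤}, Fun.IsHomogeneous i p → Fun.IsHomogeneous j q →
      S p q → S q p := by
    rintro i j p q hp hq ⟨ζ, hζ⟩
    refine ⟨-((-1 : ℝ) ^ (j * i) • ζ), fun x => ?_⟩
    rw [(h x).skew hq hp, ← hζ]
    rfl
  have S_zero : ∀ p, S p 0 := fun p => ⟨0, fun x => ((β x p).map_zero).symm⟩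
  have S_zero' : ∀ q, S 0 q := fun q => ⟨0, fun x => ((β x).map_zero₂ q).symm⟩
  have S_add : ∀ {p q q'}, S p q → S p q' → S p (q + q') := by
    rintro p q q' ⟨ζ, hζ⟩ ⟨ζ', hζ'⟩
    exact ⟨ζ + ζ', fun x => (congrArg₂ (· + ·) (hζ x) (hζ' x)).trans ((β x p).map_add q q').symm⟩
  have S_add' : ∀ {p p' q}, S p q → S p' q → S (p + p') q := by
    rintro p p' q ⟨ζ, hζ⟩ ⟨ζ', hζ'⟩
    exact ⟨ζ + ζ', fun x => (congrArg₂ (· + ·) (hζ x) (hζ' x)).trans ((β x).map_add₂ p p' q).symm⟩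
  have S_mul : ∀ {i j : ℕ} {p q r : 𝓕 ⊤}, Fun.IsHomogeneous i p → Fun.IsHomogeneous j q →
      S p q → S p r → S p (q * r) := by
    rintro i j p q r hp hq ⟨ζ, hζ⟩ ⟨ζ', hζ'⟩
    refine ⟨ζ * r + (-1 : ℝ) ^ (i * j) • (q * ζ'), fun x => ?_⟩
    rw [(h x).leibniz hp hq, ← hζ, ← hζ']
    rfl
  have S_low : ∀ {i j : ℕ} {p q : 𝓕 ⊤}, Fun.IsHomogeneous i p → Fun.IsHomogeneous j q →
      (i + j : ℤ) - 2 < 0 → S p q := by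
    intro i j p q hp hq hij
    refine ⟨0, fun x => ?_⟩
    have := (h x).degree hp hq
    rw [FreeAlg.deg_neg hij, Submodule.mem_bot] at this
    exact this.symm
  have S_hpoly : ∀ {i : ℕ} {p : 𝓕 ⊤}, Fun.IsHomogeneous i p →
      (∀ f : SmoothFun m M, S p (incl₀ FB B FQ Q f)) → (∀ τ : 𝓓, S p (incl₁ FB B τ)) →
      (∀ b : 𝓢, S p (incl₂ FQ Q b)) → ∀ {j : ℕ} {q : 𝓕 ⊤}, HPoly j q → S p q := by
    intro i p hp h0 h1 h2 j q hq
    induction hq with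
    | fn f => exact h0 f
    | dual τ => exact h1 τ
    | sec b => exact h2 b
    | zero n => exact S_zero p
    | add _ _ e e' => exact S_add e e'
    | mul hq _ e e' => exact S_mul hp hq.homogeneous e e'
  have k0 : ∀ f : SmoothFun m M, Fun.IsHomogeneous (0 : ℕ) (incl₀ FB B FQ Q f) :=
    fun f => (HPoly.fn f).homogeneous
  have k1 : ∀ τ : 𝓓, Fun.IsHomogeneous (1 : ℕ) (incl₁ FB B τ) :=
    fun τ => (HPoly.dual τ).homogeneous
  have k2 : ∀ b : 𝓢, Fun.IsHomogeneous (2 : ℕ) (incl₂ FQ Q b) :=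
    fun b => (HPoly.sec b).homogeneous
  have s2 : ∀ (b : 𝓢) {j : ℕ} {q : 𝓕 ⊤}, HPoly j q → S (incl₂ FQ Q b) q := fun b =>
    S_hpoly (k2 b) (h₂₀ b) (h₂₁ b) (h₂₂ b)
  have s1 : ∀ (τ : 𝓓) {j : ℕ} {q : 𝓕 ⊤}, HPoly j q → S (incl₁ FB B τ) q := fun τ =>
    S_hpoly (k1 τ) (fun f => S_low (k1 τ) (k0 f) (by norm_num)) (h₁₁ τ)
      fun b => S_symm (k2 b) (k1 τ) (h₂₁ b τ)
  have s0 : ∀ (f : SmoothFun m M) {j : ℕ} {q : 𝓕 ⊤}, HPoly j q → S (incl₀ FB B FQ Q f) q :=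
    fun f => S_hpoly (k0 f) (fun g => S_low (k0 f) (k0 g) (by norm_num))
      (fun τ => S_low (k0 f) (k1 τ) (by norm_num)) fun b => S_symm (k2 b) (k0 f) (h₂₀ b f)
  -- As in the uniqueness argument, a second pass in the other entry extends the claim from a
  -- generator against a polynomial to two polynomials.
  have s : ∀ {i j : ℕ} {p q : 𝓕 ⊤}, HPoly i p → HPoly j q → S p q := fun hp =>
    S_hpoly hp.homogeneous (fun f => S_symm (k0 f) hp.homogeneous (s0 f hp))
      (fun τ => S_symm (k1 τ) hp.homogeneous (s1 τ hp))
      fun b => S_symm (k2 b) hp.homogeneous (s2 b hp)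
  refine ⟨h, fun {p q} hp hq => ?_⟩
  induction hp using AddSubmonoid.closure_induction with
  | zero => exact S_zero' q
  | add p p' _ _ e e' => exact S_add' e e'
  | mem p hp =>
    obtain ⟨i, hp⟩ := hp
    induction hq using AddSubmonoid.closure_induction with
    | zero => exact S_zero p
    | add q q' _ _ e e' => exact S_add e e'
    | mem q hq =>
      obtain ⟨j, hq⟩ := hq
      exact s hp hq

/-- Every `D` comes from a bracket. -/
lemma PreRep.exists_preBracket (D : PreRep m FQ Q FB B) :
    ∃ P : PreBracket m FQ Q FB B, Corr P D := by
  choose β hβ h₂₀ h₁₁ h₂₁ h₂₂ using D.exists_bracketAt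
  have e₂₀ : ∀ (b : 𝓢) (f : SmoothFun m M) x, val (incl₀ FB B FQ Q (anchorFun D.anchor b f)) x =
      β x (incl₂ FQ Q b) (incl₀ FB B FQ Q f) := fun b f x => (h₂₀ x b f).symm
  have e₁₁ : ∀ (τ τ' : 𝓓) x, val (incl₀ FB B FQ Q (pairing τ' (homApply D.bd τ))) x =
      β x (incl₁ FB B τ) (incl₁ FB B τ') := fun τ τ' x => (h₁₁ x τ τ').symm
  have e₂₁ : ∀ (b : 𝓢) (τ : 𝓓) x, val (incl₁ FB B (D.nabla₀ b τ)) x =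
      β x (incl₂ FQ Q b) (incl₁ FB B τ) := fun b τ x => (h₂₁ x b τ).symm
  have h := bracketFamily_of_generators hβ (fun b f => ⟨_, e₂₀ b f⟩) (fun τ τ' => ⟨_, e₁₁ τ τ'⟩)
    (fun b τ => ⟨_, e₂₁ b τ⟩) fun b c => by
      obtain ⟨ζ, hζ⟩ := D.exists_curv b c
      refine ⟨incl₂ FQ Q (D.bracket b c) - ζ, fun x => ?_⟩
      rw [h₂₂, val_sub, hζ, val_incl₂]
  have hv : ∀ (ξ η : 𝓕 ⊤) x, val (h.toPreBracket.bracket ⊤ ξ η) x = β x ξ η := h.val_bracket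
  refine ⟨h.toPreBracket, fun b f => fun_ext fun x => ?_, fun τ τ' => fun_ext fun x => ?_,
    fun b τ => fun_ext fun x => ?_, fun b c x => ?_, fun b c x q q' => ?_⟩
  · rw [hv, e₂₀]
  · rw [hv, e₁₁]
  · rw [hv, e₂₁]
  · rw [hv, h₂₂, map_sub, FreeAlg.coeff₂_gen₂, D.coeff₂_curvAt, sub_zero]
  · rw [hv, h₂₂, map_sub, FreeAlg.form_gen₂, D.form_curvAt, zero_sub]

/-- The correspondence between the Poisson brackets of degree `-2` and the Lie algebroids with a
self-dual 2-representation. -/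
lemma exists_equiv : ∃ Φ : PoissonBracket (𝓡 m) FB B FQ Q ≃ SelfDualTwoRep (𝓡 m) FB B FQ Q,
    ∀ P D, Φ P = D ↔ Corresponds P D :=
  exists_equiv_of_existence PreRep.exists_preBracket

end Existence
end SplitPoisson
end


theorem theorem4p3 (m : ℕ) (M : Type*) [TopologicalSpace M] [T2Space M]
    [SecondCountableTopology M] [ChartedSpace (EuclideanSpace ℝ (Fin m)) M] [IsManifold (𝓡 m) ∞ M]
    (FQ : Type*) [NormedAddCommGroup FQ] [NormedSpace ℝ FQ] [FiniteDimensional ℝ FQ]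
    (Q : M → Type*) [TopologicalSpace (TotalSpace FQ Q)] [∀ x, AddCommGroup (Q x)]
    [∀ x, Module ℝ (Q x)] [∀ x, TopologicalSpace (Q x)] [∀ x, IsTopologicalAddGroup (Q x)]
    [∀ x, ContinuousSMul ℝ (Q x)] [FiberBundle FQ Q] [VectorBundle ℝ FQ Q]
    [ContMDiffVectorBundle ∞ FQ Q (𝓡 m)]
    (FB : Type*) [NormedAddCommGroup FB] [NormedSpace ℝ FB] [FiniteDimensional ℝ FB]
    (B : M → Type*) [TopologicalSpace (TotalSpace FB B)] [∀ x, AddCommGroup (B x)]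
    [∀ x, Module ℝ (B x)] [∀ x, TopologicalSpace (B x)] [FiberBundle FB B] [VectorBundle ℝ FB B]
    [ContMDiffVectorBundle ∞ FB B (𝓡 m)] :
    ∃ Φ : SplitPoisson.PoissonBracket (𝓡 m) FB B FQ Q ≃
        SplitPoisson.SelfDualTwoRep (𝓡 m) FB B FQ Q,
      ∀ P D, Φ P = D ↔ SplitPoisson.Corresponds P D :=
  SplitPoisson.exists_equiv
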